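/- Let $R=\mathbb{Z}[A,A^{-1}]$ and let $T=\mathbb{S}^1\times\mathbb{S}^1=\mathbb{R}^2/\mathbb{Z}^2$ be the torus with its standard orientation. A \emph{curve} is an oriented embedded closed polygonal (piecewise linear) curve on $T$, with any finite number of components, possibly none. Let $\mathcal{A}$ be the $R$-module generated by the curves modulo isotopy and the following local relations in an embedded disc (the curves being unchanged outside the disc): (a) a counterclockwise circle that is alone in the disc may be deleted at the cost of the factor $-A^{2}$, and a clockwise one at the cost of the factor $-A^{-2}$; (b) two antiparallel strands, the left one pointing down and the right one pointing up, equal the diagram consisting of an arc joining the two upper endpoints (directed from left to right), an arc joining the two lower endpoints (directed from right to left) and a clockwise circle between these arcs; and the same relation with all orientations reversed (hence with a counterclockwise circle). For an oriented link diagram $D$ on $T$ with transverse crossings, let $[D]\in\mathcal{A}$ be the class $A^{w(D)}\,[D_0]$, where $D_0$ is the curve obtained from $D$ by the orientation-respecting smoothing of every crossing, and $w(D)=\sum_c \operatorname{sgn}(c)$, where $\operatorname{sgn}(c)=+1$ if (direction of the over-strand, direction of the under-strand) is a positively oriented frame at the crossing $c$ and $\operatorname{sgn}(c)=-1$ otherwise.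 (So a positive crossing is replaced by $A$ times, and a negative crossing by $A^{-1}$ times, its oriented smoothing.) Then the multiplication on $\mathcal{A}$ by superposition and oriented smoothing is well defined: 1. for all curves $\alpha,\beta$ there is a curve $\alpha'$ isotopic to $\alpha$ that is in general position with respect to $\beta$ (the two meet only transversally, in interior points of edges), and any two curves $\alpha,\beta$ in general position have a superposition diagram of $\alpha$ over $\beta$; 2. there is exactly one $R$-bilinear map $\ast:\mathcal{A}\times\mathcal{A}\to\mathcal{A}$ such that $[\alpha]\ast[\beta]=[D]$ for all curves $\alpha,\beta$ in general position and every diagram $D$ of the superposition of $\alpha$ over $\beta$; 3. oriented Reidemeister II moves are respected: if two oriented link diagrams $D,D'$ on $T$ differ by a Reidemeister II move, with any orientation of the two strands and either strand on top, then $[D]=[D']$ in $\mathcal{A}$. -/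

import Mathlib

noncomputable section

namespace OrientedSkein

/-! ### Oriented polygonal multicurves on the torus -/

/-- The torus `S¹ × S¹ = ℝ² / ℤ²`, oriented by the standard orientation of `ℝ²`. -/
abbrev Torus : Type := UnitAddCircle × UnitAddCircle

abbrev Plane : Type := ℝ × ℝ

/-- The covering projection `ℝ² → S¹ × S¹`. -/
def proj (v : Plane) : Torus := ((v.1 : UnitAddCircle), (v.2 : UnitAddCircle))

theorem proj_add (u v : Plane) : proj (u + v) = proj u + proj v := by
  ext <;> simp [proj]

/-- The oriented area form of the plane. -/
def det (u w : Plane) : ℝ := u.1 * w.2 - u.2 * w.1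

/-- A directed straight segment on the torus: its starting point and its displacement vector. -/
abbrev Edge : Type := Torus × Plane

def Edge.start (e : Edge) : Torus := e.1

def Edge.finish (e : Edge) : Torus := e.1 + proj e.2

/-- The point at time `t ∈ [0, 1]` of a directed segment. -/
def Edge.pt (e : Edge) (t : ℝ) : Torus := e.1 + proj (t • e.2)

/-- The union of the closed segments in `E`. -/
def support (E : Set Edge) : Set Torus := {z | ∃ e ∈ E, ∃ t ∈ Set.Icc (0 : ℝ) 1, e.pt t = z}

/-- `E` is the set of edges of an oriented embedded closed polygonal curve (any finite number of
components, possibly none): every edge is followed by an edge and preceded by an edge, and the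
half-open edges are pairwise disjoint and without self-intersections. -/
structure IsMulticurve (E : Set Edge) : Prop where
  finite : E.Finite
  closed : Edge.finish '' E = Edge.start '' E
  embedded : Set.InjOn (fun q : Edge × ℝ => q.1.pt q.2) (E ×ˢ Set.Ico (0 : ℝ) 1)

/-- Oriented embedded closed polygonal curves on the torus. -/
structure Multicurve where
  edges : Set Edge
  isMulticurve : IsMulticurve edges

/-! ### Isotopy -/

/-- `E'` arises from `E` by inserting one new vertex in the interior of an edge. -/
def SubdivisionStep (E E' : Set Edge) : Prop :=
  ∃ (F : Set Edge) (e : Edge) (s : ℝ), 0 < s ∧ s < 1 ∧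
    e ∉ F ∧ (e.1, s • e.2) ∉ F ∧ (e.pt s, (1 - s) • e.2) ∉ F ∧
    E = F ∪ {e} ∧ E' = F ∪ {(e.1, s • e.2), (e.pt s, (1 - s) • e.2)}

/-- `E'` arises from `E` by inserting finitely many new vertices in the interiors of edges. -/
def Subdivision : Set Edge → Set Edge → Prop := Relation.ReflTransGen SubdivisionStep

/-- A continuous motion of the edges of `α` to those of `β` through oriented embedded
polygonal curves. -/
def Deformation (α β : Multicurve) : Prop :=
  ∃ Φ : unitInterval → Edge → Edge,
    (∀ e ∈ α.edges, Continuous fun t => Φ t e) ∧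
    (∀ e ∈ α.edges, Φ 0 e = e) ∧
    (∀ t, Set.InjOn (Φ t) α.edges ∧ IsMulticurve (Φ t '' α.edges)) ∧
    Φ 1 '' α.edges = β.edges

/-- Isotopy of oriented embedded polygonal curves: a finite sequence of continuous motions through
embedded polygonal curves, where vertices may be inserted in edges and removed again in between. -/
def Isotopic : Multicurve → Multicurve → Prop :=
  Relation.EqvGen fun α β => SubdivisionStep α.edges β.edges ∨ Deformation α β

/-! ### The oriented skein module -/

/-- The coefficient ring `ℤ[A, A⁻¹]`; `A ^ n` is `LaurentPolynomial.T n`. -/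
abbrev R : Type := LaurentPolynomial ℤ

/-- Affine coordinates on the torus at `p` along `x` and `y`. -/
def coords (p : Torus) (x y : Plane) (q : ℝ × ℝ) : Torus := p + proj (q.1 • x + q.2 • y)

/-- Coordinates of the triangle with vertices `p`, `p + x`, `p + x + y`. -/
def triangleDomain : Set (ℝ × ℝ) := {q | 0 ≤ q.2 ∧ q.2 ≤ q.1 ∧ q.1 ≤ 1}

/-- The closed solid triangle with vertices `p`, `p + x`, `p + x + y`. -/
def triangle (p : Torus) (x y : Plane) : Set Torus := coords p x y '' triangleDomain

/-- The boundary of this triangle, traversed as `p → p + x → p + x + y → p`. It is counterclockwise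
when `det x y > 0` and clockwise when `det x y < 0`. -/
def triangleBoundary (p : Torus) (x y : Plane) : Set Edge :=
  {(p, x), (p + proj x, y), (p + proj (x + y), -(x + y))}

def closedParallelogram (p : Torus) (a b : Plane) : Set Torus :=
  coords p a b '' (Set.Icc 0 1 ×ˢ Set.Icc 0 1)

def openParallelogram (p : Torus) (a b : Plane) : Set Torus :=
  coords p a b '' (Set.Ioo 0 1 ×ˢ Set.Ioo 0 1)

/-- `F` is the part outside the disc `p, p + a, p + a + b, p + b` (an embedded, positively oriented
parallelogram): it meets the closed disc at most in the four corners. -/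
structure OutsideParallelogram (F : Set Edge) (p : Torus) (a b : Plane) : Prop where
  pos : 0 < det a b
  embedded : Set.InjOn (coords p a b) (Set.Icc 0 1 ×ˢ Set.Icc 0 1)
  outside : support F ∩ closedParallelogram p a b ⊆
    {p, p + proj a, p + proj (a + b), p + proj b}

/-- The defining relations of the oriented skein module, `SkeinRel f g` meaning `f = g`. -/
inductive SkeinRel : (Multicurve →₀ R) → (Multicurve →₀ R) → Prop
  | isotopy (α β : Multicurve) (h : Isotopic α β) :
      SkeinRel (Finsupp.single α 1) (Finsupp.single β 1)
  /-- A counterclockwise circle bounding a disc disjoint from the rest is worth `-A²`. -/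
  | circle_ccw (α β : Multicurve) (p : Torus) (x y : Plane) (hxy : 0 < det x y)
      (hinj : Set.InjOn (coords p x y) triangleDomain)
      (hdisj : Disjoint (triangle p x y) (support α.edges))
      (hβ : β.edges = α.edges ∪ triangleBoundary p x y) :
      SkeinRel (Finsupp.single β 1) (Finsupp.single α (-LaurentPolynomial.T 2))
  /-- A clockwise circle bounding a disc disjoint from the rest is worth `-A⁻²`. -/
  | circle_cw (α β : Multicurve) (p : Torus) (x y : Plane) (hxy : det x y < 0)
      (hinj : Set.InjOn (coords p x y) triangleDomain)
      (hdisj : Disjoint (triangle p x y) (support α.edges))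
      (hβ : β.edges = α.edges ∪ triangleBoundary p x y) :
      SkeinRel (Finsupp.single β 1) (Finsupp.single α (-LaurentPolynomial.T (-2)))
  /-- In a disc with left side `p, p + b` and right side `p + a, p + a + b`: left strand downwards
  and right strand upwards become a top arc to the right, a bottom arc to the left and a clockwise
  circle between them. -/
  | antiparallel_down_up (α β : Multicurve) (F : Set Edge) (p : Torus) (a b : Plane)
      (hF : OutsideParallelogram F p a b)
      (c : Torus) (x y : Plane) (hxy : det x y < 0)
      (hc : triangle c x y ⊆ openParallelogram p a b)
      (hα : α.edges = F ∪ {(p + proj b, -b), (p + proj a, b)})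
      (hβ : β.edges = F ∪ {(p + proj b, a), (p + proj a, -a)} ∪ triangleBoundary c x y) :
      SkeinRel (Finsupp.single α 1) (Finsupp.single β 1)
  /-- The same with all orientations reversed. -/
  | antiparallel_up_down (α β : Multicurve) (F : Set Edge) (p : Torus) (a b : Plane)
      (hF : OutsideParallelogram F p a b)
      (c : Torus) (x y : Plane) (hxy : 0 < det x y)
      (hc : triangle c x y ⊆ openParallelogram p a b)
      (hα : α.edges = F ∪ {(p, b), (p + proj (a + b), -b)})
      (hβ : β.edges = F ∪ {(p, a), (p + proj (a + b), -a)} ∪ triangleBoundary c x y) :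
      SkeinRel (Finsupp.single α 1) (Finsupp.single β 1)

def relations : Submodule R (Multicurve →₀ R) :=
  Submodule.span R {d | ∃ f g, SkeinRel f g ∧ d = f - g}

/-- The oriented skein module `𝒜` of the torus. -/
abbrev SkeinModule : Type := (Multicurve →₀ R) ⧸ relations

/-- The class in `𝒜` of an oriented embedded curve. -/
def Multicurve.toSkein (α : Multicurve) : SkeinModule :=
  Submodule.Quotient.mk (Finsupp.single α 1)

/-! ### Oriented diagrams and their oriented smoothing -/

/-- A crossing with its small disc: the over-strand runs straight from `center - overDir` to
`center + overDir`, the under-strand straight from `center - underDir` to `center + underDir`. -/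
structure Crossing where
  center : Torus
  overDir : Plane
  underDir : Plane

namespace Crossing

def overStrand (c : Crossing) : Edge := (c.center + proj (-c.overDir), (2 : ℝ) • c.overDir)

def underStrand (c : Crossing) : Edge := (c.center + proj (-c.underDir), (2 : ℝ) • c.underDir)

def discDomain : Set (ℝ × ℝ) := {q | |q.1| + |q.2| ≤ 1}

/-- The parallelogram whose diagonals are the two strands. -/
def disc (c : Crossing) : Set Torus := coords c.center c.overDir c.underDir '' discDomain

def corners (c : Crossing) : Set Torus :=
  {c.center + proj c.overDir, c.center + proj (-c.overDir),
    c.center + proj c.underDir, c.center + proj (-c.underDir)}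

/-- The two arcs of the oriented smoothing: from the tail of the over-strand to the head of the
under-strand, and from the tail of the under-strand to the head of the over-strand. -/
def smoothing (c : Crossing) : Set Edge :=
  {(c.center + proj (-c.overDir), c.overDir + c.underDir),
    (c.center + proj (-c.underDir), c.overDir + c.underDir)}

/-- The exponent of `A` in the smoothing rule: `1` if (overDir, underDir) is a positively oriented
frame, `-1` if it is negatively oriented. -/
def sign (c : Crossing) : ℤ := (SignType.sign (det c.overDir c.underDir) : ℤ)

end Crossing

def strands (X : Set Crossing) : Set Edge := Crossing.overStrand '' X ∪ Crossing.underStrand '' X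

/-- An oriented link diagram on the torus: a closed oriented polygonal curve whose only multiple
points are transverse double points (the crossings), each with over/under information and a small
disc that meets the rest of the diagram only in the four ends of its two strands. -/
structure Diagram where
  /-- the edges outside the crossing discs -/
  arcs : Set Edge
  crossings : Finset Crossing
  finite : arcs.Finite
  transverse : ∀ c ∈ crossings, det c.overDir c.underDir ≠ 0
  disc_embedded : ∀ c ∈ crossings,
    Set.InjOn (coords c.center c.overDir c.underDir) Crossing.discDomain
  disc_disjoint : ∀ c ∈ crossings, ∀ d ∈ crossings, c ≠ d → Disjoint c.disc d.disc
  disc_arcs : ∀ c ∈ crossings, support arcs ∩ c.disc ⊆ c.corners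
  closed : Edge.finish '' (arcs ∪ strands crossings) = Edge.start '' (arcs ∪ strands crossings)
  double_points : ∀ e ∈ arcs ∪ strands crossings, ∀ f ∈ arcs ∪ strands crossings,
    ∀ s ∈ Set.Ico (0 : ℝ) 1, ∀ t ∈ Set.Ico (0 : ℝ) 1, e.pt s = f.pt t →
      (e = f ∧ s = t) ∨ ∃ c ∈ crossings, e.pt s = c.center

namespace Diagram

/-- All edges of the underlying curve of the diagram. -/
def underlying (D : Diagram) : Set Edge := D.arcs ∪ strands D.crossings

/-- The edges of the diagram after oriented smoothing of all crossings. -/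
def smoothedEdges (D : Diagram) : Set Edge := D.arcs ∪ ⋃ c ∈ D.crossings, c.smoothing

/-- The points of the smoothing arcs in the affine coordinates of the crossing disc. -/
theorem smoothing_coords (c : Crossing) {e : Edge} (he : e ∈ c.smoothing) {t : ℝ}
    (ht : t ∈ Set.Ico (0 : ℝ) 1) :
    ∃ q ∈ Crossing.discDomain, e.pt t = coords c.center c.overDir c.underDir q ∧
      ((e = (c.center + proj (-c.overDir), c.overDir + c.underDir) ∧ q = (t - 1, t)) ∨
       (e = (c.center + proj (-c.underDir), c.overDir + c.underDir) ∧ q = (t, t - 1))) := by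
  obtain ⟨h0, h1⟩ := ht
  rcases he with rfl | he
  · refine ⟨(t - 1, t), ?_, ?_, Or.inl ⟨rfl, rfl⟩⟩
    · simp only [Crossing.discDomain, Set.mem_ofPred_eq]
      rw [abs_of_nonneg h0, abs_of_neg (by linarith)]; linarith
    · simp only [Edge.pt, coords]
      rw [add_assoc, ← proj_add]; congr 2; module
  · rw [Set.mem_singleton_iff] at he
    subst he
    refine ⟨(t, t - 1), ?_, ?_, Or.inr ⟨rfl, rfl⟩⟩
    · simp only [Crossing.discDomain, Set.mem_ofPred_eq]
      rw [abs_of_nonneg h0, abs_of_neg (by linarith)]; linarith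
    · simp only [Edge.pt, coords]
      rw [add_assoc, ← proj_add]; congr 2; module

theorem corners_coords (c : Crossing) {z : Torus} (hz : z ∈ c.corners) :
    ∃ q : ℝ × ℝ, q ∈ ({(1, 0), (-1, 0), (0, 1), (0, -1)} : Set (ℝ × ℝ)) ∧
      q ∈ Crossing.discDomain ∧ z = coords c.center c.overDir c.underDir q := by
  rcases hz with rfl | rfl | rfl | hz
  · exact ⟨(1, 0), by simp, by simp [Crossing.discDomain], by simp [coords]⟩
  · exact ⟨(-1, 0), by simp, by simp [Crossing.discDomain], by simp [coords]⟩
  · exact ⟨(0, 1), by simp, by simp [Crossing.discDomain], by simp [coords]⟩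
  · rw [Set.mem_singleton_iff] at hz
    exact ⟨(0, -1), by simp, by simp [Crossing.discDomain], by simp [coords, hz]⟩

theorem center_notMem_arcs (D : Diagram) {c : Crossing} (hc : c ∈ D.crossings)
    (h : c.center ∈ support D.arcs) : False := by
  have h0 : c.center = coords c.center c.overDir c.underDir (0, 0) := by simp [coords, proj]
  have hd : ((0, 0) : ℝ × ℝ) ∈ Crossing.discDomain := by simp [Crossing.discDomain]
  obtain ⟨q, hq, hqd, hqz⟩ := corners_coords c (D.disc_arcs c hc ⟨h, ⟨_, hd, h0.symm⟩⟩)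
  have := D.disc_embedded c hc hd hqd (h0.symm.trans hqz)
  subst this
  simp at hq

theorem tail_notMem_arcs (D : Diagram) {c : Crossing} (hc : c ∈ D.crossings) {e : Edge}
    (he : e ∈ D.arcs) {s : ℝ} (hs : s ∈ Set.Ico (0 : ℝ) 1) {g : Edge}
    (hg : g ∈ strands D.crossings) (hgc : g.pt (1 / 2) = c.center) (h : e.pt s = g.pt 0) :
    False := by
  rcases D.double_points e (Or.inl he) g (Or.inr hg) s hs 0 ⟨le_rfl, zero_lt_one⟩ h with
    ⟨rfl, -⟩ | ⟨d, hd, hde⟩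
  · exact center_notMem_arcs D hc ⟨e, he, 1 / 2, by norm_num, hgc⟩
  · exact center_notMem_arcs D hd ⟨e, he, s, ⟨hs.1, hs.2.le⟩, hde⟩

theorem arc_smoothing_ne (D : Diagram) {c : Crossing} (hc : c ∈ D.crossings) {e f : Edge}
    (he : e ∈ D.arcs) (hf : f ∈ c.smoothing) {s t : ℝ} (hs : s ∈ Set.Ico (0 : ℝ) 1)
    (ht : t ∈ Set.Ico (0 : ℝ) 1) (h : e.pt s = f.pt t) : False := by
  obtain ⟨q, hqd, hq, hcase⟩ := smoothing_coords c hf ht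
  have hsupp : f.pt t ∈ support D.arcs := ⟨e, he, s, ⟨hs.1, hs.2.le⟩, h⟩
  obtain ⟨r, hr, hrd, hrz⟩ := corners_coords c (D.disc_arcs c hc ⟨hsupp, ⟨q, hqd, hq.symm⟩⟩)
  have hqr := D.disc_embedded c hc hqd hrd (hq.symm.trans hrz)
  obtain ⟨h0, h1⟩ := ht
  rcases hcase with ⟨rfl, rfl⟩ | ⟨rfl, rfl⟩
  · have ht0 : t = 0 := by
      subst hqr
      simp only [Set.mem_insert_iff, Set.mem_singleton_iff, Prod.mk.injEq] at hr
      rcases hr with hr | hr | hr | hr <;> linarith [hr.1, hr.2]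
    subst ht0
    refine tail_notMem_arcs D hc he hs (g := c.overStrand) (Or.inl ⟨c, hc, rfl⟩) ?_ (h.trans ?_)
    · simp only [Edge.pt, Crossing.overStrand]
      rw [add_assoc, ← proj_add, smul_smul]; simp [proj]
    · simp [Edge.pt, Crossing.overStrand]
  · have ht0 : t = 0 := by
      subst hqr
      simp only [Set.mem_insert_iff, Set.mem_singleton_iff, Prod.mk.injEq] at hr
      rcases hr with hr | hr | hr | hr <;> linarith [hr.1, hr.2]
    subst ht0
    refine tail_notMem_arcs D hc he hs (g := c.underStrand) (Or.inr ⟨c, hc, rfl⟩) ?_ (h.trans ?_)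
    · simp only [Edge.pt, Crossing.underStrand]
      rw [add_assoc, ← proj_add, smul_smul]; simp [proj]
    · simp [Edge.pt, Crossing.underStrand]

theorem image_smoothing_start (D : Diagram) :
    Edge.start '' (⋃ c ∈ D.crossings, c.smoothing) = Edge.start '' strands D.crossings := by
  ext z
  simp only [strands, Set.image_union, Set.image_iUnion, Set.mem_iUnion, Set.mem_union,
    Set.mem_image, Crossing.smoothing, Set.mem_insert_iff, Set.mem_singleton_iff, Edge.start,
    Crossing.overStrand, Crossing.underStrand]
  constructor
  · rintro ⟨c, hc, e, rfl | rfl, rfl⟩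
    · exact Or.inl ⟨_, ⟨c, hc, rfl⟩, rfl⟩
    · exact Or.inr ⟨_, ⟨c, hc, rfl⟩, rfl⟩
  · rintro (⟨_, ⟨c, hc, rfl⟩, rfl⟩ | ⟨_, ⟨c, hc, rfl⟩, rfl⟩)
    · exact ⟨c, hc, _, Or.inl rfl, rfl⟩
    · exact ⟨c, hc, _, Or.inr rfl, rfl⟩

theorem image_smoothing_finish (D : Diagram) :
    Edge.finish '' (⋃ c ∈ D.crossings, c.smoothing) = Edge.finish '' strands D.crossings := by
  have h1 (c : Crossing) : Edge.finish c.overStrand = c.center + proj c.overDir := by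
    simp only [Edge.finish, Crossing.overStrand]
    rw [add_assoc, ← proj_add]; congr 2; module
  have h2 (c : Crossing) : Edge.finish c.underStrand = c.center + proj c.underDir := by
    simp only [Edge.finish, Crossing.underStrand]
    rw [add_assoc, ← proj_add]; congr 2; module
  have h3 (c : Crossing) : Edge.finish (c.center + proj (-c.overDir), c.overDir + c.underDir) =
      c.center + proj c.underDir := by
    simp only [Edge.finish]
    rw [add_assoc, ← proj_add]; congr 2; module
  have h4 (c : Crossing) : Edge.finish (c.center + proj (-c.underDir), c.overDir + c.underDir) =
      c.center + proj c.overDir := by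
    simp only [Edge.finish]
    rw [add_assoc, ← proj_add]; congr 2; module
  ext z
  simp only [strands, Set.image_union, Set.image_iUnion, Set.mem_iUnion, Set.mem_union,
    Set.mem_image, Crossing.smoothing, Set.mem_insert_iff, Set.mem_singleton_iff]
  constructor
  · rintro ⟨c, hc, e, rfl | rfl, rfl⟩
    · exact Or.inr ⟨_, ⟨c, hc, rfl⟩, by rw [h2, h3]⟩
    · exact Or.inl ⟨_, ⟨c, hc, rfl⟩, by rw [h1, h4]⟩
  · rintro (⟨_, ⟨c, hc, rfl⟩, rfl⟩ | ⟨_, ⟨c, hc, rfl⟩, rfl⟩)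
    · exact ⟨c, hc, _, Or.inr rfl, by rw [h1, h4]⟩
    · exact ⟨c, hc, _, Or.inl rfl, by rw [h2, h3]⟩

/-- The oriented smoothing of a diagram is an oriented embedded curve. -/
theorem isMulticurve_smoothedEdges (D : Diagram) : IsMulticurve D.smoothedEdges where
  finite := by
    refine D.finite.union (D.crossings.finite_toSet.biUnion fun c _ => ?_)
    exact (Set.finite_singleton _).insert _
  closed := by
    have h := D.closed
    simp only [Set.image_union] at h
    rw [smoothedEdges, Set.image_union, Set.image_union, image_smoothing_start,
      image_smoothing_finish, h]
  embedded := by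
    rintro ⟨e, s⟩ ⟨he, hs⟩ ⟨f, t⟩ ⟨hf, ht⟩ h
    simp only [smoothedEdges, Set.mem_union, Set.mem_iUnion] at he hf hs ht h
    rcases he with he | ⟨c, hc, he⟩ <;> rcases hf with hf | ⟨d, hd, hf⟩
    · rcases D.double_points e (Or.inl he) f (Or.inl hf) s hs t ht h with
        ⟨rfl, rfl⟩ | ⟨c, hc, hce⟩
      · rfl
      · exact (center_notMem_arcs D hc ⟨e, he, s, ⟨hs.1, hs.2.le⟩, hce⟩).elim
    · exact (arc_smoothing_ne D hd he hf hs ht h).elim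
    · exact (arc_smoothing_ne D hc hf he ht hs h.symm).elim
    · obtain ⟨q, hqd, hq, hcase⟩ := smoothing_coords c he hs
      obtain ⟨r, hrd, hr, hcase'⟩ := smoothing_coords d hf ht
      by_cases hcd : c = d
      · subst hcd
        have hqr := D.disc_embedded c hc hqd hrd (hq.symm.trans (h.trans hr))
        obtain ⟨hs0, hs1⟩ := hs
        obtain ⟨ht0, ht1⟩ := ht
        rcases hcase with ⟨rfl, rfl⟩ | ⟨rfl, rfl⟩ <;>
          rcases hcase' with ⟨rfl, rfl⟩ | ⟨rfl, rfl⟩ <;>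
          simp only [Prod.mk.injEq] at hqr
        · rw [hqr.2]
        · linarith [hqr.1]
        · linarith [hqr.1]
        · rw [hqr.1]
      · exact ((Set.disjoint_left.1 (D.disc_disjoint c hc d hd hcd)) ⟨q, hqd, hq.symm⟩
          ⟨r, hrd, (h.trans hr).symm⟩).elim

/-- The oriented smoothing of all crossings of a diagram. -/
def smoothed (D : Diagram) : Multicurve := ⟨D.smoothedEdges, D.isMulticurve_smoothedEdges⟩

/-- The element of `𝒜` obtained from a diagram by the oriented smoothing rule: each crossing is
replaced by its oriented smoothing and contributes a factor `A` or `A⁻¹`. -/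
def toSkein (D : Diagram) : SkeinModule :=
  (LaurentPolynomial.T (∑ c ∈ D.crossings, c.sign) : R) • D.smoothed.toSkein

end Diagram

/-! ### Superposition -/

/-- The two curves meet only transversally, in interior points of edges. -/
def InGeneralPosition (α β : Multicurve) : Prop :=
  ∀ e ∈ α.edges, ∀ f ∈ β.edges, ∀ s ∈ Set.Icc (0 : ℝ) 1, ∀ t ∈ Set.Icc (0 : ℝ) 1,
    e.pt s = f.pt t → s ∈ Set.Ioo (0 : ℝ) 1 ∧ t ∈ Set.Ioo (0 : ℝ) 1 ∧ det e.2 f.2 ≠ 0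

/-- `D` is a diagram of the superposition of `α` over `β`. The edges of `α` and `β` have to be
subdivided at the boundaries of the crossing discs. -/
def Diagram.IsSuperposition (D : Diagram) (α β : Multicurve) : Prop :=
  InGeneralPosition α β ∧
  ∃ E F : Set Edge, D.arcs = E ∪ F ∧
    Subdivision α.edges (E ∪ Crossing.overStrand '' D.crossings) ∧
    Subdivision β.edges (F ∪ Crossing.underStrand '' D.crossings)

/-! ### The oriented Reidemeister II move -/

/-- `D'` arises from `D` by a Reidemeister II move. Up to subdivision, the diagrams differ in that
a segment from `p` to `p + x + y` in `D` is replaced in `D'` by the two other sides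
`p → p + x → p + x + y` of an embedded triangle; apart from `p` and `p + x + y`, the rest `F` of the
diagrams meets the triangle exactly in a chord between interior points of these two sides. Both new
crossings have the moved strand above, or both have it below. The orientation of the strand along
the chord is arbitrary, so that all orientations of the move are covered. -/
def ReidemeisterII (D D' : Diagram) : Prop :=
  ∃ (p : Torus) (x y : Plane) (F : Set Edge) (s t : ℝ) (c₁ c₂ : Crossing),
    det x y ≠ 0 ∧ Set.InjOn (coords p x y) triangleDomain ∧
    s ∈ Set.Ioo (0 : ℝ) 1 ∧ t ∈ Set.Ioo (0 : ℝ) 1 ∧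
    Subdivision (F ∪ {(p, x + y)}) D.underlying ∧
    Subdivision (F ∪ {(p, x), (p + proj x, y)}) D'.underlying ∧
    support F ∩ triangle p x y =
      {p, p + proj (x + y)} ∪ coords p x y '' segment ℝ (s, 0) (1, t) ∧
    c₁ ∉ D.crossings ∧ c₂ ∉ D.crossings ∧
    (D'.crossings : Set Crossing) = (D.crossings : Set Crossing) ∪ {c₁, c₂} ∧
    c₁.center = coords p x y (s, 0) ∧ c₂.center = coords p x y (1, t) ∧
    ((∃ k > (0 : ℝ), ∃ l > (0 : ℝ), c₁.overDir = k • x ∧ c₂.overDir = l • y) ∨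
      (∃ k > (0 : ℝ), ∃ l > (0 : ℝ), c₁.underDir = k • x ∧ c₂.underDir = l • y))

end OrientedSkein

end

noncomputable section

namespace OrientedSkein

open Set (Icc Ico Ioo InjOn image_union subset_union_left mem_singleton_iff mem_ofPred_eq image_pair
  toFinite mem_insert_iff image_singleton finite_singleton sdiff_subset mem_union disjoint_left
  mem_image_of_mem union_assoc pair_comm mem_iUnion)
open Finset (sum_insert sum_congr sum_singleton mem_filter Ioc sum_add_distrib mem_coe mem_Ico
  mem_product Ioc_eq_empty sum_product sum_sub_distrib mem_insert mul_sum sum_comm sum_image)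
open Filter Topology
open Real (Angle norm_of_nonneg pi_pos)
open Prod (fst_sub snd_sub fst_add snd_add smul_fst smul_snd fst_neg snd_neg)
open LaurentPolynomial (T_add)

local notation "π" => Real.pi
local notation "Icc₀₁" => Set.Icc (0 : ℝ) 1
local notation "Ico₀₁" => Set.Ico (0 : ℝ) 1
local notation "Ioo₀₁" => Set.Ioo (0 : ℝ) 1

variable {α β γ : Multicurve} {D D' : Diagram} {E E' F P : Set Edge} {e f : Edge} {K : Set Plane}
  {a b c u v w : Plane} {s t : ℝ}

/-! ### The projection and straight segments -/

lemma proj_zero : proj 0 = 0 := by simp [proj]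

lemma proj_neg (u : Plane) : proj (-u) = -proj u := by
  ext <;> simp [proj]

lemma proj_sub (u v : Plane) : proj (u - v) = proj u - proj v := by
  rw [sub_eq_add_neg, proj_add, proj_neg, sub_eq_add_neg]

lemma continuous_proj : Continuous proj := by
  unfold proj
  exact ((AddCircle.continuous_mk' 1).comp continuous_fst).prodMk
    ((AddCircle.continuous_mk' 1).comp continuous_snd)

lemma proj_surjective : Function.Surjective proj := by
  rintro ⟨a, b⟩
  obtain ⟨x, rfl⟩ := QuotientAddGroup.mk_surjective a
  obtain ⟨y, rfl⟩ := QuotientAddGroup.mk_surjective b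
  exact ⟨(x, y), rfl⟩

/-- The lattice vector with coordinates `m`, `n`. -/
def lat (n : ℤ × ℤ) : Plane := ((n.1 : ℝ), (n.2 : ℝ))

lemma lat_add (m n : ℤ × ℤ) : lat (m + n) = lat m + lat n := by
  ext <;> simp [lat]

lemma lat_injective : Function.Injective lat := by
  intro m n h
  simp only [lat, Prod.mk.injEq, Int.cast_inj] at h
  exact Prod.ext h.1 h.2

lemma coe_circle_eq_zero (x : ℝ) : (x : UnitAddCircle) = 0 ↔ ∃ n : ℤ, x = n := by
  rw [AddCircle.coe_eq_zero_iff]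
  constructor
  · rintro ⟨n, hn⟩; exact ⟨n, by simpa using hn.symm⟩
  · rintro ⟨n, rfl⟩; exact ⟨n, by simp⟩

lemma proj_eq_zero_iff (u : Plane) : proj u = 0 ↔ ∃ n : ℤ × ℤ, u = lat n := by
  constructor
  · intro h
    obtain ⟨m, hm⟩ := (coe_circle_eq_zero u.1).1 (congrArg Prod.fst h)
    obtain ⟨n, hn⟩ := (coe_circle_eq_zero u.2).1 (congrArg Prod.snd h)
    exact ⟨(m, n), Prod.ext hm hn⟩
  · rintro ⟨n, rfl⟩
    exact Prod.ext ((coe_circle_eq_zero _).2 ⟨n.1, rfl⟩) ((coe_circle_eq_zero _).2 ⟨n.2, rfl⟩)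

lemma proj_lat (n : ℤ × ℤ) : proj (lat n) = 0 := (proj_eq_zero_iff _).2 ⟨n, rfl⟩

lemma proj_eq_iff (u v : Plane) : proj u = proj v ↔ ∃ n : ℤ × ℤ, v = u + lat n := by
  rw [← sub_eq_zero, ← neg_eq_zero, neg_sub, ← proj_sub, proj_eq_zero_iff]
  simp only [sub_eq_iff_eq_add']

/-- `proj` is injective on sets that fit into an open-ended unit box. -/
lemma injOn_proj_of_box (x₀ y₀ : ℝ)
    (h : ∀ z ∈ K, x₀ ≤ z.1 ∧ z.1 < x₀ + 1 ∧ y₀ ≤ z.2 ∧ z.2 < y₀ + 1) : InjOn proj K := by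
  intro u hu v hv huv
  obtain ⟨⟨m, n⟩, rfl⟩ := (proj_eq_iff u v).1 huv
  have h1 := h u hu
  have h2 := h _ hv
  simp only [lat, fst_add, snd_add] at h2
  have hm : m = 0 := by
    have : (m : ℝ) < 1 ∧ (-1 : ℝ) < m := ⟨by linarith, by linarith⟩
    have h3 : m < 1 ∧ -1 < m := by exact_mod_cast this
    omega
  have hn : n = 0 := by
    have : (n : ℝ) < 1 ∧ (-1 : ℝ) < n := ⟨by linarith, by linarith⟩
    have h3 : n < 1 ∧ -1 < n := by exact_mod_cast this
    omega
  subst hm hn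
  ext <;> simp [lat]

/-- The directed segment from `proj a` to `proj b` with displacement `b - a`. -/
def seg (a b : Plane) : Edge := (proj a, b - a)

lemma seg_pt (a b : Plane) (t : ℝ) : (seg a b).pt t = proj (a + t • (b - a)) := by
  simp [seg, Edge.pt, proj_add]

lemma seg_start (a b : Plane) : (seg a b).start = proj a := rfl

lemma seg_finish (a b : Plane) : (seg a b).finish = proj b := by
  simp [seg, Edge.finish, ← proj_add]

lemma pt_zero (e : Edge) : e.pt 0 = e.start := by
  simp [Edge.pt, proj_zero, Edge.start]

lemma pt_one (e : Edge) : e.pt 1 = e.finish := by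
  simp [Edge.pt, Edge.finish]

lemma exists_eq_seg (e : Edge) : ∃ a : Plane, proj a = e.1 ∧ e = seg a (a + e.2) := by
  obtain ⟨a, ha⟩ := proj_surjective e.1
  exact ⟨a, ha, Prod.ext ha.symm (by simp [seg])⟩

lemma seg_translate (a b : Plane) (n : ℤ × ℤ) : seg (a + lat n) (b + lat n) = seg a b := by
  simp [seg, proj_add, proj_lat]

lemma continuous_pt (e : Edge) : Continuous e.pt := by
  unfold Edge.pt
  exact continuous_const.add (continuous_proj.comp (continuous_id.smul continuous_const))

lemma isCompact_support (hE : E.Finite) : IsCompact (support E) := by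
  have : support E = ⋃ e ∈ E, e.pt '' Icc₀₁ := by
    ext z; simp [support]
  rw [this]
  exact hE.isCompact_biUnion fun e _ => isCompact_Icc.image (continuous_pt e)

lemma support_union (E F : Set Edge) : support (E ∪ F) = support E ∪ support F := by
  ext z
  simp only [support, mem_union, mem_ofPred_eq, or_and_right, exists_or]

lemma support_mono (h : E ⊆ F) : support E ⊆ support F :=
  fun _ ⟨e, he, t, ht, hz⟩ => ⟨e, h he, t, ht, hz⟩

lemma pt_mem_support (he : e ∈ E) (ht : t ∈ Icc₀₁) :
    e.pt t ∈ support E := ⟨e, he, t, ht, rfl⟩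

lemma mem_Icc_of_mem_Ico (ht : t ∈ Ico₀₁) : t ∈ Icc₀₁ :=
  ⟨ht.1, ht.2.le⟩

lemma zero_mem_Ico : (0 : ℝ) ∈ Ico₀₁ := ⟨le_rfl, zero_lt_one⟩

/-! ### Elementary properties of multicurves -/

namespace IsMulticurve

variable {E : Set Edge}

lemma eq_of_pt_eq (h : IsMulticurve E) (he : e ∈ E) (hf : f ∈ E)
    (hs : s ∈ Ico₀₁) (ht : t ∈ Ico₀₁) (hst : e.pt s = f.pt t) :
    e = f ∧ s = t := by
  have := h.embedded (show (e, s) ∈ E ×ˢ Ico₀₁ from ⟨he, hs⟩)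
    (show (f, t) ∈ E ×ˢ Ico₀₁ from ⟨hf, ht⟩) hst
  exact ⟨congrArg Prod.fst this, congrArg Prod.snd this⟩

lemma start_injOn (h : IsMulticurve E) : InjOn Edge.start E := by
  intro e he f hf hef
  exact (h.eq_of_pt_eq he hf zero_mem_Ico zero_mem_Ico (by rw [pt_zero, pt_zero, hef])).1

lemma finish_injOn (h : IsMulticurve E) : InjOn Edge.finish E := by
  refine Set.injOn_of_ncard_image_eq ?_ h.finite
  rw [h.closed, h.start_injOn.ncard_image]

lemma exists_start (h : IsMulticurve E) (he : e ∈ E) :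
    ∃ f ∈ E, f.start = e.finish := by
  have : e.finish ∈ Edge.start '' E := h.closed ▸ ⟨e, he, rfl⟩
  exact this

lemma exists_finish (h : IsMulticurve E) (he : e ∈ E) :
    ∃ f ∈ E, f.finish = e.start := by
  have : e.start ∈ Edge.finish '' E := h.closed.symm ▸ ⟨e, he, rfl⟩
  exact this

lemma exists_Ico (h : IsMulticurve E) {z : Torus} (hz : z ∈ support E) :
    ∃ e ∈ E, ∃ t ∈ Ico₀₁, e.pt t = z := by
  obtain ⟨e, he, t, ht, rfl⟩ := hz
  rcases ht.2.lt_or_eq with h1 | rfl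
  · exact ⟨e, he, t, ⟨ht.1, h1⟩, rfl⟩
  · obtain ⟨f, hf, hfe⟩ := h.exists_start he
    exact ⟨f, hf, 0, zero_mem_Ico, by rw [pt_zero, pt_one, hfe]⟩

lemma disp_ne_zero (h : IsMulticurve E) (he : e ∈ E) : e.2 ≠ 0 := by
  intro h0
  have := (h.eq_of_pt_eq (s := 0) (t := 1 / 2) he he zero_mem_Ico (by norm_num)
    (by simp [Edge.pt, h0])).2
  norm_num at this

/-- A part of a multicurve does not pass through an interior vertex of the remaining part. -/
lemma vertex_notMem_support (h : IsMulticurve E) (hF : F ⊆ E)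
    (he : e ∈ E) (hf : f ∈ E) (heF : e ∉ F) (hfF : f ∉ F) (hef : e.finish = f.start) :
    f.start ∉ support F := by
  rintro ⟨g, hg, t, ht, hgt⟩
  rcases ht.2.lt_or_eq with h1 | rfl
  · have := (h.eq_of_pt_eq (hF hg) hf ⟨ht.1, h1⟩ zero_mem_Ico (by rw [hgt, pt_zero])).1
    exact hfF (this ▸ hg)
  · rw [pt_one, ← hef] at hgt
    exact heF (h.finish_injOn (hF hg) he hgt ▸ hg)

/-- Replacing a part of a multicurve. -/
lemma replace {P' : Set Edge} (h : IsMulticurve (F ∪ P)) (hP' : P'.Finite)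
    (hclosed : Edge.finish '' (F ∪ P') = Edge.start '' (F ∪ P'))
    (hinj : InjOn (fun q : Edge × ℝ => q.1.pt q.2) (P' ×ˢ Ico₀₁))
    (hdisj : ∀ e ∈ P', ∀ s ∈ Ico₀₁, ∀ f ∈ F, ∀ t ∈ Ico₀₁,
      e.pt s ≠ f.pt t) : IsMulticurve (F ∪ P') where
  finite := (h.finite.subset subset_union_left).union hP'
  closed := hclosed
  embedded := by
    rintro ⟨e, s⟩ ⟨he, hs⟩ ⟨f, t⟩ ⟨hf, ht⟩ hst
    rcases he with he | he <;> rcases hf with hf | hf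
    · obtain ⟨rfl, rfl⟩ := h.eq_of_pt_eq (.inl he) (.inl hf) hs ht hst
      rfl
    · exact (hdisj f hf t ht e he s hs hst.symm).elim
    · exact (hdisj e he s hs f hf t ht hst).elim
    · exact hinj (show (e, s) ∈ P' ×ˢ Ico₀₁ from ⟨he, hs⟩)
        (show (f, t) ∈ P' ×ˢ Ico₀₁ from ⟨hf, ht⟩) hst

end IsMulticurve

/-! ### The determinant -/

lemma det_self (u : Plane) : det u u = 0 := by simp [det]; ring

lemma det_comm (u v : Plane) : det u v = -det v u := by simp [det]; ring

lemma det_add_left (u v w : Plane) : det (u + v) w = det u w + det v w := by simp [det]; ring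

lemma det_add_right (u v w : Plane) : det u (v + w) = det u v + det u w := by simp [det]; ring

lemma det_smul_left (r : ℝ) (u v : Plane) : det (r • u) v = r * det u v := by simp [det]; ring

lemma det_smul_right (r : ℝ) (u v : Plane) : det u (r • v) = r * det u v := by simp [det]; ring

lemma det_neg_left (u v : Plane) : det (-u) v = -det u v := by simp [det]; ring

lemma det_neg_right (u v : Plane) : det u (-v) = -det u v := by simp [det]; ring

lemma det_sub_left (u v w : Plane) : det (u - v) w = det u w - det v w := by simp [det]; ring

lemma det_sub_right (u v w : Plane) : det u (v - w) = det u v - det u w := by simp [det]; ring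

lemma det_zero_left (u : Plane) : det 0 u = 0 := by simp [det]

lemma det_zero_right (u : Plane) : det u 0 = 0 := by simp [det]

/-! ### Convexity -/

lemma le_det_of_mem_convexHull {s : Set Plane} {c : ℝ} (h : ∀ z ∈ s, c ≤ det u z)
    {z : Plane} (hz : z ∈ convexHull ℝ s) : c ≤ det u z := by
  have hconv : Convex ℝ {z : Plane | c ≤ det u z} := by
    intro x hx y hy a b ha hb hab
    simp only [mem_ofPred_eq, det_add_right, det_smul_right] at hx hy ⊢
    calc c = a * c + b * c := by rw [← add_mul, hab, one_mul]
      _ ≤ _ := add_le_add (mul_le_mul_of_nonneg_left hx ha) (mul_le_mul_of_nonneg_left hy hb)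
  exact convexHull_min h hconv hz

lemma lineMap_mem_of_convex (hK : Convex ℝ K) (ha : a ∈ K)
    (hb : b ∈ K) (ht : t ∈ Icc₀₁) : a + t • (b - a) ∈ K := by
  have := hK ha hb (sub_nonneg.2 ht.2) ht.1 (by ring)
  convert this using 1
  module

/-- The edges of `F` meet `K` only in points of `V`. -/
def Touches (F : Set Edge) (K V : Set Plane) : Prop :=
  ∀ z ∈ K, proj z ∈ support F → z ∈ V

lemma Touches.seg_notMem {V : Set Plane} (h : Touches F K V)
    (hK : Convex ℝ K) (hV : V.Finite) (ha : a ∈ K) (hb : b ∈ K) (hab : a ≠ b) :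
    seg a b ∉ F := by
  intro hmem
  refine ((Set.Icc_infinite (zero_lt_one' ℝ)).image
    (AffineMap.lineMap_injective ℝ hab).injOn) (hV.subset ?_)
  rintro _ ⟨s, hs, rfl⟩
  rw [AffineMap.lineMap_apply_module', add_comm]
  exact h _ (lineMap_mem_of_convex hK ha hb hs) (seg_pt a b s ▸ pt_mem_support hmem hs)

/-! ### Curves with one gap -/

/-- `F` is an embedded polygonal curve except for a missing path from `a` to `b`. -/
structure OpenCurve (F : Set Edge) (a b : Torus) : Prop where
  finite : F.Finite
  embedded : InjOn (fun q : Edge × ℝ => q.1.pt q.2) (F ×ˢ Ico₀₁)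
  avoids : ∀ f ∈ F, ∀ t ∈ Ico₀₁, f.pt t ≠ a
  closed : Edge.finish '' F ∪ {b} = Edge.start '' F ∪ {a}

lemma IsMulticurve.openCurve_of {b : Torus} (h : IsMulticurve E)
    (hF : F ⊆ E) (he : e ∈ E) (he' : e ∉ F)
    (hc : Edge.finish '' F ∪ {b} = Edge.start '' F ∪ {e.start}) : OpenCurve F e.start b where
  finite := h.finite.subset hF
  embedded := h.embedded.mono (Set.prod_mono_left hF)
  avoids f hf t ht hft :=
    he' ((h.eq_of_pt_eq (hF hf) he ht zero_mem_Ico (by rw [hft, pt_zero])).1 ▸ hf)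
  closed := hc

lemma IsMulticurve.openCurve (h : IsMulticurve (F ∪ {e})) (he : e ∉ F) :
    OpenCurve F e.start e.finish :=
  h.openCurve_of subset_union_left (.inr rfl) he (by simpa only [image_union, image_singleton]
    using h.closed)

lemma IsMulticurve.openCurve_pair (h : IsMulticurve (F ∪ {e, f}))
    (he : e ∉ F) (hf : f ∉ F) (hef : e.finish = f.start) (h1 : e.start ≠ f.start)
    (h2 : f.finish ≠ f.start) : OpenCurve F e.start f.finish := by
  refine h.openCurve_of subset_union_left (.inr (.inl rfl)) he ?_
  have ha : f.start ∉ Edge.finish '' F := fun ⟨g, hg, hgf⟩ =>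
    he (h.finish_injOn (.inl hg) (.inr (.inl rfl)) (hgf.trans hef.symm) ▸ hg)
  have hb : f.start ∉ Edge.start '' F := fun ⟨g, hg, hgf⟩ =>
    hf (h.start_injOn (.inl hg) (.inr (.inr rfl)) hgf ▸ hg)
  ext z
  have hc := Set.ext_iff.1 h.closed z
  rw [image_union, image_union, image_pair, image_pair, hef] at hc
  simp only [mem_union, mem_insert_iff, mem_singleton_iff] at hc ⊢
  by_cases hz : z = f.start
  · subst hz
    simp [ha, hb, h1.symm, h2.symm]
  · simpa only [hz, false_or, or_false] using hc

/-- `F` meets the embedded convex disc `K` at most in its boundary points `a` and `b`. -/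
structure GapDisc (F : Set Edge) (K : Set Plane) (a b : Plane) : Prop where
  convex : Convex ℝ K
  inj : InjOn proj K
  left_mem : a ∈ K
  right_mem : b ∈ K
  ne : a ≠ b
  outside : support F ∩ proj '' K ⊆ {proj a, proj b}

namespace GapDisc

variable {F : Set Edge} {K : Set Plane} {a b : Plane}

lemma touches (h : GapDisc F K a b) : Touches F K {a, b} := fun z hz hF =>
  (h.outside ⟨hF, z, hz, rfl⟩).imp (h.inj hz h.left_mem) (h.inj hz h.right_mem)

lemma ne_pt (h : GapDisc F K a b) (ho : OpenCurve F (proj a) (proj b)) {z : Plane} (hz : z ∈ K)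
    (hb : z ≠ b) (hf : f ∈ F) (ht : t ∈ Ico₀₁) :
    proj z ≠ f.pt t := by
  intro hzt
  rcases h.touches z hz (hzt ▸ pt_mem_support hf (mem_Icc_of_mem_Ico ht)) with rfl | rfl
  · exact ho.avoids f hf t ht hzt.symm
  · exact hb rfl

lemma isMulticurve_aux (h : GapDisc F K a b) (ho : OpenCurve F (proj a) (proj b)) (hP : P.Finite)
    (hclosed : Edge.finish '' (F ∪ P) = Edge.start '' (F ∪ P)) (w : Plane)
    (hpt : ∀ e ∈ P, ∀ s ∈ Ico₀₁, ∃ z ∈ K, e.pt s = proj z ∧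
      |det (z - a) w| < |det (b - a) w|)
    (hinj : ∀ e ∈ P, ∀ s ∈ Ico₀₁, ∀ f ∈ P, ∀ t ∈ Ico₀₁,
      e.pt s = f.pt t → e = f ∧ s = t) : IsMulticurve (F ∪ P) where
  finite := ho.finite.union hP
  closed := hclosed
  embedded := by
    have key : ∀ e ∈ P, ∀ s ∈ Ico₀₁, ∀ f ∈ F, ∀ t ∈ Ico₀₁,
        e.pt s ≠ f.pt t := by
      intro e he s hs f hf t ht hst
      obtain ⟨z, hz, hez, hlt⟩ := hpt e he s hs
      refine h.ne_pt ho hz ?_ hf ht (hez.symm.trans hst)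
      rintro rfl
      exact lt_irrefl _ hlt
    rintro ⟨e, s⟩ ⟨he, hs⟩ ⟨f, t⟩ ⟨hf, ht⟩ hst
    rcases he with he | he <;> rcases hf with hf | hf
    · exact ho.embedded ⟨he, hs⟩ ⟨hf, ht⟩ hst
    · exact (key f hf t ht e he s hs hst.symm).elim
    · exact (key e he s hs f hf t ht hst).elim
    · obtain ⟨rfl, rfl⟩ := hinj e he s hs f hf t ht hst
      rfl

lemma isMulticurve_seg (h : GapDisc F K a b) (ho : OpenCurve F (proj a) (proj b)) :
    IsMulticurve (F ∪ {seg a b}) := by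
  obtain ⟨w, hw⟩ : ∃ w : Plane, det (b - a) w ≠ 0 := by
    by_contra! hcon
    have h1 := hcon (1, 0)
    have h2 := hcon (0, 1)
    simp only [det, fst_sub, snd_sub] at h1 h2
    exact h.ne (Prod.ext (by linarith) (by linarith))
  refine h.isMulticurve_aux ho (finite_singleton _) ?_ w ?_ ?_
  · rw [image_union, image_union, image_singleton, image_singleton, seg_start,
      seg_finish]
    exact ho.closed
  · rintro e rfl s hs
    refine ⟨_, lineMap_mem_of_convex h.convex h.left_mem h.right_mem (mem_Icc_of_mem_Ico hs),
      seg_pt a b s, ?_⟩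
    rw [add_sub_cancel_left, det_smul_left, abs_mul, abs_of_nonneg hs.1]
    exact mul_lt_of_lt_one_left (abs_pos.2 hw) hs.2
  · rintro e rfl s hs f rfl t ht hst
    refine ⟨rfl, ?_⟩
    rw [seg_pt, seg_pt] at hst
    have := h.inj (lineMap_mem_of_convex h.convex h.left_mem h.right_mem (mem_Icc_of_mem_Ico hs))
      (lineMap_mem_of_convex h.convex h.left_mem h.right_mem (mem_Icc_of_mem_Ico ht)) hst
    exact smul_left_injective ℝ (sub_ne_zero.2 h.ne.symm) (add_left_cancel this)

/-- The middle vertex of the bent path may move in direction `w`. -/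
lemma isMulticurve_bent (h : GapDisc F K a b) (ho : OpenCurve F (proj a) (proj b))
    (hc : c ∈ K) (hw : det (b - a) w ≠ 0) (hcw : det (c - a) w = det (b - a) w / 2) :
    IsMulticurve (F ∪ {seg a c, seg c b}) := by
  have hcw' : det (b - c) w = det (b - a) w / 2 := by
    have : b - c = (b - a) - (c - a) := by abel
    rw [this, det_sub_left, hcw]; ring
  have hD := abs_pos.2 hw
  have hca (s : ℝ) : det (a + s • (c - a) - a) w = s / 2 * det (b - a) w := by
    rw [add_sub_cancel_left, det_smul_left, hcw]; ring
  have hcb (s : ℝ) : det (c + s • (b - c) - a) w = (1 + s) / 2 * det (b - a) w := by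
    have : c + s • (b - c) - a = (c - a) + s • (b - c) := by abel
    rw [this, det_add_left, det_smul_left, hcw, hcw']; ring
  have mem1 {s : ℝ} (hs : s ∈ Ico₀₁) : a + s • (c - a) ∈ K :=
    lineMap_mem_of_convex h.convex h.left_mem hc (mem_Icc_of_mem_Ico hs)
  have mem2 {s : ℝ} (hs : s ∈ Ico₀₁) : c + s • (b - c) ∈ K :=
    lineMap_mem_of_convex h.convex hc h.right_mem (mem_Icc_of_mem_Ico hs)
  refine h.isMulticurve_aux ho (toFinite _) ?_ w ?_ ?_
  · ext z
    have := Set.ext_iff.1 ho.closed z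
    simp only [image_union, image_pair, seg_start, seg_finish, mem_union, mem_insert_iff,
      mem_singleton_iff] at this ⊢
    tauto
  · rintro e (rfl | rfl) s hs
    · refine ⟨_, mem1 hs, seg_pt a c s, ?_⟩
      rw [hca, abs_mul, abs_of_nonneg (by linarith [hs.1])]
      exact mul_lt_of_lt_one_left hD (by linarith [hs.2])
    · refine ⟨_, mem2 hs, seg_pt c b s, ?_⟩
      rw [hcb, abs_mul, abs_of_nonneg (by linarith [hs.1])]
      exact mul_lt_of_lt_one_left hD (by linarith [hs.2])
  · rintro e (rfl | rfl) s hs f (rfl | rfl) t ht hst <;> rw [seg_pt, seg_pt] at hst <;>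
      replace hst := congrArg (fun z => det (z - a) w) (h.inj (by first | exact mem1 hs | exact mem2 hs)
        (by first | exact mem1 ht | exact mem2 ht) hst) <;>
      simp only [hca, hcb] at hst <;> replace hst := mul_right_cancel₀ hw hst
    exacts [⟨rfl, by linarith⟩, by linarith [hs.2, ht.1], by linarith [ht.2, hs.1],
      ⟨rfl, by linarith⟩]

lemma seg_notMem (h : GapDisc F K a b) {d : Plane} (hc : c ∈ K) (hd : d ∈ K) (hcd : c ≠ d) :
    seg c d ∉ F :=
  h.touches.seg_notMem h.convex (toFinite _) hc hd hcd

lemma openCurve (h : GapDisc F K a b) (hα : α.edges = F ∪ {seg a b}) :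
    OpenCurve F (proj a) (proj b) := by
  have := (hα ▸ α.isMulticurve : IsMulticurve (F ∪ {seg a b})).openCurve
    (h.seg_notMem h.left_mem h.right_mem h.ne)
  rwa [seg_start, seg_finish] at this

end GapDisc

lemma Isotopic.refl (α : Multicurve) : Isotopic α α := Relation.EqvGen.refl _

lemma Isotopic.symm (h : Isotopic α β) : Isotopic β α :=
  Relation.EqvGen.symm _ _ h

lemma Isotopic.trans (h : Isotopic α β) (h' : Isotopic β γ) :
    Isotopic α γ := Relation.EqvGen.trans _ _ _ h h'

lemma Multicurve.ext' (h : α.edges = β.edges) : α = β := by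
  cases α; cases β; cases h; rfl

lemma continuous_seg {f g : unitInterval → Plane} (hf : Continuous f) (hg : Continuous g) :
    Continuous fun t => seg (f t) (g t) :=
  (continuous_proj.comp hf).prodMk (hg.sub hf)

/-- An edge may be pushed across an empty triangle. -/
lemma GapDisc.isotopic (h : GapDisc F K a b)
    (hc : c ∈ K) (hdet : det (b - a) (c - a) ≠ 0)
    (hα : α.edges = F ∪ {seg a b}) (hβ : β.edges = F ∪ {seg a c, seg c b}) : Isotopic α β := by
  classical
  set m : Plane := a + (1 / 2 : ℝ) • (b - a) with hm
  set w : Plane := c - m with hwdef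
  have hw : det (b - a) w ≠ 0 := by
    have : w = (c - a) - (1 / 2 : ℝ) • (b - a) := by rw [hwdef, hm]; abel
    rw [this, det_sub_right, det_smul_right, det_self]; simpa using hdet
  have hmK : m ∈ K := lineMap_mem_of_convex h.convex h.left_mem h.right_mem (by norm_num)
  let v : unitInterval → Plane := fun t => m + (t : ℝ) • w
  have hvc : Continuous v := by
    exact continuous_const.add (continuous_subtype_val.smul continuous_const)
  have hvK (t : unitInterval) : v t ∈ K := lineMap_mem_of_convex h.convex hmK hc t.2
  have hvw (t : unitInterval) : det (v t - a) w = det (b - a) w / 2 := by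
    have : v t - a = (1 / 2 : ℝ) • (b - a) + (t : ℝ) • w := by simp only [v, hm]; abel
    rw [this, det_add_left, det_smul_left, det_smul_left, det_self]; ring
  have hcurve (t : unitInterval) : IsMulticurve (F ∪ {seg a (v t), seg (v t) b}) :=
    h.isMulticurve_bent (h.openCurve hα) (hvK t) hw (hvw t)
  have hav (t : unitInterval) : a ≠ v t := by
    intro heq
    have := hvw t
    rw [← heq, sub_self, det_zero_left] at this
    exact hw (by linarith)
  have hvb (t : unitInterval) : v t ≠ b := by
    intro heq
    have := hvw t
    rw [heq] at this
    exact hw (by linarith)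
  have hn1 (t : unitInterval) : seg a (v t) ∉ F := h.seg_notMem h.left_mem (hvK t) (hav t)
  have hn2 (t : unitInterval) : seg (v t) b ∉ F := h.seg_notMem (hvK t) h.right_mem (hvb t)
  have hne (t : unitInterval) : seg a (v t) ≠ seg (v t) b := fun heq =>
    hav t (h.inj h.left_mem (hvK t) (congrArg Prod.fst heq))
  let γ : Multicurve := ⟨F ∪ {seg a (v 0), seg (v 0) b}, hcurve 0⟩
  have hstep : SubdivisionStep α.edges γ.edges := by
    have e1 : ((seg a b).1, (1 / 2 : ℝ) • (seg a b).2) = seg a (v 0) := by simp [seg, v, hm]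
    have e2 : ((seg a b).pt (1 / 2), (1 - 1 / 2 : ℝ) • (seg a b).2) = seg (v 0) b := by
      rw [seg_pt, seg]
      ext1 <;> simp [seg, v, hm]
      module
    refine ⟨F, seg a b, 1 / 2, by norm_num, by norm_num,
      h.seg_notMem h.left_mem h.right_mem h.ne, ?_, ?_, hα, ?_⟩ <;> simp only [e1, e2]
    exacts [hn1 0, hn2 0, rfl]
  let φ (t : unitInterval) (e : Edge) : Edge :=
    if e = seg a (v 0) then seg a (v t) else if e = seg (v 0) b then seg (v t) b else e
  have hF (t) {e} (he : e ∈ F) : φ t e = e :=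
    (if_neg (by rintro rfl; exact hn1 0 he)).trans (if_neg (by rintro rfl; exact hn2 0 he))
  have h1 (t) : φ t (seg a (v 0)) = seg a (v t) := if_pos rfl
  have h2 (t) : φ t (seg (v 0) b) = seg (v t) b := (if_neg (hne 0).symm).trans (if_pos rfl)
  have himg (t) : φ t '' γ.edges = F ∪ {seg a (v t), seg (v t) b} := by
    simp only [γ, image_union, image_pair, h1, h2]
    rw [Set.image_congr fun e he => hF t he, Set.image_id']
  refine .trans (.rel α γ (.inl hstep)) (.rel γ β (.inr ⟨φ, fun e _ => ?_, fun e _ => ?_,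
    fun t => ⟨?_, himg t ▸ hcurve t⟩, ?_⟩))
  · dsimp only [φ]
    split_ifs
    exacts [continuous_seg continuous_const hvc, continuous_seg hvc continuous_const,
      continuous_const]
  · dsimp only [φ]
    split_ifs with h1 h2
    exacts [h1.symm, h2.symm, rfl]
  · have := hn1 t
    have := hn2 t
    have := hne t
    rintro e (he | rfl | rfl) f (hf | rfl | rfl) hef <;> simp only [hF t, *] at hef <;> grind
  · rw [himg, hβ]
    simp [v, hwdef]

/-- The curve with an edge pushed across an empty triangle. -/
lemma GapDisc.exists_push (h : GapDisc F K a b)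
    (hc : c ∈ K) (hdet : det (b - a) (c - a) ≠ 0)
    (hα : α.edges = F ∪ {seg a b}) :
    ∃ β : Multicurve, β.edges = F ∪ {seg a c, seg c b} ∧ Isotopic α β := by
  have hw : det (b - a) (c - a - (1 / 2 : ℝ) • (b - a)) = det (b - a) (c - a) := by
    rw [det_sub_right, det_smul_right, det_self]; ring
  have hcurve : IsMulticurve (F ∪ {seg a c, seg c b}) := by
    refine h.isMulticurve_bent (h.openCurve hα) hc (w := c - a - (1 / 2 : ℝ) • (b - a)) (hw ▸ hdet) ?_
    rw [hw, det_sub_right, det_self, det_smul_right, det_comm (c - a)]; ring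
  exact ⟨⟨_, hcurve⟩, rfl, h.isotopic hc hdet hα rfl⟩

/-- Two consecutive edges may be replaced by the third side of an empty triangle. -/
lemma GapDisc.exists_pull (h : GapDisc F K a b)
    (hc : c ∈ K) (hdet : det (b - a) (c - a) ≠ 0)
    (hα : α.edges = F ∪ {seg a c, seg c b}) :
    ∃ β : Multicurve, β.edges = F ∪ {seg a b} ∧ Isotopic α β := by
  have hac : a ≠ c := by rintro rfl; simp [det_zero_right] at hdet
  have hcb : c ≠ b := by rintro rfl; simp [det_self] at hdet
  have hα' : IsMulticurve (F ∪ {seg a c, seg c b}) := hα ▸ α.isMulticurve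
  have ho : OpenCurve F (proj a) (proj b) := by
    have := hα'.openCurve_pair (h.seg_notMem h.left_mem hc hac) (h.seg_notMem hc h.right_mem hcb)
      (by rw [seg_start, seg_finish]) (fun heq => hac (h.inj h.left_mem hc heq))
      (fun heq => hcb (h.inj h.right_mem hc (by rwa [seg_start, seg_finish] at heq)).symm)
    rwa [seg_start, seg_finish] at this
  exact ⟨⟨_, h.isMulticurve_seg ho⟩, rfl, (h.isotopic hc hdet rfl hα).symm⟩

/-! ### Equality in the skein module up to a power of `-A²` -/

/-- The unit `-A²`. -/
def qUnit : Rˣ where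
  val := -LaurentPolynomial.T 2
  inv := -LaurentPolynomial.T (-2)
  val_inv := by rw [neg_mul_neg, ← T_add]; simp
  inv_val := by rw [neg_mul_neg, ← T_add]; simp

/-- The classes of two curves agree up to a power of `-A²`. -/
def SkeinEquiv (α β : Multicurve) : Prop :=
  ∃ k : ℤ, α.toSkein = ((qUnit ^ k : Rˣ) : R) • β.toSkein

namespace SkeinEquiv

lemma refl (α : Multicurve) : SkeinEquiv α α := ⟨0, by simp⟩

lemma symm (h : SkeinEquiv α β) : SkeinEquiv β α := by
  obtain ⟨k, hk⟩ := h
  refine ⟨-k, ?_⟩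
  rw [hk, smul_smul, ← Units.val_mul, ← zpow_add]
  simp

lemma trans (h : SkeinEquiv α β) (h' : SkeinEquiv β γ) :
    SkeinEquiv α γ := by
  obtain ⟨k, hk⟩ := h
  obtain ⟨l, hl⟩ := h'
  refine ⟨k + l, ?_⟩
  rw [hk, hl, smul_smul, ← Units.val_mul, ← zpow_add]

end SkeinEquiv

lemma SkeinRel.mk_eq {f g : Multicurve →₀ R} (h : SkeinRel f g) :
    (Submodule.Quotient.mk f : SkeinModule) = Submodule.Quotient.mk g :=
  (Submodule.Quotient.eq _).2 (Submodule.subset_span ⟨f, g, h, rfl⟩)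

lemma mk_single (α : Multicurve) (r : R) :
    (Submodule.Quotient.mk (Finsupp.single α r) : SkeinModule) = r • α.toSkein := by
  rw [Multicurve.toSkein, ← Submodule.Quotient.mk_smul, Finsupp.smul_single, smul_eq_mul, mul_one]

lemma Isotopic.toSkein_eq (h : Isotopic α β) : α.toSkein = β.toSkein :=
  (SkeinRel.isotopy α β h).mk_eq

lemma Isotopic.skeinEquiv (h : Isotopic α β) : SkeinEquiv α β :=
  ⟨0, by simp [h.toSkein_eq]⟩

lemma triangleBoundary_seg (a b c : Plane) :
    triangleBoundary (proj a) (b - a) (c - b) = {seg a b, seg b c, seg c a} := by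
  have h1 : proj a + proj (b - a) = proj b := by rw [← proj_add]; congr 1; abel
  have h2 : proj a + proj (b - a + (c - b)) = proj c := by rw [← proj_add]; congr 1; abel
  have h3 : -(b - a + (c - b)) = a - c := by abel
  simp only [triangleBoundary, h1, h2, h3, seg]

lemma coords_proj (o x y : Plane) (q : ℝ × ℝ) :
    coords (proj o) x y q = proj (o + (q.1 • x + q.2 • y)) := by
  rw [coords, proj_add o]

lemma coords_injective_plane {o x y : Plane} (h : det x y ≠ 0) {q r : ℝ × ℝ}
    (hqr : o + (q.1 • x + q.2 • y) = o + (r.1 • x + r.2 • y)) : q = r := by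
  have h0 := add_left_cancel hqr
  have h1 := congrArg (fun z => det z y) h0
  have h2 := congrArg (fun z => det x z) h0
  simp only [det_add_left, det_smul_left, det_self, det_add_right, det_smul_right, mul_zero,
    add_zero, zero_add] at h1 h2
  exact Prod.ext (mul_right_cancel₀ h h1) (mul_right_cancel₀ h h2)

lemma triangle_point_mem (hK : Convex ℝ K) (ha : a ∈ K)
    (hb : b ∈ K) (hc : c ∈ K) {q : ℝ × ℝ} (hq : q ∈ triangleDomain) :
    a + (q.1 • (b - a) + q.2 • (c - b)) ∈ K := by
  obtain ⟨h0, h1, h2⟩ := hq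
  have := hK.sum_mem (t := Finset.univ) (w := ![1 - q.1, q.1 - q.2, q.2]) (z := ![a, b, c])
    (by intro i _; fin_cases i <;> simp <;> linarith)
    (by simp [Fin.sum_univ_three])
    (by intro i _; fin_cases i <;> simp [ha, hb, hc])
  convert this using 1
  simp only [Fin.sum_univ_three, Matrix.cons_val_zero, Matrix.cons_val_one, Matrix.cons_val]
  module

/-- A triangular circle bounding an empty disc may be removed. -/
lemma skeinEquiv_circle (hK : Convex ℝ K) (hinj : InjOn proj K) (ha : a ∈ K) (hb : b ∈ K) (hc : c ∈ K) (hdet : det (b - a) (c - a) ≠ 0) (hα : Disjoint (proj '' K) (support α.edges))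
    (hβ : β.edges = α.edges ∪ {seg a b, seg b c, seg c a}) : SkeinEquiv β α := by
  have hdet' : det (b - a) (c - b) = det (b - a) (c - a) := by
    have : c - b = (c - a) - (b - a) := by abel
    rw [this, det_sub_right, det_self]; ring
  have hsub : triangle (proj a) (b - a) (c - b) ⊆ proj '' K := by
    rintro _ ⟨q, hq, rfl⟩
    rw [coords_proj]
    exact ⟨_, triangle_point_mem hK ha hb hc hq, rfl⟩
  have hinj' : InjOn (coords (proj a) (b - a) (c - b)) triangleDomain := by
    intro q hq r hr hqr
    rw [coords_proj, coords_proj] at hqr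
    exact coords_injective_plane (hdet' ▸ hdet)
      (hinj (triangle_point_mem hK ha hb hc hq) (triangle_point_mem hK ha hb hc hr) hqr)
  rw [← triangleBoundary_seg] at hβ
  rcases lt_or_gt_of_ne hdet with h | h
  · have := (SkeinRel.circle_cw α β _ _ _ (hdet' ▸ h) hinj' (hα.mono_left hsub) hβ).mk_eq
    rw [mk_single, mk_single, one_smul] at this
    exact ⟨-1, by rw [this, zpow_neg_one]; rfl⟩
  · have := (SkeinRel.circle_ccw α β _ _ _ (hdet' ▸ h) hinj' (hα.mono_left hsub) hβ).mk_eq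
    rw [mk_single, mk_single, one_smul] at this
    exact ⟨1, by rw [this, zpow_one]; rfl⟩

/-! ### The saddle move in a parallelogram -/

section Parallelogram

variable {F : Set Edge} {p : Torus} {a b : Plane}

lemma coords_left (p : Torus) (a b : Plane) (t : ℝ) : Edge.pt (p, b) t = coords p a b (0, t) := by
  simp [Edge.pt, coords]

lemma coords_right (p : Torus) (a b : Plane) (t : ℝ) :
    Edge.pt (p + proj (a + b), -b) t = coords p a b (1, 1 - t) := by
  simp only [Edge.pt, coords]
  rw [add_assoc, ← proj_add]; congr 2; module

lemma coords_bottom (p : Torus) (a b : Plane) (t : ℝ) :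
    Edge.pt (p, a) t = coords p a b (t, 0) := by
  simp [Edge.pt, coords]

lemma coords_top (p : Torus) (a b : Plane) (t : ℝ) :
    Edge.pt (p + proj (a + b), -a) t = coords p a b (1 - t, 1) := by
  simp only [Edge.pt, coords]
  rw [add_assoc, ← proj_add]; congr 2; module

lemma OutsideParallelogram.inj (h : OutsideParallelogram F p a b) {s' t' : ℝ}
    (e : coords p a b (s, t) = coords p a b (s', t'))
    (hs : 0 ≤ s ∧ s ≤ 1 ∧ 0 ≤ t ∧ t ≤ 1 := by refine ⟨?_, ?_, ?_, ?_⟩ <;> linarith)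
    (hs' : 0 ≤ s' ∧ s' ≤ 1 ∧ 0 ≤ t' ∧ t' ≤ 1 := by refine ⟨?_, ?_, ?_, ?_⟩ <;> linarith) :
    s = s' ∧ t = t' := by
  simpa using h.embedded (by simp; tauto) (by simp; tauto) e

lemma OutsideParallelogram.corner_of_mem (h : OutsideParallelogram F p a b)
    (hF : coords p a b (s, t) ∈ support F)
    (hs : 0 ≤ s ∧ s ≤ 1 ∧ 0 ≤ t ∧ t ≤ 1 := by refine ⟨?_, ?_, ?_, ?_⟩ <;> linarith) :
    (s = 0 ∨ s = 1) ∧ (t = 0 ∨ t = 1) := by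
  have h00 : p = coords p a b (0, 0) := by simp [coords, proj_zero]
  have h10 : p + proj a = coords p a b (1, 0) := by simp [coords]
  have h11 : p + proj (a + b) = coords p a b (1, 1) := by simp [coords]
  have h01 : p + proj b = coords p a b (0, 1) := by simp [coords]
  rcases h.outside ⟨hF, (s, t), by simp; tauto, rfl⟩ with h1 | h1 | h1 | h1
  · simp [h.inj (h1.trans h00)]
  · simp [h.inj (h1.trans h10)]
  · simp [h.inj (h1.trans h11)]
  · simp [h.inj (h1.trans h01)]

lemma OutsideParallelogram.exists_saddle (h : OutsideParallelogram F p a b)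
    (hα : α.edges = F ∪ {(p, b), (p + proj (a + b), -b)}) :
    ∃ β : Multicurve, β.edges = F ∪ {(p, a), (p + proj (a + b), -a)} ∧ SkeinEquiv α β := by
  have hα' : IsMulticurve (F ∪ {(p, b), (p + proj (a + b), -b)}) := hα ▸ α.isMulticurve
  have hn {e : Edge} (he : e = (p, b) ∨ e = (p + proj (a + b), -b)) : e ∉ F := fun hF => by
    have := pt_mem_support hF (t := 1 / 2) (by norm_num)
    rcases he with rfl | rfl <;> simp only [coords_left p a b, coords_right p a b] at this <;>
      have := h.corner_of_mem this <;> norm_num at this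
  have hstart {e f : Edge} (he : e = (p, b) ∨ e = (p + proj (a + b), -b)) (hf : f ∈ F) {t : ℝ}
      (ht : t ∈ Ico₀₁) : e.pt 0 ≠ f.pt t := fun heq =>
    hn he ((hα'.eq_of_pt_eq (.inr he) (.inl hf) zero_mem_Ico ht heq).1 ▸ hf)
  have hβ : IsMulticurve (F ∪ {(p, a), (p + proj (a + b), -a)}) := by
    refine hα'.replace (toFinite _) ?_ ?_ ?_
    · have hc := hα'.closed
      have e1 : Edge.finish (p, b) = Edge.finish (p + proj (a + b), -a) := by
        simp only [Edge.finish]; rw [add_assoc, ← proj_add]; congr 2; abel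
      have e2 : Edge.finish (p + proj (a + b), -b) = Edge.finish (p, a) := by
        simp only [Edge.finish]; rw [add_assoc, ← proj_add]; congr 2; abel
      rw [image_union, image_union, image_pair, image_pair] at hc ⊢
      rwa [e1, e2, pair_comm] at hc
    · rintro ⟨e, s⟩ ⟨he, hs⟩ ⟨f, t⟩ ⟨hf, ht⟩ hst
      obtain ⟨⟨hs0, hs1⟩, ht0, ht1⟩ := And.intro (Set.mem_Ico.1 hs) (Set.mem_Ico.1 ht)
      rcases he with rfl | rfl <;> rcases hf with rfl | rfl <;>
        simp only [coords_bottom p a b, coords_top p a b] at hst <;>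
        obtain ⟨h1, h2⟩ := h.inj hst <;>
        first | (exfalso; linarith) | rw [show s = t by linarith]
    · rintro e he s ⟨hs0, hs1⟩ f hf t ht hst
      have hmem : f.pt t ∈ support F := pt_mem_support hf (mem_Icc_of_mem_Ico ht)
      rcases he with rfl | rfl
      · have h1 := hstart (.inl rfl) hf ht
        rw [coords_left p a b, ← hst, coords_bottom p a b] at h1
        rw [← hst, coords_bottom p a b] at hmem
        grind [h.corner_of_mem hmem]
      · have h1 := hstart (.inr rfl) hf ht
        rw [coords_right p a b, ← hst, coords_top p a b] at h1
        rw [← hst, coords_top p a b] at hmem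
        grind [h.corner_of_mem hmem]
  set c : Torus := coords p a b (1 / 4, 1 / 4) with hc
  set x : Plane := (1 / 4 : ℝ) • a with hx
  set y : Plane := (1 / 4 : ℝ) • b with hy
  have hcoord (q : ℝ × ℝ) : coords c x y q = coords p a b (1 / 4 + q.1 / 4, 1 / 4 + q.2 / 4) := by
    simp only [hc, hx, hy, coords]
    rw [add_assoc, ← proj_add]; congr 2; module
  have hopen : triangle c x y ⊆ openParallelogram p a b := by
    rintro _ ⟨q, ⟨h0, h1, h2⟩, rfl⟩
    exact ⟨_, by simp; grind, (hcoord q).symm⟩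
  have hxy : 0 < det x y := by
    rw [hx, hy, det_smul_left, det_smul_right]; linarith [h.pos]
  have open_disj {s t : ℝ} (hs : 0 < s ∧ s < 1 ∧ 0 < t ∧ t < 1) :
      coords p a b (s, t) ∉ support (F ∪ {(p, a), (p + proj (a + b), -a)}) := by
    obtain ⟨s0, s1, t0, t1⟩ := hs
    rw [support_union]
    rintro (hm | ⟨e, he, r, ⟨hr0, hr1⟩, het⟩)
    · grind [h.corner_of_mem hm]
    · rcases he with rfl | rfl <;> simp only [coords_bottom p a b, coords_top p a b] at het <;>
        linarith [h.inj het]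
  have htb {e : Edge} (he : e ∈ triangleBoundary c x y) (t : ℝ) :
      (e = (c, x) ∧ e.pt t = coords p a b (1 / 4 + t / 4, 1 / 4)) ∨
      (e = (c + proj x, y) ∧ e.pt t = coords p a b (1 / 2, 1 / 4 + t / 4)) ∨
      (e = (c + proj (x + y), -(x + y)) ∧
        e.pt t = coords p a b (1 / 2 - t / 4, 1 / 2 - t / 4)) := by
    refine he.imp (fun he => ⟨he, ?_⟩) (Or.imp (fun he => ⟨he, ?_⟩) fun he => ⟨he, ?_⟩) <;>
      rw [he] <;> simp only [hc, hx, hy, Edge.pt, coords] <;>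
      simp only [add_assoc, ← proj_add] <;> congr 2 <;> module
  have hβ' : IsMulticurve (F ∪ {(p, a), (p + proj (a + b), -a)} ∪ triangleBoundary c x y) := by
    refine IsMulticurve.replace (P := ∅) (by rwa [Set.union_empty])
      (((finite_singleton _).insert _).insert _) ?_ ?_ ?_
    · rw [image_union, image_union _ (F ∪ _), hβ.closed]
      congr 1
      ext z
      simp [triangleBoundary, Edge.finish, Edge.start, add_assoc, ← proj_add, proj_zero]
      tauto
    · rintro ⟨e, s⟩ ⟨he, hs⟩ ⟨f, t⟩ ⟨hf, ht⟩ hst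
      obtain ⟨⟨hs0, hs1⟩, ht0, ht1⟩ := And.intro (Set.mem_Ico.1 hs) (Set.mem_Ico.1 ht)
      simp only at he hf hst
      rcases htb he s with ⟨h1, h2⟩ | ⟨h1, h2⟩ | ⟨h1, h2⟩ <;>
        rcases htb hf t with ⟨h3, h4⟩ | ⟨h3, h4⟩ | ⟨h3, h4⟩ <;>
        rw [h2, h4] at hst <;> obtain ⟨h5, h6⟩ := h.inj hst <;>
        first | exact Prod.ext (h1.trans h3.symm) (by simp only; linarith) | (exfalso; linarith)
    · rintro e he s ⟨hs0, hs1⟩ f hf t ht hst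
      have hm := hst ▸ pt_mem_support hf (mem_Icc_of_mem_Ico ht)
      rcases htb he s with ⟨-, h2⟩ | ⟨-, h2⟩ | ⟨-, h2⟩ <;> rw [h2] at hm <;>
        exact open_disj (by refine ⟨?_, ?_, ?_, ?_⟩ <;> linarith) hm
  refine ⟨⟨_, hβ⟩, rfl, 1, ?_⟩
  have s1 := (SkeinRel.antiparallel_up_down α ⟨_, hβ'⟩ F p a b h c x y hxy hopen hα rfl).mk_eq
  have s2 := (SkeinRel.circle_ccw ⟨_, hβ⟩ ⟨_, hβ'⟩ c x y hxy ?_ ?_ rfl).mk_eq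
  · rw [mk_single, mk_single, one_smul, one_smul] at s1
    rw [mk_single, mk_single, one_smul] at s2
    rw [s1, s2, zpow_one]; rfl
  · rintro q ⟨h0, h1, h2⟩ r ⟨h3, h4, h5⟩ hqr
    rw [hcoord, hcoord] at hqr
    have := h.inj hqr
    exact Prod.ext (by linarith) (by linarith)
  · rw [disjoint_left]
    intro z hz
    obtain ⟨q, hq, rfl⟩ := hopen hz
    exact open_disj ⟨hq.1.1, hq.1.2, hq.2.1, hq.2.2⟩

end Parallelogram

/-! ### Edges that touch a convex disc -/

lemma convex_le_det (u : Plane) (c : ℝ) : Convex ℝ {z : Plane | c ≤ det u z} :=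
  convex_halfSpace_ge ⟨det_add_right u, fun r => det_smul_right r u⟩ c

/-- A point of an embedded convex set that lies on a segment with ends in that set. -/
lemma eq_of_proj_eq_seg_pt (hK : Convex ℝ K) (hinj : InjOn proj K)
    {z : Plane} (ha : a ∈ K) (hb : b ∈ K) (hz : z ∈ K) (ht : t ∈ Icc₀₁)
    (h : (seg a b).pt t = proj z) : z = a + t • (b - a) :=
  (hinj (lineMap_mem_of_convex hK ha hb ht) hz (seg_pt a b t ▸ h)).symm

/-- The part of `K` on one side of a line. -/
abbrev cutOff (K : Set Plane) (u a : Plane) : Set Plane := K ∩ {z | det u a ≤ det u z}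

section Touches

variable {F F' : Set Edge} {K K' V V' : Set Plane} {a b u v p q : Plane}

lemma Touches.union (h : Touches F K V) (h' : Touches F' K V) : Touches (F ∪ F') K V := by
  intro z hz hF
  rw [support_union] at hF
  exact hF.elim (h z hz) (h' z hz)

lemma Touches.cutOff (h : Touches F K V) (hV : ∀ z ∈ V, det u v ≤ det u z → z ∈ V') :
    Touches F (cutOff K u v) V' :=
  fun z hz hF => hV z (h z hz.1 hF) hz.2

lemma touches_seg (hK : Convex ℝ K) (hinj : InjOn proj K) (hp : p ∈ K) (hq : q ∈ K)
    (h1 : det u p < det u v) (h2 : det u q ≤ det u v) (hV : det u q = det u v → q ∈ V) :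
    Touches {seg p q} (OrientedSkein.cutOff K u v) V := by
  rintro z ⟨hz, hc : det u v ≤ det u z⟩ ⟨e, rfl, t, ht, het⟩
  have hz' := eq_of_proj_eq_seg_pt hK hinj hp hq hz ht het
  rw [hz', det_add_right, det_smul_right, det_sub_right] at hc
  obtain rfl : t = 1 := by
    by_contra h
    have := lt_of_le_of_ne ht.2 h
    nlinarith [ht.1]
  rw [hz', one_smul, add_sub_cancel]
  exact hV (by linarith)

lemma Touches.reverse (h : Touches {seg p q} K V) : Touches {seg q p} K V := by
  rintro z hz ⟨e, rfl, t, ht, het⟩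
  refine h z hz ⟨_, rfl, 1 - t, ⟨by linarith [ht.2], by linarith [ht.1]⟩, ?_⟩
  rw [← het, seg_pt, seg_pt]
  congr 1
  module

lemma GapDisc.of_touches (hK : Convex ℝ K) (hinj : InjOn proj K) (ha : a ∈ K) (hb : b ∈ K)
    (hab : a ≠ b) (h1 : det u v ≤ det u a) (h2 : det u v ≤ det u b)
    (h : Touches F (OrientedSkein.cutOff K u v) {a, b}) :
    GapDisc F (OrientedSkein.cutOff K u v) a b :=
  ⟨hK.inter (convex_le_det _ _), hinj.mono Set.inter_subset_left, ⟨ha, h1⟩, ⟨hb, h2⟩, hab, by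
    rintro _ ⟨hF, z, hz, rfl⟩
    rcases h z hz hF with rfl | rfl <;> simp⟩

end Touches

namespace GapDisc

variable {F : Set Edge} {K : Set Plane} {a b c d u : Plane}

lemma restrict (h : GapDisc F K a b) (hc : c ∈ K) (h1 : det u a < det u c)
    (h3 : det u c ≤ det u b) (hcb : c ≠ b) : GapDisc (F ∪ {seg a c}) (cutOff K u c) c b :=
  .of_touches h.convex h.inj hc h.right_mem hcb le_rfl h3
    ((h.touches.cutOff (by rintro z (rfl | rfl) hz; exacts [(h1.not_ge hz).elim, .inr rfl])).union
      (touches_seg h.convex h.inj h.left_mem hc h1 le_rfl (by simp)))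

lemma exists_push₂ (h : GapDisc F K a b) (hc : c ∈ K) (hd : d ∈ K) (h1 : det u a < det u c)
    (h2 : det u c ≤ det u d) (h3 : det u c ≤ det u b) (hdet1 : det (b - a) (c - a) ≠ 0)
    (hdet2 : det (b - c) (d - c) ≠ 0) (hα : α.edges = F ∪ {seg a b}) :
    ∃ β : Multicurve, β.edges = F ∪ {seg a c, seg c d, seg d b} ∧ Isotopic α β := by
  obtain ⟨γ, hγ, hαγ⟩ := h.exists_push hc hdet1 hα
  have hcb : c ≠ b := by rintro rfl; simp [det_self] at hdet1
  obtain ⟨β, hβ, hγβ⟩ := (h.restrict hc h1 h3 hcb).exists_push (c := d) ⟨hd, h2⟩ hdet2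
    (α := γ) (by rw [hγ, union_assoc]; rfl)
  exact ⟨β, by rw [hβ, union_assoc]; rfl, hαγ.trans hγβ⟩

end GapDisc

/-! ### The saddle move in a convex quadrilateral -/

lemma eventually_mul_lt {a : ℝ} (ha : 0 < a) (b : ℝ) : ∀ᶠ t in 𝓝[>] (0 : ℝ), t * b < a :=
  nhdsWithin_le_nhds (((continuous_mul_const b).tendsto' 0 0 (by simp)).eventually_lt_const ha)

lemma eventually_mem_of_convex (hK : Convex ℝ K) {o p q : Plane} (ho : o ∈ K)
    (hp : p ∈ K) (hq : q ∈ K) (h : 0 < det (p - o) (q - o)) (h1 : 0 ≤ det (p - o) w)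
    (h2 : 0 ≤ det w (q - o)) : ∀ᶠ t in 𝓝[>] (0 : ℝ), o + t • w ∈ K := by
  filter_upwards [eventually_mul_lt h (det w (q - o) + det (p - o) w), self_mem_nhdsWithin]
    with t ht (ht0 : 0 < t)
  set D := det (p - o) (q - o)
  have hw : D • w = det w (q - o) • (p - o) + det (p - o) w • (q - o) := by
    ext <;> simp only [D, det, smul_fst, smul_snd, fst_add, snd_add,
      fst_sub, snd_sub, smul_eq_mul] <;> ring
  have hs : t * det (p - o) w / D ≤ t * (det w (q - o) + det (p - o) w) / D := by
    gcongr; nlinarith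
  convert triangle_point_mem hK ho hp hq (q := (t * (det w (q - o) + det (p - o) w) / D,
    t * det (p - o) w / D)) ⟨by positivity, hs, (div_le_one h).2 ht.le⟩ using 2
  rw [← smul_right_injective Plane h.ne' |>.eq_iff]
  simp only [smul_add, smul_smul, mul_div_cancel₀ _ h.ne']
  rw [mul_comm, mul_smul, hw]
  module

section Saddle

variable {G : Set Edge} {Q : Set Plane} {v₁ v₂ v₃ v₄ : Plane} {α : Multicurve}

/-- The saddle move in a quadrilateral whose second and fourth sides diverge. -/
lemma exists_saddle_of_diverging (hQ : Convex ℝ Q) (hinj : InjOn proj Q) (m₁ : v₁ ∈ Q)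
    (m₂ : v₂ ∈ Q) (m₃ : v₃ ∈ Q) (m₄ : v₄ ∈ Q) (h123 : 0 < det (v₂ - v₁) (v₃ - v₁))
    (h124 : 0 < det (v₂ - v₁) (v₄ - v₁)) (h134 : 0 < det (v₃ - v₁) (v₄ - v₁))
    (hdiv : 0 < det (v₃ - v₂) (v₄ - v₁)) (hG : Touches G Q {v₁, v₂, v₃, v₄})
    (hα : α.edges = G ∪ {seg v₂ v₁, seg v₄ v₃}) :
    ∃ β : Multicurve, β.edges = G ∪ {seg v₂ v₃, seg v₄ v₁} ∧ SkeinEquiv α β := by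
  set w := (v₃ - v₂) + (v₄ - v₁) with hw
  have i1 : 0 < det (v₂ - v₁) w := by
    simp only [hw, det, fst_sub, snd_sub, fst_add, snd_add] at *; linarith
  have i2 : 0 < det w (v₄ - v₁) := by rwa [hw, det_add_left, det_self, add_zero]
  have i3 : 0 < det (v₃ - v₂) w := by rwa [hw, det_add_right, det_self, zero_add]
  have i4 : 0 < det (v₃ - v₂) (v₁ - v₂) := by
    simp only [det, fst_sub, snd_sub] at *; linarith
  have i5 : 0 < det w (v₁ - v₂) := by rwa [det_comm, ← det_neg_left, neg_sub]
  obtain ⟨t, c1, c2, c3, c4, c5, t0⟩ := ((eventually_mem_of_convex hQ m₁ m₂ m₄ h124 i1.le i2.le).and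
    ((eventually_mem_of_convex hQ m₂ m₃ m₁ i4 i3.le i5.le).and ((eventually_mul_lt h123 (det (v₂ - v₁) w)).and
    ((eventually_mul_lt h124 (det (v₂ - v₁) w)).and ((eventually_mul_lt h134
      (det (v₃ - v₄) w)).and self_mem_nhdsWithin))))).exists
  replace t0 : 0 < t := t0
  set c := v₁ + t • w with hc
  set d := v₂ + t • w with hd
  have f14 : det (-w) v₄ < det (-w) v₁ := by
    simp only [det, fst_sub, snd_sub, fst_neg, snd_neg] at *; linarith
  have f12 : det (-w) v₁ < det (-w) v₂ := by
    simp only [det, fst_sub, snd_sub, fst_neg, snd_neg] at *; linarith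
  have f23 : det (-w) v₂ < det (-w) v₃ := by
    simp only [det, fst_sub, snd_sub, fst_neg, snd_neg] at *; linarith
  have f1 : det (-w) c = det (-w) v₁ := by simp [hc, det_add_right, det_smul_right, det_self, det_neg_left]
  have f2 : det (-w) d = det (-w) v₂ := by simp [hd, det_add_right, det_smul_right, det_self, det_neg_left]
  have e1 : det (v₂ - v₁) c = det (v₂ - v₁) v₁ + t * det (v₂ - v₁) w := by
    rw [hc, det_add_right, det_smul_right]
  have e2 : det (v₂ - v₁) d = det (v₂ - v₁) c := by
    simp only [hc, hd, det_add_right, add_left_inj]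
    simp only [det, fst_sub, snd_sub]; ring
  have e3 : det (v₂ - v₁) v₂ = det (v₂ - v₁) v₁ := by
    simp only [det, fst_sub, snd_sub]; ring
  rw [det_sub_right] at h123 h124 c3 c4
  have hpos := mul_pos t0 i1
  have g1 : GapDisc (G ∪ {seg v₂ v₁}) (cutOff Q (v₂ - v₁) c) v₄ v₃ :=
    .of_touches hQ hinj m₄ m₃ (by rintro rfl; simp [det_self] at h134) (by linarith) (by linarith)
      ((hG.cutOff (by rintro z (rfl | rfl | rfl | rfl) hz <;> first | simp; done | linarith)).union
      (touches_seg hQ hinj m₂ m₁ (by linarith) (by linarith) (by intro; linarith)))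
  obtain ⟨β, hβ, hαβ⟩ := g1.exists_push₂ (u := -w) (c := c) (d := d) (α := α)
    ⟨c1, le_refl (det (v₂ - v₁) c)⟩ ⟨c2, e2.ge⟩ (by linarith) (by linarith) (by linarith)
    (ne_of_lt (by
      simp only [hc, det, fst_sub, snd_sub, fst_add, snd_add, smul_fst,
        smul_snd, smul_eq_mul] at c5 ⊢
      linarith))
    (ne_of_lt (by
      rw [det_comm, show d - c = v₂ - v₁ by rw [hc, hd]; abel, det_sub_right]
      linarith))
    (by rw [hα, union_assoc]; rfl)
  have hneg (z : Plane) : det w z = -det (-w) z := by rw [det_neg_left, neg_neg]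
  have hout : OutsideParallelogram (G ∪ ({seg v₄ c} ∪ {seg d v₃})) (proj v₂) (t • w)
      (v₁ - v₂) := by
    have hmem {q : ℝ × ℝ} (hq : q ∈ Icc₀₁ ×ˢ Icc₀₁) :
        v₂ + (q.1 • t • w + q.2 • (v₁ - v₂)) ∈ Q := by
      convert lineMap_mem_of_convex hQ (lineMap_mem_of_convex hQ m₂ m₁ hq.2)
        (lineMap_mem_of_convex hQ c2 c1 hq.2) hq.1 using 1
      rw [hc, hd]; module
    have hdet : 0 < det (t • w) (v₁ - v₂) := by rw [det_smul_left]; exact mul_pos t0 i5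
    refine ⟨hdet, fun q hq r hr hqr => ?_, ?_⟩
    · rw [coords_proj, coords_proj] at hqr
      exact coords_injective_plane hdet.ne' (hinj (hmem hq) (hmem hr) hqr)
    · rintro _ ⟨hF, q, hq, rfl⟩
      rw [coords_proj] at hF ⊢
      have hz := hmem hq
      have hdz : det (-w) (v₂ + (q.1 • t • w + q.2 • (v₁ - v₂))) =
          det (-w) v₂ + q.2 * (det (-w) v₁ - det (-w) v₂) := by
        simp only [det_add_right, det_smul_right, det_sub_right, det_neg_left, det_self]; ring
      generalize v₂ + (q.1 • t • w + q.2 • (v₁ - v₂)) = z at *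
      obtain ⟨-, q0, q1⟩ := hq
      have z1 : det (-w) v₁ ≤ det (-w) z := by nlinarith
      have z2 : det w v₂ ≤ det w z := by simp only [hneg]; nlinarith
      rw [← proj_add, ← proj_add, ← proj_add, show v₂ + (t • w + (v₁ - v₂)) = c by rw [hc]; abel,
        add_sub_cancel]
      rw [support_union, support_union] at hF
      rcases hF with hF | hF | hF
      · rcases hG z hz hF with rfl | rfl | rfl | rfl
        exacts [by simp, by simp, by simp only [hneg] at z2; linarith, by linarith]
      · rcases touches_seg (V := {c}) hQ hinj m₄ c1 f14 f1.le (by simp) z ⟨hz, z1⟩ hF with rfl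
        simp
      · rcases (touches_seg (V := {d}) (u := w) (v := v₂) hQ hinj m₃ c2 (by simp only [hneg]; linarith)
          (by simp only [hneg]; linarith) (by simp)).reverse z ⟨hz, z2⟩ hF with rfl
        simp [hd]
  obtain ⟨γ, hγ, hβγ⟩ := hout.exists_saddle (α := β) (by
    rw [hβ, show ((proj v₂, v₁ - v₂) : Edge) = seg v₂ v₁ from rfl, ← proj_add,
      show v₂ + (t • w + (v₁ - v₂)) = c by rw [hc]; abel,
      show ((proj c, -(v₁ - v₂)) : Edge) = seg c d by rw [seg, hc, hd]; congr 1; abel]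
    ext; simp; tauto)
  rw [show ((proj v₂, t • w) : Edge) = seg v₂ d by rw [seg, hd, add_sub_cancel_left], ← proj_add,
    show v₂ + (t • w + (v₁ - v₂)) = c by rw [hc]; abel,
    show ((proj c, -(t • w)) : Edge) = seg c v₁ by rw [seg, hc]; congr 1; abel] at hγ
  have g2 : GapDisc (G ∪ ({seg v₂ d} ∪ {seg d v₃})) (cutOff Q w v₁) v₄ v₁ := by
    refine .of_touches hQ hinj m₄ m₁ (by rintro rfl; simp [det_zero_right] at h134) ?_ le_rfl
      ((hG.cutOff ?_).union ((touches_seg hQ hinj m₂ c2 ?_ ?_ ?_).union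
      (touches_seg hQ hinj c2 m₃ ?_ ?_ ?_))) <;> simp only [hneg]
    on_goal 2 => rintro z (rfl | rfl | rfl | rfl) hz <;> first | simp; done | linarith
    all_goals first | linarith | (intro; linarith)
  obtain ⟨δ, hδ, hγδ⟩ := g2.exists_pull (c := c) (α := γ)
    ⟨c1, by simp only [mem_ofPred_eq, hneg]; linarith⟩ (by
      rw [show c - v₄ = t • w - (v₄ - v₁) by rw [hc]; abel, ← neg_sub v₄, det_sub_right,
        det_neg_left, det_neg_left, det_self, det_smul_right, det_comm]
      simpa using ⟨t0.ne', i2.ne'⟩)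
    (by rw [hγ]; ext; simp; tauto)
  have g3 : GapDisc (G ∪ {seg v₄ v₁}) (cutOff Q (-w) v₂) v₂ v₃ :=
    .of_touches hQ hinj m₂ m₃ (by rintro rfl; simp [det_zero_left] at i3) le_rfl f23.le
      ((hG.cutOff (by rintro z (rfl | rfl | rfl | rfl) hz <;> first | simp; done | linarith)).union
      (touches_seg hQ hinj m₄ m₁ (by linarith) f12.le (by intro; linarith)))
  obtain ⟨ε, hε, hδε⟩ := g3.exists_pull (c := d) (α := δ) ⟨c2, f2.ge⟩ (by
      rw [hd, add_sub_cancel_left, det_smul_right]; exact (mul_pos t0 i3).ne')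
    (by rw [hδ]; ext; simp; tauto)
  refine ⟨ε, ?_, hαβ.skeinEquiv.trans (hβγ.trans (hγδ.trans hδε).skeinEquiv)⟩
  rw [hε]; ext; simp

/-- The saddle move in a strictly convex quadrilateral. -/
lemma exists_saddle (hQ : Convex ℝ Q) (hinj : InjOn proj Q) (m₁ : v₁ ∈ Q) (m₂ : v₂ ∈ Q)
    (m₃ : v₃ ∈ Q) (m₄ : v₄ ∈ Q) (h123 : 0 < det (v₂ - v₁) (v₃ - v₁))
    (h124 : 0 < det (v₂ - v₁) (v₄ - v₁)) (h134 : 0 < det (v₃ - v₁) (v₄ - v₁))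
    (h234 : 0 < det (v₃ - v₂) (v₄ - v₂)) (hG : Touches G Q {v₁, v₂, v₃, v₄})
    (hα : α.edges = G ∪ {seg v₂ v₁, seg v₄ v₃}) :
    ∃ β : Multicurve, β.edges = G ∪ {seg v₂ v₃, seg v₄ v₁} ∧ SkeinEquiv α β := by
  obtain ⟨t, m₅, k₁, k₂, k₃, k₄, t0⟩ := ((eventually_mem_of_convex hQ m₁ m₂ m₃
    (w := (v₂ - v₁) + (v₃ - v₁)) h123 (by rw [det_add_right, det_self, zero_add]; exact h123.le)
    (by rw [det_add_left, det_self, add_zero]; exact h123.le)).and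
    ((eventually_mul_lt h123 (2 * det (v₂ - v₁) (v₃ - v₁))).and
    ((eventually_mul_lt h134 (det (v₂ - v₁) (v₄ - v₁) + det (v₃ - v₁) (v₄ - v₁))).and
    ((eventually_mul_lt h124 (det (v₂ - v₁) (v₄ - v₁) + det (v₃ - v₁) (v₄ - v₁))).and
    ((eventually_mul_lt h124 (det (v₂ - v₁) (v₃ - v₁))).and self_mem_nhdsWithin))))).exists
  have k₅ := mul_pos t0 h123
  have k₆ := mul_pos t0 h124
  have k₇ := mul_pos t0 h134
  generalize hx : v₁ + t • ((v₂ - v₁) + (v₃ - v₁)) = x at m₅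
  obtain ⟨a₁, a₂, a₃, a₄, a₅, a₆, a₇, a₈, a₉, b₁, b₂, b₃⟩ :
      det (v₁ - v₂) v₂ = det (v₁ - v₂) v₁ ∧ det (v₃ - v₁) v₃ = det (v₃ - v₁) v₁ ∧
      det (v₁ - v₄) v₄ = det (v₁ - v₄) v₁ ∧
      det (v₁ - v₂) v₃ = det (v₁ - v₂) v₁ - det (v₂ - v₁) (v₃ - v₁) ∧
      det (v₁ - v₂) v₄ = det (v₁ - v₂) v₁ - det (v₂ - v₁) (v₄ - v₁) ∧
      det (v₃ - v₁) v₂ = det (v₃ - v₁) v₁ - det (v₂ - v₁) (v₃ - v₁) ∧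
      det (v₃ - v₁) v₄ = det (v₃ - v₁) v₁ + det (v₃ - v₁) (v₄ - v₁) ∧
      det (v₁ - v₄) v₂ = det (v₁ - v₄) v₁ + det (v₂ - v₁) (v₄ - v₁) ∧
      det (v₁ - v₄) v₃ = det (v₁ - v₄) v₁ + det (v₃ - v₁) (v₄ - v₁) ∧
      det (v₁ - v₂) x = det (v₁ - v₂) v₁ - t * det (v₂ - v₁) (v₃ - v₁) ∧
      det (v₃ - v₁) x = det (v₃ - v₁) v₁ - t * det (v₂ - v₁) (v₃ - v₁) ∧
      det (v₁ - v₄) x = det (v₁ - v₄) v₁ +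
        t * (det (v₂ - v₁) (v₄ - v₁) + det (v₃ - v₁) (v₄ - v₁)) := by
    refine ⟨?_, ?_, ?_, ?_, ?_, ?_, ?_, ?_, ?_, ?_, ?_, ?_⟩ <;> simp only [← hx, det, fst_sub,
      snd_sub, fst_add, snd_add, smul_fst, smul_snd, smul_eq_mul] <;> ring
  have hxd (u v : Plane) : det (x - u) v = det (v₁ - u) v +
      t * (det (v₂ - v₁) v + det (v₃ - v₁) v) := by
    rw [← hx]; simp only [det_add_left, det_sub_left, det_smul_left]; ring
  have g1 : GapDisc (G ∪ {seg v₄ v₃}) (cutOff Q (v₁ - v₂) x) v₂ v₁ :=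
    .of_touches hQ hinj m₂ m₁ (by rintro rfl; simp [det_zero_left] at h124) (by linarith)
      (by linarith) ((hG.cutOff (by
        rintro z (rfl | rfl | rfl | rfl) hz <;> first | simp; done | linarith)).union
      (touches_seg hQ hinj m₄ m₃ (by linarith) (by linarith) (by intro; linarith)))
  obtain ⟨β, hβ, hαβ⟩ := g1.exists_push (c := x) (α := α) ⟨m₅, le_refl (det (v₁ - v₂) x)⟩
    (by rw [det_sub_right]; exact ne_of_lt (by linarith)) (by rw [hα]; ext; simp)
  obtain ⟨γ, hγ, hβγ⟩ := exists_saddle_of_diverging (G := G ∪ {seg v₂ x}) (α := β) (v₁ := v₁)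
    (v₂ := x) (v₃ := v₃) (v₄ := v₄) (hQ.inter (convex_le_det (v₃ - v₁) (det (v₃ - v₁) x)))
    (hinj.mono Set.inter_subset_left) ⟨m₁, show det _ _ ≤ det _ _ by linarith⟩
    ⟨m₅, le_refl (det (v₃ - v₁) x)⟩ ⟨m₃, show det _ _ ≤ det _ _ by linarith⟩
    ⟨m₄, show det _ _ ≤ det _ _ by linarith⟩
    (by rw [det_comm, det_sub_right]; linarith) (by rw [hxd, sub_self, det_zero_left]; linarith) h134
    (by rw [← neg_sub x, det_neg_left, hxd, ← neg_sub v₃ v₁, det_neg_left]; linarith)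
    ((hG.cutOff (by
      rintro z (rfl | rfl | rfl | rfl) hz <;> first | simp; done | linarith)).union
    (touches_seg hQ hinj m₂ m₅ (by linarith) le_rfl (by simp)))
    (by rw [hβ]; ext; simp; tauto)
  have g2 : GapDisc (G ∪ {seg v₄ v₁}) (cutOff Q (v₁ - v₄) x) v₂ v₃ :=
    .of_touches hQ hinj m₂ m₃ (by rintro rfl; simp [det_self] at h123) (by linarith) (by linarith)
      ((hG.cutOff (by rintro z (rfl | rfl | rfl | rfl) hz <;> first | simp; done | linarith)).union
      (touches_seg hQ hinj m₄ m₁ (by linarith) (by linarith) (by intro; linarith)))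
  obtain ⟨δ, hδ, hγδ⟩ := g2.exists_pull (c := x) (α := γ) ⟨m₅, le_refl (det (v₁ - v₄) x)⟩
    (by
      rw [show v₃ - v₂ = (v₃ - v₁) + (v₁ - v₂) by abel, det_add_left, det_sub_right, det_sub_right]
      exact ne_of_gt (by linarith))
    (by rw [hγ]; ext; simp; tauto)
  refine ⟨δ, ?_, hαβ.skeinEquiv.trans (hβγ.trans hγδ.skeinEquiv)⟩
  rw [hδ]; ext; simp

end Saddle

/-! ### Flipping a convex polygon -/

/-- A cyclic list of points in strictly convex counterclockwise position. -/
def CcwList (l : List Plane) : Prop :=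
  ∀ a b c : Plane, [a, b, c].Sublist l → 0 < det (b - a) (c - a)

lemma det_cyclic (a b c : Plane) : det (b - a) (c - a) = det (c - b) (a - b) := by
  simp only [det, fst_sub, snd_sub]; ring

lemma CcwList.rotate {x : Plane} {l : List Plane} (h : CcwList (x :: l)) :
    CcwList (l ++ [x]) := by
  intro a b c habc
  obtain ⟨l₁, l₂, heq, h1, h2⟩ := List.sublist_append_iff.1 habc
  rcases List.sublist_singleton.1 h2 with rfl | rfl
  · rw [List.append_nil] at heq
    exact h a b c (heq ▸ h1.cons x)
  · obtain ⟨rfl, h3⟩ := List.append_inj' (show [a, b] ++ [c] = _ from heq) rfl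
    rw [det_cyclic, det_cyclic, List.singleton_inj.1 h3]
    exact h _ _ _ (h1.cons_cons _)

/-- The side from a flagged vertex `x` to `y` if the flag is `τ`; it is directed backwards if
`τ = true`. -/
def side (τ : Bool) (x : Plane × Bool) (y : Plane) : Set Edge :=
  if x.2 = τ then {if τ then seg y x.1 else seg x.1 y} else ∅

/-- The first vertex of a path that ends at `z`. -/
def first : List (Plane × Bool) → Plane → Plane
  | [], z => z
  | y :: _, _ => y.1

/-- The sides with flag `τ` of a path that ends at `z`. -/
def path (τ : Bool) : List (Plane × Bool) → Plane → Set Edge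
  | [], _ => ∅
  | x :: l, z => side τ x (first l z) ∪ path τ l z

/-- The sides with flag `τ` of a polygon. -/
def sides (τ : Bool) (l : List (Plane × Bool)) : Set Edge := path τ l (first l 0)

lemma path_append (τ : Bool) (x : Plane × Bool) (z : Plane) :
    ∀ l, path τ (l ++ [x]) z = path τ l x.1 ∪ side τ x z
  | [] => by simp [path, first]
  | y :: l => by
    rw [List.cons_append, path, path_append τ x z l, path, union_assoc]
    cases l <;> rfl

lemma sides_rotate (τ : Bool) (x : Plane × Bool) (l : List (Plane × Bool)) :
    sides τ (l ++ [x]) = sides τ (x :: l) := by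
  rw [sides, path_append, Set.union_comm, sides, path]
  cases l <;> rfl

lemma mem_side {τ : Bool} {x : Plane × Bool} {y : Plane} :
    e ∈ side τ x y ↔ x.2 = τ ∧ e = if τ then seg y x.1 else seg x.1 y := by
  unfold side
  split_ifs with h <;> simp [h]

lemma eq_of_mem_side {τ : Bool} {x : Plane × Bool} {y : Plane} (h : e ∈ side τ x y) :
    e = seg x.1 y ∨ e = seg y x.1 := by
  have := (mem_side.1 h).2
  cases τ <;> simp_all

lemma exists_of_mem_path {τ : Bool} {z : Plane} : ∀ {l}, e ∈ path τ l z →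
    ∃ p ∈ l.map Prod.fst, ∃ q ∈ l.map Prod.fst ++ [z], e = seg p q ∨ e = seg q p
  | x :: l, h => by
    rcases h with h | h
    · exact ⟨x.1, by simp, first l z, by cases l <;> simp [first], eq_of_mem_side h⟩
    · obtain ⟨p, hp, q, hq, h⟩ := exists_of_mem_path h
      exact ⟨p, by simp_all, q, by simp_all, h⟩

/-- The data of a flip: a flagged strictly convex polygon in an embedded convex disc `K`, and a
set of edges `F` that meets the disc at most in vertices of the polygon. -/
structure FlipDisc (F : Set Edge) (K : Set Plane) (l : List (Plane × Bool)) : Prop where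
  convex : Convex ℝ K
  inj : InjOn proj K
  mem : ∀ x ∈ l.map Prod.fst, x ∈ K
  ccw : CcwList (l.map Prod.fst)
  touches : Touches F K {z | z ∈ l.map Prod.fst}

/-- All flips of this polygon with these flags preserve the class up to a power of `-A²`. -/
def Flips (F : Set Edge) (l : List (Plane × Bool)) : Prop :=
  ∀ τ, ∀ α β : Multicurve, α.edges = F ∪ sides τ l → β.edges = F ∪ sides (!τ) l → SkeinEquiv α β

lemma Flips.of_eq {l : List (Plane × Bool)} (τ : Bool)
    (h : ∀ α β : Multicurve, α.edges = F ∪ sides τ l → β.edges = F ∪ sides (!τ) l →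
      SkeinEquiv α β) : Flips F l := by
  intro σ α β hα hβ
  by_cases hσ : σ = τ
  · exact h α β (hσ ▸ hα) (hσ ▸ hβ)
  · obtain rfl : σ = !τ := by cases σ <;> cases τ <;> simp_all
    exact (h β α (by rwa [Bool.not_not] at hβ) hα).symm

lemma ne_of_det_pos (h : 0 < det (b - a) (c - a)) : a ≠ b ∧ b ≠ c ∧ a ≠ c := by
  refine ⟨?_, ?_, ?_⟩ <;> rintro rfl <;> simp [det_zero_left, det_self, det_zero_right] at h

namespace FlipDisc

variable {F : Set Edge} {K : Set Plane} {v v' w : Plane} {x : Plane × Bool}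
  {A l t : List (Plane × Bool)}

attribute [local simp] sides path side first

lemma rotate (h : FlipDisc F K (x :: l)) (hl : FlipDisc F K (l ++ [x]) → Flips F (l ++ [x])) :
    Flips F (x :: l) := by
  intro τ α β hα hβ
  rw [← sides_rotate] at hα hβ
  refine hl ⟨h.convex, h.inj, ?_, ?_, ?_⟩ τ α β hα hβ
  · have := h.mem
    simp_all; grind
  · simpa using h.ccw.rotate
  · have := h.touches
    intro z hz hF
    simpa [or_comm] using this z hz hF

lemma seg_notMem (h : FlipDisc F K l) (ha : a ∈ K) (hb : b ∈ K) (hab : a ≠ b) :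
    seg a b ∉ F :=
  h.touches.seg_notMem h.convex (List.finite_toSet _) ha hb hab

/-- A vertex between two sides that belong to the curve is not in `F`. -/
lemma vertex_notMem (h : FlipDisc F K l) {τ : Bool}
    (hα : α.edges = F ∪ sides τ l) (a c : Plane)
    (ha : a ∈ l.map Prod.fst := by simp) (hb : b ∈ l.map Prod.fst := by simp)
    (hc : c ∈ l.map Prod.fst := by simp)
    (hab : a ≠ b := by first | assumption | (symm; assumption))
    (hbc : b ≠ c := by first | assumption | (symm; assumption))
    (h1 : seg a b ∈ sides τ l := by simp) (h2 : seg b c ∈ sides τ l := by simp) :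
    proj b ∉ support F := by
  have := α.isMulticurve.vertex_notMem_support (hα ▸ subset_union_left) (hα ▸ .inr h1)
    (hα ▸ .inr h2) (h.seg_notMem (h.mem a ha) (h.mem b hb) hab)
    (h.seg_notMem (h.mem b hb) (h.mem c hc) hbc) (by rw [seg_finish, seg_start])
  rwa [seg_start] at this

/-- The position of the other vertices relative to the chord from `v` to `w`. -/
lemma chord {i : Bool} (h : FlipDisc F K ((v, i) :: A ++ x :: t)) :
    (∀ a ∈ A.map Prod.fst, det (x.1 - v) a < det (x.1 - v) v) ∧
    (∀ a ∈ t.map Prod.fst, det (x.1 - v) v < det (x.1 - v) a) ∧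
    det (x.1 - v) x.1 = det (x.1 - v) v := by
  refine ⟨fun a ha => ?_, fun a ha => ?_, ?_⟩
  · have := h.ccw v a x.1 (by
      simpa using (List.singleton_sublist.2 ha).append (List.singleton_sublist.2 (by simp)))
    rw [det_comm, det_sub_right] at this
    linarith
  · have := h.ccw v x.1 a (by
      simpa using ((List.singleton_sublist.2 ha).cons_cons x.1).trans
        (List.sublist_append_right (A.map Prod.fst) _))
    rw [det_sub_right] at this
    linarith
  · simp only [det, fst_sub, snd_sub]; ring

lemma of_chord {i j : Bool} {F' : Set Edge} (h : FlipDisc F K ((v, i) :: A ++ x :: t))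
    (hF : Touches F' (cutOff K (x.1 - v) v) {z | z ∈ v :: x.1 :: t.map Prod.fst}) :
    FlipDisc F' (cutOff K (x.1 - v) v) ((v, j) :: x :: t) := by
  obtain ⟨-, ht, hx⟩ := h.chord
  refine ⟨h.convex.inter (convex_le_det _ _), h.inj.mono Set.inter_subset_left, fun z hz =>
    ⟨h.mem z (by simp at hz ⊢; tauto), ?_⟩, ?_, by simpa using hF⟩
  · simp only [List.map_cons, List.mem_cons] at hz
    rcases hz with rfl | rfl | hz
    exacts [le_refl (det _ _), hx.ge, (ht z hz).le]
  · intro a b c habc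
    exact h.ccw a b c (habc.trans (by simp))

lemma touches_path {i τ : Bool} {V : Set Plane} (h : FlipDisc F K ((v, i) :: A ++ x :: t))
    (hx : t = [] → x.2 ≠ τ) (hF : Touches F K ({v, x.1} ∪ V ∪ {z | z ∈ t.map Prod.fst})) :
    Touches (F ∪ path τ (x :: t) v) (cutOff K (v - x.1) v) ({v, x.1} ∪ V) := by
  obtain ⟨-, ht, hx'⟩ := h.chord
  have hm := h.mem
  have hneg (z : Plane) : det (v - x.1) z = -det (x.1 - v) z := by rw [← neg_sub, det_neg_left]
  have key {p q : Plane} (hp : p ∈ t.map Prod.fst)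
      (hq : q ∈ x.1 :: t.map Prod.fst ++ [v]) :
      Touches {seg p q} (cutOff K (v - x.1) v) ({v, x.1} ∪ V) := by
    have hq' : q ∈ t.map Prod.fst ∨ q = v ∨ q = x.1 := by simp at hq ⊢; tauto
    refine touches_seg h.convex h.inj (hm p (by simp at hp ⊢; tauto)) (hm q (by simp at hq ⊢; tauto))
      (by simpa only [hneg, neg_lt_neg_iff] using ht p hp) ?_ ?_ <;>
    rcases hq' with hq' | rfl | rfl
    · simpa only [hneg, neg_le_neg_iff] using (ht q hq').le
    · exact le_rfl
    · rw [hneg, hneg, hx']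
    · intro heq
      have := ht q hq'
      simp only [hneg] at heq
      linarith
    all_goals simp
  refine (hF.cutOff ?_).union fun z hz ⟨e, he, r⟩ => ?_
  · rintro z (hz | hz) hd
    · exact hz
    · have := ht z hz
      simp only [hneg] at hd
      linarith
  · rcases he with he | he
    · rcases t with _ | ⟨y, t⟩
      · simp [hx] at he
      · have := key (p := y.1) (q := x.1) (by simp) (by simp)
        rcases eq_of_mem_side he with rfl | rfl
        exacts [this.reverse z hz ⟨_, rfl, r⟩, this z hz ⟨_, rfl, r⟩]
    · obtain ⟨p, hp, q, hq, rfl | rfl⟩ := exists_of_mem_path he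
      · exact key hp (by simp at hq ⊢; tauto) z hz ⟨_, rfl, r⟩
      · exact (key hp (by simp at hq ⊢; tauto)).reverse z hz ⟨_, rfl, r⟩

/-- A polygon with two consecutive equal flags can be shortened. -/
lemma flips_ear {τ : Bool} (h : FlipDisc F K ((v, τ) :: (v', τ) :: x :: t))
    (hx : t = [] → x.2 ≠ τ)
    (ih : ∀ K', FlipDisc F K' ((v, τ) :: x :: t) → Flips F ((v, τ) :: x :: t)) :
    Flips F ((v, τ) :: (v', τ) :: x :: t) := by
  refine .of_eq τ fun α β hα hβ => ?_
  have hdet : 0 < det (v' - v) (x.1 - v) := h.ccw _ _ _ (by simp)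
  obtain ⟨n1, n2, n3⟩ := ne_of_det_pos hdet
  have m : v ∈ K ∧ v' ∈ K ∧ x.1 ∈ K :=
    ⟨h.mem _ (by simp), h.mem _ (by simp), h.mem _ (by simp)⟩
  have hv' : proj v' ∉ support F := by
    cases τ
    exacts [h.vertex_notMem hα v x.1, h.vertex_notMem hα x.1 v]
  have hT : Touches F K ({v, x.1} ∪ ∅ ∪ {z | z ∈ t.map Prod.fst}) := fun z hz hF => by
    have := h.touches z hz hF
    by_cases hzv : z = v'
    · exact (hv' (hzv ▸ hF)).elim
    · simp at this ⊢; tauto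
  obtain ⟨hA, -, hx'⟩ := h.chord (A := [(v', τ)])
  have hT' := h.touches_path (A := [(v', τ)]) hx hT
  have hd1 : det (v - x.1) v ≤ det (v - x.1) v' := by
    have := hA v' (by simp)
    rw [← neg_sub, det_neg_left, det_neg_left]; linarith
  have hd2 : det (v - x.1) x.1 = det (v - x.1) v := by rw [← neg_sub, det_neg_left, det_neg_left, hx']
  rw [Set.union_empty] at hT'
  obtain ⟨γ, hγ, hαγ⟩ : ∃ γ : Multicurve, γ.edges = F ∪ sides τ ((v, τ) :: x :: t) ∧
      Isotopic α γ := by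
    cases τ
    · obtain ⟨γ, hγ, h'⟩ := (GapDisc.of_touches h.convex h.inj m.1 m.2.2 n3 le_rfl hd2.ge
        hT').exists_pull (c := v') (α := α) ⟨m.2.1, hd1⟩ (by rw [det_comm]; linarith [hdet])
        (by rw [hα]; ext; simp; tauto)
      exact ⟨γ, by rw [hγ]; ext; simp [or_comm], h'⟩
    · obtain ⟨γ, hγ, h'⟩ := (GapDisc.of_touches h.convex h.inj m.2.2 m.1 n3.symm hd2.ge le_rfl
        (pair_comm _ _ ▸ hT')).exists_pull (c := v') (α := α) ⟨m.2.1, hd1⟩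
        (by rw [det_cyclic, det_cyclic] at hdet; exact hdet.ne')
        (by rw [hα]; ext; simp)
      exact ⟨γ, by rw [hγ]; ext; simp [or_comm], h'⟩
  refine hαγ.skeinEquiv.trans (ih _ (h.of_chord (A := [(v', τ)]) (hT.cutOff ?_)) τ γ β hγ ?_)
  · intro z hz _; simp at hz ⊢; tauto
  · rw [hβ]; cases τ <;> simp

/-- A saddle move shortens a polygon with alternating flags. -/
lemma flips_saddle {v₁ v₂ v₃ v₄ : Plane}
    (h : FlipDisc F K ((v₁, true) :: (v₂, false) :: (v₃, true) :: (v₄, false) :: t))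
    (ih : ∀ F' K', FlipDisc F' K' ((v₁, true) :: (v₄, false) :: t) →
      Flips F' ((v₁, true) :: (v₄, false) :: t)) :
    Flips F ((v₁, true) :: (v₂, false) :: (v₃, true) :: (v₄, false) :: t) := by
  refine .of_eq true fun α β hα hβ => ?_
  have m (z) (hz : z ∈ [v₁, v₂, v₃, v₄]) : z ∈ K := h.mem z (by simp at hz ⊢; tauto)
  obtain ⟨hA, ht, hx⟩ := h.chord (A := [(v₂, false), (v₃, true)])
  have hneg (z : Plane) : det (v₁ - v₄) z = -det (v₄ - v₁) z := by rw [← neg_sub, det_neg_left]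
  have a₂ := hA v₂ (by simp)
  have a₃ := hA v₃ (by simp)
  simp only at a₂ a₃ hx
  have hT := h.touches_path (A := [(v₂, false), (v₃, true)]) (τ := true) (V := {v₂, v₃}) (by simp)
    fun z hz hF => by have := h.touches z hz hF; simp at this ⊢; tauto
  obtain ⟨γ, hγ, hαγ⟩ := exists_saddle (v₁ := v₁) (v₂ := v₂) (v₃ := v₃) (v₄ := v₄) (α := α)
    (h.convex.inter (convex_le_det _ _)) (h.inj.mono Set.inter_subset_left)
    ⟨m _ (by simp), le_refl (det (v₁ - v₄) v₁)⟩
    ⟨m _ (by simp), show det _ _ ≤ det _ _ by simp only [hneg]; linarith⟩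
    ⟨m _ (by simp), show det _ _ ≤ det _ _ by simp only [hneg]; linarith⟩
    ⟨m _ (by simp), show det _ _ ≤ det _ _ by simp only [hneg]; linarith⟩
    (h.ccw _ _ _ (by simp)) (h.ccw _ _ _ (by simp)) (h.ccw _ _ _ (by simp)) (h.ccw _ _ _ (by simp))
    (fun z hz hF => by have := hT z hz hF; simp at this ⊢; tauto)
    (by rw [hα]; ext; simp; tauto)
  refine hαγ.trans (ih (F ∪ {seg v₂ v₃}) _ (h.of_chord (A := [(v₂, false), (v₃, true)])
    ((h.touches.cutOff ?_).union (touches_seg h.convex h.inj (m _ (by simp)) (m _ (by simp)) a₂ a₃.le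
      fun h => (a₃.ne h).elim))) true γ β ?_ ?_)
  · intro z hz hd
    simp at hz ⊢
    rcases hz with rfl | rfl | rfl | hz
    exacts [.inl rfl, by linarith, by linarith, .inr hz]
  · rw [hγ]; ext; simp; tauto
  · rw [hβ]; ext; simp; tauto

lemma flips_circle {τ : Bool} (h : FlipDisc F K [(a, τ), (b, τ), (c, τ)]) :
    Flips F [(a, τ), (b, τ), (c, τ)] := by
  refine .of_eq τ fun α β hα hβ => ?_
  have hdet : 0 < det (b - a) (c - a) := h.ccw _ _ _ (by simp)
  obtain ⟨n1, n2, n3⟩ := ne_of_det_pos hdet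
  have m : a ∈ K ∧ b ∈ K ∧ c ∈ K :=
    ⟨h.mem _ (by simp), h.mem _ (by simp), h.mem _ (by simp)⟩
  have hβ : β.edges = F := by rw [hβ]; cases τ <;> simp
  have hdisj (hv : ∀ z ∈ [a, b, c], proj z ∉ support F) :
      Disjoint (proj '' K) (support β.edges) := by
    rw [disjoint_left, hβ]
    rintro _ ⟨z, hz, rfl⟩ hF
    exact hv z (by simpa using h.touches z hz hF) hF
  cases τ
  · refine skeinEquiv_circle h.convex h.inj m.1 m.2.1 m.2.2 hdet.ne' (hdisj ?_) ?_
    · simp only [List.mem_cons, List.not_mem_nil, or_false]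
      rintro z (rfl | rfl | rfl)
      exacts [h.vertex_notMem hα c b, h.vertex_notMem hα a c, h.vertex_notMem hα b a]
    · rw [hα, hβ]; ext; simp; tauto
  · refine skeinEquiv_circle h.convex h.inj m.1 m.2.2 m.2.1 (by rw [det_comm]; linarith [hdet])
      (hdisj ?_) ?_
    · simp only [List.mem_cons, List.not_mem_nil, or_false]
      rintro z (rfl | rfl | rfl)
      exacts [h.vertex_notMem hα b c, h.vertex_notMem hα c a, h.vertex_notMem hα a b]
    · rw [hα, hβ]; ext; simp

lemma flips_two {x y : Plane × Bool} (hxy : y.2 ≠ x.2) : Flips F [x, y] := by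
  refine .of_eq true fun α β hα hβ => ?_
  have : α = β := Multicurve.ext' (by
    rw [hα, hβ]
    obtain ⟨x, i⟩ := x
    obtain ⟨y, j⟩ := y
    cases i <;> cases j <;> simp_all)
  exact this ▸ .refl _

lemma flips_three {a b c : Plane × Bool} (h : FlipDisc F K [a, b, c]) : Flips F [a, b, c] := by
  obtain ⟨a, _ | _⟩ := a <;> obtain ⟨b, _ | _⟩ := b <;> obtain ⟨c, _ | _⟩ := c <;>
  first
  | exact h.flips_circle
  | exact h.flips_ear (by simp) fun _ _ => flips_two (by simp)
  | exact h.rotate fun h => h.flips_ear (by simp) fun _ _ => flips_two (by simp)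
  | exact h.rotate fun h => h.rotate fun h => h.flips_ear (by simp) fun _ _ => flips_two (by simp)

lemma flips_or {a b c d : Plane × Bool} (h : FlipDisc F K (a :: b :: c :: d :: t))
    (ih : ∀ {K'}, FlipDisc F K' (a :: c :: d :: t) → Flips F (a :: c :: d :: t))
    (h' : a.2 ≠ b.2 → FlipDisc F K (b :: c :: d :: t ++ [a]) → Flips F (b :: c :: d :: t ++ [a])) :
    Flips F (a :: b :: c :: d :: t) := by
  by_cases hab : a.2 = b.2
  · obtain ⟨a, i⟩ := a
    obtain ⟨b, j⟩ := b
    obtain rfl : i = j := hab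
    exact h.flips_ear (by simp) fun _ => ih
  · exact h.rotate (h' hab)

lemma flips_four {a b c d : Plane × Bool} (h : FlipDisc F K [a, b, c, d]) :
    Flips F [a, b, c, d] := by
  refine h.flips_or flips_three fun h1 h => h.flips_or flips_three fun h2 h =>
    h.flips_or flips_three fun h3 h => ?_
  obtain ⟨a, _ | _⟩ := a <;> obtain ⟨b, _ | _⟩ := b <;> obtain ⟨c, _ | _⟩ := c <;>
    obtain ⟨d, _ | _⟩ := d <;> simp at h1 h2 h3
  · exact h.flips_saddle fun _ _ _ => flips_two (by simp)
  · exact h.rotate fun h => h.flips_saddle fun _ _ _ => flips_two (by simp)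

lemma flips_five {a b c d e : Plane × Bool} (h : FlipDisc F K [a, b, c, d, e]) :
    Flips F [a, b, c, d, e] :=
  h.flips_or flips_four fun h1 h => h.flips_or flips_four fun h2 h => h.flips_or flips_four
    fun h3 h => h.flips_or flips_four fun h4 h => h.flips_or flips_four fun h5 _ => by
      cases h : a.2 <;> simp_all

/-- Flipping a strictly convex hexagon preserves the class up to a power of `-A²`. -/
lemma flips_six {a b c d e f : Plane × Bool} (h : FlipDisc F K [a, b, c, d, e, f]) :
    Flips F [a, b, c, d, e, f] := by
  refine h.flips_or flips_five fun h1 h => h.flips_or flips_five fun h2 h =>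
    h.flips_or flips_five fun h3 h => h.flips_or flips_five fun h4 h => h.flips_or flips_five
    fun h5 h => ?_
  obtain ⟨a, _ | _⟩ := a <;> obtain ⟨b, _ | _⟩ := b <;> obtain ⟨c, _ | _⟩ := c <;>
    obtain ⟨d, _ | _⟩ := d <;> obtain ⟨e, _ | _⟩ := e <;> obtain ⟨f, _ | _⟩ := f <;>
    simp at h1 h2 h3 h4 h5
  · exact h.flips_saddle fun _ _ => flips_four
  · exact h.rotate fun h => h.flips_saddle fun _ _ => flips_four

end FlipDisc

/-- A rectangular grid on the torus, lifted to the plane, together with the size `η` of a small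
diagonal that resolves every vertex of the grid into two trivalent vertices. -/
structure Grid where
  M : ℤ
  N : ℤ
  x : ℤ → ℝ
  y : ℤ → ℝ
  η : ℝ
  three_le_M : 3 ≤ M
  three_le_N : 3 ≤ N
  x_add : ∀ i, x (i + M) = x i + 1
  y_add : ∀ j, y (j + N) = y j + 1
  η_pos : 0 < η
  x_lt : ∀ i, x i + 2 * η < x (i + 1)
  y_lt : ∀ j, y j + 2 * η < y (j + 1)

/-- The three kinds of edges of the trivalent graph: the diagonal, and the edges that are nearly
horizontal and nearly vertical. -/
inductive Side
  | d
  | p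
  | q
  deriving DecidableEq

instance : Fintype Side := ⟨{.d, .p, .q}, fun τ => by cases τ <;> simp⟩

lemma Side.forall {P : Side → Prop} : (∀ τ, P τ) ↔ P .d ∧ P .p ∧ P .q :=
  ⟨fun h => ⟨h _, h _, h _⟩, fun h τ => by cases τ <;> tauto⟩

lemma Side.exists {P : Side → Prop} : (∃ τ, P τ) ↔ P .d ∨ P .p ∨ P .q := by
  rw [← not_iff_not]; push Not; exact Side.forall

/-- The reversed edge. -/
def Edge.rev (e : Edge) : Edge := (e.finish, -e.2)

lemma rev_seg (a b : Plane) : (seg a b).rev = seg b a := by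
  rw [Edge.rev, seg_finish]; simp [seg]

lemma rev_start (e : Edge) : e.rev.start = e.finish := rfl

lemma rev_rev (e : Edge) : e.rev.rev = e := by
  simp [Edge.rev, Edge.finish, proj_neg]

lemma rev_injective : Function.Injective Edge.rev := fun e f h => by
  rw [← rev_rev e, h, rev_rev]

lemma periodic_mul {A : Type*} [AddCommGroup A] {f : ℤ → A} {M : ℤ} {a : A}
    (h : ∀ i, f (i + M) = f i + a) (i k : ℤ) : f (i + k * M) = f i + k • a := by
  induction k with
  | zero => simp
  | succ k ih => rw [add_mul, ← add_assoc, one_mul, h, ih, add_smul, one_smul, add_assoc]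
  | pred k ih =>
    have := h (i + (-(k : ℤ) - 1) * M)
    rw [show i + (-(k : ℤ) - 1) * M + M = i + -(k : ℤ) * M by ring, ih] at this
    rw [sub_smul, ← add_sub_assoc, this, one_smul, add_sub_cancel_right]

namespace Grid

variable (g : Grid) {i j k l i' j' : ℤ} {z : Plane} {τ τ' : Side} {b b' ν ν' : Bool} {s t : ℝ}

lemma x_mono : StrictMono g.x :=
  strictMono_int_of_lt_succ fun i => by linarith [g.x_lt i, g.η_pos]

lemma y_mono : StrictMono g.y :=
  strictMono_int_of_lt_succ fun i => by linarith [g.y_lt i, g.η_pos]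

lemma lt_of_x (h : g.x i < g.x k) : i < k := g.x_mono.lt_iff_lt.1 h

lemma lt_of_y (h : g.y i < g.y k) : i < k := g.y_mono.lt_iff_lt.1 h

def sw (i j : ℤ) : Plane := (g.x i, g.y j)

def ne (i j : ℤ) : Plane := (g.x i + g.η, g.y j + g.η)

lemma sw_add (i j k l : ℤ) : g.sw (i + k * g.M) (j + l * g.N) = g.sw i j + lat (k, l) := by
  simp [sw, lat, periodic_mul g.x_add, periodic_mul g.y_add]

lemma ne_eq (i j : ℤ) : g.ne i j = g.sw i j + (g.η, g.η) := rfl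

lemma ne_add (i j k l : ℤ) : g.ne (i + k * g.M) (j + l * g.N) = g.ne i j + lat (k, l) := by
  simp only [ne_eq, sw_add, add_right_comm]

/-- The vertices of the trivalent graph. -/
def vtx : Bool → ℤ → ℤ → Plane
  | true => g.ne
  | false => g.sw

def tail : Side → ℤ → ℤ → Plane
  | .d, i, j => g.sw i j
  | .p, i, j => g.ne i j
  | .q, i, j => g.ne i j

def head : Side → ℤ → ℤ → Plane
  | .d, i, j => g.ne i j
  | .p, i, j => g.sw (i + 1) j
  | .q, i, j => g.sw i (j + 1)

lemma vtx_add (ν : Bool) (i j k l : ℤ) :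
    g.vtx ν (i + k * g.M) (j + l * g.N) = g.vtx ν i j + lat (k, l) := by
  cases ν <;> simp only [vtx, sw_add, ne_add]

lemma tail_add (τ : Side) (i j k l : ℤ) :
    g.tail τ (i + k * g.M) (j + l * g.N) = g.tail τ i j + lat (k, l) := by
  cases τ <;> simp only [tail, sw_add, ne_add]

lemma head_add (τ : Side) (i j k l : ℤ) :
    g.head τ (i + k * g.M) (j + l * g.N) = g.head τ i j + lat (k, l) := by
  cases τ <;> simp only [head, ne_add, add_right_comm _ _ (1 : ℤ), sw_add]

/-- The edge of the trivalent graph, directed from tail to head or from head to tail. -/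
def oedge (τ : Side) (i j : ℤ) : Bool → Edge
  | true => seg (g.tail τ i j) (g.head τ i j)
  | false => seg (g.head τ i j) (g.tail τ i j)

lemma oedge_add (τ : Side) (i j k l : ℤ) (b : Bool) :
    g.oedge τ (i + k * g.M) (j + l * g.N) b = g.oedge τ i j b := by
  cases b <;> simp only [oedge, tail_add, head_add, seg_translate]

lemma rev_oedge (τ : Side) (i j : ℤ) (b : Bool) : (g.oedge τ i j b).rev = g.oedge τ i j !b := by
  cases b <;> exact rev_seg _ _

/-- The edge of type `τ` directed away from a vertex. -/
def out : Bool → Side → ℤ → ℤ → Edge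
  | true, .d, i, j => g.oedge .d i j false
  | true, .p, i, j => g.oedge .p i j true
  | true, .q, i, j => g.oedge .q i j true
  | false, .d, i, j => g.oedge .d i j true
  | false, .p, i, j => g.oedge .p (i - 1) j false
  | false, .q, i, j => g.oedge .q i (j - 1) false

lemma out_start (ν : Bool) (τ : Side) (i j : ℤ) :
    (g.out ν τ i j).start = proj (g.vtx ν i j) := by
  cases ν <;> cases τ <;> simp [out, oedge, seg_start, head, tail, vtx]

/-- The sign of a direction. -/
def sgn : Bool → ℤ
  | true => 1
  | false => -1

/-- The edges of the graph with coefficient `1`, and those with coefficient `-1` reversed. -/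
def chainEdges (c : Side → ℤ → ℤ → ℤ) : Set Edge :=
  {e | ∃ τ i j b, c τ i j = sgn b ∧ e = g.oedge τ i j b}

/-- `z` lies in the interior of an edge of the graph. -/
def InSide (τ : Side) (i j : ℤ) (z : Plane) : Prop :=
  ∃ s ∈ Ioo₀₁, z = g.tail τ i j + s • (g.head τ i j - g.tail τ i j)

lemma x_not_between (h1 : g.x i < g.x k) (h2 : g.x k < g.x (i + 1)) : False := by
  have := g.lt_of_x h1
  have := g.lt_of_x h2
  omega

lemma y_not_between (h1 : g.y i < g.y k) (h2 : g.y k < g.y (i + 1)) : False := by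
  have := g.lt_of_y h1
  have := g.lt_of_y h2
  omega

variable {g}

lemma InSide.d (h : g.InSide .d i j z) :
    z.1 - g.x i = z.2 - g.y j ∧ 0 < z.1 - g.x i ∧ z.1 - g.x i < g.η := by
  obtain ⟨s, ⟨h0, h1⟩, rfl⟩ := h
  have := g.η_pos
  simp [tail, head, sw, ne]
  constructor <;> nlinarith

lemma InSide.p (h : g.InSide .p i j z) :
    g.x i + g.η < z.1 ∧ z.1 < g.x (i + 1) ∧ g.y j < z.2 ∧ z.2 < g.y j + g.η := by
  obtain ⟨s, ⟨h0, h1⟩, rfl⟩ := h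
  have := g.η_pos
  have := g.x_lt i
  simp [tail, head, sw, ne]
  refine ⟨?_, ?_, ?_, ?_⟩ <;> nlinarith

lemma InSide.q (h : g.InSide .q i j z) :
    g.x i < z.1 ∧ z.1 < g.x i + g.η ∧ g.y j + g.η < z.2 ∧ z.2 < g.y (j + 1) := by
  obtain ⟨s, ⟨h0, h1⟩, rfl⟩ := h
  have := g.η_pos
  have := g.y_lt j
  simp [tail, head, sw, ne]
  refine ⟨?_, ?_, ?_, ?_⟩ <;> nlinarith

lemma InSide.bounds (h : g.InSide τ i j z) :
    g.x i < z.1 ∧ z.1 < g.x (i + 1) ∧ g.y j < z.2 ∧ z.2 < g.y (j + 1) := by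
  have := g.x_lt i
  have := g.y_lt j
  have := g.η_pos
  cases τ
  · have := h.d; grind
  · have := h.p; grind
  · have := h.q; grind

lemma InSide.unique (h : g.InSide τ i j z) (h' : g.InSide τ' i' j' z) :
    τ = τ' ∧ i = i' ∧ j = j' := by
  obtain ⟨a1, a2, a3, a4⟩ := h.bounds
  obtain ⟨b1, b2, b3, b4⟩ := h'.bounds
  have := g.lt_of_x (a1.trans b2)
  have := g.lt_of_x (b1.trans a2)
  have := g.lt_of_y (a3.trans b4)
  have := g.lt_of_y (b3.trans a4)
  obtain rfl : i = i' := by omega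
  obtain rfl : j = j' := by omega
  refine ⟨?_, rfl, rfl⟩
  cases τ <;> cases τ' <;> first | rfl | exfalso
  · linarith [h.d.1, h.d.2.2, h'.p.1]
  · linarith [h.d.1, h.d.2.2, h'.q.2.2.1]
  · linarith [h'.d.1, h'.d.2.2, h.p.1]
  · linarith [h.p.1, h'.q.2.1]
  · linarith [h'.d.1, h'.d.2.2, h.q.2.2.1]
  · linarith [h'.p.1, h.q.2.1]

lemma InSide.ne_vtx (h : g.InSide τ i j (g.vtx ν i' j')) : False := by
  obtain ⟨a1, a2, -, -⟩ := h.bounds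
  cases ν
  · exact g.x_not_between a1 a2
  have h1 := g.x_lt (i - 1)
  have h2 := g.y_lt (j - 1)
  have h3 := g.η_pos
  rw [sub_add_cancel] at h1 h2
  have hx (h5 : g.x i' < g.x i) : g.x i < g.x i' + g.η + g.η → False := fun h4 =>
    g.x_not_between (i := i - 1) (k := i') (by linarith) (by rwa [sub_add_cancel])
  cases τ
  · obtain ⟨a, b, c⟩ := h.d
    simp only [vtx, ne] at a b c
    exact hx (by linarith) (by linarith)
  · obtain ⟨a, b, c, d⟩ := h.p
    simp only [vtx, ne] at a b c d
    exact g.y_not_between (i := j - 1) (k := j') (by linarith) (by rw [sub_add_cancel]; linarith)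
  · obtain ⟨a, b, c, d⟩ := h.q
    simp only [vtx, ne] at a b c d
    exact hx (by linarith) (by linarith)

lemma sw_ne_ne (h : g.sw i j = g.ne i' j') : False := by
  have := g.η_pos
  have := g.x_lt i'
  have := congrArg Prod.fst h
  simp only [sw, ne] at this
  exact g.x_not_between (i := i') (k := i) (by linarith) (by linarith)

lemma vtx_inj (h : g.vtx ν i j = g.vtx ν' i' j') : ν = ν' ∧ i = i' ∧ j = j' := by
  have key (h : g.sw i j = g.sw i' j') : i = i' ∧ j = j' :=
    ⟨g.x_mono.injective (congrArg Prod.fst h), g.y_mono.injective (congrArg Prod.snd h)⟩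
  cases ν <;> cases ν'
  · exact ⟨rfl, key h⟩
  · exact (sw_ne_ne h).elim
  · exact (sw_ne_ne h.symm).elim
  · exact ⟨rfl, key (add_right_cancel (show g.sw i j + (g.η, g.η) = g.sw i' j' + _ from h))⟩

lemma tail_ne_head (τ : Side) (i j : ℤ) : g.tail τ i j ≠ g.head τ i j := by
  cases τ
  exacts [fun h => sw_ne_ne h, fun h => sw_ne_ne h.symm, fun h => sw_ne_ne h.symm]

lemma InSide.add (h : g.InSide τ i j z) (k l : ℤ) :
    g.InSide τ (i + k * g.M) (j + l * g.N) (z + lat (k, l)) := by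
  obtain ⟨s, hs, rfl⟩ := h
  exact ⟨s, hs, by rw [tail_add, head_add]; module⟩

lemma oedge_pt (τ : Side) (i j : ℤ) (b : Bool) (s : ℝ) :
    (g.oedge τ i j b).pt s = proj (g.tail τ i j + (if b then s else 1 - s) •
      (g.head τ i j - g.tail τ i j)) := by
  cases b <;> simp only [oedge, seg_pt] <;> congr 1
  simp; module

lemma ite_mem_Ioo (hs : s ∈ Ioo₀₁) (b : Bool) :
    (if b then s else 1 - s) ∈ Ioo₀₁ := by
  cases b <;> simp [hs.1, hs.2]

/-- Interior points determine the directed edge up to direction. -/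
lemma oedge_interior (hs : s ∈ Ioo₀₁) (ht : t ∈ Ioo₀₁)
    (h : (g.oedge τ i j b).pt s = (g.oedge τ' i' j' b').pt t) :
    τ = τ' ∧ (∃ k l, i' = i + k * g.M ∧ j' = j + l * g.N) ∧
      (if b then s else 1 - s) = if b' then t else 1 - t := by
  rw [oedge_pt, oedge_pt, proj_eq_iff] at h
  obtain ⟨⟨k, l⟩, h⟩ := h
  have h1 : g.InSide τ i j _ := ⟨_, ite_mem_Ioo hs b, rfl⟩
  have h1' := h1.add k l
  rw [← h] at h1'
  obtain ⟨rfl, rfl, rfl⟩ := h1'.unique ⟨_, ite_mem_Ioo ht b', rfl⟩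
  refine ⟨rfl, ⟨k, l, rfl, rfl⟩, ?_⟩
  rw [tail_add, head_add, add_sub_add_right_eq_sub, add_right_comm] at h
  exact (smul_left_injective ℝ (sub_ne_zero.2 (tail_ne_head τ i j).symm)
    (add_left_cancel (add_right_cancel h))).symm

lemma oedge_inj (h : g.oedge τ i j b = g.oedge τ' i' j' b') :
    τ = τ' ∧ (∃ k l, i' = i + k * g.M ∧ j' = j + l * g.N) ∧ b = b' := by
  obtain ⟨h1, h2, h3⟩ := oedge_interior (s := 1 / 3) (t := 1 / 3) (by norm_num)
    (by norm_num) (congrArg (fun e => Edge.pt e (1 / 3)) h)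
  refine ⟨h1, h2, ?_⟩
  cases b <;> cases b' <;> simp at h3 <;> norm_num at h3 <;> rfl

lemma exists_out (τ : Side) (i j : ℤ) (b : Bool) : ∃ ν k l, g.oedge τ i j b = g.out ν τ k l := by
  cases τ <;> cases b
  exacts [⟨true, i, j, rfl⟩, ⟨false, i, j, rfl⟩, ⟨false, i + 1, j, by simp [out]⟩,
    ⟨true, i, j, rfl⟩, ⟨false, i, j + 1, by simp [out]⟩, ⟨true, i, j, rfl⟩]

lemma out_add (ν : Bool) (τ : Side) (i j k l : ℤ) :
    g.out ν τ (i + k * g.M) (j + l * g.N) = g.out ν τ i j := by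
  cases ν <;> cases τ <;> simp only [out, add_sub_right_comm _ _ (1 : ℤ), oedge_add]

lemma eq_out_of_start (h : (g.oedge τ i j b).start = proj (g.vtx ν k l)) :
    g.oedge τ i j b = g.out ν τ k l := by
  obtain ⟨ν', i', j', h'⟩ := g.exists_out τ i j b
  rw [h', out_start, proj_eq_iff] at h
  obtain ⟨⟨m, n⟩, h⟩ := h
  rw [← vtx_add] at h
  obtain ⟨rfl, rfl, rfl⟩ := vtx_inj h
  rw [h', out_add]

/-- A vertex of the graph is not an interior point of an edge. -/
lemma oedge_interior_ne (hs : s ∈ Ioo₀₁)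
    (h : (g.oedge τ i j b).pt s = proj (g.vtx ν k l)) : False := by
  rw [oedge_pt, proj_eq_iff] at h
  obtain ⟨⟨m, n⟩, h⟩ := h
  have h1 : g.InSide τ i j _ := ⟨_, ite_mem_Ioo hs b, rfl⟩
  exact (h ▸ h1.add m n).ne_vtx

/-- The coefficient of the edge of type `τ` directed away from a vertex. -/
def flux (c : Side → ℤ → ℤ → ℤ) : Bool → Side → ℤ → ℤ → ℤ
  | true, .d, i, j => -c .d i j
  | true, .p, i, j => c .p i j
  | true, .q, i, j => c .q i j
  | false, .d, i, j => c .d i j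
  | false, .p, i, j => -c .p (i - 1) j
  | false, .q, i, j => -c .q i (j - 1)

variable {c : Side → ℤ → ℤ → ℤ}

/-- An integral chain on the trivalent graph with coefficients in `{-1, 0, 1}`. -/
structure IsChain (g : Grid) (c : Side → ℤ → ℤ → ℤ) : Prop where
  add : ∀ τ i j k l, c τ (i + k * g.M) (j + l * g.N) = c τ i j
  le_one : ∀ τ i j, c τ i j ≤ 1
  neg_one_le : ∀ τ i j, -1 ≤ c τ i j

/-- An integral cycle on the trivalent graph with coefficients in `{-1, 0, 1}`. -/
structure IsCycle (g : Grid) (c : Side → ℤ → ℤ → ℤ) : Prop extends IsChain g c where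
  kirchhoff : ∀ ν i j, flux c ν .d i j + flux c ν .p i j + flux c ν .q i j = 0

lemma IsCycle.ne (h : g.IsCycle c) (i j : ℤ) : c .d i j = c .p i j + c .q i j := by
  have := h.kirchhoff true i j
  simp only [flux] at this
  linarith

lemma IsCycle.sw (h : g.IsCycle c) (i j : ℤ) : c .d i j = c .p (i - 1) j + c .q i (j - 1) := by
  have := h.kirchhoff false i j
  simp only [flux] at this
  linarith

lemma IsChain.neg (h : g.IsChain c) : g.IsChain fun τ i j => -c τ i j :=
  ⟨fun τ i j k l => by rw [h.add], fun τ i j => by linarith [h.neg_one_le τ i j],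
    fun τ i j => by linarith [h.le_one τ i j]⟩

lemma flux_neg (ν : Bool) (τ : Side) (i j : ℤ) :
    flux (fun τ i j => -c τ i j) ν τ i j = -flux c ν τ i j := by
  cases ν <;> cases τ <;> rfl

lemma IsChain.flux_bounds (h : g.IsChain c) (ν : Bool) (i j : ℤ) :
    ∀ τ, flux c ν τ i j ≤ 1 ∧ -1 ≤ flux c ν τ i j := by
  intro τ
  cases ν <;> cases τ <;>
    exact ⟨by first | exact h.le_one _ _ _ | exact neg_le.1 (h.neg_one_le _ _ _),
      by first | exact h.neg_one_le _ _ _ | exact neg_le_neg (h.le_one _ _ _)⟩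

/-- A coefficient of a chain as a flux at the starting point of the directed edge. -/
lemma out_mem_chainEdges (h : g.IsChain c) :
    g.out ν τ i j ∈ g.chainEdges c ↔ flux c ν τ i j = 1 := by
  have key (τ : Side) (i j : ℤ) (b : Bool) : g.oedge τ i j b ∈ g.chainEdges c ↔ c τ i j = sgn b := by
    refine ⟨?_, fun hc => ⟨τ, i, j, b, hc, rfl⟩⟩
    rintro ⟨τ', i', j', b', hc, he⟩
    obtain ⟨rfl, ⟨k, l, rfl, rfl⟩, rfl⟩ := oedge_inj he
    rwa [h.add] at hc
  cases ν <;> cases τ <;> simp only [out, flux, key, sgn, neg_eq_iff_eq_neg]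

lemma rev_mem_chainEdges :
    e.rev ∈ g.chainEdges (fun τ i j => -c τ i j) ↔ e ∈ g.chainEdges c := by
  have key {c : Side → ℤ → ℤ → ℤ} {e : Edge} (he : e ∈ g.chainEdges c) :
      e.rev ∈ g.chainEdges fun τ i j => -c τ i j := by
    obtain ⟨τ, i, j, b, hc, rfl⟩ := he
    exact ⟨τ, i, j, !b, by simp only [hc]; cases b <;> rfl, g.rev_oedge τ i j b⟩
  refine ⟨fun h => ?_, key⟩
  simpa only [neg_neg, rev_rev] using key h

lemma exists_out_of_mem (he : e ∈ g.chainEdges c) :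
    ∃ ν τ i j, e = g.out ν τ i j := by
  obtain ⟨τ, i, j, b, -, rfl⟩ := he
  obtain ⟨ν, k, l, h⟩ := g.exists_out τ i j b
  exact ⟨ν, τ, k, l, h⟩

/-- The edges of a chain that start at a given vertex. -/
lemma IsChain.exists_start_iff (h : g.IsChain c) :
    e ∈ g.chainEdges c ∧ e.start = proj (g.vtx ν i j) ↔
      ∃ τ, flux c ν τ i j = 1 ∧ e = g.out ν τ i j := by
  constructor
  · rintro ⟨he, hs⟩
    obtain ⟨τ, k, l, b, hc, rfl⟩ := id he
    rw [eq_out_of_start hs] at he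
    exact ⟨τ, (out_mem_chainEdges h).1 he, eq_out_of_start hs⟩
  · rintro ⟨τ, hτ, rfl⟩
    exact ⟨(out_mem_chainEdges h).2 hτ, g.out_start ν τ i j⟩

/-- The edges of a chain that end at a given vertex. -/
lemma IsChain.exists_finish_iff (h : g.IsChain c) :
    e ∈ g.chainEdges c ∧ e.finish = proj (g.vtx ν i j) ↔
      ∃ τ, flux c ν τ i j = -1 ∧ e.rev = g.out ν τ i j := by
  have := h.neg.exists_start_iff (e := e.rev) (ν := ν) (i := i) (j := j)
  simpa only [flux_neg, neg_eq_iff_eq_neg, rev_mem_chainEdges, rev_start] using this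

lemma IsCycle.start_injOn (h : g.IsCycle c) : InjOn Edge.start (g.chainEdges c) := by
  intro e he e' he' hee
  obtain ⟨ν, τ, i, j, rfl⟩ := exists_out_of_mem he
  obtain ⟨τ', h', rfl⟩ := h.exists_start_iff.1 ⟨he', hee.symm.trans (g.out_start ν τ i j)⟩
  have h1 := (out_mem_chainEdges h.toIsChain).1 he
  have h2 := h.kirchhoff ν i j
  obtain ⟨b1, b2, b3⟩ := Side.forall.1 (h.flux_bounds ν i j)
  cases τ <;> cases τ' <;> first | rfl | omega

lemma IsCycle.exists_flux (h : g.IsCycle c) (hτ : flux c ν τ i j = 1) :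
    ∃ τ, flux c ν τ i j = -1 := by
  have h2 := h.kirchhoff ν i j
  obtain ⟨b1, b2, b3⟩ := Side.forall.1 (h.flux_bounds ν i j)
  rw [Side.exists]
  cases τ <;> omega

lemma IsCycle.neg (h : g.IsCycle c) : g.IsCycle fun τ i j => -c τ i j :=
  ⟨h.toIsChain.neg, fun ν i j => by simp only [flux_neg]; linarith [h.kirchhoff ν i j]⟩

lemma IsCycle.start_subset (h : g.IsCycle c) :
    Edge.start '' (g.chainEdges c) ⊆ Edge.finish '' (g.chainEdges c) := by
  rintro _ ⟨e, he, rfl⟩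
  obtain ⟨ν, τ, i, j, rfl⟩ := exists_out_of_mem he
  obtain ⟨τ', h'⟩ := h.exists_flux ((out_mem_chainEdges h.toIsChain).1 he)
  obtain ⟨h1, h2⟩ := h.exists_finish_iff.2 ⟨τ', h', rev_rev _⟩
  exact ⟨_, h1, h2.trans (g.out_start ν τ i j).symm⟩

lemma IsCycle.closed (h : g.IsCycle c) :
    Edge.finish '' (g.chainEdges c) = Edge.start '' (g.chainEdges c) := by
  refine Set.Subset.antisymm ?_ h.start_subset
  rintro _ ⟨e, he, rfl⟩
  obtain ⟨f, hf, h'⟩ := h.neg.start_subset ⟨e.rev, rev_mem_chainEdges.2 he, rfl⟩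
  exact ⟨f.rev, rev_mem_chainEdges.1 (by rwa [rev_rev]), h'⟩

lemma exists_residue (g : Grid) (i j : ℤ) :
    ∃ m n : ℤ, i + m * g.M ∈ Finset.Ico 0 g.M ∧ j + n * g.N ∈ Finset.Ico 0 g.N := by
  have key {M : ℤ} (hM : 3 ≤ M) (i : ℤ) : i + -(i / M) * M ∈ Finset.Ico 0 M := by
    rw [neg_mul, ← sub_eq_add_neg, mul_comm, ← Int.emod_def, mem_Ico]
    exact ⟨Int.emod_nonneg i (by omega), Int.emod_lt_of_pos i (by omega)⟩
  exact ⟨_, _, key g.three_le_M i, key g.three_le_N j⟩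

lemma finite_chainEdges (c : Side → ℤ → ℤ → ℤ) : (g.chainEdges c).Finite := by
  refine (((Finset.univ : Finset Side) ×ˢ (Finset.Ico 0 g.M) ×ˢ (Finset.Ico 0 g.N) ×ˢ
    (Finset.univ : Finset Bool)).image
      fun u => g.oedge u.1 u.2.1 u.2.2.1 u.2.2.2).finite_toSet.subset ?_
  rintro _ ⟨τ, i, j, b, -, rfl⟩
  obtain ⟨m, n, h1, h2⟩ := g.exists_residue i j
  rw [← g.oedge_add τ i j m n]
  exact Finset.mem_image.2 ⟨(τ, _, _, b), by simp [h1, h2], rfl⟩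

lemma mem_chainEdges (h : c τ i j = sgn b) : g.oedge τ i j b ∈ g.chainEdges c :=
  ⟨τ, i, j, b, h, rfl⟩

lemma IsCycle.isMulticurve (h : g.IsCycle c) : IsMulticurve (g.chainEdges c) where
  finite := finite_chainEdges c
  closed := h.closed
  embedded := by
    rintro ⟨e, s⟩ ⟨he, hs0, hs1⟩ ⟨e', t⟩ ⟨he', ht0, ht1⟩ hst
    simp only at he he' hs0 hs1 ht0 ht1 hst
    have key {e e' : Edge} (he : e ∈ g.chainEdges c) (he' : e' ∈ g.chainEdges c) {s : ℝ}
        (hs : s ∈ Ioo₀₁) (hst : e.pt s = e'.pt 0) : False := by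
      obtain ⟨τ, i, j, b, hc, rfl⟩ := he
      obtain ⟨ν, τ', k, l, rfl⟩ := exists_out_of_mem he'
      exact oedge_interior_ne hs (by rw [hst, pt_zero, out_start])
    rcases hs0.eq_or_lt with rfl | hs0 <;> rcases ht0.eq_or_lt with rfl | ht0
    · rw [pt_zero, pt_zero] at hst
      rw [h.start_injOn he he' hst]
    · exact (key he' he ⟨ht0, ht1⟩ hst.symm).elim
    · exact (key he he' ⟨hs0, hs1⟩ hst).elim
    · obtain ⟨τ, i, j, b, hc, rfl⟩ := he
      obtain ⟨τ', i', j', b', hc', rfl⟩ := he'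
      obtain ⟨rfl, ⟨k, l, rfl, rfl⟩, h3⟩ := oedge_interior ⟨hs0, hs1⟩ ⟨ht0, ht1⟩ hst
      rw [h.add, hc] at hc'
      rw [oedge_add]
      cases b <;> cases b' <;> simp_all [sgn]

/-- A curve in the trivalent graph defines a cycle. -/
lemma IsChain.isCycle (h : g.IsChain c) (hm : IsMulticurve (g.chainEdges c)) :
    g.IsCycle c := by
  refine ⟨h, fun ν i j => ?_⟩
  have out_inj {τ τ' : Side} (h : g.out ν τ i j = g.out ν τ' i j) : τ = τ' := by
    have h' (τ : Side) : ∃ k l b, g.out ν τ i j = g.oedge τ k l b := by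
      cases ν <;> cases τ <;> simp only [out] <;> exact ⟨_, _, _, rfl⟩
    obtain ⟨_, _, _, h1⟩ := h' τ
    obtain ⟨_, _, _, h2⟩ := h' τ'
    exact (oedge_inj (h1.symm.trans (h.trans h2))).1
  have u1 (τ τ' : Side) (h1 : flux c ν τ i j = 1) (h2 : flux c ν τ' i j = 1) : τ = τ' := by
    obtain ⟨a, a'⟩ := h.exists_start_iff.2 ⟨τ, h1, rfl⟩
    obtain ⟨b, b'⟩ := h.exists_start_iff.2 ⟨τ', h2, rfl⟩
    exact out_inj (hm.start_injOn a b (a'.trans b'.symm))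
  have u2 (τ τ' : Side) (h1 : flux c ν τ i j = -1) (h2 : flux c ν τ' i j = -1) : τ = τ' := by
    obtain ⟨a, a'⟩ := h.exists_finish_iff.2 ⟨τ, h1, rev_rev _⟩
    obtain ⟨b, b'⟩ := h.exists_finish_iff.2 ⟨τ', h2, rev_rev _⟩
    exact out_inj (rev_injective (hm.finish_injOn a b (a'.trans b'.symm)))
  have e1 (τ : Side) (h1 : flux c ν τ i j = 1) : ∃ τ, flux c ν τ i j = -1 := by
    obtain ⟨a, a'⟩ := h.exists_start_iff.2 ⟨τ, h1, rfl⟩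
    obtain ⟨f, hf, h'⟩ := hm.exists_finish a
    exact (h.exists_finish_iff.1 ⟨hf, h'.trans a'⟩).imp fun _ => And.left
  have e2 (τ : Side) (h1 : flux c ν τ i j = -1) : ∃ τ, flux c ν τ i j = 1 := by
    obtain ⟨a, a'⟩ := h.exists_finish_iff.2 ⟨τ, h1, rev_rev _⟩
    obtain ⟨f, hf, h'⟩ := hm.exists_start a
    exact (h.exists_start_iff.1 ⟨hf, h'.trans a'⟩).imp fun _ => And.left
  have b1 := h.flux_bounds ν i j
  simp only [Side.forall, Side.exists, reduceCtorEq, imp_false] at u1 u2 e1 e2 b1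
  grind

end Grid

lemma ccwList_cons {l : List Plane}
    (h : l.Pairwise fun b c => 0 < det (b - a) (c - a)) (hl : CcwList l) : CcwList (a :: l) := by
  intro u v w huvw
  rcases huvw with _ | ⟨_, huvw⟩ | ⟨_, huvw⟩
  · exact hl u v w huvw
  · exact List.pairwise_iff_forall_sublist.1 h huvw

namespace Grid

variable {g : Grid} {i j k l : ℤ} {z : Plane} {τ : Side} {b ν : Bool} {c₁ c₂ : ℤ}
  {f f' : ℤ → ℤ → ℤ}

/-- The coboundary of a function on the hexagonal faces. -/
def cob (f : ℤ → ℤ → ℤ) : Side → ℤ → ℤ → ℤ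
  | .d, i, j => f (i - 1) j - f i (j - 1)
  | .p, i, j => f i j - f i (j - 1)
  | .q, i, j => f (i - 1) j - f i j

/-- A function on the hexagonal faces with prescribed periods that changes by at most one between
neighbouring faces. -/
structure IsHeight (g : Grid) (c₁ c₂ : ℤ) (f : ℤ → ℤ → ℤ) : Prop where
  add : ∀ i j k l, f (i + k * g.M) (j + l * g.N) = f i j + k * c₁ + l * c₂
  le_one : ∀ τ i j, cob f τ i j ≤ 1
  neg_one_le : ∀ τ i j, -1 ≤ cob f τ i j

lemma IsHeight.isCycle (h : g.IsHeight c₁ c₂ f) : g.IsCycle (cob f) where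
  add := by
    intro τ i j k l
    cases τ <;> simp only [cob, add_sub_right_comm _ _ (1 : ℤ), h.add] <;> ring
  le_one := h.le_one
  neg_one_le := h.neg_one_le
  kirchhoff := by intro ν i j; cases ν <;> simp only [flux, cob] <;> ring

/-- The curve along which the function jumps. -/
def IsHeight.curve (h : g.IsHeight c₁ c₂ f) : Multicurve :=
  ⟨g.chainEdges (cob f), h.isCycle.isMulticurve⟩

variable (g) in
/-- The vertices of a hexagonal face. -/
def hexagon (i j : ℤ) : Set Plane :=
  {g.ne i j, g.sw (i + 1) j, g.ne (i + 1) j, g.sw (i + 1) (j + 1), g.ne i (j + 1), g.sw i (j + 1)}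

lemma hexagon_bounds (hz : z ∈ convexHull ℝ (g.hexagon i j)) :
    (g.x i ≤ z.1 ∧ z.1 ≤ g.x (i + 1) + g.η) ∧ (g.y j ≤ z.2 ∧ z.2 ≤ g.y (j + 1) + g.η) ∧
    (z.1 - g.x (i + 1) ≤ z.2 - g.y j ∧ z.2 - g.y (j + 1) ≤ z.1 - g.x i) ∧
    0 ≤ (g.x (i + 1) - g.x i - g.η) * (z.2 - g.y j) + g.η * (z.1 - g.x (i + 1)) ∧
    g.η * (z.2 - g.y (j + 1)) + (g.y (j + 1) - g.y j - g.η) * (z.1 - g.x (i + 1)) ≤ 0 := by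
  have h1 := g.x_lt i
  have h2 := g.y_lt j
  have h3 := g.η_pos
  have h4 : 0 ≤ (g.x (i + 1) - g.x i - 2 * g.η) * (g.y (j + 1) - g.y j - 2 * g.η) :=
    mul_nonneg (by linarith) (by linarith)
  have key (a b c : ℝ) (h : ∀ v ∈ g.hexagon i j, 0 ≤ a * v.1 + b * v.2 + c) :
      0 ≤ a * z.1 + b * z.2 + c := by
    have := le_det_of_mem_convexHull (u := (b, -a)) (c := -c)
      (fun v hv => by simp only [det]; linarith [h v hv]) hz
    simp only [det] at this
    linarith
  simp only [hexagon, mem_insert_iff, mem_singleton_iff, forall_eq_or_imp, forall_eq, sw,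
    ne] at key
  refine ⟨⟨?_, ?_⟩, ⟨?_, ?_⟩, ⟨?_, ?_⟩, ?_, ?_⟩
  · linarith [key 1 0 (-g.x i) (by grind)]
  · linarith [key (-1) 0 (g.x (i + 1) + g.η) (by grind)]
  · linarith [key 0 1 (-g.y j) (by grind)]
  · linarith [key 0 (-1) (g.y (j + 1) + g.η) (by grind)]
  · linarith [key (-1) 1 (g.x (i + 1) - g.y j) (by grind)]
  · linarith [key 1 (-1) (g.y (j + 1) - g.x i) (by grind)]
  · linarith [key g.η (g.x (i + 1) - g.x i - g.η)
      (-(g.x (i + 1) - g.x i - g.η) * g.y j - g.η * g.x (i + 1))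
      (by refine ⟨?_, ?_, ?_, ?_, ?_, ?_⟩ <;> nlinarith)]
  · linarith [key (-(g.y (j + 1) - g.y j - g.η)) (-g.η)
      ((g.y (j + 1) - g.y j - g.η) * g.x (i + 1) + g.η * g.y (j + 1))
      (by refine ⟨?_, ?_, ?_, ?_, ?_, ?_⟩ <;> nlinarith)]

lemma hexagon_vtx (hz : g.vtx ν k l ∈ convexHull ℝ (g.hexagon i j)) :
    g.vtx ν k l ∈ g.hexagon i j := by
  have h3 := g.η_pos
  obtain ⟨⟨a, b⟩, ⟨c, d⟩, -, hl, hu⟩ := hexagon_bounds hz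
  have hx := g.x_lt
  have hy := g.y_lt
  cases ν
  · simp only [vtx, sw] at a b c d hl
    have := g.lt_of_x (i := i) (k := k + 1) (by linarith [hx k])
    have := g.lt_of_x (i := k) (k := i + 1 + 1) (by linarith [hx (i + 1)])
    have := g.lt_of_y (i := j) (k := l + 1) (by linarith [hy l])
    have := g.lt_of_y (i := l) (k := j + 1 + 1) (by linarith [hy (j + 1)])
    obtain rfl | rfl : k = i ∨ k = i + 1 := by omega
    · obtain rfl | rfl : l = j ∨ l = j + 1 := by omega
      · nlinarith [hx k]
      · simp [hexagon, vtx]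
    · obtain rfl | rfl : l = j ∨ l = j + 1 := by omega
      all_goals simp [hexagon, vtx]
  · simp only [vtx, ne] at a b c d hu
    have := g.lt_of_x (i := i) (k := k + 1) (by linarith [hx k])
    have := g.lt_of_x (i := k) (k := i + 1 + 1) (by linarith [hx (i + 1)])
    have := g.lt_of_y (i := j) (k := l + 1) (by linarith [hy l])
    have := g.lt_of_y (i := l) (k := j + 1 + 1) (by linarith [hy (j + 1)])
    obtain rfl | rfl : k = i ∨ k = i + 1 := by omega
    · obtain rfl | rfl : l = j ∨ l = j + 1 := by omega
      all_goals simp [hexagon, vtx]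
    · obtain rfl | rfl : l = j ∨ l = j + 1 := by omega
      · simp [hexagon, vtx]
      · nlinarith [hy j]

/-- The sides of a hexagonal face. -/
def IsHexSide (i j : ℤ) (τ : Side) (k l : ℤ) : Prop :=
  (τ = .p ∧ k = i ∧ (l = j ∨ l = j + 1)) ∨ (τ = .q ∧ (k = i ∨ k = i + 1) ∧ l = j) ∨
    (τ = .d ∧ ((k = i + 1 ∧ l = j) ∨ (k = i ∧ l = j + 1)))

/-- The interiors of the edges that meet a closed hexagonal face are on its boundary. -/
lemma hexagon_inSide (hz : z ∈ convexHull ℝ (g.hexagon i j)) (hs : g.InSide τ k l z) :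
    IsHexSide i j τ k l := by
  have h1 := g.x_lt (i + 1)
  have h2 := g.y_lt (j + 1)
  have h3 := g.η_pos
  have h4 := g.x_lt i
  have h5 := g.y_lt j
  obtain ⟨⟨a, b⟩, ⟨c, d⟩, -, hl, hu⟩ := hexagon_bounds hz
  obtain ⟨a', b', c', d'⟩ := hs.bounds
  have := g.lt_of_x (i := i) (k := k + 1) (by linarith)
  have := g.lt_of_x (i := k) (k := i + 1 + 1) (by linarith)
  have := g.lt_of_y (i := j) (k := l + 1) (by linarith)
  have := g.lt_of_y (i := l) (k := j + 1 + 1) (by linarith)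
  obtain rfl | rfl : k = i ∨ k = i + 1 := by omega
  · obtain rfl | rfl : l = j ∨ l = j + 1 := by omega
    · cases τ
      · obtain ⟨e1, e2, e3⟩ := hs.d
        rw [← e1] at hl
        nlinarith
      all_goals simp [IsHexSide]
    · cases τ
      · simp [IsHexSide]
      · simp [IsHexSide]
      · linarith [hs.q.2.2.1]
  · obtain rfl | rfl : l = j ∨ l = j + 1 := by omega
    · cases τ
      · simp [IsHexSide]
      · linarith [hs.p.1]
      · simp [IsHexSide]
    · nlinarith

/-- The hexagonal face as a flagged polygon. -/
def hexList (g : Grid) (f : ℤ → ℤ → ℤ) (i j : ℤ) : List (Plane × Bool) :=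
  [(g.ne i j, decide (cob f .p i j = -1)), (g.sw (i + 1) j, decide (cob f .d (i + 1) j = -1)),
    (g.ne (i + 1) j, decide (cob f .q (i + 1) j = -1)),
    (g.sw (i + 1) (j + 1), decide (cob f .p i (j + 1) = 1)),
    (g.ne i (j + 1), decide (cob f .d i (j + 1) = 1)),
    (g.sw i (j + 1), decide (cob f .q i j = 1))]

lemma ccwList_hexList (f : ℤ → ℤ → ℤ) (i j : ℤ) :
    CcwList ((g.hexList f i j).map Prod.fst) := by
  have h3 := g.η_pos
  obtain ⟨w, hw, hx⟩ : ∃ w, 0 < w ∧ g.x (i + 1) = g.x i + 2 * g.η + w :=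
    ⟨g.x (i + 1) - g.x i - 2 * g.η, by linarith [g.x_lt i], by ring⟩
  obtain ⟨h, hh, hy⟩ : ∃ h, 0 < h ∧ g.y (j + 1) = g.y j + 2 * g.η + h :=
    ⟨g.y (j + 1) - g.y j - 2 * g.η, by linarith [g.y_lt j], by ring⟩
  simp only [hexList, List.map_cons, List.map_nil]
  refine ccwList_cons ?_ (ccwList_cons ?_ (ccwList_cons ?_ (ccwList_cons ?_ (ccwList_cons ?_
    (ccwList_cons ?_ fun _ _ _ h => by simp at h))))) <;>
  simp only [List.pairwise_cons, List.mem_cons, List.not_mem_nil, or_false, forall_eq_or_imp,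
    forall_eq, false_imp_iff, implies_true, List.Pairwise.nil, and_true, sw, ne, det, hx, hy,
    fst_sub, snd_sub] <;>
  (repeat' apply And.intro) <;> ring_nf <;> positivity

lemma injOn_hexagon (i j : ℤ) : InjOn proj (convexHull ℝ (g.hexagon i j)) := by
  refine injOn_proj_of_box (g.x i) (g.y j) fun z hz => ?_
  obtain ⟨⟨a, b⟩, ⟨c, d⟩, -⟩ := hexagon_bounds hz
  have h1 := g.x_lt (i + 1)
  have h2 := g.y_lt (j + 1)
  have h3 := g.η_pos
  have h4 := g.x_mono.monotone (show i + 1 + 1 ≤ i + g.M by linarith [g.three_le_M])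
  have h5 := g.y_mono.monotone (show j + 1 + 1 ≤ j + g.N by linarith [g.three_le_N])
  rw [g.x_add] at h4
  rw [g.y_add] at h5
  refine ⟨?_, ?_, ?_, ?_⟩ <;> linarith

/-- The points of an edge are vertices of the graph or interior points. -/
lemma oedge_pt_cases (ht : t ∈ Icc₀₁)
    (h : (g.oedge τ k l b).pt t = proj z) :
    (∃ ν i j, z = g.vtx ν i j) ∨ ∃ m n, g.InSide τ (k + m * g.M) (l + n * g.N) z := by
  have hv (τ : Side) (i j : ℤ) : (∃ ν k l, g.tail τ i j = g.vtx ν k l) ∧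
      ∃ ν k l, g.head τ i j = g.vtx ν k l := by
    cases τ
    exacts [⟨⟨false, _, _, rfl⟩, true, _, _, rfl⟩, ⟨⟨true, _, _, rfl⟩, false, _, _, rfl⟩,
      ⟨⟨true, _, _, rfl⟩, false, _, _, rfl⟩]
  rw [oedge_pt, proj_eq_iff] at h
  obtain ⟨⟨m, n⟩, h⟩ := h
  rw [add_right_comm, ← tail_add,
    ← add_sub_add_right_eq_sub (g.head τ k l) _ (lat (m, n)), ← tail_add, ← head_add] at h
  have hs : (if b then t else 1 - t) ∈ Icc₀₁ := by
    cases b <;> simp [ht.1, ht.2]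
  rcases hs.1.eq_or_lt with h0 | h0
  · rw [← h0, zero_smul, add_zero] at h
    exact Or.inl (h ▸ (hv _ _ _).1)
  rcases hs.2.eq_or_lt with h1 | h1
  · rw [h1, one_smul, add_sub_cancel] at h
    exact Or.inl (h ▸ (hv _ _ _).2)
  · exact Or.inr ⟨m, n, _, ⟨h0, h1⟩, h⟩

lemma flipDisc_hexagon (hF : ∀ e ∈ F, ∃ τ k l b, e = g.oedge τ k l b ∧
      ∀ m n : ℤ, ¬ IsHexSide i j τ (k + m * g.M) (l + n * g.N)) :
    FlipDisc F (convexHull ℝ (g.hexagon i j)) (g.hexList f i j) where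
  convex := convex_convexHull ℝ _
  inj := injOn_hexagon i j
  mem x hx := subset_convexHull ℝ _ (by simpa [hexagon, hexList] using hx)
  ccw := ccwList_hexList f i j
  touches := by
    rintro z hz ⟨e, he, t, ht, hzt⟩
    obtain ⟨τ, k, l, b, rfl, hn⟩ := hF e he
    rcases oedge_pt_cases ht hzt with ⟨ν, i', j', rfl⟩ | ⟨m, n, hs⟩
    · simpa [hexagon, hexList] using hexagon_vtx hz
    · exact (hn m n (hexagon_inSide hz hs)).elim

/-- The indicator function of the class of one face. -/
def bump (g : Grid) (i j k l : ℤ) : ℤ := if g.M ∣ k - i ∧ g.N ∣ l - j then 1 else 0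

lemma bump_self (i j : ℤ) : g.bump i j i j = 1 := by simp [bump]

lemma bump_of_ne (hk : |k - i| ≤ 2) (hl : |l - j| ≤ 2) (h : k ≠ i ∨ l ≠ j) :
    g.bump i j k l = 0 := by
  refine if_neg fun ⟨h1, h2⟩ => ?_
  have := Int.eq_zero_of_abs_lt_dvd h1 (by linarith [g.three_le_M])
  have := Int.eq_zero_of_abs_lt_dvd h2 (by linarith [g.three_le_N])
  omega

lemma exists_of_bump_ne_zero (h : g.bump i j k l ≠ 0) :
    ∃ m n : ℤ, k + m * g.M = i ∧ l + n * g.N = j := by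
  obtain ⟨⟨m, hm⟩, n, hn⟩ := (ite_ne_right_iff.1 h).1
  exact ⟨-m, -n, by linarith, by linarith⟩

lemma bump_add (i j k l m n : ℤ) :
    g.bump i j (k + m * g.M) (l + n * g.N) = g.bump i j k l := by
  simp only [bump, add_sub_right_comm, Int.dvd_add_left (Int.dvd_mul_left _ _)]

lemma isHexSide_of_cob_bump_ne (h : cob (g.bump i j) τ k l ≠ 0) :
    ∃ m n : ℤ, IsHexSide i j τ (k + m * g.M) (l + n * g.N) := by
  have key {a b : ℤ} (h : a - b ≠ 0) : a ≠ 0 ∨ b ≠ 0 := by omega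
  cases τ <;> rcases key h with h | h <;>
    obtain ⟨m, n, h1, h2⟩ := exists_of_bump_ne_zero h <;>
    exact ⟨m, n, by simp [IsHexSide]; omega⟩

lemma cob_bump_sides (i j : ℤ) : cob (g.bump i j) .p i j = 1 ∧
    cob (g.bump i j) .d (i + 1) j = 1 ∧ cob (g.bump i j) .q (i + 1) j = 1 ∧
    cob (g.bump i j) .p i (j + 1) = -1 ∧ cob (g.bump i j) .d i (j + 1) = -1 ∧
    cob (g.bump i j) .q i j = -1 := by
  simp only [cob, add_sub_cancel_right, bump_self]
  rw [bump_of_ne (k := i) (l := j - 1), bump_of_ne (k := i + 1) (l := j - 1),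
    bump_of_ne (k := i + 1) (l := j), bump_of_ne (k := i) (l := j + 1),
    bump_of_ne (k := i - 1) (l := j + 1), bump_of_ne (k := i - 1) (l := j)] <;> simp

lemma cob_add (f f' : ℤ → ℤ → ℤ) (τ : Side) (i j : ℤ) :
    cob (fun k l => f k l + f' k l) τ i j = cob f τ i j + cob f' τ i j := by
  cases τ <;> simp only [cob] <;> ring

/-- Raising the height function on one face. -/
lemma IsHeight.skeinEquiv_bump (h : g.IsHeight c₁ c₂ f)
    (h' : g.IsHeight c₁ c₂ fun k l => f k l + g.bump i j k l) : SkeinEquiv h.curve h'.curve := by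
  set F : Set Edge := {e | ∃ τ k l b, cob (g.bump i j) τ k l = 0 ∧ cob f τ k l = sgn b ∧
    e = g.oedge τ k l b} with hF
  have l1 := h.le_one
  have l2 := h.neg_one_le
  have l3 := h'.le_one
  have l4 := h'.neg_one_le
  have hc' := h'.isCycle
  simp only [cob_add] at l3 l4
  obtain ⟨s1, s2, s3, s4, s5, s6⟩ := g.cob_bump_sides i j
  have hper (τ : Side) (k l m n : ℤ) : cob (g.bump i j) τ (k + m * g.M) (l + n * g.N) =
      cob (g.bump i j) τ k l := by
    cases τ <;> simp only [cob, add_sub_right_comm _ _ (1 : ℤ), bump_add]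
  have hside {τ : Side} {k l : ℤ} (hk : IsHexSide i j τ k l) : cob (g.bump i j) τ k l ≠ 0 := by
    rcases hk with ⟨rfl, rfl, rfl | rfl⟩ | ⟨rfl, rfl | rfl, rfl⟩ | ⟨rfl, ⟨rfl, rfl⟩ | ⟨rfl, rfl⟩⟩ <;>
      omega
  have hdisc : FlipDisc F (convexHull ℝ (g.hexagon i j)) (g.hexList f i j) := by
    refine flipDisc_hexagon ?_
    rintro e ⟨τ, k, l, b, h0, -, rfl⟩
    exact ⟨τ, k, l, b, rfl, fun m n hk => hside hk (by rw [hper, h0])⟩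
  have hsplit {c : Side → ℤ → ℤ → ℤ} (hc : g.IsChain c)
      (h0 : ∀ τ k l, cob (g.bump i j) τ k l = 0 → c τ k l = cob f τ k l) {S : Set Edge}
      (hS : ∀ e, e ∈ S ↔ ∃ τ k l b, IsHexSide i j τ k l ∧ c τ k l = sgn b ∧ e = g.oedge τ k l b) :
      g.chainEdges c = F ∪ S := by
    ext e
    rw [mem_union, hS]
    constructor
    · rintro ⟨τ, k, l, b, hb, rfl⟩
      by_cases h1 : cob (g.bump i j) τ k l = 0
      · exact Or.inl ⟨τ, k, l, b, h1, h0 τ k l h1 ▸ hb, rfl⟩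
      · obtain ⟨m, n, hmn⟩ := isHexSide_of_cob_bump_ne h1
        exact Or.inr ⟨τ, _, _, b, hmn, by rwa [hc.add], (g.oedge_add _ _ _ _ _ _).symm⟩
    · rintro (⟨τ, k, l, b, h1, hb, rfl⟩ | ⟨τ, k, l, b, -, hb, rfl⟩)
      · exact mem_chainEdges ((h0 τ k l h1).trans hb)
      · exact mem_chainEdges hb
  refine hdisc.flips_six true _ _ (hsplit h.isCycle.toIsChain (fun _ _ _ _ => rfl) fun e => ?_)
    (hsplit h'.isCycle.toIsChain (fun _ _ _ h0 => by rw [cob_add, h0, add_zero]) fun e => ?_)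
  all_goals
    have := And.intro (And.intro (l1 .p i (j + 1)) (And.intro (l1 .d i (j + 1)) (l1 .q i j)))
      (And.intro (l2 .p i j) (And.intro (l2 .d (i + 1) j) (l2 .q (i + 1) j)))
    have := And.intro this (And.intro (And.intro (l3 .p i j) (And.intro (l3 .d (i + 1) j)
      (l3 .q (i + 1) j))) (And.intro (l4 .p i (j + 1)) (And.intro (l4 .d i (j + 1)) (l4 .q i j))))
    simp [sides, path, first, mem_side, cob_add, IsHexSide, or_and_right, and_or_left,
      exists_or, and_assoc, or_assoc, oedge, tail, head, sgn]
    clear * - this s1 s2 s3 s4 s5 s6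
    constructor
    · rintro (h | h | h | h | h | h) <;> grind
    · rintro (h | h | h | h | h | h | h | h | h | h) <;> grind

lemma IsHeight.neighbours (h : g.IsHeight c₁ c₂ f) (i j : ℤ) :
    f i j - 1 ≤ f i (j - 1) ∧ f i j - 1 ≤ f (i + 1) (j - 1) ∧ f i j - 1 ≤ f (i + 1) j ∧
      f i j - 1 ≤ f i (j + 1) ∧ f i j - 1 ≤ f (i - 1) (j + 1) ∧ f i j - 1 ≤ f (i - 1) j := by
  have a1 := h.le_one .p i j
  have a2 := h.le_one .d (i + 1) j
  have a3 := h.le_one .q (i + 1) j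
  have a4 := h.neg_one_le .p i (j + 1)
  have a5 := h.neg_one_le .d i (j + 1)
  have a6 := h.neg_one_le .q i j
  simp only [cob, add_sub_cancel_right] at a1 a2 a3 a4 a5 a6
  omega

lemma bump_nonneg (i j k l : ℤ) : 0 ≤ g.bump i j k l ∧ g.bump i j k l ≤ 1 := by
  unfold bump; split_ifs <;> simp

/-- The discrepancy between a height function and the linear function with the same periods. -/
def excess (g : Grid) (c₁ c₂ : ℤ) (f : ℤ → ℤ → ℤ) (i j : ℤ) : ℤ :=
  g.M * g.N * f i j - c₁ * g.N * i - c₂ * g.M * j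

lemma IsHeight.excess_add (h : g.IsHeight c₁ c₂ f) (i j k l : ℤ) :
    g.excess c₁ c₂ f (i + k * g.M) (j + l * g.N) = g.excess c₁ c₂ f i j := by
  simp only [excess, h.add]; ring

/-- Below a height function `f'`, the function `f` can be raised at some face where it is not
equal to `f'`. -/
lemma IsHeight.exists_bump (h : g.IsHeight c₁ c₂ f) (h' : g.IsHeight c₁ c₂ f')
    (hM : 2 * |c₁| < g.M) (hN : 2 * |c₂| < g.N) {a b : ℤ} (hab : f a b < f' a b) :
    ∃ i ∈ Finset.Ico 0 g.M, ∃ j ∈ Finset.Ico 0 g.N, f i j < f' i j ∧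
      g.IsHeight c₁ c₂ (fun k l => f k l + g.bump i j k l) := by
  classical
  set S := (Finset.Ico 0 g.M ×ˢ Finset.Ico 0 g.N).filter fun u => f u.1 u.2 < f' u.1 u.2 with hS
  have hmem {k l : ℤ} (hkl : f k l < f' k l) :
      ∃ m n : ℤ, (k + m * g.M, l + n * g.N) ∈ S := by
    obtain ⟨m, n, h1, h2⟩ := g.exists_residue k l
    exact ⟨m, n, Finset.mem_filter.2 ⟨Finset.mem_product.2 ⟨h1, h2⟩, by
      simp only [h.add, h'.add]; omega⟩⟩
  obtain ⟨_, _, h0⟩ := hmem hab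
  obtain ⟨⟨i, j⟩, hij, hmin⟩ := S.exists_min_image (fun u => g.excess c₁ c₂ f u.1 u.2) ⟨_, h0⟩
  rw [hS, mem_filter, mem_product] at hij
  obtain ⟨⟨hi, hj⟩, hlt⟩ := hij
  simp only at hi hj hlt hmin
  have hM0 := g.three_le_M
  have hN0 := g.three_le_N
  have hc1 := abs_lt.1 (show |2 * c₁| < g.M by rwa [abs_mul, abs_two])
  have hc2 := abs_lt.1 (show |2 * c₂| < g.N by rwa [abs_mul, abs_two])
  have hnb {k l : ℤ} (h1 : f i j - 1 ≤ f k l) (h2 : f' i j - 1 ≤ f' k l)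
      (hL : c₁ * g.N * (i - k) + c₂ * g.M * (j - l) < g.M * g.N) : f i j ≤ f k l := by
    by_contra hcon
    have e1 : f k l = f i j - 1 := by omega
    obtain ⟨m, n, h3⟩ := hmem (k := k) (l := l) (by omega)
    have := hmin _ h3
    simp only [h.excess_add] at this
    simp only [excess, e1] at this
    nlinarith
  have n1 : c₁ * g.N < g.M * g.N ∧ -(c₁ * g.N) < g.M * g.N := by constructor <;> nlinarith
  have n2 : c₂ * g.M < g.M * g.N ∧ -(c₂ * g.M) < g.M * g.N := by constructor <;> nlinarith
  have n3 : c₁ * g.N - c₂ * g.M < g.M * g.N ∧ -(c₁ * g.N) + c₂ * g.M < g.M * g.N := by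
    constructor <;> nlinarith
  obtain ⟨a1, a2, a3, a4, a5, a6⟩ := h.neighbours i j
  obtain ⟨b1, b2, b3, b4, b5, b6⟩ := h'.neighbours i j
  have t1 := hnb a1 b1 (by ring_nf; linarith [n2.1])
  have t2 := hnb a2 b2 (by ring_nf; linarith [n3.2])
  have t3 := hnb a3 b3 (by ring_nf; linarith [n1.2])
  have t4 := hnb a4 b4 (by ring_nf; linarith [n2.2])
  have t5 := hnb a5 b5 (by ring_nf; linarith [n3.1])
  have t6 := hnb a6 b6 (by ring_nf; linarith [n1.1])
  obtain ⟨s1, s2, s3, s4, s5, s6⟩ := g.cob_bump_sides i j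
  have hadd (k l m n : ℤ) : f (k + m * g.M) (l + n * g.N) +
      g.bump i j (k + m * g.M) (l + n * g.N) = f k l + g.bump i j k l + m * c₁ + n * c₂ := by
    rw [h.add, bump_add]; ring
  have hbound (τ : Side) (k l : ℤ) : cob (fun k l => f k l + g.bump i j k l) τ k l ≤ 1 ∧
      -1 ≤ cob (fun k l => f k l + g.bump i j k l) τ k l := by
    have u1 := h.le_one τ
    have u2 := h.neg_one_le τ
    by_cases h0 : cob (g.bump i j) τ k l = 0
    · rw [cob_add, h0, add_zero]
      exact ⟨u1 k l, u2 k l⟩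
    · obtain ⟨m, n, hmn⟩ := isHexSide_of_cob_bump_ne h0
      have hper : cob (fun k l => f k l + g.bump i j k l) τ (k + m * g.M) (l + n * g.N) =
          cob (fun k l => f k l + g.bump i j k l) τ k l := by
        cases τ <;> simp only [cob, add_sub_right_comm _ _ (1 : ℤ), hadd] <;> ring
      rw [← hper, cob_add]
      have u3 := u1 (k + m * g.M) (l + n * g.N)
      have u4 := u2 (k + m * g.M) (l + n * g.N)
      revert u3 u4 hmn
      generalize k + m * g.M = k
      generalize l + n * g.N = l
      clear hper h0
      intro hmn _ _
      rcases hmn with ⟨rfl, rfl, rfl | rfl⟩ | ⟨rfl, rfl | rfl, rfl⟩ |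
        ⟨rfl, ⟨rfl, rfl⟩ | ⟨rfl, rfl⟩⟩ <;>
        simp only [cob, add_sub_cancel_right] at * <;> omega
  exact ⟨i, hi, j, hj, hlt, hadd, fun τ k l => (hbound τ k l).1, fun τ k l => (hbound τ k l).2⟩

lemma IsHeight.skeinEquiv_of_le (h' : g.IsHeight c₁ c₂ f') (hM : 2 * |c₁| < g.M)
    (hN : 2 * |c₂| < g.N) (h : g.IsHeight c₁ c₂ f) (hle : ∀ i j, f i j ≤ f' i j) :
    SkeinEquiv h.curve h'.curve := by
  obtain ⟨n, hn⟩ : ∃ n : ℕ, ∑ u ∈ Finset.Ico 0 g.M ×ˢ Finset.Ico 0 g.N,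
    (f' u.1 u.2 - f u.1 u.2) < n := exists_nat_gt _
  induction n generalizing f with
  | zero => exact absurd hn (not_lt.2 (Finset.sum_nonneg fun u _ => sub_nonneg.2 (hle _ _)))
  | succ n ih =>
    by_cases hlt : ∃ a b, f a b < f' a b
    · obtain ⟨a, b, hab⟩ := hlt
      obtain ⟨i, hi, j, hj, hij, hf⟩ := h.exists_bump h' hM hN hab
      refine (h.skeinEquiv_bump hf).trans (ih hf (fun k l => ?_) ?_)
      · by_cases h0 : g.bump i j k l = 0
        · rw [h0, add_zero]; exact hle k l
        · obtain ⟨m, n, rfl, rfl⟩ := exists_of_bump_ne_zero h0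
          rw [h.add, h'.add] at hij
          have := (g.bump_nonneg (k + m * g.M) (l + n * g.N) k l).2
          omega
      · have : ∑ u ∈ Finset.Ico 0 g.M ×ˢ Finset.Ico 0 g.N,
            (f' u.1 u.2 - (f u.1 u.2 + g.bump i j u.1 u.2)) <
            ∑ u ∈ Finset.Ico 0 g.M ×ˢ Finset.Ico 0 g.N, (f' u.1 u.2 - f u.1 u.2) := by
          refine Finset.sum_lt_sum (fun u _ => ?_) ⟨(i, j), Finset.mem_product.2 ⟨hi, hj⟩, ?_⟩
          · have := (g.bump_nonneg i j u.1 u.2).1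
            omega
          · simp only [bump_self]; omega
        push_cast at hn
        omega
    · push Not at hlt
      obtain rfl : f = f' := funext₂ fun i j => le_antisymm (hle i j) (hlt i j)
      exact SkeinEquiv.refl _

/-- Height functions with the same periods define curves that agree up to a power of `-A²`. -/
lemma IsHeight.skeinEquiv (h : g.IsHeight c₁ c₂ f) (h' : g.IsHeight c₁ c₂ f')
    (hM : 2 * |c₁| < g.M) (hN : 2 * |c₂| < g.N) : SkeinEquiv h.curve h'.curve := by
  set C := ∑ u ∈ Finset.Ico 0 g.M ×ˢ Finset.Ico 0 g.N, |f u.1 u.2 - f' u.1 u.2| with hC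
  have hcob : cob (fun i j => f' i j + C) = cob f' := by
    ext τ i j
    cases τ <;> simp only [cob] <;> ring
  have h2 : g.IsHeight c₁ c₂ fun i j => f' i j + C :=
    ⟨fun i j k l => by rw [h'.add]; ring, hcob ▸ h'.le_one, hcob ▸ h'.neg_one_le⟩
  rw [← show h2.curve = h'.curve from Multicurve.ext' (congrArg g.chainEdges hcob)]
  refine h2.skeinEquiv_of_le hM hN h fun i j => ?_
  obtain ⟨m, n, h3, h4⟩ := g.exists_residue i j
  have := Finset.single_le_sum (f := fun u : ℤ × ℤ => |f u.1 u.2 - f' u.1 u.2|)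
    (fun u _ => abs_nonneg _)
    (show (i + m * g.M, j + n * g.N) ∈ _ from Finset.mem_product.2 ⟨h3, h4⟩)
  simp only [← hC, h.add, h'.add] at this
  linarith [(le_abs_self _).trans this]

end Grid

/-- The sum of the displacement vectors of the edges; for a closed curve this is its homology
class. -/
def homology (E : Set Edge) : Plane := ∑ᶠ e ∈ E, e.2

namespace Grid

variable {g : Grid} {c : Side → ℤ → ℤ → ℤ}

open Classical in
/-- The coefficients of a set of directed edges of the graph. -/
def coeff (g : Grid) (E : Set Edge) (τ : Side) (i j : ℤ) : ℤ :=
  if g.oedge τ i j true ∈ E then 1 else if g.oedge τ i j false ∈ E then -1 else 0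

lemma oedge_rev_notMem (h : IsMulticurve E) {τ : Side} {i j : ℤ} {b : Bool}
    (hb : g.oedge τ i j b ∈ E) : g.oedge τ i j (!b) ∉ E := by
  intro hb'
  have h3 := (h.eq_of_pt_eq hb hb' (s := 1 / 2) (t := 1 / 2) (by norm_num) (by norm_num) (by
      rw [oedge_pt, oedge_pt]; cases b <;> norm_num)).1
  simpa using (oedge_inj h3).2.2

lemma chainEdges_coeff (h : IsMulticurve E)
    (hE : ∀ e ∈ E, ∃ τ i j b, e = g.oedge τ i j b) : g.chainEdges (g.coeff E) = E := by
  ext e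
  constructor
  · rintro ⟨τ, i, j, b, hc, rfl⟩
    unfold coeff at hc
    split_ifs at hc <;> cases b <;> simp_all [sgn]
  · intro he
    obtain ⟨τ, i, j, b, rfl⟩ := hE e he
    have := oedge_rev_notMem h he
    refine mem_chainEdges ?_
    unfold coeff
    cases b <;> simp_all [sgn]

lemma isCycle_coeff (h : IsMulticurve E)
    (hE : ∀ e ∈ E, ∃ τ i j b, e = g.oedge τ i j b) : g.IsCycle (g.coeff E) := by
  refine IsChain.isCycle ⟨fun τ i j k l => ?_, fun τ i j => ?_, fun τ i j => ?_⟩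
    ((chainEdges_coeff h hE).symm ▸ h) <;> unfold coeff
  · rw [oedge_add, oedge_add]
  all_goals split_ifs <;> simp

lemma exists_primitive (a : ℤ → ℤ) : ∃ F : ℤ → ℤ, F 0 = 0 ∧ ∀ n, F n - F (n - 1) = a n := by
  refine ⟨fun n => ∑ k ∈ Ioc 0 n, a k - ∑ k ∈ Ioc n 0, a k, by simp, fun n => ?_⟩
  simp only
  rcases lt_or_ge 0 n with hn | hn
  · have e1 : Ioc 0 n = insert n (Ioc 0 (n - 1)) := by
      ext k; simp only [Finset.mem_Ioc, mem_insert]; omega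
    rw [e1, sum_insert (by simp), Ioc_eq_empty (a := n) (by omega),
      Ioc_eq_empty (a := n - 1) (by omega)]
    simp
  · have e1 : Ioc (n - 1) 0 = insert n (Ioc n 0) := by
      ext k; simp only [Finset.mem_Ioc, mem_insert]; omega
    rw [e1, sum_insert (by simp), Ioc_eq_empty (b := n) (by omega),
      Ioc_eq_empty (b := n - 1) (by omega)]
    simp

lemma eq_of_sub_one {F : ℤ → ℤ} (h : ∀ n, F n = F (n - 1)) (m n : ℤ) : F m = F n := by
  have := periodic_mul (f := F) (M := 1) (a := 0)
    (fun i => by rw [h, add_sub_cancel_right, add_zero]) n (m - n)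
  rwa [mul_one, add_sub_cancel, smul_zero, add_zero] at this

/-- Every cycle is the coboundary of a height function. -/
lemma IsCycle.exists_height (h : g.IsCycle c) : ∃ c₁ c₂ f, g.IsHeight c₁ c₂ f ∧ cob f = c := by
  choose P hP0 hP using fun i => exists_primitive (fun j => c .p i j)
  obtain ⟨Q, -, hQ⟩ := exists_primitive (fun i => -c .q i 0)
  set f : ℤ → ℤ → ℤ := fun i j => Q i + P i j with hf
  have hp (i j : ℤ) : f i j - f i (j - 1) = c .p i j := by
    simp only [hf]; linarith [hP i j]
  have hq (i j : ℤ) : f (i - 1) j - f i j = c .q i j := by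
    have := eq_of_sub_one (F := fun j => f (i - 1) j - f i j - c .q i j) (fun j => by
      linarith [hp i j, hp (i - 1) j, h.ne i j, h.sw i j]) j 0
    have e0 := hQ i
    simp only [hf, hP0] at this e0 ⊢
    linarith
  have hcob : cob f = c := by
    ext τ i j
    cases τ <;> simp only [cob]
    · rw [h.ne, ← hp, ← hq]; ring
    · exact hp i j
    · exact hq i j
  clear_value f
  have hconst (m n : ℤ) (i j : ℤ) :
      f (i + m * g.M) (j + n * g.N) - f i j = f (0 + m * g.M) (0 + n * g.N) - f 0 0 := by
    have e1 (i j : ℤ) := hp (i + m * g.M) (j + n * g.N)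
    have e2 (i j : ℤ) := hq (i + m * g.M) (j + n * g.N)
    simp only [h.add, add_sub_right_comm _ _ (1 : ℤ)] at e1 e2
    rw [eq_of_sub_one (F := fun j => f (i + m * g.M) (j + n * g.N) - f i j)
        (fun j => by linarith [e1 i j, hp i j]) j 0,
      eq_of_sub_one (F := fun i => f (i + m * g.M) (0 + n * g.N) - f i 0)
        (fun i => by linarith [e2 i 0, hq i 0]) i 0]
  refine ⟨f (0 + 1 * g.M) (0 + 0 * g.N) - f 0 0, f (0 + 0 * g.M) (0 + 1 * g.N) - f 0 0, f,
    ⟨fun i j k l => ?_, hcob ▸ h.le_one, hcob ▸ h.neg_one_le⟩, hcob⟩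
  have h1 (i j : ℤ) := hconst 1 0 i j
  have h2 (i j : ℤ) := hconst 0 1 i j
  generalize f (0 + 1 * g.M) (0 + 0 * g.N) - f 0 0 = c₁ at h1 ⊢
  generalize f (0 + 0 * g.M) (0 + 1 * g.N) - f 0 0 = c₂ at h2 ⊢
  simp only [one_mul, zero_mul, add_zero, sub_eq_iff_eq_add'] at h1 h2
  rw [periodic_mul (f := fun i => f i _) (fun i => h1 i _), periodic_mul (h2 i)]
  simp only [smul_eq_mul]
  ring

lemma sum_Ico_telescope {A : Type*} [AddCommGroup A] (F : ℤ → A) {M : ℤ} (hM : 0 ≤ M) :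
    ∑ i ∈ Finset.Ico 0 M, (F (i + 1) - F i) = F M - F 0 := by
  lift M to ℕ using hM
  induction M with
  | zero => simp
  | succ n ih =>
    have : Finset.Ico (0 : ℤ) ((n + 1 : ℕ) : ℤ) = insert (n : ℤ) (Finset.Ico 0 (n : ℤ)) := by
      ext k; simp only [mem_Ico, mem_insert]; omega
    rw [this, sum_insert (by simp), ih]
    push_cast
    abel

lemma homology_chainEdges (h : g.IsCycle c) :
    homology (g.chainEdges c) = ∑ i ∈ Finset.Ico 0 g.M, ∑ j ∈ Finset.Ico 0 g.N,
      (c .p i j * (g.x (i + 1) - g.x i), c .q i j * (g.y (j + 1) - g.y j)) := by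
  classical
  set S := (Finset.univ : Finset Side) ×ˢ Finset.Ico 0 g.M ×ˢ Finset.Ico 0 g.N with hS
  have hcase {τ : Side} {i j : ℤ} (h0 : c τ i j ≠ 0) : c τ i j = 1 ∨ c τ i j = -1 := by
    have h1 := h.le_one τ i j
    have h2 := h.neg_one_le τ i j
    omega
  have hres {M i k : ℤ} (h1 : i ∈ Finset.Ico 0 M) (h2 : i + k * M ∈ Finset.Ico 0 M) : k * M = 0 := by
    rw [mem_Ico] at h1 h2
    exact Int.eq_zero_of_abs_lt_dvd (Dvd.intro_left k rfl) (abs_lt.2 ⟨by linarith, by linarith⟩)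
  have hbij : Set.BijOn (fun u : Side × ℤ × ℤ => g.oedge u.1 u.2.1 u.2.2 (decide
      (c u.1 u.2.1 u.2.2 = 1))) (S.filter fun u => c u.1 u.2.1 u.2.2 ≠ 0) (g.chainEdges c) := by
    refine ⟨?_, ?_, ?_⟩
    · rintro ⟨τ, i, j⟩ hu
      rw [mem_coe, mem_filter] at hu
      rcases hcase hu.2 with h3 | h3 <;> exact mem_chainEdges (by simp [h3, sgn])
    · rintro ⟨τ, i, j⟩ hu ⟨τ', i', j'⟩ hu' he
      simp only [mem_coe, mem_filter, hS, mem_product, Finset.mem_univ,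
        true_and] at hu hu'
      obtain ⟨rfl, ⟨k, l, rfl, rfl⟩, -⟩ := oedge_inj he
      simp [hres hu.1.1 hu'.1.1, hres hu.1.2 hu'.1.2]
    · rintro _ ⟨τ, i, j, b, hc, rfl⟩
      obtain ⟨m, n, h1, h2⟩ := g.exists_residue i j
      refine ⟨(τ, i + m * g.M, j + n * g.N), ?_, ?_⟩
      · rw [mem_coe, mem_filter, hS]
        refine ⟨by simp [h1, h2, - mem_Ico], ?_⟩
        cases b <;> simp [h.add, hc, sgn]
      · cases b <;> simp [h.add, oedge_add, hc, sgn]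
  rw [homology, ← finsum_mem_eq_of_bijOn _ hbij (f := fun u => (c u.1 u.2.1 u.2.2 : ℝ) •
    (g.head u.1 u.2.1 u.2.2 - g.tail u.1 u.2.1 u.2.2)), finsum_mem_coe_finset,
    Finset.sum_filter_of_ne, hS, sum_product]
  · simp only [sum_product]
    rw [show (Finset.univ : Finset Side) = {.d, .p, .q} from rfl, sum_insert (by simp),
      sum_insert (by simp), sum_singleton]
    simp only [← sum_add_distrib, h.ne]
    refine sum_congr rfl fun i _ => sum_congr rfl fun j _ => ?_
    push_cast
    ext <;> simp [head, tail, sw, ne] <;> ring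
  · intro u _ h0 h1
    exact h0 (by rw [h1]; simp)
  · rintro ⟨τ, i, j⟩ hu
    rw [mem_coe, mem_filter] at hu
    rcases hcase hu.2 with h3 | h3 <;> simp [h3, oedge, seg]

lemma homology_height {c₁ c₂ : ℤ} {f : ℤ → ℤ → ℤ} (h : g.IsHeight c₁ c₂ f) :
    homology (g.chainEdges (cob f)) = ((c₂ : ℝ), -(c₁ : ℝ)) := by
  have hM : 0 ≤ g.M := by linarith [g.three_le_M]
  have hN : 0 ≤ g.N := by linarith [g.three_le_N]
  have tel {M : ℤ} (hM : 0 ≤ M) (F : ℤ → ℤ) :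
      ∑ k ∈ Finset.Ico 0 M, ((F k : ℝ) - F (k - 1)) = F (-1 + M) - F (-1) := by
    have := sum_Ico_telescope (fun k => (F (k - 1) : ℝ)) hM
    simpa [add_comm, sub_eq_add_neg] using this
  have hx := g.x_add 0
  have hy := g.y_add 0
  rw [zero_add] at hx hy
  rw [homology_chainEdges h.isCycle]
  ext
  · have e (i : ℤ) := h.add i (-1) 0 1
    simp only [zero_mul, add_zero, one_mul] at e
    simp only [Prod.fst_sum, cob, Int.cast_sub, ← Finset.sum_mul, tel hN (f _), e]
    simp only [Int.cast_add, add_sub_cancel_left, ← mul_sum, sum_Ico_telescope _ hM, hx]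
    ring
  · have e (j : ℤ) := h.add (-1) j 1 0
    simp only [zero_mul, add_zero, one_mul] at e
    simp only [Prod.snd_sum, cob, Int.cast_sub]
    rw [sum_comm]
    have e1 (j : ℤ) : ∑ i ∈ Finset.Ico 0 g.M, ((f (i - 1) j : ℝ) - f i j) = -c₁ := by
      rw [← neg_inj, ← Finset.sum_neg_distrib]
      simp only [neg_sub, tel hM fun i => f i j, e]
      simp
    simp only [← Finset.sum_mul, e1, ← mul_sum, sum_Ico_telescope _ hN, hy]
    ring

/-- Curves in the trivalent graph with the same homology class agree up to a power of `-A²`, if the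
grid is fine enough. -/
lemma skeinEquiv_of_homology_eq (c₁ c₂ : ℤ)
    (hα : ∀ e ∈ α.edges, ∃ τ i j b, e = g.oedge τ i j b)
    (hβ : ∀ e ∈ β.edges, ∃ τ i j b, e = g.oedge τ i j b)
    (hαc : homology α.edges = ((c₂ : ℝ), -(c₁ : ℝ))) (hβc : homology β.edges = ((c₂ : ℝ), -(c₁ : ℝ)))
    (hM : 2 * |c₁| < g.M) (hN : 2 * |c₂| < g.N) : SkeinEquiv α β := by
  have key {γ : Multicurve} (hγ : ∀ e ∈ γ.edges, ∃ τ i j b, e = g.oedge τ i j b)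
      (hγc : homology γ.edges = ((c₂ : ℝ), -(c₁ : ℝ))) :
      ∃ f, ∃ h : g.IsHeight c₁ c₂ f, h.curve = γ := by
    obtain ⟨d₁, d₂, f, h, hf⟩ := (isCycle_coeff γ.isMulticurve hγ).exists_height
    have he : g.chainEdges (cob f) = γ.edges := by rw [hf, chainEdges_coeff γ.isMulticurve hγ]
    have := homology_height h
    rw [he, hγc, Prod.mk.injEq, neg_inj, Int.cast_inj, Int.cast_inj] at this
    obtain ⟨rfl, rfl⟩ := this
    exact ⟨f, h, Multicurve.ext' he⟩
  obtain ⟨f, h, rfl⟩ := key hα hαc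
  obtain ⟨f', h', rfl⟩ := key hβ hβc
  exact h.skeinEquiv h' hM hN

end Grid

/-- Removing bad edges one by one by isotopies. -/
lemma exists_isotopic_of_step {P : Multicurve → Prop} {bad : Set Edge}
    (hstep : ∀ α, P α → ∀ e ∈ α.edges, e ∈ bad → ∃ β, P β ∧ Isotopic α β ∧
      (β.edges ∩ bad).ncard < (α.edges ∩ bad).ncard) (α : Multicurve) (hα : P α) :
    ∃ β, P β ∧ Isotopic α β ∧ ∀ e ∈ β.edges, e ∉ bad := by
  obtain ⟨n, hn⟩ : ∃ n, (α.edges ∩ bad).ncard = n := ⟨_, rfl⟩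
  induction n using Nat.strong_induction_on generalizing α with
  | _ n ih =>
    by_cases h : ∃ e ∈ α.edges, e ∈ bad
    · obtain ⟨e, he, hb⟩ := h
      obtain ⟨β, hβ, hiso, hlt⟩ := hstep α hα e he hb
      obtain ⟨γ, hγ, hiso', hγ'⟩ := ih _ (hn ▸ hlt) β hβ rfl
      exact ⟨γ, hγ, hiso.trans hiso', hγ'⟩
    · push Not at h
      exact ⟨α, hα, Isotopic.refl α, h⟩

lemma ncard_inter_lt {bad : Set Edge} (hE : E.Finite) (he : e ∈ E) (hb : e ∈ bad)
    (hF : ∀ f ∈ F, f ∈ bad → f ∈ E ∧ f ≠ e) : (F ∩ bad).ncard < (E ∩ bad).ncard := by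
  refine Set.ncard_lt_ncard ⟨fun f hf => ⟨(hF f hf.1 hf.2).1, hf.2⟩, fun hsub => ?_⟩
    (hE.subset Set.inter_subset_left)
  exact (hF e (hsub ⟨he, hb⟩).1 hb).2 rfl

lemma sdiff_union_singleton (he : e ∈ E) : E = E \ {e} ∪ {e} := by
  rw [Set.sdiff_union_self, Set.union_eq_left.2]; simpa using he

lemma sdiff_union_pair (he : e ∈ E) (hf : f ∈ E) :
    E = E \ {e, f} ∪ {e, f} := by
  rw [Set.sdiff_union_self, Set.union_eq_left.2]
  rintro x (rfl | rfl) <;> assumption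

namespace Grid

variable {g : Grid} {i j k l : ℤ} {z : Plane} {τ : Side} {b b' μ μ' ν : Bool} {E F N : Set Edge}

/-- The right (`true`) or upper (`false`) neighbour of a vertex of the grid. -/
def far (g : Grid) : Bool → ℤ → ℤ → Plane
  | true, i, j => g.sw (i + 1) j
  | false, i, j => g.sw i (j + 1)

/-- The side of the trivalent graph that is parallel to an edge of the grid. -/
def long : Bool → Side
  | true => .p
  | false => .q

/-- The directed horizontal (`true`) and vertical (`false`) edges of the grid. -/
def sqedge (g : Grid) (μ : Bool) (i j : ℤ) : Bool → Edge
  | true => seg (g.sw i j) (g.far μ i j)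
  | false => seg (g.far μ i j) (g.sw i j)

lemma far_add (μ : Bool) (i j k l : ℤ) :
    g.far μ (i + k * g.M) (j + l * g.N) = g.far μ i j + lat (k, l) := by
  cases μ <;> rw [far, far, ← sw_add] <;> congr 1 <;> ring

lemma sqedge_add (μ : Bool) (i j k l : ℤ) (b : Bool) :
    g.sqedge μ (i + k * g.M) (j + l * g.N) b = g.sqedge μ i j b := by
  cases b <;> simp only [sqedge, far_add, sw_add, seg_translate]

lemma sqedge_pt (μ : Bool) (i j : ℤ) (b : Bool) (s : ℝ) :
    (g.sqedge μ i j b).pt s = proj (g.sw i j + (if b then s else 1 - s) •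
      (g.far μ i j - g.sw i j)) := by
  cases b <;> simp only [sqedge, seg_pt] <;> congr 1
  simp; module

lemma head_long (μ : Bool) (i j : ℤ) : g.head (long μ) i j = g.far μ i j := by
  cases μ <;> rfl

lemma tail_long (μ : Bool) (i j : ℤ) : g.tail (long μ) i j = g.ne i j := by
  cases μ <;> rfl

variable (g) in
/-- `z` lies in the interior of an edge of the grid. -/
def InEdge (μ : Bool) (i j : ℤ) (z : Plane) : Prop :=
  if μ then z.2 = g.y j ∧ g.x i < z.1 ∧ z.1 < g.x (i + 1)
  else z.1 = g.x i ∧ g.y j < z.2 ∧ z.2 < g.y (j + 1)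

lemma inEdge_of_mem_Ioo (hs : s ∈ Ioo₀₁) (μ : Bool) (i j : ℤ) :
    g.InEdge μ i j (g.sw i j + s • (g.far μ i j - g.sw i j)) := by
  have := g.x_mono (lt_add_one i)
  have := g.y_mono (lt_add_one j)
  cases μ <;> simp [InEdge, far, sw] <;> constructor <;> nlinarith [hs.1, hs.2]

lemma sqedge_pt_cases (ht : t ∈ Icc₀₁)
    (h : (g.sqedge μ k l b).pt t = proj z) :
    (∃ i j, z = g.vtx false i j) ∨ ∃ m n, g.InEdge μ (k + m * g.M) (l + n * g.N) z := by
  rw [sqedge_pt, proj_eq_iff] at h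
  obtain ⟨⟨m, n⟩, h⟩ := h
  rw [add_right_comm, ← sw_add,
    ← add_sub_add_right_eq_sub (g.far μ k l) _ (lat (m, n)), ← sw_add, ← far_add] at h
  have hs : (if b then t else 1 - t) ∈ Icc₀₁ := by
    cases b <;> simp [ht.1, ht.2]
  rcases hs.1.eq_or_lt with h0 | h0
  · rw [← h0, zero_smul, add_zero] at h
    exact Or.inl ⟨_, _, h⟩
  rcases hs.2.eq_or_lt with h1 | h1
  · rw [h1, one_smul, add_sub_cancel] at h
    cases μ <;> exact Or.inl ⟨_, _, h⟩
  · exact Or.inr ⟨m, n, h ▸ inEdge_of_mem_Ioo ⟨h0, h1⟩ _ _ _⟩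

lemma oedge_ne_sqedge (h : g.oedge τ i j b = g.sqedge μ k l b') : False := by
  obtain ⟨s, hs⟩ : ∃ s : ℝ, s ∈ Ioo₀₁ := ⟨1 / 2, by norm_num⟩
  have h1 := (oedge_pt (g := g) τ i j b s).symm
  rw [h, sqedge_pt, proj_eq_iff] at h1
  obtain ⟨⟨m, n⟩, h1⟩ := h1
  have h2 : g.InSide τ i j _ := ⟨_, ite_mem_Ioo hs b, rfl⟩
  have h4 := (h2.add m n).bounds
  rw [← h1] at h4
  have h3 := inEdge_of_mem_Ioo (g := g) (ite_mem_Ioo hs b') μ k l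
  cases μ <;> simp only [InEdge, if_true, Bool.false_eq_true, if_false] at h3
  · rw [h3.1] at h4
    exact g.x_not_between h4.1 h4.2.1
  · rw [h3.1] at h4
    exact g.y_not_between h4.2.2.1 h4.2.2.2

lemma sqedge_pt_ne (ht : t ∈ Icc₀₁)
    (h : (g.sqedge μ k l b).pt t = proj (g.ne i j)) : False := by
  have := g.η_pos
  have := g.x_lt i
  have := g.y_lt j
  rcases sqedge_pt_cases ht h with ⟨_, _, h⟩ | ⟨m, n, h⟩
  · exact sw_ne_ne h.symm
  · cases μ <;> simp only [InEdge, ne, if_true, Bool.false_eq_true, if_false] at h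
    · exact g.x_not_between (i := i) (k := k + m * g.M) (by linarith) (by linarith)
    · exact g.y_not_between (i := j) (k := l + n * g.N) (by linarith) (by linarith)

variable (g) in
/-- The thin triangle between an edge of the grid and the trivalent graph. -/
def thin (μ : Bool) (i j : ℤ) : Set Plane :=
  if μ then {z | g.y j ≤ z.2 ∧ z.2 - g.y j ≤ z.1 - g.x i ∧
      g.η * (z.1 - g.x (i + 1)) + (g.x (i + 1) - g.x i - g.η) * (z.2 - g.y j) ≤ 0}
  else {z | g.x i ≤ z.1 ∧ z.1 - g.x i ≤ z.2 - g.y j ∧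
      g.η * (z.2 - g.y (j + 1)) + (g.y (j + 1) - g.y j - g.η) * (z.1 - g.x i) ≤ 0}

lemma convex_thin (μ : Bool) (i j : ℤ) : Convex ℝ (g.thin μ i j) := by
  cases μ
  all_goals
    rintro z ⟨h1, h2, h3⟩ w ⟨h4, h5, h6⟩ a b ha hb hab
    obtain rfl : b = 1 - a := by linarith
    refine ⟨?_, ?_, ?_⟩ <;> simp only [fst_add, snd_add, smul_fst, smul_snd,
      smul_eq_mul] <;> nlinarith

lemma mem_thin (μ : Bool) (i j : ℤ) :
    g.sw i j ∈ g.thin μ i j ∧ g.far μ i j ∈ g.thin μ i j ∧ g.ne i j ∈ g.thin μ i j := by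
  have := g.η_pos
  have := g.x_lt i
  have := g.y_lt j
  cases μ <;> simp only [thin, sw, far, ne, if_true, Bool.false_eq_true, if_false] <;>
    refine ⟨⟨?_, ?_, ?_⟩, ⟨?_, ?_, ?_⟩, ?_, ?_, ?_⟩ <;> nlinarith

lemma thin_bounds (hz : z ∈ g.thin μ i j) : (g.x i ≤ z.1 ∧ z.1 ≤ g.x (i + 1)) ∧
    (g.y j ≤ z.2 ∧ z.2 ≤ g.y (j + 1)) ∧ if μ then z.2 ≤ g.y j + g.η else z.1 ≤ g.x i + g.η := by
  have := g.η_pos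
  have := g.x_lt i
  have := g.y_lt j
  cases μ <;> obtain ⟨h1, h2, h3⟩ := hz <;> simp only [↓reduceIte, reduceCtorEq] <;>
    refine ⟨⟨?_, ?_⟩, ⟨?_, ?_⟩, ?_⟩ <;> nlinarith

lemma injOn_thin (μ : Bool) (i j : ℤ) : InjOn proj (g.thin μ i j) := by
  refine injOn_proj_of_box (g.x i) (g.y j) fun z hz => ?_
  have h4 := g.x_mono (show i + 1 < i + g.M by linarith [g.three_le_M])
  have h5 := g.y_mono (show j + 1 < j + g.N by linarith [g.three_le_N])
  rw [g.x_add] at h4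
  rw [g.y_add] at h5
  obtain ⟨⟨a, b⟩, ⟨c, d⟩, -⟩ := thin_bounds hz
  refine ⟨?_, ?_, ?_, ?_⟩ <;> linarith

lemma eq_of_x_lt (h : g.x i < g.x (k + 1)) (h' : g.x k < g.x (i + 1)) : k = i := by
  have := g.lt_of_x h
  have := g.lt_of_x h'
  omega

lemma eq_of_y_lt (h : g.y j < g.y (l + 1)) (h' : g.y l < g.y (j + 1)) : l = j := by
  have := g.lt_of_y h
  have := g.lt_of_y h'
  omega

lemma thin_vtx (hz : g.vtx ν k l ∈ g.thin μ i j) :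
    g.vtx ν k l ∈ ({g.sw i j, g.far μ i j, g.ne i j} : Set Plane) := by
  have := g.η_pos
  have := g.x_lt i
  have := g.y_lt j
  have := g.x_lt k
  have := g.y_lt l
  obtain ⟨⟨a, b⟩, ⟨c, d⟩, e⟩ := thin_bounds hz
  cases ν <;> simp only [vtx, sw, ne] at a b c d e
  · have := g.x_mono.le_iff_le.1 a
    have := g.x_mono.le_iff_le.1 b
    have := g.y_mono.le_iff_le.1 c
    have := g.y_mono.le_iff_le.1 d
    obtain rfl | rfl : k = i ∨ k = i + 1 := by omega
    all_goals obtain rfl | rfl : l = j ∨ l = j + 1 := by omega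
    all_goals cases μ <;> simp only [↓reduceIte, reduceCtorEq] at e
    all_goals first | simp [vtx, far]; done | linarith
  · have := g.lt_of_x (i := i) (k := k + 1) (by linarith)
    have := g.lt_of_x (i := k) (k := i + 1) (by linarith)
    obtain rfl : k = i := g.eq_of_x_lt (by linarith) (by linarith)
    obtain rfl : l = j := g.eq_of_y_lt (by linarith) (by linarith)
    simp [vtx]

lemma thin_inSide (hz : z ∈ g.thin μ i j) (hs : g.InSide τ k l z) :
    k = i ∧ l = j ∧ (τ = .d ∨ τ = long μ) := by
  obtain ⟨⟨a, b⟩, ⟨c, d⟩, e⟩ := thin_bounds hz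
  obtain ⟨a', b', c', d'⟩ := hs.bounds
  obtain rfl : k = i := g.eq_of_x_lt (by linarith) (by linarith)
  obtain rfl : l = j := g.eq_of_y_lt (by linarith) (by linarith)
  refine ⟨rfl, rfl, ?_⟩
  cases μ <;> simp only [↓reduceIte, reduceCtorEq] at e <;> cases τ <;>
    simp only [long, reduceCtorEq, or_true, true_or, or_self]
  · linarith [hs.p.1]
  · linarith [hs.q.2.2.1]

lemma thin_inEdge (hz : z ∈ g.thin μ i j) (hs : g.InEdge μ' k l z) : k = i ∧ l = j ∧ μ' = μ := by
  have h3 := g.η_pos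
  have h1 := g.x_lt i
  have h2 := g.y_lt j
  obtain ⟨⟨a, b⟩, ⟨c, d⟩, e⟩ := thin_bounds hz
  cases μ' <;> obtain ⟨a', b', c'⟩ := hs
  · rw [a'] at a b
    have := g.x_mono.le_iff_le.1 a
    have := g.x_mono.le_iff_le.1 b
    obtain rfl : l = j := g.eq_of_y_lt (by linarith) (by linarith)
    obtain rfl | rfl : k = i ∨ k = i + 1 := by omega
    all_goals cases μ <;> simp only [↓reduceIte, reduceCtorEq] at e
    all_goals first | simp; done | (exfalso; linarith) | obtain ⟨e1, e2, e3⟩ := hz; rw [a'] at *; exfalso; nlinarith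
  · rw [a'] at c d
    have := g.y_mono.le_iff_le.1 c
    have := g.y_mono.le_iff_le.1 d
    obtain rfl : k = i := g.eq_of_x_lt (by linarith) (by linarith)
    obtain rfl | rfl : l = j ∨ l = j + 1 := by omega
    all_goals cases μ <;> simp only [↓reduceIte, reduceCtorEq] at e
    all_goals first | simp; done | (exfalso; linarith) | obtain ⟨e1, e2, e3⟩ := hz; rw [a'] at *; exfalso; nlinarith

/-- The intermediate curves between the grid and the trivalent graph. -/
structure IsMixed (g : Grid) (E : Set Edge) : Prop where
  mem : ∀ e ∈ E, (∃ τ k l b, e = g.oedge τ k l b) ∨ ∃ μ k l b, e = g.sqedge μ k l b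
  excl : ∀ μ k l b b', g.oedge (long μ) k l b ∈ E → g.sqedge μ k l b' ∉ E

lemma sqedge_rev_notMem (h : IsMulticurve E) (hb : g.sqedge μ i j b ∈ E) :
    g.sqedge μ i j (!b) ∉ E := by
  intro hb'
  have h3 := congrArg Prod.snd (h.eq_of_pt_eq hb hb' (s := 1 / 2) (t := 1 / 2) (by norm_num)
    (by norm_num) (by rw [sqedge_pt, sqedge_pt]; cases b <;> norm_num)).1
  have := g.x_mono (lt_add_one i)
  have := g.y_mono (lt_add_one j)
  cases b <;> cases μ <;> simp [sqedge, seg, far, sw] at h3 <;> linarith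

lemma IsMixed.exists_diagonal (hE : g.IsMixed E) (h : IsMulticurve E)
    (hμ : g.sqedge μ i j b ∈ E) (hne : proj (g.ne i j) ∈ support E) :
    ∃ b', g.oedge .d i j b' ∈ E := by
  obtain ⟨e, he, t, ht, hte⟩ := h.exists_Ico hne
  obtain ⟨τ, k, l, b', rfl⟩ := (hE.mem e he).resolve_right (by
    rintro ⟨μ', k, l, b', rfl⟩; exact sqedge_pt_ne (mem_Icc_of_mem_Ico ht) hte)
  obtain rfl : t = 0 := by
    by_contra h0
    exact oedge_interior_ne (ν := true) ⟨ht.1.lt_of_ne' h0, ht.2⟩ hte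
  rw [pt_zero] at hte
  obtain ⟨e', he', hf⟩ := h.exists_finish he
  rw [hte] at hf
  obtain ⟨τ', k', l', b'', rfl⟩ := (hE.mem e' he').resolve_right (by
    rintro ⟨μ', k, l, b', rfl⟩; exact sqedge_pt_ne (t := 1) (by norm_num) ((pt_one _).trans hf))
  rw [← rev_start, rev_oedge] at hf
  rw [eq_out_of_start (ν := true) hte] at he
  rw [← Bool.not_not b'', ← rev_oedge, eq_out_of_start (ν := true) hf] at he'
  have hx := fun b' => mt (hE.excl μ i j b' b) (not_not.2 hμ)
  cases τ <;> cases τ' <;> cases μ <;> simp only [out, rev_oedge, long] at he he' hx <;>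
    first | exact ⟨_, he⟩ | exact ⟨_, he'⟩ | exact (hx _ he).elim | exact (hx _ he').elim |
      exact (oedge_rev_notMem h he he').elim

/-- The edges of the grid. -/
def gridEdges (g : Grid) : Set Edge := {e | ∃ μ k l b, e = g.sqedge μ k l b}

lemma IsMixed.replace (hE : g.IsMixed E) (h : IsMulticurve E) (hμ : g.sqedge μ i j b ∈ E)
    (hF : F ⊆ E) (heF : g.sqedge μ i j b ∉ F) (hN : N ⊆ {g.oedge .d i j b, g.oedge (long μ) i j b}) :
    g.IsMixed (F ∪ N) ∧ ((F ∪ N) ∩ g.gridEdges).ncard < (E ∩ g.gridEdges).ncard := by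
  have hsq {μ' : Bool} {k l : ℤ} {b' : Bool} (h1 : g.sqedge μ' k l b' ∈ F ∪ N) :
      g.sqedge μ' k l b' ∈ F := by
    refine h1.resolve_right fun h1 => ?_
    rcases hN h1 with h2 | h2 <;> exact oedge_ne_sqedge h2.symm
  refine ⟨⟨?_, ?_⟩, ncard_inter_lt h.finite hμ ⟨_, _, _, _, rfl⟩ ?_⟩
  · rintro e (he | he)
    · exact hE.mem e (hF he)
    · rcases hN he with rfl | rfl <;> exact Or.inl ⟨_, _, _, _, rfl⟩
  · intro ν k l b₁ b₂ h1 h2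
    have h2' := hsq h2
    rcases h1 with h1 | h1
    · exact hE.excl ν k l b₁ b₂ (hF h1) (hF h2')
    rcases hN h1 with h3 | h3
    · have := (oedge_inj h3).1
      cases ν <;> simp [long] at this
    · obtain ⟨h4, ⟨m, n, h5, h6⟩, -⟩ := oedge_inj (Set.mem_singleton_iff.1 h3).symm
      obtain rfl : ν = μ := by cases ν <;> cases μ <;> simp_all [long]
      rw [h5, h6, sqedge_add] at h2'
      rcases Bool.eq_or_eq_not b₂ b with rfl | rfl
      exacts [heF h2', sqedge_rev_notMem h hμ (hF h2')]
  · rintro f hf ⟨μ', k, l, b', rfl⟩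
    exact ⟨hF (hsq hf), fun h' => heF (h' ▸ hsq hf)⟩

lemma IsMixed.touches (hE : g.IsMixed E) (h : IsMulticurve E) (hμ : g.sqedge μ i j b ∈ E)
    (hF : F ⊆ E) (heF : g.sqedge μ i j b ∉ F) (hd : ∀ b', g.oedge .d i j b' ∉ F) :
    Touches F (g.thin μ i j) {g.sw i j, g.far μ i j, g.ne i j} := by
  rintro z hz ⟨e, he, t, ht, hzt⟩
  rcases hE.mem e (hF he) with ⟨τ, k, l, b', rfl⟩ | ⟨μ', k, l, b', rfl⟩
  · rcases oedge_pt_cases ht hzt with ⟨ν, k, l, rfl⟩ | ⟨m, n, hs⟩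
    · exact thin_vtx hz
    rw [← g.oedge_add τ k l m n] at he
    obtain ⟨h1, h2, rfl | rfl⟩ := thin_inSide hz hs <;> rw [h1, h2] at he
    exacts [(hd _ he).elim, (hE.excl μ i j b' b (hF he) hμ).elim]
  · rcases sqedge_pt_cases ht hzt with ⟨k, l, rfl⟩ | ⟨m, n, hs⟩
    · exact thin_vtx hz
    rw [← g.sqedge_add μ' k l m n] at he
    obtain ⟨h1, h2, rfl⟩ := thin_inEdge hz hs
    rw [h1, h2] at he
    rcases Bool.eq_or_eq_not b' b with rfl | rfl
    exacts [(heF he).elim, (sqedge_rev_notMem h hμ (hF he)).elim]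

lemma det_thin (μ : Bool) (i j : ℤ) :
    det (g.far μ i j - g.sw i j) (g.ne i j - g.sw i j) ≠ 0 := by
  have := mul_pos g.η_pos (show 0 < g.x (i + 1) - g.x i by linarith [g.x_lt i, g.η_pos])
  have := mul_pos g.η_pos (show 0 < g.y (j + 1) - g.y j by linarith [g.y_lt j, g.η_pos])
  cases μ <;> simp only [far, sw, ne, det, fst_sub, snd_sub] <;> grind

lemma IsMixed.step (hα : g.IsMixed α.edges)
    (hμ : g.sqedge μ i j b ∈ α.edges) : ∃ β : Multicurve, g.IsMixed β.edges ∧ Isotopic α β ∧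
      (β.edges ∩ g.gridEdges).ncard < (α.edges ∩ g.gridEdges).ncard := by
  have hm := α.isMulticurve
  obtain ⟨m1, m2, m3⟩ := g.mem_thin μ i j
  have hdet := g.det_thin μ i j
  have hgap {F : Set Edge} {a c v : Plane} (h : Touches F (g.thin μ i j) {v, a, c})
      (hv : proj v ∉ support F) (ha : a ∈ g.thin μ i j) (hc : c ∈ g.thin μ i j)
      (hd : det (c - a) (v - a) ≠ 0) : GapDisc F (g.thin μ i j) a c := by
    refine ⟨convex_thin μ i j, injOn_thin μ i j, ha, hc, fun h => hd (by simp [h, det]), ?_⟩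
    rintro _ ⟨hzF, z, hz, rfl⟩
    rcases h z hz hzF with rfl | rfl | rfl
    exacts [(hv hzF).elim, .inl rfl, .inr rfl]
  by_cases hne : proj (g.ne i j) ∈ support α.edges
  · obtain ⟨b', hb'⟩ := hα.exists_diagonal hm hμ hne
    obtain rfl : b' = !b := by
      rcases Bool.eq_or_eq_not b' b with rfl | rfl
      · cases b'
        · exact (oedge_ne_sqedge (hm.finish_injOn hb' hμ (by
            simp [oedge, tail, sqedge, seg_finish]))).elim
        · exact (oedge_ne_sqedge (hm.start_injOn hb' hμ (by
            simp [oedge, tail, sqedge, seg_start]))).elim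
      · rfl
    set F := α.edges \ {g.sqedge μ i j b, g.oedge .d i j !b} with hFdef
    have hF : F ⊆ α.edges := sdiff_subset
    have heF : g.sqedge μ i j b ∉ F := by simp [F]
    have hdF : ∀ b', g.oedge .d i j b' ∉ F := by
      intro b' hb''
      rcases Bool.eq_or_eq_not b' b with rfl | rfl
      · exact oedge_rev_notMem hm (hF hb'') hb'
      · simp [F] at hb''
    have hsw : proj (g.sw i j) ∉ support F := by
      cases b
      · exact hm.vertex_notMem_support hF hμ hb' heF (hdF _) (by
          simp [sqedge, oedge, seg_start, seg_finish, tail])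
      · exact hm.vertex_notMem_support hF hb' hμ (hdF _) heF (by
          simp [sqedge, oedge, seg_start, seg_finish, tail])
    have ht := hα.touches hm hμ hF heF hdF
    obtain ⟨β, hβ, hiso⟩ : ∃ β : Multicurve, β.edges = F ∪ {g.oedge (long μ) i j b} ∧
        Isotopic α β := by
      cases b <;> simp only [oedge, head_long, tail_long]
      · refine (hgap ht hsw m2 m3 ?_).exists_pull m1 ?_ (sdiff_union_pair hμ hb') <;>
          simp only [det, fst_sub, snd_sub] at hdet ⊢ <;> grind
      · refine (hgap (pair_comm _ _ ▸ ht) hsw m3 m2 ?_).exists_pull m1 ?_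
          (by rw [pair_comm]; exact sdiff_union_pair hμ hb') <;>
          simp only [det, fst_sub, snd_sub] at hdet ⊢ <;> grind
    obtain ⟨h1, h2⟩ := hα.replace hm hμ hF heF (N := {g.oedge (long μ) i j b}) (by simp)
    exact ⟨β, hβ ▸ h1, hiso, hβ ▸ h2⟩
  · have hF : α.edges \ {g.sqedge μ i j b} ⊆ α.edges := sdiff_subset
    have heF : g.sqedge μ i j b ∉ α.edges \ {g.sqedge μ i j b} := by simp
    have ht := hα.touches hm hμ hF heF fun b' hb' => hne (by
      cases b'
      · exact ⟨_, hF hb', 0, by norm_num, by simp [oedge, pt_zero, seg_start, head]⟩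
      · exact ⟨_, hF hb', 1, by norm_num, by simp [oedge, pt_one, seg_finish, head]⟩)
    have hv := fun h => hne (support_mono hF h)
    obtain ⟨β, hβ, hiso⟩ : ∃ β : Multicurve, β.edges =
        α.edges \ {g.sqedge μ i j b} ∪ {g.oedge .d i j b, g.oedge (long μ) i j b} ∧
        Isotopic α β := by
      cases b <;> simp only [oedge, head_long, tail_long]
      · rw [pair_comm]
        refine (hgap (fun z hz h => ?_) hv m2 m1 ?_).exists_push m3 ?_ (sdiff_union_singleton hμ)
        · have := ht z hz h; simp at this ⊢; tauto
        all_goals simp only [det, fst_sub, snd_sub] at hdet ⊢; grind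
      · refine (hgap (fun z hz h => ?_) hv m1 m2 ?_).exists_push m3 ?_ (sdiff_union_singleton hμ)
        · have := ht z hz h; simp at this ⊢; tauto
        all_goals simp only [det, head, fst_sub, snd_sub] at hdet ⊢; grind
    obtain ⟨h1, h2⟩ := hα.replace hm hμ hF heF le_rfl
    exact ⟨β, hβ ▸ h1, hiso, hβ ▸ h2⟩

/-- Every curve in the grid is isotopic to a curve in the trivalent graph. -/
lemma exists_isotopic_trivalent
    (hα : ∀ e ∈ α.edges, ∃ μ k l b, e = g.sqedge μ k l b) :
    ∃ β : Multicurve, Isotopic α β ∧ ∀ e ∈ β.edges, ∃ τ k l b, e = g.oedge τ k l b := by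
  have h0 : g.IsMixed α.edges := by
    refine ⟨fun e he => Or.inr (hα e he), fun μ k l b b' h _ => ?_⟩
    obtain ⟨μ', k', l', b', h'⟩ := hα _ h
    exact oedge_ne_sqedge h'
  obtain ⟨β, hβ, hiso, hbad⟩ := exists_isotopic_of_step (P := fun α => g.IsMixed α.edges)
    (bad := g.gridEdges) (fun α hα e he hb => by
      obtain ⟨μ, k, l, b, rfl⟩ := hb
      exact hα.step he) α h0
  exact ⟨β, hiso, fun e he => (hβ.mem e he).resolve_right (hbad e he)⟩

end Grid

lemma sub_pt (e : Edge) (s t r : ℝ) :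
    Edge.pt (e.pt s, (t - s) • e.2) r = e.pt (s + r * (t - s)) := by
  simp only [Edge.pt, smul_smul, add_assoc, ← proj_add, ← add_smul]

lemma sub_start (e : Edge) (s t : ℝ) : Edge.start (e.pt s, (t - s) • e.2) = e.pt s := rfl

lemma sub_finish (e : Edge) (s t : ℝ) : Edge.finish (e.pt s, (t - s) • e.2) = e.pt t := by
  rw [← pt_one, sub_pt]; congr 1; ring

/-- The two parts of an edge cut at time `s`. -/
def cut (e : Edge) (s : ℝ) : Set Edge := {(e.1, s • e.2), (e.pt s, (1 - s) • e.2)}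

lemma mem_cut : f ∈ cut e s ↔
    f = (e.pt 0, (s - 0) • e.2) ∨ f = (e.pt s, (1 - s) • e.2) := by
  simp only [cut, mem_insert_iff, mem_singleton_iff, sub_zero, pt_zero, Edge.start]

lemma support_cut (hs : s ∈ Ioo₀₁) :
    support (cut e s) = support {e} := by
  obtain ⟨h0, h1⟩ := hs
  ext z
  constructor
  · rintro ⟨f, hf, t, ⟨ht0, ht1⟩, rfl⟩
    rcases mem_cut.1 hf with rfl | rfl
    · rw [sub_pt]
      exact ⟨e, rfl, _, ⟨by nlinarith, by nlinarith⟩, rfl⟩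
    · rw [sub_pt]
      exact ⟨e, rfl, _, ⟨by nlinarith, by nlinarith⟩, rfl⟩
  · rintro ⟨f, rfl, t, ⟨ht0, ht1⟩, rfl⟩
    rcases le_or_gt t s with h | h
    · refine ⟨_, mem_cut.2 (.inl rfl), t / s, ⟨by positivity, by rwa [div_le_one h0]⟩, ?_⟩
      rw [sub_pt]; congr 1; field_simp; ring
    · refine ⟨_, mem_cut.2 (.inr rfl), (t - s) / (1 - s), ⟨div_nonneg (by linarith) (by linarith),
        by rw [div_le_one (by linarith)]; linarith⟩, ?_⟩
      rw [sub_pt]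
      congr 1
      have : 1 - s ≠ 0 := by linarith
      field_simp
      ring

lemma IsMulticurve.cut (h : IsMulticurve (F ∪ {e})) (heF : e ∉ F) (hs : s ∈ Ioo₀₁) : IsMulticurve (F ∪ cut e s) := by
  obtain ⟨h0, h1⟩ := hs
  have heE : e ∈ F ∪ {e} := by simp
  have key {f : Edge} (hf : f ∈ OrientedSkein.cut e s) {t : ℝ} (ht : t ∈ Ico₀₁) :
      ∃ r ∈ Ico₀₁, f.pt t = e.pt r ∧
        ((f = (e.pt 0, (s - 0) • e.2) ∧ r < s ∧ r = t * s) ∨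
          (f = (e.pt s, (1 - s) • e.2) ∧ s ≤ r ∧ r = s + t * (1 - s))) := by
    obtain ⟨ht0, ht1⟩ := ht
    rcases mem_cut.1 hf with rfl | rfl
    · refine ⟨t * s, ⟨by positivity, by nlinarith⟩, ?_, Or.inl ⟨rfl, by nlinarith, rfl⟩⟩
      rw [sub_pt]; congr 1; ring
    · exact ⟨_, ⟨by nlinarith, by nlinarith⟩, sub_pt _ _ _ _, Or.inr ⟨rfl, by nlinarith, rfl⟩⟩
  refine h.replace ?_ ?_ ?_ ?_
  · exact (finite_singleton _).insert _
  · have h2 := h.closed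
    rw [image_union, image_union, image_singleton, image_singleton] at h2
    rw [image_union, image_union, OrientedSkein.cut, image_pair, image_pair]
    have e1 : Edge.finish (e.1, s • e.2) = e.pt s := rfl
    have e2 : Edge.finish (e.pt s, (1 - s) • e.2) = e.finish := by rw [sub_finish, pt_one]
    have e3 : Edge.start (e.1, s • e.2) = e.start := rfl
    have e4 : Edge.start (e.pt s, (1 - s) • e.2) = e.pt s := rfl
    rw [e1, e2, e3, e4, pair_comm, Set.insert_eq, Set.insert_eq, ← union_assoc,
      ← union_assoc, h2]
  · rintro ⟨f, t⟩ ⟨hf, ht⟩ ⟨f', t'⟩ ⟨hf', ht'⟩ hff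
    simp only at hf ht hf' ht' hff
    obtain ⟨r, hr, e1, c1⟩ := key hf ht
    obtain ⟨r', hr', e2, c2⟩ := key hf' ht'
    have := (h.eq_of_pt_eq heE heE hr hr' (by rw [← e1, ← e2, hff])).2
    subst this
    have hs1 : 1 - s ≠ 0 := by linarith
    rcases c1 with ⟨rfl, a1, a2⟩ | ⟨rfl, a1, a2⟩ <;> rcases c2 with ⟨rfl, b1, b2⟩ | ⟨rfl, b1, b2⟩
    · rw [Prod.mk.injEq]
      exact ⟨rfl, mul_right_cancel₀ h0.ne' (a2.symm.trans b2)⟩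
    · linarith
    · linarith
    · rw [Prod.mk.injEq]
      exact ⟨rfl, mul_right_cancel₀ hs1 (by linarith)⟩
  · intro f hf t ht f' hf' t' ht' hff
    obtain ⟨r, hr, e1, -⟩ := key hf ht
    exact heF ((h.eq_of_pt_eq heE (.inl hf') hr ht' (by rw [← e1, hff])).1 ▸ hf')

lemma IsMulticurve.cut_notMem (h : IsMulticurve (F ∪ {e})) (heF : e ∉ F) (hs : s ∈ Ioo₀₁) :
    (e.1, s • e.2) ∉ F ∧ (e.pt s, (1 - s) • e.2) ∉ F := by
  constructor
  · intro hF
    exact heF (h.start_injOn (.inl hF) (.inr rfl) (show _ = e.start from rfl) ▸ hF)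
  · intro hF
    have := (h.eq_of_pt_eq (f := e) (.inl hF) (.inr rfl) zero_mem_Ico ⟨hs.1.le, hs.2⟩
      (pt_zero _)).1
    exact heF (this ▸ hF)

/-- `f` is a part of `e`. -/
def IsPart (f e : Edge) : Prop :=
  ∃ s t : ℝ, 0 ≤ s ∧ s < t ∧ t ≤ 1 ∧ f = (e.pt s, (t - s) • e.2)

lemma IsPart.refl (e : Edge) : IsPart e e :=
  ⟨0, 1, le_rfl, zero_lt_one, le_rfl, by rw [pt_zero]; simp [Edge.start]⟩

lemma IsPart.trans {d : Edge} (h : IsPart f e) (h' : IsPart e d) : IsPart f d := by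
  obtain ⟨s, t, h0, hst, h1, rfl⟩ := h
  obtain ⟨s', t', h0', hst', h1', rfl⟩ := h'
  refine ⟨s' + s * (t' - s'), s' + t * (t' - s'), by nlinarith, by nlinarith, by nlinarith, ?_⟩
  rw [sub_pt, smul_smul]
  congr 2; ring

lemma isPart_of_mem_cut (hs : s ∈ Ioo₀₁) (hf : f ∈ cut e s) :
    IsPart f e := by
  rcases mem_cut.1 hf with rfl | rfl
  · exact ⟨0, s, le_rfl, hs.1, hs.2.le, rfl⟩
  · exact ⟨s, 1, hs.1.le, hs.2, le_rfl, rfl⟩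

/-- Cutting an edge of a curve. -/
lemma exists_cut (α : Multicurve) (he : e ∈ α.edges)
    (hs : s ∈ Ioo₀₁) :
    ∃ β : Multicurve, β.edges = α.edges \ {e} ∪ cut e s ∧ SubdivisionStep α.edges β.edges := by
  have hα := α.isMulticurve
  rw [sdiff_union_singleton he] at hα
  have heF : e ∉ α.edges \ {e} := by simp
  refine ⟨⟨_, hα.cut heF hs⟩, rfl, ?_⟩
  obtain ⟨n1, n2⟩ := hα.cut_notMem heF hs
  exact ⟨α.edges \ {e}, e, s, hs.1, hs.2, heF, n1, n2, sdiff_union_singleton he, rfl⟩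

/-- A curve can be subdivided at any finite set of points. -/
lemma exists_subdivision (α : Multicurve) {V : Set Torus} (hV : V.Finite) :
    ∃ β : Multicurve, Subdivision α.edges β.edges ∧ Isotopic α β ∧
      support β.edges = support α.edges ∧
      (∀ v ∈ V, v ∈ support α.edges → ∃ f ∈ β.edges, f.start = v) ∧
      (∀ f ∈ β.edges, ∃ e ∈ α.edges, IsPart f e) ∧
      ∀ f ∈ β.edges, f.start ∈ V ∨ ∃ e ∈ α.edges, f.start = e.start := by
  induction V, hV using Set.Finite.induction_on with
  | empty =>
    exact ⟨α, .refl, .refl α, rfl, by simp, fun f hf => ⟨f, hf, .refl f⟩,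
      fun f hf => Or.inr ⟨f, hf, rfl⟩⟩
  | @insert v V _ _ ih =>
    obtain ⟨β, h1, h2, h3, h4, h5, h7⟩ := ih
    by_cases hv : v ∈ support α.edges ∧ ∀ f ∈ β.edges, f.start ≠ v
    · obtain ⟨hv, hvs⟩ := hv
      rw [← h3] at hv
      obtain ⟨e, he, s, hs, rfl⟩ := β.isMulticurve.exists_Ico hv
      have hs' : s ∈ Ioo₀₁ := by
        refine ⟨hs.1.lt_of_ne ?_, hs.2⟩
        rintro rfl
        exact hvs e he (pt_zero e).symm
      obtain ⟨γ, hγ, hβγ⟩ := exists_cut β he hs'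
      refine ⟨γ, h1.tail hβγ, h2.trans (Relation.EqvGen.rel _ _ (.inl hβγ)), ?_, ?_, ?_, ?_⟩
      · rw [← h3, hγ, support_union, support_cut hs', ← support_union,
          ← sdiff_union_singleton he]
      · rw [hγ]
        rintro w (rfl | hw) hwα
        · exact ⟨(e.pt s, (1 - s) • e.2), by simp [cut], rfl⟩
        · obtain ⟨f, hf, rfl⟩ := h4 w hw hwα
          by_cases hfe : f = e
          · exact ⟨(e.1, s • e.2), by simp [cut], hfe ▸ rfl⟩
          · exact ⟨f, Or.inl ⟨hf, hfe⟩, rfl⟩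
      · rw [hγ]
        rintro f (hf | hf)
        · exact h5 f hf.1
        · obtain ⟨d, hd, hed⟩ := h5 e he
          exact ⟨d, hd, (isPart_of_mem_cut hs' hf).trans hed⟩
      · rw [hγ]
        rintro f (hf | rfl | rfl)
        exacts [(h7 f hf.1).imp_left Or.inr, (h7 e he).imp_left Or.inr, Or.inl (.inl rfl)]
    · push Not at hv
      refine ⟨β, h1, h2, h3, ?_, h5, fun f hf => (h7 f hf).imp_left Or.inr⟩
      rintro w (rfl | hw) hwα
      exacts [hv hwα, h4 w hw hwα]

/-- All edges are short. -/
def IsShort (E : Set Edge) : Prop := ∀ e ∈ E, ‖e.2‖ < 1 / 4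

/-- Every curve is isotopic to a curve with short edges. -/
lemma exists_isotopic_short (α : Multicurve) : ∃ β : Multicurve, Isotopic α β ∧ IsShort β.edges := by
  obtain ⟨n, hn⟩ : ∃ n : ℕ, ∀ e ∈ α.edges, ‖e.2‖ < n / 4 := by
    obtain ⟨C, hC⟩ := (α.isMulticurve.finite.image fun e => ‖e.2‖).bddAbove
    obtain ⟨n, hn⟩ := exists_nat_gt (4 * C)
    exact ⟨n, fun e he => by linarith [hC ⟨e, he, rfl⟩]⟩
  obtain ⟨β, -, hiso, hsupp, hstart, hpart, -⟩ := exists_subdivision α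
    (V := ⋃ e ∈ α.edges, (fun k : ℕ => e.pt (k / n)) '' (Set.Iio n))
    (α.isMulticurve.finite.biUnion fun e _ => (Set.finite_Iio n).image _)
  refine ⟨β, hiso, fun f hf => ?_⟩
  obtain ⟨e, he, s, t, h0, hst, h1, rfl⟩ := hpart f hf
  have b1 := hn e he
  have hn0 : (0 : ℝ) < n := by linarith [norm_nonneg e.2]
  have hts : 0 < t - s := sub_pos.2 hst
  rw [norm_smul, norm_of_nonneg hts.le]
  suffices hlen : (t - s) * n ≤ 1 by nlinarith
  by_contra! hlen
  set k := ⌊s * n⌋₊ + 1 with hk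
  have hk1 : s * n < k := by rw [hk]; exact_mod_cast Nat.lt_floor_add_one (s * n)
  have hk2 : (k : ℝ) ≤ s * n + 1 := by
    rw [hk]; push_cast; linarith [Nat.floor_le (show 0 ≤ s * n by positivity)]
  have hkn : k < n := by exact_mod_cast (show (k : ℝ) < n by nlinarith)
  have hs' : s < k / n := by rwa [lt_div_iff₀ hn0]
  have ht' : (k : ℝ) / n < t := by rw [div_lt_iff₀ hn0]; linarith
  obtain ⟨f, hf', hfs⟩ := hstart (e.pt (k / n))
    (Set.mem_iUnion₂.2 ⟨e, he, k, hkn, rfl⟩) (pt_mem_support he ⟨by linarith, by linarith⟩)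
  have h3 : 0 < ((k : ℝ) / n - s) / (t - s) := div_pos (by linarith) hts
  rw [← pt_zero] at hfs
  refine h3.ne (β.isMulticurve.eq_of_pt_eq hf' hf zero_mem_Ico
    ⟨h3.le, by rw [div_lt_one hts]; linarith⟩ ?_).2
  rw [hfs, sub_pt, div_mul_cancel₀ _ hts.ne']; congr 1; ring

/-- The linear forms represented by `u` and `w` are the basis dual to `X` and `Y`. -/
structure IsDual (X Y u w : Plane) : Prop where
  uX : det u X = 1
  uY : det u Y = 0
  wX : det w X = 0
  wY : det w Y = 1
  ne : det X Y ≠ 0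
  eq : ∀ z, z = det u z • X + det w z • Y

/-- Replacing a segment by a staircase inside an embedded disc. -/
lemma GapDisc.exists_stairs {X Y : Plane} (hd : IsDual X Y u w) (n : ℕ) :
    ∀ {F : Set Edge} {K : Set Plane} {a : Plane}, GapDisc F K a (a + ((n : ℝ) + 1) • (X + Y)) →
      (∀ k : ℕ, k ≤ n → a + (k : ℝ) • (X + Y) ∈ K ∧ a + (k : ℝ) • (X + Y) + X ∈ K) →
      ∀ {α : Multicurve}, α.edges = F ∪ {seg a (a + ((n : ℝ) + 1) • (X + Y))} →
      ∃ (β : Multicurve) (G : Set Edge), β.edges = F ∪ G ∧ Isotopic α β ∧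
        ∀ e ∈ G, e.2 = X ∨ e.2 = Y := by
  induction n with
  | zero =>
    intro F K a h hK α hα
    obtain ⟨β, hβ, hiso⟩ := h.exists_push (c := a + X) (by simpa using (hK 0 le_rfl).2)
      (by simp [det_add_left, det_self, det_comm Y, hd.ne]) hα
    exact ⟨β, _, hβ, hiso, by rintro e (rfl | rfl) <;> simp [seg]⟩
  | succ n ih =>
    intro F K a h hK α hα
    have hc : a + X ∈ K := by simpa using (hK 0 (by omega)).2
    have hd' : a + (X + Y) ∈ K := by simpa using (hK 1 (by omega)).1
    set b := a + (((n + 1 : ℕ) : ℝ) + 1) • (X + Y) with hb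
    have hb' : b = a + (X + Y) + ((n : ℝ) + 1) • (X + Y) := by rw [hb]; push_cast; module
    have hn : (0 : ℝ) ≤ n := Nat.cast_nonneg n
    have ub : det u b = det u a + (n + 2) := by rw [hb']; simp [det_add_right, det_smul_right, hd.uX, hd.uY]; ring
    have wb : det w b = det w a + (n + 2) := by rw [hb']; simp [det_add_right, det_smul_right, hd.wX, hd.wY]; ring
    have uc : det u (a + X) = det u a + 1 := by simp [det_add_right, hd.uX]
    have wc : det w (a + X) = det w a := by simp [det_add_right, hd.wX]
    have ue : det u (a + (X + Y)) = det u a + 1 := by simp [det_add_right, hd.uX, hd.uY]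
    have we : det w (a + (X + Y)) = det w a + 1 := by simp [det_add_right, hd.wX, hd.wY]
    obtain ⟨γ, hγ, hiso⟩ := h.exists_push₂ (u := u) hc hd' (by linarith) (by linarith) (by linarith)
      (by
        rw [hb]
        simp only [add_sub_cancel_left, det_smul_left, det_add_left, det_self, zero_add, det_comm Y]
        exact mul_ne_zero (by positivity) (neg_ne_zero.2 hd.ne))
      (by
        rw [show b - (a + X) = ((n : ℝ) + 1) • X + ((n : ℝ) + 2) • Y by rw [hb']; module,
          show a + (X + Y) - (a + X) = Y by module, det_add_left, det_smul_left, det_smul_left,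
          det_self, mul_zero, add_zero]
        exact mul_ne_zero (by positivity) hd.ne) hα
    have h2 := (h.restrict (u := u) hc (by linarith) (by linarith)
      (fun h => by rw [h] at wc; linarith)).restrict (c := a + (X + Y)) (u := w) ⟨hd', by simp [uc, ue]⟩
      (by linarith) (by linarith) (fun h => by rw [h] at we; linarith)
    rw [hb'] at h2
    obtain ⟨δ, G, hδ, hiso', hG⟩ := ih h2 (fun k hk => by
      have := hK (k + 1) (by omega)
      rw [show a + ((k + 1 : ℕ) : ℝ) • (X + Y) = a + (X + Y) + (k : ℝ) • (X + Y) by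
        push_cast; module] at this
      have hk0 : (0 : ℝ) ≤ k := Nat.cast_nonneg k
      refine ⟨⟨⟨this.1, ?_⟩, ?_⟩, ⟨⟨this.2, ?_⟩, ?_⟩⟩ <;>
        simp only [mem_ofPred_eq, det_add_right, det_smul_right, hd.uX, hd.uY, hd.wX, hd.wY] <;>
        linarith)
      (α := γ) (by rw [hγ, hb']; ext e; simp; tauto)
    refine ⟨δ, {seg a (a + X), seg (a + X) (a + (X + Y))} ∪ G, ?_, hiso.trans hiso', ?_⟩
    · rw [hδ]; ext; simp; tauto
    · rintro e ((rfl | rfl) | he)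
      exacts [by simp [seg], by simp [seg], hG e he]

lemma eq_of_proj_eq_of_norm_lt {z z' : Plane} (h : proj z = proj z') (hn : ‖z' - z‖ < 1) :
    z = z' := by
  obtain ⟨⟨k, l⟩, rfl⟩ := (proj_eq_iff _ _).1 h
  simp only [add_sub_cancel_left, lat, Prod.norm_def, sup_lt_iff, Real.norm_eq_abs] at hn
  have h1 : k = 0 := Int.abs_lt_one_iff.1 (by exact_mod_cast hn.1)
  have h2 : l = 0 := Int.abs_lt_one_iff.1 (by exact_mod_cast hn.2)
  simp [h1, h2, lat]

/-- Two edges of a curve meet only in endpoints. -/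
lemma IsMulticurve.pt_eq_cases (h : IsMulticurve E) {d : Edge} (hd : d ∈ E)
    (he : e ∈ E) (hde : d ≠ e) (ht : t ∈ Icc₀₁) (hs : s ∈ Icc₀₁)
    (hst : d.pt t = e.pt s) : d.finish = e.start ∧ s = 0 ∨ d.start = e.finish ∧ s = 1 := by
  have key {d e : Edge} (hd : d ∈ E) (he : e ∈ E) (hde : d ≠ e) {s t : ℝ} (ht : t ∈ Icc₀₁)
      (hs : s ∈ Icc₀₁) (hst : d.pt t = e.pt s) (h1 : t = 1) : s = 0 := by
    subst h1
    rw [pt_one] at hst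
    by_contra hs0
    obtain ⟨d', hd', h'⟩ := h.exists_start hd
    rcases hs.2.eq_or_lt with rfl | hs1
    · exact hde (h.finish_injOn hd he (hst.trans (pt_one e)))
    · exact hs0 (h.eq_of_pt_eq hd' he zero_mem_Ico ⟨hs.1, hs1⟩ (by rw [pt_zero, h', hst])).2.symm
  rcases ht.2.eq_or_lt with rfl | h1
  · obtain rfl := key hd he hde ht hs hst rfl
    exact Or.inl ⟨by rw [← pt_one, hst, pt_zero], rfl⟩
  · rcases hs.2.eq_or_lt with rfl | h2
    · obtain rfl := key he hd hde.symm hs ht hst.symm rfl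
      exact Or.inr ⟨by rw [← pt_zero, hst, pt_one], rfl⟩
    · exact (hde (h.eq_of_pt_eq hd he ⟨ht.1, h1⟩ ⟨hs.1, h2⟩ hst).1).elim

/-- `z` points into the closed cone spanned by `X` and `X + Y`. -/
def InCone (X Y z : Plane) : Prop := ∃ p q : ℝ, 0 ≤ q ∧ q ≤ p ∧ z = p • X + q • Y

/-- A segment that is not entered from the sides of the right triangle at its ends can be replaced
by a staircase. -/
lemma exists_stairs {X Y : Plane} (hd : IsDual X Y u w)
    (hbox : ∀ p ∈ Icc₀₁, ∀ q ∈ Icc₀₁, ‖p • X + q • Y‖ < 1 / 4) (hα : α.edges = F ∪ {seg a (a + (X + Y))}) (heF : seg a (a + (X + Y)) ∉ F)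
    (hshort : IsShort F) (hleft : ∀ f ∈ F, f.finish = proj a → ¬ InCone X Y (-f.2))
    (hright : ∀ f ∈ F, f.start = proj (a + (X + Y)) → ¬ InCone Y X (-f.2)) :
    ∃ (β : Multicurve) (G : Set Edge), β.edges = F ∪ G ∧ Isotopic α β ∧
      ∃ r : ℝ, 0 < r ∧ r ≤ 1 ∧ ∀ e ∈ G, e.2 = r • X ∨ e.2 = r • Y := by
  have hm := α.isMulticurve
  rw [hα] at hm
  set T : Set Plane :=
    {z | 0 ≤ det w (z - a) ∧ det w (z - a) ≤ det u (z - a) ∧ det u (z - a) ≤ 1} with hTdef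
  have hTmem (p q : ℝ) : a + (p • X + q • Y) ∈ T ↔ 0 ≤ q ∧ q ≤ p ∧ p ≤ 1 := by
    simp [hTdef, det_add_right, det_smul_right, hd.uX, hd.uY, hd.wX, hd.wY]
  have hT {z : Plane} (hz : z ∈ T) : ∃ p q : ℝ, 0 ≤ q ∧ q ≤ p ∧ p ≤ 1 ∧ z = a + (p • X + q • Y) :=
    ⟨_, _, hz.1, hz.2.1, hz.2.2, by rw [← hd.eq, add_sub_cancel]⟩
  have hball {z : Plane} (hz : z ∈ T) : ‖z - a‖ < 1 / 4 ∧ ‖z - (a + (X + Y))‖ < 1 / 4 := by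
    obtain ⟨p, q, h0, h1, h2, rfl⟩ := hT hz
    refine ⟨by simpa using hbox p ⟨by linarith, h2⟩ q ⟨h0, by linarith⟩, ?_⟩
    rw [show a + (p • X + q • Y) - (a + (X + Y)) = -((1 - p) • X + (1 - q) • Y) by module, norm_neg]
    exact hbox _ ⟨by linarith, by linarith⟩ _ ⟨by linarith, by linarith⟩
  have hinj : InjOn proj T := fun z hz z' hz' h => eq_of_proj_eq_of_norm_lt h (by
    have := norm_sub_le (z' - a) (z - a)
    rw [sub_sub_sub_cancel_right] at this
    linarith [(hball hz).1, (hball hz').1])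
  have hsmall {f : Edge} (hf : f ∈ F) {t : ℝ} (ht : t ∈ Icc₀₁) : ‖t • f.2‖ < 1 / 4 := by
    rw [norm_smul, norm_of_nonneg ht.1]
    nlinarith [hshort f hf, ht.2, norm_nonneg f.2]
  have hfin {z : Plane} (hz : z ∈ T) {f : Edge} (hf : f ∈ F) (hfa : f.finish = proj a) {t : ℝ}
      (ht : t ∈ Icc₀₁) (hzt : f.pt t = proj z) : z = a := by
    have hzt' : z = a + (1 - t) • -f.2 := by
      refine eq_of_proj_eq_of_norm_lt ?_ ?_
      · rw [← hzt, Edge.pt, proj_add, ← hfa, Edge.finish, add_assoc, ← proj_add]; congr 2; module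
      · rw [add_sub_right_comm, smul_neg]
        have := norm_sub_le (a - z) ((1 - t) • f.2)
        have := hsmall hf (t := 1 - t) ⟨by linarith [ht.2], by linarith [ht.1]⟩
        rw [← sub_eq_add_neg]
        linarith [norm_sub_rev a z, (hball hz).1]
    rcases ht.2.eq_or_lt with rfl | h1
    · simpa using hzt'
    obtain ⟨p, q, h2, h3, h4, rfl⟩ := hT hz
    refine (hleft f hf hfa ⟨(1 - t)⁻¹ * p, (1 - t)⁻¹ * q, ?_, ?_, ?_⟩).elim
    · have := sub_pos.2 h1; positivity
    · have := inv_pos.2 (sub_pos.2 h1); gcongr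
    · rw [mul_smul, mul_smul, ← smul_add, add_left_cancel hzt', smul_smul,
        inv_mul_cancel₀ (sub_pos.2 h1).ne', one_smul]
  have hstart {z : Plane} (hz : z ∈ T) {f : Edge} (hf : f ∈ F) (hfa : f.start = proj (a + (X + Y)))
      {t : ℝ} (ht : t ∈ Icc₀₁) (hzt : f.pt t = proj z) : z = a + (X + Y) := by
    have hzt' : z = a + (X + Y) + t • f.2 := by
      refine eq_of_proj_eq_of_norm_lt ?_ ?_
      · rw [← hzt, Edge.pt, proj_add _ (t • f.2), ← hfa]; rfl
      · rw [add_sub_right_comm]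
        have := norm_add_le (a + (X + Y) - z) (t • f.2)
        linarith [norm_sub_rev (a + (X + Y)) z, (hball hz).2, hsmall hf ht]
    rcases ht.1.eq_or_lt with rfl | h1
    · simpa using hzt'
    obtain ⟨p, q, h2, h3, h4, rfl⟩ := hT hz
    refine (hright f hf hfa ⟨t⁻¹ * (1 - q), t⁻¹ * (1 - p), ?_, ?_, ?_⟩).elim
    · have := sub_nonneg.2 h4; positivity
    · gcongr
    · rw [mul_smul, mul_smul, ← smul_add, show (1 - q) • Y + (1 - p) • X = t • -f.2 by
        rw [smul_neg, ← sub_eq_of_eq_add' hzt']; module, smul_smul, inv_mul_cancel₀ h1.ne', one_smul]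
  have hcu : Continuous fun z => det u (z - a) := by unfold det; fun_prop
  have hcw : Continuous fun z => det w (z - a) := by unfold det; fun_prop
  have hcont : Continuous fun z => det u (z - a) - det w (z - a) := hcu.sub hcw
  set F₀ := {d ∈ F | d.finish ≠ proj a ∧ d.start ≠ proj (a + (X + Y))}
  have hC : IsCompact (T ∩ proj ⁻¹' support F₀) := by
    have hK : IsCompact ((fun r : ℝ × ℝ => a + (r.1 • X + r.2 • Y)) '' Icc 0 1) :=
      isCompact_Icc.image (by fun_prop)
    refine (hK.of_isClosed_subset ?_ ?_).inter_right ((isCompact_support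
      ((hm.finite.subset subset_union_left).subset (Set.sep_subset _ _))).isClosed.preimage
      continuous_proj)
    · exact (isClosed_le continuous_const hcw).inter ((isClosed_le hcw hcu).inter
        (isClosed_le hcu continuous_const))
    · intro z hz
      obtain ⟨p, q, h0, h1, h2, rfl⟩ := hT hz
      exact ⟨(p, q), ⟨⟨by dsimp; linarith, h0⟩, ⟨h2, by dsimp; linarith⟩⟩, rfl⟩
  obtain ⟨ρ, hρ, hρC⟩ := hC.exists_forall_le' hcont.continuousOn (a := 0) (by
    rintro z ⟨hz, d, hdF, t, ht, hdt⟩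
    obtain ⟨p, q, h0, h1, h2, rfl⟩ := hT hz
    simp only [add_sub_cancel_left, det_add_right, det_smul_right, hd.uX, hd.uY, hd.wX, hd.wY]
    refine sub_pos.2 (lt_of_le_of_ne (by linarith) fun hpq => ?_)
    obtain rfl : q = p := by linarith
    have := hm.pt_eq_cases (.inl hdF.1) (.inr rfl) (fun h => heF (h ▸ hdF.1)) ht ⟨h0, h2⟩
      (hdt.trans (by rw [seg_pt]; congr 2; module))
    rw [seg_start, seg_finish] at this
    exact this.elim (fun h => hdF.2.1 h.1) fun h => hdF.2.2 h.1)
  obtain ⟨n, hn⟩ := exists_nat_one_div_lt hρ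
  set r : ℝ := 1 / ((n : ℝ) + 1) with hr
  have hr0 : 0 < r := by positivity
  have hrn : ((n : ℝ) + 1) * r = 1 := mul_one_div_cancel (by positivity)
  have hend : a + ((n : ℝ) + 1) • (r • X + r • Y) = a + (X + Y) := by
    rw [← smul_add, smul_smul, hrn, one_smul]
  have hKmem (p q : ℝ) : a + (p • X + q • Y) ∈ T ∩ {z | det u (z - a) - det w (z - a) ≤ r} ↔
      (0 ≤ q ∧ q ≤ p ∧ p ≤ 1) ∧ p - q ≤ r := by
    rw [Set.mem_inter_iff, hTmem]
    simp [det_add_right, det_smul_right, hd.uX, hd.uY, hd.wX, hd.wY]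
  have hgap : GapDisc F (T ∩ {z | det u (z - a) - det w (z - a) ≤ r}) a
      (a + ((n : ℝ) + 1) • (r • X + r • Y)) := by
    rw [hend]
    refine ⟨?_, hinj.mono Set.inter_subset_left, by simpa using (hKmem 0 0).2 ⟨by simp, by simpa using hr0.le⟩,
      by simpa using (hKmem 1 1).2 ⟨by simp, by simpa using hr0.le⟩, fun h => hd.ne ?_, ?_⟩
    · rintro z ⟨⟨a1, a2, a3⟩, a4⟩ z' ⟨⟨b1, b2, b3⟩, b4⟩ s t hs ht hst
      obtain rfl : t = 1 - s := by linarith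
      rw [show s • z + (1 - s) • z' = z' + s • (z - z') by module]
      simp only [hTdef, Set.mem_inter_iff, mem_ofPred_eq, det_sub_right, det_add_right, det_smul_right] at *
      refine ⟨⟨?_, ?_, ?_⟩, ?_⟩ <;> nlinarith
    · have : X + Y = 0 := by simpa using h
      rw [eq_neg_of_add_eq_zero_right this, det_neg_right, det_self, neg_zero]
    · rintro _ ⟨⟨d, hdF, t, ht, hdt⟩, z, ⟨hz, hzH⟩, rfl⟩
      by_cases h1 : d.finish = proj a
      · exact Or.inl (congrArg proj (hfin hz hdF h1 ht hdt))
      by_cases h2 : d.start = proj (a + (X + Y))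
      · exact Or.inr (congrArg proj (hstart hz hdF h2 ht hdt))
      · exact (((hρC z ⟨hz, d, ⟨hdF, h1, h2⟩, t, ht, hdt⟩).trans hzH).not_gt hn).elim
  obtain ⟨β, G, hβ, hiso, hG⟩ := hgap.exists_stairs (u := r⁻¹ • u) (w := r⁻¹ • w)
    ⟨by simp [det_smul_left, det_smul_right, hd.uX, hr0.ne'], by simp [det_smul_left, det_smul_right, hd.uY],
      by simp [det_smul_left, det_smul_right, hd.wX], by simp [det_smul_left, det_smul_right, hd.wY, hr0.ne'],
      by simp [det_smul_left, det_smul_right, hd.ne, hr0.ne'], fun z => by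
        nth_rw 1 [hd.eq z]
        simp only [det_smul_left, smul_smul]
        field_simp⟩ n (fun k hk => by
    have hk1 : (k : ℝ) ≤ n := by exact_mod_cast hk
    have hkr : (k : ℝ) * r + r ≤ 1 := by nlinarith
    have hkr0 : 0 ≤ (k : ℝ) * r := by positivity
    rw [show a + (k : ℝ) • (r • X + r • Y) + r • X = a + ((k * r + r) • X + (k * r) • Y) by module,
      show a + (k : ℝ) • (r • X + r • Y) = a + ((k * r) • X + (k * r) • Y) by module, hKmem, hKmem]
    exact ⟨⟨⟨hkr0, le_rfl, by linarith⟩, by linarith⟩, ⟨hkr0, by linarith, by linarith⟩, by linarith⟩)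
    (α := α) (by rw [hα, hend])
  exact ⟨β, G, hβ, hiso, r, hr0, by nlinarith, hG⟩

/-- A curve does not backtrack at a vertex. -/
lemma IsMulticurve.not_backtrack (h : IsMulticurve E) (he : e ∈ E)
    (hf : f ∈ E) (hfe : f.finish = e.start) {r : ℝ} (hr : 0 < r) : -f.2 ≠ r • e.2 := by
  intro heq
  have h1 : 0 < 1 + r := by linarith
  have hpt : f.pt (1 - 1 / (1 + r)) = e.pt (1 / (1 + r) * r) := by
    have : e.1 = f.1 + proj f.2 := hfe.symm
    rw [Edge.pt, Edge.pt, this, add_assoc, ← proj_add, mul_smul, ← heq]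
    congr 2; module
  have hef := (h.eq_of_pt_eq hf he ⟨?_, ?_⟩ ⟨?_, ?_⟩ hpt).1
  · subst hef
    have h0 : (1 + r) • f.2 = 0 := by
      rw [add_smul, one_smul, ← heq]; simp
    exact h.disp_ne_zero hf ((smul_eq_zero.1 h0).resolve_left h1.ne')
  · rw [sub_nonneg, div_le_one h1]; linarith
  · simp [h1]
  · positivity
  · rw [div_mul_eq_mul_div, one_mul, div_lt_one h1]; linarith

/-- `X` and `Y` are the horizontal and the vertical component of `v`, in some order. -/
def IsSplit (v X Y : Plane) : Prop :=
  (X = (v.1, 0) ∧ Y = (0, v.2)) ∨ (X = (0, v.2) ∧ Y = (v.1, 0))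

section Split

variable {v X Y f : Plane}

lemma IsSplit.add (h : IsSplit v X Y) : X + Y = v := by
  rcases h with ⟨rfl, rfl⟩ | ⟨rfl, rfl⟩ <;> ext <;> simp

lemma IsSplit.symm (h : IsSplit v X Y) : IsSplit v Y X := by
  unfold IsSplit at *; tauto

lemma IsSplit.exists_isDual (h : IsSplit v X Y) (h1 : v.1 ≠ 0) (h2 : v.2 ≠ 0) :
    ∃ u w, IsDual X Y u w := by
  rcases h with ⟨rfl, rfl⟩ | ⟨rfl, rfl⟩
  · refine ⟨(0, -v.1⁻¹), (v.2⁻¹, 0), ?_⟩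
    constructor <;> simp [det, h1, h2]
    intro a b; field_simp; simp
  · refine ⟨(v.2⁻¹, 0), (0, -v.1⁻¹), ?_⟩
    constructor <;> simp [det, h1, h2]
    intro a b; field_simp; simp

lemma IsSplit.norm_lt (h : IsSplit v X Y) {c : ℝ} (hv : ‖v‖ < c) {p q : ℝ}
    (hp : p ∈ Icc₀₁) (hq : q ∈ Icc₀₁) : ‖p • X + q • Y‖ < c := by
  have key {s x : ℝ} (hs : s ∈ Icc₀₁) (hx : |x| < c) : |s| * |x| < c := by
    rw [abs_of_nonneg hs.1]; nlinarith [hs.2, abs_nonneg x]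
  obtain ⟨h1, h2⟩ := sup_lt_iff.1 hv
  rcases h with ⟨rfl, rfl⟩ | ⟨rfl, rfl⟩ <;>
    simpa [Prod.norm_def] using ⟨key (by assumption) h1, key (by assumption) h2⟩

/-- The components of `f` do not have the opposite sign as those of `v`. -/
def Forward (v f : Plane) : Prop := 0 ≤ v.1 * f.1 ∧ 0 ≤ v.2 * f.2

lemma IsSplit.not_inCone (h : IsSplit v X Y) (hf : Forward v f) (h0 : f ≠ 0) (h1 : v.1 ≠ 0)
    (h2 : v.2 ≠ 0) : ¬ InCone X Y (-f) := by
  rintro ⟨p, q, hq, hpq, hfe⟩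
  have e1 := congrArg Prod.fst hfe
  have e2 := congrArg Prod.snd hfe
  have key {x y : ℝ} (hx : x ≠ 0) (hy : 0 ≤ x * y) (h : -y = p * x) : p = 0 := by
    rw [← neg_eq_iff_eq_neg.2 h.symm] at hy
    nlinarith [mul_self_pos.2 hx]
  obtain ⟨f1, f2⟩ := hf
  rcases h with ⟨rfl, rfl⟩ | ⟨rfl, rfl⟩ <;> simp at e1 e2
  · obtain rfl := key h1 f1 e1
    obtain rfl : q = 0 := by linarith
    exact h0 (by simpa using hfe)
  · obtain rfl := key h2 f2 e2
    obtain rfl : q = 0 := by linarith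
    exact h0 (by simpa using hfe)

/-- A vector not parallel to `v` avoids one of the two cones between `v` and its components. -/
lemma exists_split (h1 : v.1 ≠ 0) (h2 : v.2 ≠ 0) (h0 : f ≠ 0)
    (hf : ∀ r : ℝ, 0 < r → f ≠ r • v) : ∃ X Y, IsSplit v X Y ∧ ¬ InCone X Y f := by
  by_contra! hcon
  obtain ⟨p, q, hq, hpq, rfl⟩ := hcon (v.1, 0) (0, v.2) (Or.inl ⟨rfl, rfl⟩)
  obtain ⟨p', q', hq', hpq', h⟩ := hcon (0, v.2) (v.1, 0) (Or.inr ⟨rfl, rfl⟩)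
  simp [h1, h2] at h
  obtain rfl : p = q := by linarith
  have hv : p • ((v.1, 0) : Plane) + p • (0, v.2) = p • v := by ext <;> simp
  rcases hq.eq_or_lt with rfl | hq
  · simp at h0
  · exact hf p hq hv

end Split

/-- A slanted segment can be replaced by a staircase if the curve does not turn back at one of its
ends. -/
lemma exists_stairs_of_forward (h1 : v.1 ≠ 0) (h2 : v.2 ≠ 0)
    (hv : ‖v‖ < 1 / 4) (hα : α.edges = F ∪ {seg a (a + v)})
    (heF : seg a (a + v) ∉ F) (hs : IsShort F)
    (hfree : (∀ f ∈ F, f.start = proj (a + v) → Forward v f.2) ∨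
      ∀ f ∈ F, f.finish = proj a → Forward v f.2) :
    ∃ (β : Multicurve) (G : Set Edge), β.edges = F ∪ G ∧ Isotopic α β ∧
      ∃ r : ℝ, 0 < r ∧ r ≤ 1 ∧ ∀ e ∈ G, e.2 = r • (v.1, 0) ∨ e.2 = r • (0, v.2) := by
  have hm := hα ▸ α.isMulticurve
  have hne {f : Edge} (hf : f ∈ F) : f.2 ≠ 0 := hm.disp_ne_zero (.inl hf)
  have heE : seg a (a + v) ∈ F ∪ {seg a (a + v)} := .inr rfl
  have he2 : (seg a (a + v)).2 = v := by simp [seg]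
  have hpa : proj a ≠ proj (a + v) := fun h => h1 (by
    have := eq_of_proj_eq_of_norm_lt h (by simpa using by linarith)
    simp [show v = 0 by simpa using this])
  obtain ⟨X, Y, hsp, hl, hr⟩ : ∃ X Y, IsSplit v X Y ∧
      (∀ f ∈ F, f.finish = proj a → ¬ InCone X Y (-f.2)) ∧
      ∀ f ∈ F, f.start = proj (a + v) → ¬ InCone Y X (-f.2) := by
    rcases hfree with hfree | hfree
    · obtain ⟨f, hf, hff⟩ := hm.exists_finish heE
      have hfF : f ∈ F := hf.resolve_right (by
        rintro rfl; rw [seg_start, seg_finish] at hff; exact hpa hff.symm)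
      obtain ⟨X, Y, hsp, hc⟩ := exists_split h1 h2 (neg_ne_zero.2 (hne hfF)) fun r hr h =>
        hm.not_backtrack heE hf hff hr (by rw [h, he2])
      exact ⟨X, Y, hsp, fun d hd hda => hm.finish_injOn (.inl hd) hf (hda.trans hff.symm) ▸ hc,
        fun d hd hda => hsp.symm.not_inCone (hfree d hd hda) (hne hd) h1 h2⟩
    · obtain ⟨f, hf, hff⟩ := hm.exists_start heE
      have hfF : f ∈ F := hf.resolve_right (by
        rintro rfl; rw [seg_start, seg_finish] at hff; exact hpa hff)
      obtain ⟨Y, X, hsp, hc⟩ := exists_split h1 h2 (neg_ne_zero.2 (hne hfF)) fun r hr h =>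
        hm.not_backtrack hf heE hff.symm (inv_pos.2 hr) (by
          rw [he2, eq_inv_smul_iff₀ hr.ne', smul_neg, ← h, neg_neg])
      rw [seg_finish] at hff
      exact ⟨X, Y, hsp.symm, fun d hd hda => hsp.symm.not_inCone (hfree d hd hda) (hne hd) h1 h2,
        fun d hd hda => hm.start_injOn (.inl hd) hf (hda.trans hff.symm) ▸ hc⟩
  obtain ⟨u, w, hd⟩ := hsp.exists_isDual h1 h2
  rw [← hsp.add] at hα heF hr
  obtain ⟨β, G, hβ, hiso, r, hr0, hr1, hG⟩ :=
    exists_stairs hd (fun p hp q hq => hsp.norm_lt hv hp hq) hα heF hs hl hr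
  refine ⟨β, G, hβ, hiso, r, hr0, hr1, fun e he => ?_⟩
  rcases hsp with ⟨rfl, rfl⟩ | ⟨rfl, rfl⟩
  exacts [hG e he, (hG e he).symm]

/-- The edges that are neither horizontal nor vertical. -/
def slanted : Set Edge := {e | e.2.1 ≠ 0 ∧ e.2.2 ≠ 0}

lemma exists_unslant (hs : IsShort α.edges) (he : e ∈ α.edges)
    (hb : e ∈ slanted) : ∃ β : Multicurve, IsShort β.edges ∧ Isotopic α β ∧
      (β.edges ∩ slanted).ncard < (α.edges ∩ slanted).ncard := by
  obtain ⟨a, ha, hea⟩ := exists_eq_seg e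
  set v : Plane := (1 / 2 : ℝ) • e.2 with hv
  have hv1 : v.1 ≠ 0 := by simpa [hv] using hb.1
  have hv2 : v.2 ≠ 0 := by simpa [hv] using hb.2
  have hvs : ‖v‖ < 1 / 4 := by
    rw [hv, norm_smul]; norm_num; linarith [hs e he, norm_nonneg e.2]
  have hhalf : (1 / 2 : ℝ) ∈ Ioo₀₁ := by norm_num
  obtain ⟨β₁, hβ₁, hcut⟩ := exists_cut α he hhalf
  have hαF := α.isMulticurve
  rw [sdiff_union_singleton he] at hαF
  obtain ⟨n1, n2⟩ := hαF.cut_notMem (by simp) hhalf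
  set F := α.edges \ {e} with hF
  have c1 : ((e.1, (1 / 2 : ℝ) • e.2) : Edge) = seg a (a + v) := by
    rw [seg, ha, add_sub_cancel_left]
  have c2 : ((e.pt (1 / 2), (1 - 1 / 2 : ℝ) • e.2) : Edge) = seg (a + v) (a + v + v) := by
    rw [seg, add_sub_cancel_left, proj_add, ha, Edge.pt, ← hv]
    congr 1
    rw [hv]; module
  rw [c1] at n1
  rw [c2] at n2
  rw [cut, c1, c2] at hβ₁
  have hβm := hβ₁ ▸ β₁.isMulticurve
  have m₁ : seg a (a + v) ∈ F ∪ {seg a (a + v), seg (a + v) (a + v + v)} := by simp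
  have m₂ : seg (a + v) (a + v + v) ∈ F ∪ {seg a (a + v), seg (a + v) (a + v + v)} := by simp
  have hFs : IsShort F := fun f hf => hs f hf.1
  have hGs {G : Set Edge} {r : ℝ} (h0 : 0 < r) (h1 : r ≤ 1)
      (hG : ∀ e ∈ G, e.2 = r • (v.1, 0) ∨ e.2 = r • (0, v.2)) {d : Edge} (hd : d ∈ G) :
      ‖d.2‖ < 1 / 4 ∧ d ∉ slanted ∧ Forward v d.2 := by
    have hsp : IsSplit v (v.1, 0) (0, v.2) := Or.inl ⟨rfl, rfl⟩
    have hr : r ∈ Icc₀₁ := ⟨h0.le, h1⟩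
    have z : (0 : ℝ) ∈ Icc₀₁ := by simp
    refine ⟨?_, ?_, ?_⟩
    · rcases hG d hd with h | h <;> rw [h]
      exacts [by simpa using hsp.norm_lt hvs hr z, by simpa using hsp.norm_lt hvs z hr]
    · rintro ⟨h2, h3⟩
      rcases hG d hd with h | h <;> simp [h] at h2 h3
    · rcases hG d hd with h | h <;> rw [h] <;> constructor <;> simp <;>
        rw [mul_left_comm] <;> exact mul_nonneg h0.le (mul_self_nonneg _)
  obtain ⟨β₂, G, hβ₂, hiso₂, r, hr0, hr1, hG⟩ := exists_stairs_of_forward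
    (F := F ∪ {seg a (a + v)}) hv1 hv2 hvs (α := β₁) (by rw [hβ₁, union_assoc]; rfl)
    (by
      rintro (h | h)
      · exact n2 h
      · have := congrArg Edge.start (Set.mem_singleton_iff.1 h)
        rw [seg_start, seg_start] at this
        exact hv1 (by simp [show v = 0 by
          simpa using eq_of_proj_eq_of_norm_lt this.symm (by simpa using by linarith)]))
    (by
      rintro f (hf | rfl)
      · exact hFs f hf
      · simpa [seg] using hvs)
    (Or.inr fun f hf hff => by
      rw [hβm.finish_injOn (hf.imp_right Or.inl) m₁ (by rw [hff, seg_finish])]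
      simpa [seg, Forward] using ⟨mul_self_nonneg v.1, mul_self_nonneg v.2⟩)
  obtain ⟨β₃, G', hβ₃, hiso₃, r', hr0', hr1', hG'⟩ := exists_stairs_of_forward (F := F ∪ G)
    (a := a) hv1 hv2 hvs (α := β₂) (by rw [hβ₂, Set.union_right_comm])
    (by
      rintro (h | h)
      · exact n1 h
      · exact (hGs hr0 hr1 hG h).2.1 (by simpa [slanted, seg] using ⟨hv1, hv2⟩))
    (by
      rintro f (hf | hf)
      exacts [hFs f hf, (hGs hr0 hr1 hG hf).1])
    (Or.inl fun f hf hff => by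
      rcases hf with hf | hf
      · exact (n2 (hβm.start_injOn (.inl hf) m₂ (by rw [hff, seg_start]) ▸ hf)).elim
      · exact (hGs hr0 hr1 hG hf).2.2)
  refine ⟨β₃, ?_, (.trans (.rel _ _ (.inl hcut)) (hiso₂.trans hiso₃)), ?_⟩ <;> rw [hβ₃]
  · rintro d ((hd | hd) | hd)
    exacts [hFs d hd, (hGs hr0 hr1 hG hd).1, (hGs hr0' hr1' hG' hd).1]
  · refine ncard_inter_lt α.isMulticurve.finite he hb ?_
    rintro d ((hd | hd) | hd) hdb
    exacts [hd, ((hGs hr0 hr1 hG hd).2.1 hdb).elim, ((hGs hr0' hr1' hG' hd).2.1 hdb).elim]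

/-- Every curve is isotopic to a curve with horizontal and vertical edges. -/
lemma exists_isotopic_rectilinear (α : Multicurve) :
    ∃ β : Multicurve, Isotopic α β ∧ ∀ e ∈ β.edges, e.2.1 = 0 ∨ e.2.2 = 0 := by
  obtain ⟨β, hβ, hs⟩ := exists_isotopic_short α
  obtain ⟨γ, hγ, hiso, hb⟩ := exists_isotopic_of_step (P := fun α => IsShort α.edges)
    (bad := slanted) (fun α hα e he hb => exists_unslant hα he hb) β hs
  refine ⟨γ, hβ.trans hiso, fun e he => ?_⟩
  have := hb e he
  simp only [slanted, mem_ofPred_eq] at this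
  tauto

/-! ### Homology -/

lemma homology_union (hE : E.Finite) (hF : F.Finite) (h : Disjoint E F) :
    homology (E ∪ F) = homology E + homology F :=
  finsum_mem_union h hE hF

lemma homology_singleton (e : Edge) : homology {e} = e.2 := finsum_mem_singleton

lemma homology_pair (h : e ≠ f) : homology {e, f} = e.2 + f.2 :=
  finsum_mem_pair h

lemma proj_finsum (hE : E.Finite) :
    proj (homology E) = ∑ᶠ e ∈ E, proj e.2 := by
  let φ : Plane →+ Torus := ⟨⟨proj, proj_zero⟩, proj_add⟩
  exact φ.map_finsum_mem (fun e : Edge => e.2) hE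

/-- The homology class of a closed curve is integral. -/
lemma exists_homology_eq (h : IsMulticurve E) : ∃ n : ℤ × ℤ, homology E = lat n := by
  rw [← proj_eq_zero_iff, proj_finsum h.finite]
  have h1 : ∀ e ∈ E, proj e.2 = e.finish - e.start := fun e _ => by
    simp [Edge.finish, Edge.start]
  rw [finsum_mem_congr rfl h1, finsum_mem_sub_distrib (f := Edge.finish) (g := Edge.start) h.finite, sub_eq_zero]
  have e1 := finsum_mem_image (f := fun z : Torus => z) h.finish_injOn
  have e2 := finsum_mem_image (f := fun z : Torus => z) h.start_injOn
  rw [← e1, ← e2, h.closed]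

/-- An integer-valued continuous function on the unit interval is constant. -/
lemma eq_of_continuous_int {f : unitInterval → ℝ} (hf : Continuous f)
    (h : ∀ t, ∃ n : ℤ, f t = n) : f 0 = f 1 := by
  choose n hn using h
  have hfn : f = (fun k : ℤ => (k : ℝ)) ∘ n := funext hn
  rw [hfn, ← Int.isClosedEmbedding_coe_real.isInducing.continuous_iff] at hf
  have := PreconnectedSpace.constant inferInstance hf (x := 0) (y := 1)
  rw [hn, hn, this]

lemma continuous_homology (hE : E.Finite) {Φ : unitInterval → Edge → Edge}
    (hΦ : ∀ e ∈ E, Continuous fun t => Φ t e) (hinj : ∀ t, InjOn (Φ t) E) :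
    Continuous fun t => homology (Φ t '' E) := by
  have h1 : (fun t => homology (Φ t '' E)) = fun t => ∑ e ∈ hE.toFinset, (Φ t e).2 := by
    funext t
    rw [homology, finsum_mem_image (hinj t), finsum_mem_eq_finite_toFinset_sum _ hE]
  rw [h1]
  refine continuous_finsetSum _ fun e he => ?_
  exact continuous_snd.comp (hΦ e (hE.mem_toFinset.1 he))

lemma Deformation.homology_eq (h : Deformation α β) :
    homology α.edges = homology β.edges := by
  obtain ⟨Φ, hc, h0, hm, h1⟩ := h
  have hcont := continuous_homology α.isMulticurve.finite hc fun t => (hm t).1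
  have h0' : Φ 0 '' α.edges = α.edges := by
    rw [Set.image_congr h0]; simp
  have key : homology (Φ 0 '' α.edges) = homology (Φ 1 '' α.edges) := by
    ext
    · refine eq_of_continuous_int (f := fun t => (homology (Φ t '' α.edges)).1)
        (continuous_fst.comp hcont) fun t => ?_
      obtain ⟨n, hn⟩ := exists_homology_eq (hm t).2
      exact ⟨n.1, by rw [hn]; rfl⟩
    · refine eq_of_continuous_int (f := fun t => (homology (Φ t '' α.edges)).2)
        (continuous_snd.comp hcont) fun t => ?_
      obtain ⟨n, hn⟩ := exists_homology_eq (hm t).2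
      exact ⟨n.2, by rw [hn]; rfl⟩
  rwa [h0', h1] at key

lemma SubdivisionStep.homology_eq (hE : IsMulticurve E)
    (h : SubdivisionStep E E') : homology E = homology E' := by
  obtain ⟨F, e, s, hs0, hs1, heF, h1, h2, rfl, rfl⟩ := h
  have hF : F.Finite := hE.finite.subset subset_union_left
  have hne : ((e.1, s • e.2) : Edge) ≠ (e.pt s, (1 - s) • e.2) := by
    intro heq
    have h0 : e.pt 0 = e.pt s := (pt_zero e).trans (congrArg Prod.fst heq)
    exact hs0.ne (hE.eq_of_pt_eq (.inr rfl) (.inr rfl) zero_mem_Ico ⟨hs0.le, hs1⟩ h0).2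
  rw [homology_union hF (finite_singleton _) (by simpa using heF),
    homology_union hF (toFinite _) (by simp [h1, h2]), homology_singleton, homology_pair hne]
  congr 1
  module

lemma Isotopic.homology_eq (h : Isotopic α β) :
    homology α.edges = homology β.edges := by
  induction h with
  | rel α β h =>
    rcases h with h | h
    · exact h.homology_eq α.isMulticurve
    · exact h.homology_eq
  | refl α => rfl
  | symm α β _ ih => exact ih.symm
  | trans α β γ _ _ ih ih' => exact ih.trans ih'

/-! ### Grids through given points -/

/-- A finite subset of `[0, 1)` extends periodically to an increasing sequence. -/
lemma exists_periodic_sequence {X : Finset ℝ} (hX : ∀ r ∈ X, 0 ≤ r ∧ r < 1) (hne : 0 < X.card) :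
    ∃ x : ℤ → ℝ, (∀ i, x i < x (i + 1)) ∧ (∀ i, x (i + X.card) = x i + 1) ∧
      ∀ r ∈ X, ∃ i, x i = r := by
  set M : ℤ := (X.card : ℤ) with hM
  have hM0 : 0 < M := by omega
  have hlt (i : ℤ) : (i % M).toNat < X.card := by
    have h1 := Int.emod_nonneg i hM0.ne'
    have h2 := Int.emod_lt_of_pos i hM0
    omega
  set ε := X.orderEmbOfFin rfl with hε
  have hεm (k : Fin X.card) : 0 ≤ ε k ∧ ε k < 1 := hX _ (X.orderEmbOfFin_mem rfl k)
  refine ⟨fun i => ((i / M : ℤ) : ℝ) + ε ⟨(i % M).toNat, hlt i⟩, fun i => ?_, fun i => ?_,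
    fun r hr => ?_⟩
  · have h1 := Int.emod_nonneg i hM0.ne'
    have h2 := Int.emod_lt_of_pos i hM0
    have h3 := Int.emod_add_mul_ediv i M
    by_cases hi : i % M + 1 < M
    · have hd : (i + 1) / M = i / M := by
        rw [Int.ediv_eq_iff_of_pos hM0]
        constructor <;> nlinarith
      have hm : (i + 1) % M = i % M + 1 := by
        have := Int.emod_add_mul_ediv (i + 1) M
        rw [hd] at this
        linarith
      beta_reduce
      rw [hd]
      refine add_lt_add_right (ε.strictMono ?_) _
      rw [Fin.mk_lt_mk, hm]
      omega
    · have hd : (i + 1) / M = i / M + 1 := by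
        rw [Int.ediv_eq_iff_of_pos hM0]
        constructor <;> nlinarith
      beta_reduce
      rw [hd]
      push_cast
      linarith [(hεm ⟨(i % M).toNat, hlt i⟩).2, (hεm ⟨((i + 1) % M).toNat, hlt (i + 1)⟩).1]
  · beta_reduce
    have hd : (i + M) / M = i / M + 1 := Int.add_ediv_of_dvd_right (dvd_refl M) |>.trans (by
      rw [Int.ediv_self hM0.ne'])
    have hm : (i + M) % M = i % M := by simp
    simp only [hd, hm]
    push_cast
    ring
  · have : r ∈ Set.range ε := by rw [hε, X.range_orderEmbOfFin rfl]; exact hr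
    obtain ⟨k, hk⟩ := this
    have hk1 : ((k : ℕ) : ℤ) < M := by have := k.2; omega
    refine ⟨(k : ℕ), ?_⟩
    beta_reduce
    have hd : (((k : ℕ) : ℤ) / M) = 0 := Int.ediv_eq_zero_of_lt (by omega) hk1
    have hm : (((k : ℕ) : ℤ) % M) = k := Int.emod_eq_of_lt (by omega) hk1
    simp only [hd, hm, Int.toNat_natCast, Fin.eta, hk]
    simp

lemma exists_lt_of_periodic {f : ℤ → ℝ} {M : ℤ} (hM : 0 < M) (hf : ∀ i, f (i + M) = f i)
    (hpos : ∀ i, 0 < f i) : ∃ ε > 0, ∀ i, ε < f i := by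
  obtain ⟨k, -, hk⟩ := (Finset.Ico 0 M).exists_min_image f ⟨0, by simpa using hM⟩
  refine ⟨f k / 2, by linarith [hpos k], fun i => ?_⟩
  have h1 := periodic_mul (f := f) (M := M) (a := (0 : ℝ)) (fun i => by rw [hf, add_zero]) (i % M) (i / M)
  rw [mul_comm, Int.emod_add_mul_ediv, smul_zero, add_zero] at h1
  linarith [hpos k, hk (i % M) (by simp [Int.emod_nonneg i hM.ne', Int.emod_lt_of_pos i hM])]

/-- An increasing periodic sequence with many terms through given points. -/
lemma exists_periodic_sequence_through {A : Set ℝ} (hA : A.Finite) (n : ℕ) :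
    ∃ (x : ℤ → ℝ) (M : ℤ) (ε : ℝ), (n : ℤ) ≤ M ∧ (∀ i, x (i + M) = x i + 1) ∧ 0 < ε ∧
      (∀ i, x i + ε < x (i + 1)) ∧ ∀ a ∈ A, ∃ i, x i = a := by
  classical
  set X : Finset ℝ := (hA.toFinset.image Int.fract) ∪
    (Finset.range (n + 1)).image (fun k : ℕ => (k : ℝ) / (n + 1)) with hX
  have hn : (0 : ℝ) < n + 1 := by positivity
  have hX01 : ∀ r ∈ X, 0 ≤ r ∧ r < 1 := by
    intro r hr
    rcases Finset.mem_union.1 hr with hr | hr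
    · obtain ⟨a, -, rfl⟩ := Finset.mem_image.1 hr
      exact ⟨Int.fract_nonneg a, Int.fract_lt_one a⟩
    · obtain ⟨k, hk, rfl⟩ := Finset.mem_image.1 hr
      refine ⟨by positivity, ?_⟩
      rw [div_lt_one hn]
      exact_mod_cast Finset.mem_range.1 hk
  have hcard : n + 1 ≤ X.card := by
    calc n + 1 = ((Finset.range (n + 1)).image (fun k : ℕ => (k : ℝ) / (n + 1))).card := by
          rw [Finset.card_image_of_injective, Finset.card_range]
          intro a b hab
          exact_mod_cast (div_left_inj' hn.ne').1 hab
      _ ≤ X.card := Finset.card_le_card Finset.subset_union_right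
  obtain ⟨x, hlt, hadd, hr⟩ := exists_periodic_sequence hX01 (by omega)
  obtain ⟨ε, hε, hεx⟩ := exists_lt_of_periodic (f := fun i => x (i + 1) - x i) (M := X.card)
    (by omega) (fun i => by
      rw [add_right_comm, hadd, hadd]; ring) (fun i => sub_pos.2 (hlt i))
  refine ⟨x, X.card, ε, by omega, hadd, hε, fun i => by linarith [hεx i], fun a ha => ?_⟩
  obtain ⟨i, hi⟩ := hr (Int.fract a) (Finset.mem_union_left _ (Finset.mem_image_of_mem _ (by simpa)))
  refine ⟨i + ⌊a⌋ * X.card, ?_⟩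
  rw [periodic_mul hadd, hi, zsmul_one]
  exact Int.fract_add_floor a

lemma exists_grid {A B : Set ℝ} (hA : A.Finite) (hB : B.Finite) (n : ℕ) :
    ∃ g : Grid, (n : ℤ) ≤ g.M ∧ (n : ℤ) ≤ g.N ∧ (∀ a ∈ A, ∃ i, g.x i = a) ∧
      ∀ b ∈ B, ∃ j, g.y j = b := by
  obtain ⟨x, M, ε, hM, hx, hε, hε', hxA⟩ := exists_periodic_sequence_through hA (n + 3)
  obtain ⟨y, N, δ, hN, hy, hδ, hδ', hyB⟩ := exists_periodic_sequence_through hB (n + 3)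
  push_cast at hM hN
  have h1 := min_le_left ε δ
  have h2 := min_le_right ε δ
  have h3 : 0 < min ε δ := lt_min hε hδ
  exact ⟨⟨M, N, x, y, min ε δ / 2, by omega, by omega, hx, hy, by linarith,
    fun i => by linarith [hε' i], fun i => by linarith [hδ' i]⟩, by dsimp; omega, by dsimp; omega,
    hxA, hyB⟩

namespace Grid

lemma eq_or_eq_of_not_between {x : ℤ → ℝ} (hx : StrictMono x) {i k : ℤ} (hki : k ≠ i)
    (h : ∀ m, ∀ s ∈ Ioo₀₁, x i + s * (x k - x i) ≠ x m) : k = i + 1 ∨ i = k + 1 := by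
  by_contra! hcon
  have key (m : ℤ) (h1 : 0 < (x m - x i) / (x k - x i)) (h2 : (x m - x i) / (x k - x i) < 1) :
      False := by
    refine h m _ ⟨h1, h2⟩ ?_
    rw [div_mul_cancel₀ _ (sub_ne_zero.2 (hx.injective.ne hki))]; ring
  rcases lt_or_gt_of_ne hki with hlt | hlt
  · have a1 := hx (show k < i - 1 by omega)
    have a2 := hx (show i - 1 < i by omega)
    refine key (i - 1) (div_pos_of_neg_of_neg (by linarith) (by linarith)) ?_
    rw [div_lt_one_of_neg (by linarith)]; linarith
  · have a1 := hx (show i + 1 < k by omega)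
    have a2 := hx (show i < i + 1 by omega)
    refine key (i + 1) (div_pos (by linarith) (by linarith)) ?_
    rw [div_lt_one (by linarith)]; linarith

/-- A curve with horizontal and vertical edges and vertices on the grid is a union of edges of the
grid after subdivision. -/
lemma exists_subdivision_grid (g : Grid)
    (hα : ∀ e ∈ α.edges, e.2.1 = 0 ∨ e.2.2 = 0)
    (hv : ∀ e ∈ α.edges, ∃ i j, e.start = proj (g.sw i j)) :
    ∃ β : Multicurve, Isotopic α β ∧ ∀ e ∈ β.edges, ∃ μ i j b, e = g.sqedge μ i j b := by
  set V : Set Torus := {z | ∃ i j, z = proj (g.sw i j)} with hV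
  have hVfin : V.Finite := by
    refine (((Finset.Ico 0 g.M) ×ˢ (Finset.Ico 0 g.N)).finite_toSet.image
      fun q : ℤ × ℤ => proj (g.sw q.1 q.2)).subset ?_
    rintro _ ⟨i, j, rfl⟩
    obtain ⟨m, n, hm, hn⟩ := g.exists_residue i j
    exact ⟨_, Finset.mem_coe.2 (Finset.mk_mem_product hm hn),
      ((proj_eq_iff _ _).2 ⟨_, g.sw_add i j m n⟩).symm⟩
  obtain ⟨β, -, hiso, hsupp, hVβ, hpart, hstart⟩ := exists_subdivision α hVfin
  have hβm := β.isMulticurve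
  have hsV : ∀ f ∈ β.edges, f.start ∈ V := by
    intro f hf
    rcases hstart f hf with h | ⟨e, he, h⟩
    exacts [h, h ▸ hv e he]
  refine ⟨β, hiso, fun f hf => ?_⟩
  obtain ⟨i, j, hij⟩ := hsV f hf
  obtain ⟨f', hf', hff'⟩ := hβm.exists_start hf
  obtain ⟨k', l', hkl'⟩ := hsV f' hf'
  have hfs : f.1 = proj (g.sw i j) := hij
  obtain ⟨k, l, hkl⟩ : ∃ k l, g.sw i j + f.2 = g.sw k l := by
    obtain ⟨n, hn⟩ := (proj_eq_iff (g.sw k' l') (g.sw i j + f.2)).1 (by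
      rw [proj_add, ← hfs, ← hkl', hff']; rfl)
    exact ⟨_, _, hn.trans (g.sw_add k' l' n.1 n.2).symm⟩
  have hf2 : f.2 = g.sw k l - g.sw i j := by rw [← hkl, add_sub_cancel_left]
  have hfe : f = seg (g.sw i j) (g.sw k l) := Prod.ext hfs hf2
  have hne := hβm.disp_ne_zero hf
  have hvert (s : ℝ) (hs : s ∈ Ioo₀₁) (m n : ℤ)
      (h : g.sw i j + s • f.2 = g.sw m n) : False := by
    obtain ⟨f', hf', h'⟩ := hVβ (f.pt s) ⟨m, n, by rw [Edge.pt, hfs, ← proj_add, h]⟩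
      (hsupp ▸ pt_mem_support hf ⟨hs.1.le, hs.2.le⟩)
    exact hs.1.ne (hβm.eq_of_pt_eq hf' hf zero_mem_Ico ⟨hs.1.le, hs.2⟩ ((pt_zero _).trans h')).2
  have hdir : f.2.1 = 0 ∨ f.2.2 = 0 := by
    obtain ⟨e, he, s, t, -, -, -, rfl⟩ := hpart f hf
    simpa using (hα e he).imp Or.inr Or.inr
  have e1 : f.2.1 = g.x k - g.x i := by rw [hf2]; rfl
  have e2 : f.2.2 = g.y l - g.y j := by rw [hf2]; rfl
  rcases hdir with h | h
  · obtain rfl : k = i := g.x_mono.injective (by linarith)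
    obtain rfl | rfl := eq_or_eq_of_not_between g.y_mono (i := j) (k := l)
      (by rintro rfl; exact hne (Prod.ext h (by simp [e2])))
      (fun m s hs hm => hvert s hs k m (by ext <;> simp [h, sw, e2, hm]))
    exacts [⟨false, k, j, true, hfe⟩, ⟨false, k, l, false, hfe⟩]
  · obtain rfl : l = j := g.y_mono.injective (by linarith)
    obtain rfl | rfl := eq_or_eq_of_not_between g.x_mono (i := i) (k := k)
      (by rintro rfl; exact hne (Prod.ext (by simp [e1]) h))
      (fun m s hs hm => hvert s hs m l (by ext <;> simp [h, sw, e1, hm]))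
    exacts [⟨true, i, l, true, hfe⟩, ⟨true, k, l, false, hfe⟩]

end Grid

/-- Curves with the same homology class agree in the skein module up to a power of `-A²`. -/
lemma skeinEquiv_of_homology_eq (h : homology α.edges = homology β.edges) :
    SkeinEquiv α β := by
  obtain ⟨α₁, hα₁, hαr⟩ := exists_isotopic_rectilinear α
  obtain ⟨β₁, hβ₁, hβr⟩ := exists_isotopic_rectilinear β
  obtain ⟨n, hn⟩ := exists_homology_eq α.isMulticurve
  choose lift hl using proj_surjective
  have hfin : (α₁.edges ∪ β₁.edges).Finite := α₁.isMulticurve.finite.union β₁.isMulticurve.finite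
  obtain ⟨g, hM, hN, hx, hy⟩ := exists_grid (hfin.image fun e => (lift e.1).1)
    (hfin.image fun e => (lift e.1).2) (2 * n.1.natAbs + 2 * n.2.natAbs + 1)
  have hv : ∀ e ∈ α₁.edges ∪ β₁.edges, ∃ i j, e.start = proj (g.sw i j) := by
    intro e he
    obtain ⟨i, hi⟩ := hx _ ⟨e, he, rfl⟩
    obtain ⟨j, hj⟩ := hy _ ⟨e, he, rfl⟩
    refine ⟨i, j, ?_⟩
    rw [Grid.sw, hi, hj]; exact (hl e.1).symm
  obtain ⟨α₂, hα₂, hαg⟩ := g.exists_subdivision_grid hαr fun e he => hv e (.inl he)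
  obtain ⟨β₂, hβ₂, hβg⟩ := g.exists_subdivision_grid hβr fun e he => hv e (.inr he)
  obtain ⟨α₃, hα₃, hαt⟩ := g.exists_isotopic_trivalent hαg
  obtain ⟨β₃, hβ₃, hβt⟩ := g.exists_isotopic_trivalent hβg
  have hα' := (hα₁.trans hα₂).trans hα₃
  have hβ' := (hβ₁.trans hβ₂).trans hβ₃
  have e1 : homology α.edges = (((n.1 : ℤ) : ℝ), -((-n.2 : ℤ) : ℝ)) := by
    rw [hn, lat]; ext <;> simp
  refine (hα'.skeinEquiv.trans (g.skeinEquiv_of_homology_eq (-n.2) n.1 hαt hβt ?_ ?_ ?_ ?_)).trans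
    hβ'.skeinEquiv.symm
  · rw [← hα'.homology_eq, e1]
  · rw [← hβ'.homology_eq, ← h, e1]
  · push_cast at hM
    rw [abs_neg]
    linarith [abs_nonneg n.1, abs_nonneg n.2]
  · push_cast at hN
    linarith [abs_nonneg n.1, abs_nonneg n.2]

/-! ### Angles -/

def toC (u : Plane) : ℂ := ⟨u.1, u.2⟩

/-- The oriented angle in `(-π, π]` from `u` to `w`. -/
def turn (u w : Plane) : ℝ := Complex.arg (star (toC u) * toC w)

lemma re_turn (u w : Plane) : (star (toC u) * toC w).re = u.1 * w.1 + u.2 * w.2 := by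
  simp [toC]

lemma im_turn (u w : Plane) : (star (toC u) * toC w).im = det u w := by
  simp [toC, det]; ring

lemma toC_smul (r : ℝ) (u : Plane) : toC (r • u) = r * toC u := by
  apply Complex.ext <;> simp [toC]

lemma toC_ne_zero (h : u ≠ 0) : toC u ≠ 0 := fun h0 =>
  h (Prod.ext (congrArg Complex.re h0) (congrArg Complex.im h0))

lemma turn_smul_left {r : ℝ} (hr : 0 < r) (u w : Plane) : turn (r • u) w = turn u w := by
  rw [turn, toC_smul, star_mul', mul_assoc, turn, ← Complex.arg_real_mul (star (toC u) * toC w) hr]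
  simp

lemma turn_smul_right {r : ℝ} (hr : 0 < r) (u w : Plane) : turn u (r • w) = turn u w := by
  rw [turn, toC_smul, mul_left_comm]
  exact Complex.arg_real_mul _ hr

lemma turn_zero_left (w : Plane) : turn 0 w = 0 := by
  rw [turn, show toC 0 = 0 from rfl]; simp

lemma turn_zero_right (w : Plane) : turn w 0 = 0 := by
  rw [turn, show toC 0 = 0 from rfl]; simp

lemma turn_self_smul (u : Plane) {r : ℝ} (hr : 0 < r) (hs : 0 < s) :
    turn (r • u) (s • u) = 0 := by
  rw [turn_smul_left hr, turn_smul_right hs, turn, Complex.arg_eq_zero_iff, re_turn, im_turn]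
  exact ⟨add_nonneg (mul_self_nonneg _) (mul_self_nonneg _), det_self u⟩

lemma turn_coe (hu : u ≠ 0) (hw : w ≠ 0) :
    (turn u w : Angle) = (toC w).arg - (toC u).arg := by
  rw [turn, Complex.arg_mul_coe_angle (star_ne_zero.2 (toC_ne_zero hu)) (toC_ne_zero hw)]
  have := Complex.arg_conj_coe_angle (toC u)
  rw [starRingEnd_apply] at this
  rw [this]; abel

lemma turn_lt (u w : Plane) : -π < turn u w := Complex.neg_pi_lt_arg _

lemma turn_le (u w : Plane) : turn u w ≤ π := Complex.arg_le_pi _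

lemma turn_nonneg_iff : 0 ≤ turn u w ↔ 0 ≤ det u w := by
  rw [turn, Complex.arg_nonneg_iff, im_turn]

lemma turn_pos (h : 0 < det u w) : 0 < turn u w ∧ turn u w < π := by
  refine ⟨(turn_nonneg_iff.2 h.le).lt_of_ne fun h0 => ?_, ?_⟩
  · have := (Complex.arg_eq_zero_iff.1 h0.symm).2
    rw [im_turn] at this; exact h.ne' this
  · exact Complex.arg_lt_pi_iff.2 (Or.inr (by rw [im_turn]; exact h.ne'))

lemma turn_neg_iff : turn u w < 0 ↔ det u w < 0 := by
  rw [← not_le, turn_nonneg_iff, not_le]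

lemma eq_of_angle_eq {x y : ℝ} (h : (x : Angle) = y) (h1 : x - y < 2 * π)
    (h2 : y - x < 2 * π) : x = y := by
  obtain ⟨k, hk⟩ := Real.Angle.angle_eq_iff_two_pi_dvd_sub.1 h
  have hp := pi_pos
  have a1 : (k : ℝ) < 1 := by nlinarith
  have a2 : (-1 : ℝ) < k := by nlinarith
  have b1 : k < 1 := by exact_mod_cast a1
  have b2 : -1 < k := by exact_mod_cast a2
  obtain rfl : k = 0 := by omega
  simp at hk; linarith

lemma mem_slitPlane (h : ∀ r : ℝ, 0 < r → -u ≠ r • w) (hu : u ≠ 0) (hw : w ≠ 0) :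
    star (toC u) * toC w ∈ Complex.slitPlane := by
  rw [Complex.mem_slitPlane_iff_arg]
  refine ⟨fun hpi => ?_, mul_ne_zero (star_ne_zero.2 (toC_ne_zero hu)) (toC_ne_zero hw)⟩
  obtain ⟨h1, h2⟩ := Complex.arg_eq_pi_iff.1 hpi
  rw [re_turn] at h1
  rw [im_turn, det] at h2
  have hw2 : 0 < w.1 * w.1 + w.2 * w.2 := by
    rcases not_and_or.1 (fun h0 : w.1 = 0 ∧ w.2 = 0 => hw (Prod.ext h0.1 h0.2)) with h0 | h0
    · nlinarith [mul_self_pos.2 h0, mul_self_nonneg w.2]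
    · nlinarith [mul_self_pos.2 h0, mul_self_nonneg w.1]
  refine h (-(u.1 * w.1 + u.2 * w.2) / (w.1 * w.1 + w.2 * w.2)) (div_pos (by linarith) hw2) ?_
  ext <;> simp only [fst_neg, snd_neg, smul_fst, smul_snd, smul_eq_mul] <;>
    rw [div_mul_eq_mul_div, eq_div_iff hw2.ne']
  · linear_combination -w.2 * h2
  · linear_combination w.1 * h2

lemma turn_swap (h : ∀ r : ℝ, 0 < r → -u ≠ r • w) (hu : u ≠ 0) (hw : w ≠ 0) :
    turn w u = -turn u w := by
  have e : star (toC w) * toC u = starRingEnd ℂ (star (toC u) * toC w) := by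
    rw [starRingEnd_apply, star_mul', star_star, mul_comm]
  rw [turn, e, Complex.arg_conj, if_neg (Complex.mem_slitPlane_iff_arg.1 (mem_slitPlane h hu hw)).1,
    turn]

lemma ne_zero_of_det (h : det u w ≠ 0) : u ≠ 0 ∧ w ≠ 0 :=
  ⟨by rintro rfl; exact h (det_zero_left _), by rintro rfl; exact h (det_zero_right _)⟩

/-- Angles add up if the direction opposite to `u` is not between the other two. -/
lemma turn_add (hu : u ≠ 0) (hbc : det b c ≠ 0)
    (h : ∀ l m : ℝ, 0 ≤ l → 0 ≤ m → -u ≠ l • b + m • c) : turn u b + turn b c = turn u c := by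
  obtain ⟨hb, hc⟩ := ne_zero_of_det hbc
  have hang : ((turn u b + turn b c : ℝ) : Angle) = turn u c := by
    rw [Real.Angle.coe_add, turn_coe hu hb, turn_coe hb hc, turn_coe hu hc]; abel
  have key : ¬ (0 ≤ -det u c / det b c ∧ 0 ≤ det u b / det b c) := by
    rintro ⟨h1, h2⟩
    refine h _ _ h1 h2 ?_
    ext <;> simp only [fst_neg, snd_neg, fst_add, snd_add, smul_fst,
      smul_snd, smul_eq_mul] <;> field_simp <;> simp only [det] <;> ring
  have a1 := turn_lt u b
  have a2 := turn_le u b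
  have a3 := turn_lt u c
  have a4 := turn_le u c
  have a5 := turn_lt b c
  have a6 := turn_le b c
  apply eq_of_angle_eq hang
  · by_contra hcon
    rcases lt_or_gt_of_ne hbc with hd | hd
    · have := turn_neg_iff.2 hd; linarith
    · have hd' := turn_pos hd
      have h1 : det u c < 0 := turn_neg_iff.1 (by linarith)
      have h2 : 0 ≤ det u b := turn_nonneg_iff.1 (by linarith)
      exact key ⟨div_nonneg (by linarith) hd.le, div_nonneg h2 hd.le⟩
  · by_contra hcon
    rcases lt_or_gt_of_ne hbc with hd | hd
    · have h1 : 0 ≤ det u c := turn_nonneg_iff.1 (by linarith)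
      have h2 : det u b < 0 := turn_neg_iff.1 (by linarith)
      exact key ⟨div_nonneg_of_nonpos (by linarith) hd.le, div_nonneg_of_nonpos h2.le hd.le⟩
    · have := turn_pos hd; linarith

lemma turn_add_neg (h : 0 < det a b) : turn a b + turn b (-a) = π := by
  obtain ⟨ha, hb⟩ := ne_zero_of_det h.ne'
  have h1 := turn_pos h
  have h2 := turn_pos (u := b) (w := -a) (by rw [det_neg_right, det_comm]; simpa using h)
  refine eq_of_angle_eq ?_ (by linarith) (by linarith)
  have e : toC (-a) = -toC a := by apply Complex.ext <;> simp [toC]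
  rw [Real.Angle.coe_add, turn_coe ha hb, turn_coe hb (neg_ne_zero.2 ha), e,
    Complex.arg_neg_coe_angle (toC_ne_zero ha)]
  abel

lemma turn_neg_neg (a b : Plane) : turn (-a) (-b) = turn a b := by
  have e (a : Plane) : toC (-a) = -toC a := by apply Complex.ext <;> simp [toC]
  rw [turn, turn, e, e]; simp

lemma turn_triangle {x y : Plane} (h : 0 < det x y) :
    turn x y + turn y (-(x + y)) + turn (-(x + y)) x = 2 * π := by
  obtain ⟨hx, hy⟩ := ne_zero_of_det h.ne'
  have e1 : det y (-(x + y)) = det x y := by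
    rw [det_neg_right, det_add_right, det_self, det_comm y x]; ring
  have e2 : det (-(x + y)) x = det x y := by
    rw [det_neg_left, det_add_left, det_self, det_comm y x]; ring
  have hz := (ne_zero_of_det (e1 ▸ h.ne')).2
  have h1 := turn_pos h
  have h2 := turn_pos (e1 ▸ h)
  have h3 := turn_pos (e2 ▸ h)
  refine eq_of_angle_eq ?_ (by linarith) (by linarith)
  rw [Real.Angle.coe_add, Real.Angle.coe_add, turn_coe hx hy, turn_coe hy hz, turn_coe hz hx]
  simp

lemma turn_swap_of_det (h : det u w ≠ 0) : turn w u = -turn u w := by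
  obtain ⟨hu, hw⟩ := ne_zero_of_det h
  refine turn_swap (fun r _ heq => h ?_) hu hw
  rw [← neg_neg u, heq, det_neg_left, det_smul_left, det_self]; simp

lemma turn_triangle_neg {x y : Plane} (h : det x y < 0) :
    turn x y + turn y (-(x + y)) + turn (-(x + y)) x = -(2 * π) := by
  have e0 : 0 < det y x := by rw [det_comm]; linarith
  have e1 : det y (-(x + y)) = det x y := by
    rw [det_neg_right, det_add_right, det_self, det_comm y x]; ring
  have e2 : det (-(x + y)) x = det x y := by
    rw [det_neg_left, det_add_left, det_self, det_comm y x]; ring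
  have := turn_triangle e0
  rw [turn_swap_of_det h.ne, add_comm y x, turn_swap_of_det (u := -(x + y)) (by rw [e2]; exact h.ne),
    turn_swap_of_det (u := y) (w := -(x + y)) (by rw [e1]; exact h.ne)] at this
  linarith

/-! ### The turning number -/

/-- The direction in which a curve arrives at a point. -/
def inDir (E : Set Edge) (z : Torus) : Plane := homology {e | e ∈ E ∧ e.finish = z}

/-- The direction in which a curve leaves a point. -/
def outDir (E : Set Edge) (z : Torus) : Plane := homology {e | e ∈ E ∧ e.start = z}

/-- The total turning angle. -/
def rotation (E : Set Edge) : ℝ := ∑ᶠ z, turn (inDir E z) (outDir E z)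

/-- A closed curve with well-defined successors of its edges. -/
structure IsClosedCurve (E : Set Edge) : Prop where
  finite : E.Finite
  closed : Edge.finish '' E = Edge.start '' E
  start_injOn : InjOn Edge.start E

lemma IsMulticurve.isClosedCurve (h : IsMulticurve E) : IsClosedCurve E :=
  ⟨h.finite, h.closed, h.start_injOn⟩

lemma inDir_eq (h : InjOn Edge.finish E) (he : e ∈ E) {z : Torus}
    (hz : e.finish = z) : inDir E z = e.2 := by
  rw [inDir, show {f | f ∈ E ∧ f.finish = z} = {e} from ?_, homology_singleton]
  ext f
  exact ⟨fun hf => h hf.1 he (hf.2.trans hz.symm), by rintro rfl; exact ⟨he, hz⟩⟩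

lemma outDir_eq (h : InjOn Edge.start E) (he : e ∈ E) {z : Torus}
    (hz : e.start = z) : outDir E z = e.2 := by
  rw [outDir, show {f | f ∈ E ∧ f.start = z} = {e} from ?_, homology_singleton]
  ext f
  exact ⟨fun hf => h hf.1 he (hf.2.trans hz.symm), by rintro rfl; exact ⟨he, hz⟩⟩

lemma homology_empty : homology ∅ = 0 := finsum_mem_empty

lemma inDir_eq_zero {z : Torus} (h : ∀ e ∈ E, e.finish ≠ z) : inDir E z = 0 := by
  rw [inDir, show {e | e ∈ E ∧ e.finish = z} = ∅ from
    Set.eq_empty_iff_forall_notMem.2 fun e he => h e he.1 he.2, homology_empty]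

lemma outDir_eq_zero {z : Torus} (h : ∀ e ∈ E, e.start ≠ z) : outDir E z = 0 := by
  rw [outDir, show {e | e ∈ E ∧ e.start = z} = ∅ from
    Set.eq_empty_iff_forall_notMem.2 fun e he => h e he.1 he.2, homology_empty]

lemma inDir_union {z : Torus} (h : ∀ e ∈ P, e.finish ≠ z) :
    inDir (E ∪ P) z = inDir E z := by
  rw [inDir, inDir]; congr 1; ext e
  exact ⟨fun he => ⟨he.1.resolve_right fun h' => h e h' he.2, he.2⟩, fun he => ⟨.inl he.1, he.2⟩⟩

lemma outDir_union {z : Torus} (h : ∀ e ∈ P, e.start ≠ z) :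
    outDir (E ∪ P) z = outDir E z := by
  rw [outDir, outDir]; congr 1; ext e
  exact ⟨fun he => ⟨he.1.resolve_right fun h' => h e h' he.2, he.2⟩, fun he => ⟨.inl he.1, he.2⟩⟩

lemma support_turn :
    (Function.support fun z => turn (inDir E z) (outDir E z)) ⊆ Edge.start '' E := by
  intro z hz
  by_contra h
  refine hz ?_
  beta_reduce
  rw [outDir_eq_zero fun e he hez => h ⟨e, he, hez⟩, turn_zero_right]

namespace IsClosedCurve

variable {E : Set Edge}

lemma finish_injOn (h : IsClosedCurve E) : InjOn Edge.finish E := by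
  have h1 := h.start_injOn.ncard_image
  rw [← h.closed] at h1
  exact Set.injOn_of_ncard_image_eq h1 h.finite

lemma exists_start (h : IsClosedCurve E) (he : e ∈ E) : ∃ f ∈ E, f.start = e.finish := by
  have : e.finish ∈ Edge.start '' E := h.closed ▸ ⟨e, he, rfl⟩
  exact this

lemma exists_finish (h : IsClosedCurve E) (he : e ∈ E) :
    ∃ f ∈ E, f.finish = e.start := by
  have : e.start ∈ Edge.finish '' E := h.closed ▸ ⟨e, he, rfl⟩
  exact this

lemma rotation_eq (h : IsClosedCurve E) :
    rotation E = ∑ e ∈ h.finite.toFinset, turn e.2 (outDir E e.finish) := by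
  rw [rotation, ← finsum_mem_eq_finite_toFinset_sum (fun e : Edge => turn e.2 (outDir E e.finish)),
    ← finsum_mem_univ, ← finsum_mem_inter_support_eq' _ (Edge.finish '' E) Set.univ,
    finsum_mem_image h.finish_injOn]
  · exact finsum_mem_congr rfl fun e he => by rw [inDir_eq h.finish_injOn he rfl]
  · intro z hz
    simpa [h.closed] using support_turn hz

lemma exists_rotation_eq (h : IsClosedCurve E) (h0 : ∀ e ∈ E, e.2 ≠ 0) :
    ∃ k : ℤ, rotation E = 2 * π * k := by
  have hang : (rotation E : Angle) = 0 := by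
    rw [h.rotation_eq]
    have hc := map_sum (Real.Angle.coeHom) (fun e : Edge => turn e.2 (outDir E e.finish))
      h.finite.toFinset
    simp only [Real.Angle.coe_coeHom] at hc
    rw [hc]
    have e1 : ∑ e ∈ h.finite.toFinset, (turn e.2 (outDir E e.finish) : Angle) =
        ∑ e ∈ h.finite.toFinset, (((toC (outDir E e.finish)).arg : Angle) -
          (toC e.2).arg) := by
      refine sum_congr rfl fun e he => ?_
      rw [h.finite.mem_toFinset] at he
      obtain ⟨f, hf, hfe⟩ := h.exists_start he
      rw [outDir_eq h.start_injOn hf hfe, turn_coe (h0 e he) (h0 f hf)]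
    rw [e1, sum_sub_distrib, sub_eq_zero, ← finsum_mem_eq_finite_toFinset_sum
      (fun e : Edge => ((toC (outDir E e.finish)).arg : Angle)),
      ← finsum_mem_eq_finite_toFinset_sum (fun e : Edge => ((toC e.2).arg : Angle)),
      ← finsum_mem_image (f := fun z => ((toC (outDir E z)).arg : Angle)) h.finish_injOn,
      h.closed, finsum_mem_image h.start_injOn]
    exact finsum_mem_congr rfl fun e he => by rw [outDir_eq h.start_injOn he rfl]
  obtain ⟨k, hk⟩ := Real.Angle.angle_eq_iff_two_pi_dvd_sub.1 (hang.trans Real.Angle.coe_zero.symm)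
  exact ⟨k, by simpa using hk⟩

end IsClosedCurve

/-- The turning numbers of two curves differ by the contributions of the vertices at which they
differ. -/
lemma rotation_sub (hE : E.Finite) (hE' : E'.Finite) (S : Finset Torus)
    (h : ∀ z ∉ S, turn (inDir E z) (outDir E z) = turn (inDir E' z) (outDir E' z)) :
    rotation E - rotation E' =
      ∑ z ∈ S, (turn (inDir E z) (outDir E z) - turn (inDir E' z) (outDir E' z)) := by
  rw [rotation, rotation, ← finsum_sub_distrib ((hE.image _).subset support_turn)
    ((hE'.image _).subset support_turn)]
  refine finsum_eq_sum_of_support_subset _ fun z hz => ?_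
  by_contra hzS
  exact hz (sub_eq_zero.2 (h z hzS))

lemma rotation_union {T : Set Edge} (hE : E.Finite) (hT : T.Finite)
    (h : ∀ e ∈ E, ∀ f ∈ T, e.start ≠ f.start ∧ e.finish ≠ f.finish ∧ e.start ≠ f.finish ∧
      e.finish ≠ f.start) :
    rotation (E ∪ T) = rotation E + rotation T := by
  rw [rotation, rotation, rotation, ← finsum_add_distrib ((hE.image _).subset support_turn)
    ((hT.image _).subset support_turn)]
  refine finsum_congr fun z => ?_
  by_cases hz : ∃ f ∈ T, f.start = z ∨ f.finish = z
  · obtain ⟨f, hf, hfz⟩ := hz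
    have h1 : ∀ e ∈ E, e.start ≠ z := fun e he => by
      obtain ⟨a, b, c, d⟩ := h e he f hf; rcases hfz with rfl | rfl <;> assumption
    have h2 : ∀ e ∈ E, e.finish ≠ z := fun e he => by
      obtain ⟨a, b, c, d⟩ := h e he f hf; rcases hfz with rfl | rfl <;> assumption
    rw [Set.union_comm, inDir_union h2, outDir_union h1, inDir_eq_zero h2, turn_zero_left, zero_add]
  · push Not at hz
    have h1 : ∀ e ∈ T, e.start ≠ z := fun e he => (hz e he).1
    have h2 : ∀ e ∈ T, e.finish ≠ z := fun e he => (hz e he).2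
    rw [inDir_union h2, outDir_union h1, inDir_eq_zero h2, turn_zero_left, add_zero]

/-! ### Invariance of the turning number under isotopy -/

lemma SubdivisionStep.isClosedCurve (h : SubdivisionStep E E')
    (hE' : IsClosedCurve E') : IsClosedCurve E ∧ rotation E = rotation E' := by
  obtain ⟨F, e, s, hs0, hs1, heF, h1, h2, rfl, rfl⟩ := h
  set e₁ : Edge := (e.1, s • e.2) with he₁
  set e₂ : Edge := (e.pt s, (1 - s) • e.2) with he₂
  have m1 : e₁ ∈ F ∪ {e₁, e₂} := Or.inr (.inl rfl)
  have m2 : e₂ ∈ F ∪ {e₁, e₂} := Or.inr (.inr rfl)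
  have a1 : e₁.start = e.start := rfl
  have a2 : e₁.finish = e.pt s := rfl
  have a3 : e₂.start = e.pt s := rfl
  have a4 : e₂.finish = e.finish := by rw [he₂, sub_finish, pt_one]
  have hF : F.Finite := hE'.finite.subset subset_union_left
  have hfin := hE'.finish_injOn
  have b1 {f : Edge} (hf : f ∈ F) : f.start ≠ e.start := fun h =>
    h1 (hE'.start_injOn (.inl hf) m1 h ▸ hf)
  have b2 {f : Edge} (hf : f ∈ F) : f.finish ≠ e.finish := fun h =>
    h2 (hfin (.inl hf) m2 (h.trans a4.symm) ▸ hf)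
  have b3 {f : Edge} (hf : f ∈ F) : f.start ≠ e.pt s := fun h =>
    h2 (hE'.start_injOn (.inl hf) m2 h ▸ hf)
  have b4 {f : Edge} (hf : f ∈ F) : f.finish ≠ e.pt s := fun h =>
    h1 (hfin (.inl hf) m1 h ▸ hf)
  have hfinish : InjOn Edge.finish (F ∪ {e}) := by
    rintro f (hf | rfl) g (hg | rfl) h
    exacts [hfin (.inl hf) (.inl hg) h, (b2 hf h).elim, (b2 hg h.symm).elim, rfl]
  have hstart : InjOn Edge.start (F ∪ {e}) := by
    rintro f (hf | rfl) g (hg | rfl) h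
    exacts [hE'.start_injOn (.inl hf) (.inl hg) h, (b1 hf h).elim, (b1 hg h.symm).elim, rfl]
  have hcl := hE'.closed
  simp only [image_union, image_pair, a1, a2, a3, a4] at hcl
  have hdeg : (e.pt s = e.start ↔ e.pt s = e.finish) ∧ (e.pt s = e.start → e₁ = e₂) := by
    refine ⟨⟨fun h => ?_, fun h => ?_⟩, fun h => hE'.start_injOn m1 m2 (by rw [a1, a3, h])⟩
    · rw [← a4, ← hE'.start_injOn m1 m2 (by rw [a1, a3, h]), a2]
    · rw [← a1, hfin m1 m2 (by rw [a2, a4, h]), a3]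
  have hin (z : Torus) (hz : z ≠ e.pt s ∨ e₁ = e₂) :
      ∃ r : ℝ, 0 < r ∧ inDir (F ∪ {e₁, e₂}) z = r • inDir (F ∪ {e}) z := by
    by_cases hze : e.finish = z
    · refine ⟨1 - s, by linarith, ?_⟩
      rw [inDir_eq hfin m2 (a4.trans hze), inDir_eq hfinish (.inr rfl) hze]
    · refine ⟨1, one_pos, ?_⟩
      rw [inDir_union, inDir_union, one_smul]
      · rintro _ rfl; exact hze
      · rintro _ (rfl | rfl) h
        exacts [hz.elim (fun hz => hz (h.symm.trans a2)) fun hz => hze (by rw [← a4, ← hz, h]),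
          hze (a4.symm.trans h)]
  have hout (z : Torus) (hz : z ≠ e.pt s ∨ e₁ = e₂) :
      ∃ r : ℝ, 0 < r ∧ outDir (F ∪ {e₁, e₂}) z = r • outDir (F ∪ {e}) z := by
    by_cases hze : e.start = z
    · refine ⟨s, hs0, ?_⟩
      rw [outDir_eq hE'.start_injOn m1 (a1.trans hze), outDir_eq hstart (.inr rfl) hze]
    · refine ⟨1, one_pos, ?_⟩
      rw [outDir_union, outDir_union, one_smul]
      · rintro _ rfl; exact hze
      · rintro _ (rfl | rfl) h
        exacts [hze (a1.symm.trans h),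
          hz.elim (fun hz => hz (h.symm.trans a3)) fun hz => hze (by rw [← a1, hz, h])]
  refine ⟨⟨hF.union (finite_singleton _), ?_, hstart⟩, ?_⟩
  · simp only [image_union, image_singleton]
    by_cases hd : e.pt s = e.start
    · have hd' := hdeg.1.1 hd
      simpa [hd, ← hd', ← hd.symm.trans hd'] using hcl
    · have hd' := fun h => hd (hdeg.1.2 h)
      ext z
      by_cases hz : z = e.pt s
      · subst hz
        refine iff_of_false ?_ ?_ <;> rintro (⟨f, hf, h⟩ | h)
        exacts [b4 hf h, hd' h, b3 hf h, hd h]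
      · simpa [hz] using Set.ext_iff.1 hcl z
  · refine finsum_congr fun z => ?_
    by_cases hz : z ≠ e.pt s ∨ e₁ = e₂
    · obtain ⟨r, hr, h⟩ := hin z hz
      obtain ⟨r', hr', h'⟩ := hout z hz
      rw [h, h', turn_smul_left hr, turn_smul_right hr']
    · push Not at hz
      obtain ⟨rfl, hne⟩ := hz
      rw [inDir_eq hfin m1 a2, outDir_eq hE'.start_injOn m2 a3, he₁, he₂,
        turn_self_smul _ hs0 (by linarith), inDir_eq_zero, turn_zero_left]
      rintro f (hf | rfl) h
      exacts [b4 hf h, hne (hdeg.2 (hdeg.1.2 h.symm))]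

lemma Subdivision.isClosedCurve (h : Subdivision E E')
    (hE' : IsClosedCurve E') : IsClosedCurve E ∧ rotation E = rotation E' := by
  induction h with
  | refl => exact ⟨hE', rfl⟩
  | tail _ hs ih =>
    obtain ⟨h1, h2⟩ := hs.isClosedCurve hE'
    obtain ⟨h3, h4⟩ := ih h1
    exact ⟨h3, h4.trans h2⟩

lemma Deformation.rotation_eq (h : Deformation α β) :
    rotation α.edges = rotation β.edges := by
  obtain ⟨Φ, hc, h0, hm, h1⟩ := h
  have hα := α.isMulticurve
  have h0' : Φ 0 '' α.edges = α.edges := by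
    rw [Set.image_congr h0]; simp
  -- successors do not change
  have hstart {e : Edge} (he : e ∈ α.edges) : Continuous fun t => (Φ t e).start :=
    continuous_fst.comp (hc e he)
  have hfinish {e : Edge} (he : e ∈ α.edges) : Continuous fun t => (Φ t e).finish :=
    (continuous_fst.comp (hc e he)).add (continuous_proj.comp (continuous_snd.comp (hc e he)))
  have hσ : ∀ e ∈ α.edges, ∃ f ∈ α.edges, ∀ t, (Φ t e).finish = (Φ t f).start := by
    intro e he
    obtain ⟨f, hf, hfe⟩ := hα.exists_start he
    set C : Edge → Set unitInterval := fun g => {t | (Φ t e).finish = (Φ t g).start} with hC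
    have hCc {g : Edge} (hg : g ∈ α.edges) : IsClosed (C g) := isClosed_eq (hfinish he) (hstart hg)
    have hcompl : (C f)ᶜ = ⋃ g ∈ α.edges \ {f}, C g := by
      ext t
      simp only [Set.mem_compl_iff, mem_iUnion, hC, mem_ofPred_eq]
      constructor
      · intro ht
        obtain ⟨_, ⟨g, hg, rfl⟩, hge⟩ := (hm t).2.exists_start (mem_image_of_mem _ he)
        exact ⟨g, ⟨hg, by rintro rfl; exact ht hge.symm⟩, hge.symm⟩
      · rintro ⟨g, ⟨hg, hgf⟩, hge⟩ ht
        exact hgf ((hm t).1 hg hf ((hm t).2.start_injOn (mem_image_of_mem _ hg)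
          (mem_image_of_mem _ hf) (hge.symm.trans ht)))
    have hclopen : IsClopen (C f) := by
      refine ⟨hCc hf, ?_⟩
      rw [← isClosed_compl_iff, hcompl]
      exact (hα.finite.subset sdiff_subset).isClosed_biUnion fun g hg => hCc hg.1
    have huniv := hclopen.eq_univ ⟨0, by rw [hC, mem_ofPred_eq, h0 e he, h0 f hf, hfe]⟩
    exact ⟨f, hf, fun t => by have : t ∈ C f := huniv ▸ Set.mem_univ t; exact this⟩
  choose! σ hσm hσ using hσ
  have hrot (t : unitInterval) : rotation (Φ t '' α.edges) =
      ∑ e ∈ hα.finite.toFinset, turn (Φ t e).2 (Φ t (σ e)).2 := by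
    rw [(hm t).2.isClosedCurve.rotation_eq, ← finsum_mem_eq_finite_toFinset_sum (fun e : Edge =>
      turn e.2 (outDir (Φ t '' α.edges) e.finish)), finsum_mem_image (hm t).1,
      finsum_mem_eq_finite_toFinset_sum _ hα.finite]
    refine sum_congr rfl fun e he => ?_
    rw [hα.finite.mem_toFinset] at he
    rw [outDir_eq (hm t).2.start_injOn (mem_image_of_mem _ (hσm e he)) (hσ e he t).symm]
  have hcont : Continuous fun t => rotation (Φ t '' α.edges) / (2 * π) := by
    simp only [hrot]
    refine Continuous.div_const (continuous_finsetSum _ fun e he => ?_) _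
    rw [hα.finite.mem_toFinset] at he
    have hC : Continuous toC := by
      have : toC = Complex.equivRealProdCLM.symm := by funext u; apply Complex.ext <;> simp [toC]
      rw [this]; exact Complex.equivRealProdCLM.symm.continuous
    refine continuous_iff_continuousAt.2 fun t => ContinuousAt.comp (g := Complex.arg)
      (f := fun t => star (toC (Φ t e).2) * toC (Φ t (σ e)).2) (Complex.continuousAt_arg ?_) ?_
    · refine mem_slitPlane (fun r hr => (hm t).2.not_backtrack (mem_image_of_mem _ (hσm e he))
        (mem_image_of_mem _ he) (hσ e he t) hr) ((hm t).2.disp_ne_zero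
        (mem_image_of_mem _ he)) ((hm t).2.disp_ne_zero (mem_image_of_mem _ (hσm e he)))
    · exact ((hC.comp (continuous_snd.comp (hc e he))).star.mul
        (hC.comp (continuous_snd.comp (hc _ (hσm e he))))).continuousAt
  have hp := pi_pos
  have key := eq_of_continuous_int hcont fun t => by
    obtain ⟨k, hk⟩ := (hm t).2.isClosedCurve.exists_rotation_eq fun e he => (hm t).2.disp_ne_zero he
    exact ⟨k, by rw [hk]; field_simp⟩
  rw [h0', h1] at key
  exact (div_left_inj' (by positivity)).1 key

lemma Isotopic.rotation_eq (h : Isotopic α β) :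
    rotation α.edges = rotation β.edges := by
  induction h with
  | rel α β h =>
    rcases h with h | h
    · exact (h.isClosedCurve β.isMulticurve.isClosedCurve).2
    · exact h.rotation_eq
  | refl α => rfl
  | symm α β _ ih => exact ih.symm
  | trans α β γ _ _ ih ih' => exact ih.trans ih'

/-! ### Changing a curve at a corner of a disc -/

/-- `F` does not run into the cone spanned by `b` and `c` at `z`. -/
def Avoids (F : Set Edge) (z : Torus) (b c : Plane) : Prop :=
  ∀ l m : ℝ, 0 ≤ l → 0 ≤ m → l • b + m • c ≠ 0 →
    ¬ ∀ t ∈ Icc₀₁, z + proj (t • (l • b + m • c)) ∈ support F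

lemma Avoids.turn_out {z : Torus} (h : Avoids F z b c)
    (hbc : det b c ≠ 0) (hf : f ∈ F) (hfz : f.finish = z) (h0 : f.2 ≠ 0) :
    turn f.2 c - turn f.2 b = turn b c := by
  rw [← turn_add h0 hbc fun l m hl hm heq => h l m hl hm (heq ▸ neg_ne_zero.2 h0) fun t ht => ?_]
  · ring
  · refine ⟨f, hf, 1 - t, ⟨by linarith [ht.2], by linarith [ht.1]⟩, ?_⟩
    rw [← heq, ← hfz, Edge.pt, Edge.finish, add_assoc, ← proj_add]; congr 2; module

lemma Avoids.turn_in {z : Torus} (h : Avoids F z (-b) (-c))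
    (hbc : det b c ≠ 0) (hf : f ∈ F) (hfz : f.start = z) (h0 : f.2 ≠ 0) :
    turn c f.2 - turn b f.2 = turn c b := by
  have key : ∀ l m : ℝ, 0 ≤ l → 0 ≤ m → -f.2 ≠ l • b + m • c := fun l m hl hm heq => by
    have e : l • -b + m • -c = f.2 := by rw [← neg_neg f.2, heq]; module
    refine h l m hl hm (e ▸ h0) fun t ht => ⟨f, hf, t, ht, ?_⟩
    rw [e, ← hfz]; rfl
  obtain ⟨hb, hc⟩ := ne_zero_of_det hbc
  have := turn_add h0 hbc key
  rw [turn_swap (u := f.2) (w := c) (fun r hr heq => key 0 r le_rfl hr.le (by rw [heq]; module))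
    h0 hc, turn_swap (u := f.2) (w := b) (fun r hr heq => key r 0 hr.le le_rfl (by rw [heq]; module))
    h0 hb, turn_swap_of_det hbc]
  linarith

lemma infinite_ray (z : Torus) (hv : v ≠ 0) {ε : ℝ} (hε : 0 < ε) :
    ((fun t : ℝ => z + proj (t • v)) '' Ioo 0 ε).Infinite := by
  have hcont : Continuous fun t : ℝ => z + proj (t • v) :=
    continuous_const.add (continuous_proj.comp (by fun_prop))
  refine (isPreconnected_Ioo.image _ hcont.continuousOn).infinite_of_nontrivial ?_
  have hn := norm_pos_iff.2 hv
  set δ := min (ε / 3) (1 / (2 * ‖v‖))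
  have h1 : δ ≤ ε / 3 := min_le_left _ _
  have h2 : δ ≤ 1 / (2 * ‖v‖) := min_le_right _ _
  have h3 : 0 < δ := lt_min (by positivity) (by positivity)
  refine ⟨_, ⟨δ, ⟨h3, by linarith⟩, rfl⟩, _, ⟨2 * δ, ⟨by linarith, by linarith⟩, rfl⟩, fun h => ?_⟩
  have h4 := eq_of_proj_eq_of_norm_lt (add_left_cancel h) (by
    rw [two_mul, add_smul, add_sub_cancel_left, norm_smul, norm_of_nonneg h3.le]
    have := mul_le_mul_of_nonneg_right h2 hn.le
    rw [one_div, mul_inv, mul_assoc, inv_mul_cancel₀ hn.ne'] at this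
    linarith)
  rw [two_mul, add_smul, left_eq_add] at h4
  exact smul_ne_zero h3.ne' hv h4

/-- A curve that meets a disc in finitely many points does not run into its corners. -/
lemma avoids_of_convex {o : Torus} {x y : Plane} {K : Set (ℝ × ℝ)}
    (hK : Convex ℝ K) (hfin : (support F ∩ coords o x y '' K).Finite) {q b c : ℝ × ℝ} (hq : q ∈ K)
    (hb : q + b ∈ K) (hc : q + c ∈ K) :
    Avoids F (coords o x y q) (b.1 • x + b.2 • y) (c.1 • x + c.2 • y) := by
  intro l m hl hm h0 hsub
  set v := l • (b.1 • x + b.2 • y) + m • (c.1 • x + c.2 • y) with hv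
  have hε1 : (l + m + 1)⁻¹ * (l + m + 1) = 1 := inv_mul_cancel₀ (by positivity)
  refine (infinite_ray (coords o x y q) h0 (ε := (l + m + 1)⁻¹) (by positivity)) (hfin.subset ?_)
  rintro _ ⟨t, ⟨t0, t1⟩, rfl⟩
  have h1 := mul_lt_mul_of_pos_right t1 (show 0 < l + m + 1 by positivity)
  rw [hε1] at h1
  have hl' := mul_nonneg t0.le hl
  have hm' := mul_nonneg t0.le hm
  refine ⟨hsub t ⟨t0.le, by linarith⟩, q + (t * l) • b + (t * m) • c, ?_, ?_⟩
  · have := hK.sum_mem (t := (Finset.univ : Finset (Fin 3)))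
      (w := ![1 - t * l - t * m, t * l, t * m]) (z := ![q, q + b, q + c])
      (by intro i _; fin_cases i <;> simp <;> linarith)
      (by simp [Fin.sum_univ_three]; ring)
      (by intro i _; fin_cases i <;> simp [hq, hb, hc])
    simp only [Fin.sum_univ_three] at this
    convert this using 1
    simp
    module
  · simp only [coords, hv]
    rw [add_assoc o, ← proj_add]; congr 2
    simp only [fst_add, snd_add, smul_fst, smul_snd, smul_eq_mul]
    module

lemma Avoids.of_smul {z : Torus} {k : ℝ} (hk : 0 < k)
    (h : Avoids F z (k • b) (k • c)) : Avoids F z b c := by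
  intro l m hl hm h0
  have := h (l / k) (m / k) (by positivity) (by positivity)
  simp only [smul_smul, div_mul_cancel₀ _ hk.ne'] at this
  exact this h0

/-! ### The skein relations and the invariants -/

def vertexTurn (E : Set Edge) (z : Torus) : ℝ := turn (inDir E z) (outDir E z)

section

variable {E E' F : Set Edge} {e e' f : Edge}

lemma vertexTurn_out (hE : IsClosedCurve E) (hE' : IsClosedCurve E') (hF : F ⊆ E)
    (hF' : F ⊆ E') (he : e ∈ E) (he' : e' ∈ E') (hf : f ∈ F) (h0 : f.2 ≠ 0)
    (hd : det e'.2 e.2 ≠ 0) {z : Torus} (hz : e.start = z) (hz' : e'.start = z) (hfz : f.finish = z)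
    (hA : Avoids F z e'.2 e.2) : vertexTurn E z - vertexTurn E' z = turn e'.2 e.2 := by
  rw [vertexTurn, vertexTurn, inDir_eq hE.finish_injOn (hF hf) hfz,
    inDir_eq hE'.finish_injOn (hF' hf) hfz, outDir_eq hE.start_injOn he hz,
    outDir_eq hE'.start_injOn he' hz']
  exact hA.turn_out hd hf hfz h0

lemma vertexTurn_in (hE : IsClosedCurve E) (hE' : IsClosedCurve E') (hF : F ⊆ E)
    (hF' : F ⊆ E') (he : e ∈ E) (he' : e' ∈ E') (hf : f ∈ F) (h0 : f.2 ≠ 0)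
    (hd : det e'.2 e.2 ≠ 0) {z : Torus} (hz : e.finish = z) (hz' : e'.finish = z) (hfz : f.start = z)
    (hA : Avoids F z (-e'.2) (-e.2)) : vertexTurn E z - vertexTurn E' z = turn e.2 e'.2 := by
  rw [vertexTurn, vertexTurn, outDir_eq hE.start_injOn (hF hf) hfz,
    outDir_eq hE'.start_injOn (hF' hf) hfz, inDir_eq hE.finish_injOn he hz,
    inDir_eq hE'.finish_injOn he' hz']
  exact hA.turn_in hd hf hfz h0

end

lemma vertexTurn_eq {P' : Set Edge} {z : Torus} (h : ∀ e ∈ P, e.start ≠ z ∧ e.finish ≠ z)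
    (h' : ∀ e ∈ P', e.start ≠ z ∧ e.finish ≠ z) :
    vertexTurn (F ∪ P) z = vertexTurn (F ∪ P') z := by
  rw [vertexTurn, vertexTurn, inDir_union fun e he => (h e he).2,
    inDir_union fun e he => (h' e he).2, outDir_union fun e he => (h e he).1,
    outDir_union fun e he => (h' e he).1]

section

variable {F : Set Edge} {p : Torus} {a b : Plane}

lemma OutsideParallelogram.rotation_saddle (h : OutsideParallelogram F p a b)
    (hE : IsClosedCurve (F ∪ {((p, b) : Edge), (p + proj (a + b), -b)}))
    (hE' : IsClosedCurve (F ∪ {((p, a) : Edge), (p + proj (a + b), -a)})) (h0 : ∀ e ∈ F, e.2 ≠ 0) :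
    rotation (F ∪ {((p, b) : Edge), (p + proj (a + b), -b)}) =
      rotation (F ∪ {((p, a) : Edge), (p + proj (a + b), -a)}) + 2 * π := by
  classical
  have hd := h.pos
  have k00 : p = coords p a b (0, 0) := by simp [coords, proj_zero]
  have k10 : p + proj a = coords p a b (1, 0) := by simp [coords]
  have k11 : p + proj (a + b) = coords p a b (1, 1) := by simp [coords]
  have k01 : p + proj b = coords p a b (0, 1) := by simp [coords]
  have n1 : p ≠ p + proj a := fun e => by simpa using h.inj (k00.symm.trans (e.trans k10))
  have n2 : p ≠ p + proj (a + b) := fun e => by simpa using h.inj (k00.symm.trans (e.trans k11))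
  have n3 : p ≠ p + proj b := fun e => by simpa using h.inj (k00.symm.trans (e.trans k01))
  have n4 : p + proj a ≠ p + proj (a + b) := fun e => by
    simpa using h.inj (k10.symm.trans (e.trans k11))
  have n5 : p + proj a ≠ p + proj b := fun e => by simpa using h.inj (k10.symm.trans (e.trans k01))
  have n6 : p + proj (a + b) ≠ p + proj b := fun e => by
    simpa using h.inj (k11.symm.trans (e.trans k01))
  have hav {q b' c : ℝ × ℝ} := avoids_of_convex (F := F) (o := p) (x := a) (y := b)
    ((convex_Icc (0 : ℝ) 1).prod (convex_Icc (0 : ℝ) 1))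
    ((toFinite _).subset h.outside) (q := q) (b := b') (c := c)
  have f1 (v : Plane) : Edge.finish (p, v) = p + proj v := rfl
  have f2 : Edge.finish (p + proj (a + b), -b) = p + proj a := by
    rw [Edge.finish, add_assoc, ← proj_add]; simp
  have f4 : Edge.finish (p + proj (a + b), -a) = p + proj b := by
    rw [Edge.finish, add_assoc, ← proj_add]; simp
  have s1 (z : Torus) (v : Plane) : Edge.start (z, v) = z := rfl
  have mem {g : Edge} (hg : g ∈ F ∪ {((p, b) : Edge), (p + proj (a + b), -b)})
      (e : g.finish = p ∨ g.finish = p + proj (a + b) ∨ g.start = p + proj b ∨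
        g.start = p + proj a) : g ∈ F := by
    rcases hg with hg | rfl | rfl
    · exact hg
    all_goals
      simp [-add_eq_left, f1, f2, s1, n1, n3, n4, n6, n1.symm, n3.symm, n4.symm, n6.symm] at e
  obtain ⟨g1, hg1, e1⟩ := hE.exists_finish (Or.inr (.inl rfl))
  obtain ⟨g2, hg2, e2⟩ := hE.exists_finish (Or.inr (.inr rfl))
  obtain ⟨g3, hg3, e3⟩ := hE.exists_start (Or.inr (.inl rfl))
  obtain ⟨g4, hg4, e4⟩ := hE.exists_start (Or.inr (.inr rfl))
  rw [s1] at e1 e2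
  rw [f1] at e3
  rw [f2] at e4
  replace hg1 := mem hg1 (by simp [e1])
  replace hg2 := mem hg2 (by simp [e2])
  replace hg3 := mem hg3 (by simp [e3])
  replace hg4 := mem hg4 (by simp [e4])
  have d1 := vertexTurn_out hE hE' subset_union_left subset_union_left
    (Or.inr (.inl rfl)) (Or.inr (.inl rfl)) hg1 (h0 _ hg1) hd.ne' rfl rfl e1 (by
      simpa [← k00, s1] using
        hav (q := (0, 0)) (b' := (1, 0)) (c := (0, 1)) (by simp) (by simp) (by simp))
  have d2 := vertexTurn_out hE hE' subset_union_left subset_union_left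
    (Or.inr (.inr rfl)) (Or.inr (.inr rfl)) hg2 (h0 _ hg2)
    (by simpa [det_neg_left, det_neg_right] using hd.ne') rfl rfl e2 (by
      simpa [← k11, s1] using
        hav (q := (1, 1)) (b' := (-1, 0)) (c := (0, -1)) (by simp) (by simp) (by simp))
  have d3 := vertexTurn_in hE hE' subset_union_left subset_union_left
    (Or.inr (.inl rfl)) (Or.inr (.inr rfl)) hg3 (h0 _ hg3)
    (by simpa [det_neg_left] using hd.ne') rfl f4 e3 (by
      simpa [← k01, f1] using
        hav (q := (0, 1)) (b' := (1, 0)) (c := (0, -1)) (by simp) (by simp) (by simp))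
  have d4 := vertexTurn_in hE hE' subset_union_left subset_union_left
    (Or.inr (.inr rfl)) (Or.inr (.inl rfl)) hg4 (h0 _ hg4)
    (by simpa [det_neg_right] using hd.ne') f2 rfl e4 (by
      simpa [← k10] using
        hav (q := (1, 0)) (b' := (-1, 0)) (c := (0, 1)) (by simp) (by simp) (by simp))
  have hsub := rotation_sub hE.finite hE'.finite {p, p + proj a, p + proj (a + b), p + proj b}
    fun z hz => by
      refine vertexTurn_eq ?_ ?_ <;> rintro e (rfl | rfl) <;> simp only [f1, f2, f4, s1] <;> grind
  change _ = ∑ z ∈ _, (vertexTurn _ z - vertexTurn _ z) at hsub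
  rw [sum_insert (by simp [n1, n2, n3]), sum_insert (by simp [n4, n5]),
    sum_insert (by simp [n6]), sum_singleton] at hsub
  have t1 := turn_add_neg hd
  have t2 : turn (-b) a = turn b (-a) := by rw [← turn_neg_neg, neg_neg]
  simp only [s1, f1, turn_neg_neg, t2] at d1 d2 d3 d4
  linarith

lemma OutsideParallelogram.homology_saddle (h : OutsideParallelogram F p a b) (hF : F.Finite) :
    homology (F ∪ {((p, b) : Edge), (p + proj (a + b), -b)}) = homology F ∧
      homology (F ∪ {((p, a) : Edge), (p + proj (a + b), -a)}) = homology F := by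
  have key {e : Edge} {s t : ℝ} (he : e.pt (1 / 2) = coords p a b (s, t))
      (hs : 0 ≤ s ∧ s ≤ 1 ∧ 0 ≤ t ∧ t ≤ 1) (hc : ¬ ((s = 0 ∨ s = 1) ∧ (t = 0 ∨ t = 1))) :
      e ∉ F := fun hF' => hc (h.corner_of_mem (he ▸ pt_mem_support hF' (by norm_num)) hs)
  have hd := ne_zero_of_det h.pos.ne'
  have hh {v : Plane} (hv : v ≠ 0) (h1 : ((p, v) : Edge) ∉ F) (h2 : (p + proj (a + b), -v) ∉ F) :
      homology (F ∪ {((p, v) : Edge), (p + proj (a + b), -v)}) = homology F := by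
    rw [homology_union hF (toFinite _) (by simp [h1, h2]),
      homology_pair fun e => hv (self_eq_neg.1 (congrArg Prod.snd e))]; simp
  refine ⟨hh hd.2 (key (coords_left p a b _) ?_ ?_) (key (coords_right p a b _) ?_ ?_),
    hh hd.1 (key (coords_bottom p a b _) ?_ ?_) (key (coords_top p a b _) ?_ ?_)⟩ <;> norm_num

end

/-- The edges of a triangle that is disjoint from the rest of the curve. -/
lemma union_triangle {p : Torus} {x y : Plane} (hxy : det x y ≠ 0)
    (hm : IsMulticurve (E ∪ triangleBoundary p x y))
    (hdisj : Disjoint (triangle p x y) (support E)) :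
    IsClosedCurve E ∧ homology (E ∪ triangleBoundary p x y) = homology E ∧
      rotation (E ∪ triangleBoundary p x y) =
        rotation E + if 0 < det x y then 2 * π else -(2 * π) := by
  classical
  have hE : E.Finite := hm.finite.subset subset_union_left
  have hTs := hm.start_injOn.mono Set.subset_union_right
  have hmem1 : ((p, x) : Edge) ∈ triangleBoundary p x y := .inl rfl
  have hmem2 : ((p + proj x, y) : Edge) ∈ triangleBoundary p x y := Or.inr (.inl rfl)
  have hmem3 : ((p + proj (x + y), -(x + y)) : Edge) ∈ triangleBoundary p x y :=
    Or.inr (.inr rfl)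
  have hT : triangleBoundary p x y = {(p, x), (p + proj x, y), (p + proj (x + y), -(x + y))} := rfl
  set T := triangleBoundary p x y
  have hst {z w : Torus} {u v : Plane} (he : (z, u) ∈ T) (hf : (w, v) ∈ T) (hd : det u v ≠ 0) :
      z ≠ w := fun e => by
    obtain rfl := congrArg Prod.snd (hTs he hf e); exact hd (det_self _)
  have n1 := hst hmem1 hmem2 hxy
  have n2 := hst hmem1 hmem3 (by simpa [det_neg_right, det_add_right, det_self] using hxy)
  have n3 := hst hmem2 hmem3
    (by rw [det_neg_right, det_add_right, det_self, det_comm]; simpa using hxy)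
  have f1 : Edge.finish (p + proj x, y) = p + proj (x + y) := by
    rw [Edge.finish, add_assoc, ← proj_add]
  have f2 : Edge.finish (p + proj (x + y), -(x + y)) = p := by
    rw [Edge.finish, add_assoc, ← proj_add]; simp [proj_zero]
  have hTc : IsClosedCurve T := by
    refine ⟨by rw [hT]; exact toFinite _, ?_, hTs⟩
    simp only [hT, Set.image_insert_eq, image_singleton, f1, f2]
    ext z
    simp only [Edge.finish, Edge.start, mem_insert_iff, mem_singleton_iff]
    tauto
  have hvert : ∀ f ∈ T, f.start ∈ triangle p x y ∧ f.finish ∈ triangle p x y := by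
    have t0 : p ∈ triangle p x y := ⟨(0, 0), by simp [triangleDomain], by simp [coords, proj_zero]⟩
    have t1 : p + proj x ∈ triangle p x y := ⟨(1, 0), by simp [triangleDomain], by simp [coords]⟩
    have t2 : p + proj (x + y) ∈ triangle p x y :=
      ⟨(1, 1), by simp [triangleDomain], by simp [coords]⟩
    rintro f (rfl | rfl | rfl)
    exacts [⟨t0, t1⟩, ⟨t1, f1 ▸ t2⟩, ⟨t2, f2.symm ▸ t0⟩]
  have hoff {e f : Edge} (he : e ∈ E) (hf : f ∈ T) : e.start ≠ f.start ∧ e.finish ≠ f.finish ∧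
      e.start ≠ f.finish ∧ e.finish ≠ f.start := by
    have hn {z : Torus} (hz : z ∈ triangle p x y) : e.start ≠ z ∧ e.finish ≠ z := by
      constructor <;> rintro rfl
      · exact Set.disjoint_left.1 hdisj hz ⟨e, he, 0, by simp, pt_zero e⟩
      · exact Set.disjoint_left.1 hdisj hz ⟨e, he, 1, by simp, pt_one e⟩
    have := hvert f hf
    exact ⟨(hn this.1).1, (hn this.2).2, (hn this.2).1, (hn this.1).2⟩
  have hT0 : homology T = 0 := by
    rw [hT, Set.insert_eq, homology_union (finite_singleton _)
      (toFinite _), homology_singleton, homology_pair fun h => n3 (congrArg Prod.fst h)]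
    · simp
    · simp [-add_eq_left, n1, n2]
  have hTr : rotation T = if 0 < det x y then 2 * π else -(2 * π) := by
    rw [rotation, finsum_eq_sum_of_support_subset (s := {p, p + proj x, p + proj (x + y)})]
    · rw [sum_insert (by simp [n1, n2]), sum_insert (by simp [n3]),
        sum_singleton, outDir_eq hTs (z := p) hmem1 rfl,
        outDir_eq hTs (z := p + proj x) hmem2 rfl, outDir_eq hTs (z := p + proj (x + y)) hmem3 rfl,
        inDir_eq hTc.finish_injOn hmem3 f2,
        inDir_eq hTc.finish_injOn (z := p + proj x) hmem1 rfl, inDir_eq hTc.finish_injOn hmem2 f1]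
      split_ifs with hpos
      · linarith [turn_triangle hpos]
      · linarith [turn_triangle_neg (lt_of_le_of_ne (not_lt.1 hpos) hxy)]
    · intro z hz
      obtain ⟨e, rfl | rfl | rfl, rfl⟩ := support_turn hz <;> simp [Edge.start]
  refine ⟨⟨hE, ?_, hm.start_injOn.mono subset_union_left⟩, ?_, ?_⟩
  · have hcl := hm.closed
    rw [image_union, image_union, hTc.closed] at hcl
    have hd {g : Edge → Torus} (hg : ∀ e ∈ E, ∀ f ∈ T, g e ≠ f.start) :
        Disjoint (g '' E) (Edge.start '' T) := by
      rw [disjoint_left]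
      rintro _ ⟨e, he, rfl⟩ ⟨f, hf, hfe⟩
      exact hg e he f hf hfe.symm
    rw [← (hd fun e he f hf => (hoff he hf).2.2.2).sup_sdiff_cancel_right,
      ← (hd fun e he f hf => (hoff he hf).1).sup_sdiff_cancel_right]
    exact congrArg (· \ _) hcl
  · rw [homology_union hE hTc.finite, hT0, add_zero]
    exact Set.disjoint_left.2 fun e he he' => (hoff he he').1 rfl
  · rw [rotation_union hE hTc.finite (fun e he f hf => hoff he hf), hTr]

/-! ### The invariant of the skein module -/

lemma Multicurve.exists_rotation (α : Multicurve) : ∃ k : ℤ, rotation α.edges = 2 * π * k :=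
  α.isMulticurve.isClosedCurve.exists_rotation_eq fun _ he => α.isMulticurve.disp_ne_zero he

/-- The turning number. -/
def Multicurve.rot (α : Multicurve) : ℤ := α.exists_rotation.choose

lemma Multicurve.rotation_eq (α : Multicurve) : rotation α.edges = 2 * π * α.rot :=
  α.exists_rotation.choose_spec

/-- The homology class in `ℤ²`. -/
def Multicurve.hom (α : Multicurve) : ℤ × ℤ := (exists_homology_eq α.isMulticurve).choose

lemma Multicurve.homology_eq (α : Multicurve) : homology α.edges = lat α.hom :=
  (exists_homology_eq α.isMulticurve).choose_spec

lemma Multicurve.hom_eq (h : homology α.edges = homology β.edges) :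
    α.hom = β.hom :=
  lat_injective (by rw [← α.homology_eq, ← β.homology_eq, h])

lemma Multicurve.rot_eq {k : ℤ}
    (h : rotation α.edges = rotation β.edges + 2 * π * k) : α.rot = β.rot + k := by
  rw [α.rotation_eq, β.rotation_eq, ← mul_add] at h
  have := mul_left_cancel₀ (by positivity) h
  exact_mod_cast this

def invariantFree : (Multicurve →₀ R) →ₗ[R] (ℤ × ℤ →₀ R) :=
  Finsupp.linearCombination R fun α => Finsupp.single α.hom ((qUnit ^ α.rot : Rˣ) : R)

lemma invariantFree_single (α : Multicurve) (r : R) : invariantFree (Finsupp.single α r) =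
    Finsupp.single α.hom (r * ((qUnit ^ α.rot : Rˣ) : R)) := by
  simp [invariantFree]

lemma invariantFree_eq (k : ℤ)
    (h : homology α.edges = homology β.edges)
    (hr : rotation α.edges = rotation β.edges + 2 * π * k) :
    invariantFree (Finsupp.single α 1) =
      invariantFree (Finsupp.single β ((qUnit ^ k : Rˣ) : R)) := by
  rw [invariantFree_single, invariantFree_single, Multicurve.hom_eq h, Multicurve.rot_eq hr, one_mul,
    add_comm, zpow_add, Units.val_mul]

section

variable {F : Set Edge} {p : Torus} {a b : Plane}

lemma OutsideParallelogram.rotate (h : OutsideParallelogram F p a b) :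
    OutsideParallelogram F (p + proj b) (-b) a := by
  have key (q : ℝ × ℝ) : coords (p + proj b) (-b) a q = coords p a b (q.2, 1 - q.1) := by
    rw [coords, coords, add_assoc, ← proj_add]; congr 2; module
  refine ⟨by rw [det_neg_left, det_comm]; simpa using h.pos, ?_, ?_⟩
  · rintro q ⟨⟨q1, q2⟩, q3, q4⟩ r ⟨⟨r1, r2⟩, r3, r4⟩ heq
    rw [key, key] at heq
    have := h.inj heq
    exact Prod.ext (by linarith) this.1
  · rintro _ ⟨hz, q, ⟨⟨q1, q2⟩, hq⟩, rfl⟩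
    rw [key] at hz ⊢
    have := h.outside ⟨hz, _, ⟨hq, by linarith, by linarith⟩, rfl⟩
    have e1 : p + proj b + proj (-b + a) = p + proj a := by
      rw [add_assoc, ← proj_add]; simp
    have e2 : p + proj b + proj (-b) = p := by rw [add_assoc, ← proj_add]; simp [proj_zero]
    have e3 : p + proj b + proj a = p + proj (a + b) := by
      rw [add_assoc, ← proj_add, add_comm b]
    rw [e1, e2, e3]
    rcases this with h | h | h | h <;> rw [h] <;> simp

/-- The invariants of the two sides of the antiparallel relations. -/
lemma OutsideParallelogram.invariants (h : OutsideParallelogram F p a b) {c : Torus} {x y : Plane}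
    (huv : (u = a ∧ v = b ∧ 0 < det x y) ∨ (u = b ∧ v = a ∧ det x y < 0))
    (hc : triangle c x y ⊆ openParallelogram p a b)
    (hα : α.edges = F ∪ {((p, v) : Edge), (p + proj (a + b), -v)})
    (hβ : β.edges = F ∪ {((p, u) : Edge), (p + proj (a + b), -u)} ∪ triangleBoundary c x y) :
    homology α.edges = homology β.edges ∧ rotation α.edges = rotation β.edges := by
  have hα' := α.isMulticurve
  have hβ' := β.isMulticurve
  rw [hα] at hα'
  rw [hβ] at hβ'
  have hF : F.Finite := hα'.finite.subset subset_union_left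
  have h0 : ∀ e ∈ F, e.2 ≠ 0 := fun e he => hα'.disp_ne_zero (.inl he)
  have hdisj : Disjoint (triangle c x y)
      (support (F ∪ {((p, u) : Edge), (p + proj (a + b), -u)})) := by
    rw [support_union, disjoint_left]
    rintro _ hz (hs | ⟨e, he, t, ⟨ht0, ht1⟩, het⟩) <;>
      obtain ⟨q, ⟨⟨q1, q2⟩, q3, q4⟩, rfl⟩ := hc hz
    · rcases h.corner_of_mem hs with ⟨h | h, -⟩ <;> linarith
    · rcases huv with ⟨rfl, -⟩ | ⟨rfl, -⟩ <;> rcases he with rfl | rfl <;>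
        [rw [coords_bottom p _ b] at het; rw [coords_top p _ b] at het;
          rw [coords_left p a] at het; rw [coords_right p a] at het] <;>
        linarith [h.inj het]
  have hd : det x y ≠ 0 := by rcases huv with ⟨-, -, h⟩ | ⟨-, -, h⟩ <;> [exact h.ne'; exact h.ne]
  obtain ⟨hcl, hh, hr⟩ := union_triangle hd hβ' hdisj
  obtain ⟨h1, h2⟩ := h.homology_saddle hF
  rw [hα, hβ, hh, hr]
  rcases huv with ⟨rfl, rfl, hpos⟩ | ⟨rfl, rfl, hneg⟩
  · exact ⟨h1.trans h2.symm,
      by rw [if_pos hpos, h.rotation_saddle hα'.isClosedCurve hcl h0]⟩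
  · refine ⟨h2.trans h1.symm, ?_⟩
    rw [if_neg hneg.le.not_gt, h.rotation_saddle hcl hα'.isClosedCurve h0]; ring

end

lemma SkeinRel.invariantFree_eq {f g : Multicurve →₀ R} (h : SkeinRel f g) :
    invariantFree f = invariantFree g := by
  cases h with
  | isotopy α β h =>
    simpa using OrientedSkein.invariantFree_eq 0 h.homology_eq (by simpa using h.rotation_eq)
  | circle_ccw α β p x y hxy hinj hdisj hβ =>
    obtain ⟨-, h1, h2⟩ := union_triangle hxy.ne' (hβ ▸ β.isMulticurve) hdisj
    rw [← hβ] at h1 h2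
    rw [if_pos hxy] at h2
    simpa [qUnit] using OrientedSkein.invariantFree_eq 1 h1 (by simpa using h2)
  | circle_cw α β p x y hxy hinj hdisj hβ =>
    obtain ⟨-, h1, h2⟩ := union_triangle hxy.ne (hβ ▸ β.isMulticurve) hdisj
    rw [← hβ] at h1 h2
    rw [if_neg hxy.le.not_gt] at h2
    simpa [qUnit] using OrientedSkein.invariantFree_eq (-1) h1 (by simpa using h2)
  | antiparallel_down_up α β F p a b hF c x y hxy hc hα hβ =>
    have e : p + proj b + proj (-b + a) = p + proj a := by rw [add_assoc, ← proj_add]; simp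
    have hc' : triangle c x y ⊆ openParallelogram (p + proj b) (-b) a := by
      refine hc.trans ?_
      rintro _ ⟨q, hq, rfl⟩
      refine ⟨(1 - q.2, q.1), ⟨⟨by linarith [hq.2.2], by linarith [hq.2.1]⟩, hq.1⟩, ?_⟩
      rw [coords, coords, add_assoc, ← proj_add]; congr 2; module
    obtain ⟨h1, h2⟩ := hF.rotate.invariants (u := a) (v := -b) (Or.inr ⟨rfl, rfl, hxy⟩) hc'
      (by rw [hα, e, neg_neg]) (by rw [hβ, e])
    simpa using OrientedSkein.invariantFree_eq 0 h1 (by simpa using h2)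
  | antiparallel_up_down α β F p a b hF c x y hxy hc hα hβ =>
    obtain ⟨h1, h2⟩ := hF.invariants (Or.inl ⟨rfl, rfl, hxy⟩) hc hα hβ
    simpa using OrientedSkein.invariantFree_eq 0 h1 (by simpa using h2)

/-- The invariant `[α] ↦ (-A²) ^ r(α) e_{h(α)}` of the skein module, where `r` is the turning number
and `h` the homology class. -/
def invariant : SkeinModule →ₗ[R] (ℤ × ℤ →₀ R) :=
  relations.liftQ invariantFree (by
    rw [relations, Submodule.span_le]
    rintro _ ⟨f, g, h, rfl⟩
    rw [SetLike.mem_coe, LinearMap.mem_ker, map_sub, h.invariantFree_eq, sub_self])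

lemma invariant_toSkein (α : Multicurve) :
    invariant α.toSkein = Finsupp.single α.hom ((qUnit ^ α.rot : Rˣ) : R) := by
  have : invariant α.toSkein = invariantFree (Finsupp.single α 1) := rfl
  rw [this, invariantFree_single, one_mul]

open Classical in
/-- A left inverse of the invariant. -/
def section₀ : (ℤ × ℤ →₀ R) →ₗ[R] SkeinModule :=
  Finsupp.linearCombination R fun n => if h : ∃ σ : Multicurve, σ.hom = n then
    ((qUnit ^ (-h.choose.rot) : Rˣ) : R) • h.choose.toSkein else 0

lemma section₀_single (α : Multicurve) (r : R) :
    section₀ (Finsupp.single α.hom r) = (r * ((qUnit ^ (-α.rot) : Rˣ) : R)) • α.toSkein := by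
  have h : ∃ σ : Multicurve, σ.hom = α.hom := ⟨α, rfl⟩
  rw [section₀, Finsupp.linearCombination_single, dif_pos h, mul_smul]
  have hσ := h.choose_spec
  set σ := h.choose
  obtain ⟨k, hk⟩ := skeinEquiv_of_homology_eq (α := α) (β := σ)
    (by rw [α.homology_eq, σ.homology_eq, hσ])
  have h1 := congrArg invariant hk
  rw [map_smul, invariant_toSkein, invariant_toSkein, hσ, Finsupp.smul_single, smul_eq_mul,
    ← Units.val_mul] at h1
  have h2 := Units.ext (Finsupp.single_injective _ h1)
  have h3 : ((qUnit ^ (-σ.rot) : Rˣ) : R) =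
      ((qUnit ^ (-α.rot) : Rˣ) : R) * ((qUnit ^ k : Rˣ) : R) := by
    rw [← Units.val_mul, zpow_neg, zpow_neg, h2, mul_inv_rev, mul_assoc, inv_mul_cancel, mul_one]
  rw [hk, h3, mul_smul]

lemma section₀_invariant (m : SkeinModule) : section₀ (invariant m) = m := by
  have : section₀ ∘ₗ invariant = LinearMap.id := by
    refine Submodule.linearMap_qext _ (Finsupp.lhom_ext fun α r => ?_)
    have e : (section₀ ∘ₗ invariant) (Submodule.Quotient.mk (Finsupp.single α r)) =
        Submodule.Quotient.mk (Finsupp.single α r) := by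
      rw [mk_single, LinearMap.comp_apply, map_smul, map_smul, invariant_toSkein, section₀_single,
        ← Units.val_mul, ← zpow_add, add_neg_cancel, zpow_zero, Units.val_one, one_smul]
    exact e
  exact LinearMap.congr_fun this m

/-! ### General position -/

/-- The plane is not the union of countably many lines. -/
lemma exists_off_lines {ι : Type*} [Countable ι] (w : ι → Plane) (c : ι → ℝ) (hw : ∀ i, w i ≠ 0) :
    ∃ v : Plane, ∀ i, det (w i) v ≠ c i := by
  by_contra! hcon
  have hsub : (Set.univ : Set ℝ) ⊆ ⋃ i, {x : ℝ | det (w i) (x, x ^ 2) = c i} := fun x _ => by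
    obtain ⟨i, hi⟩ := hcon (x, x ^ 2)
    exact Set.mem_iUnion.2 ⟨i, hi⟩
  refine Set.not_countable_univ (Set.Countable.mono hsub (Set.countable_iUnion fun i => ?_))
  let p : Polynomial ℝ := .C (w i).1 * .X ^ 2 - .C (w i).2 * .X - .C (c i)
  have hp : p ≠ 0 := fun h0 => hw i (Prod.ext
    (by simpa [p, Polynomial.coeff_X, Polynomial.coeff_C] using congrArg (Polynomial.coeff · 2) h0)
    (by simpa [p, Polynomial.coeff_X_pow, Polynomial.coeff_C] using
      congrArg (Polynomial.coeff · 1) h0))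
  refine (p.roots.toFinset.finite_toSet.subset fun x hx => ?_).countable
  simp only [mem_ofPred_eq, det] at hx
  simp [hp, p]; linarith

/-- Translation of an edge. -/
def Edge.translate (v : Plane) (e : Edge) : Edge := (e.1 + proj v, e.2)

lemma translate_pt (v : Plane) (e : Edge) (t : ℝ) : (e.translate v).pt t = e.pt t + proj v := by
  simp only [Edge.pt, Edge.translate]; abel

lemma translate_injective (v : Plane) : Function.Injective (Edge.translate v) := fun e _ h =>
  Prod.ext (add_right_cancel (congrArg Prod.fst h)) (show (e.translate v).2 = _ from h ▸ rfl)

lemma IsMulticurve.translate (h : IsMulticurve E) (v : Plane) :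
    IsMulticurve (Edge.translate v '' E) where
  finite := h.finite.image _
  closed := by
    have h1 : Edge.finish '' (Edge.translate v '' E) = (· + proj v) '' (Edge.finish '' E) := by
      simp only [Set.image_image]; congr 1; funext e; rw [← pt_one, translate_pt, pt_one]
    have h2 : Edge.start '' (Edge.translate v '' E) = (· + proj v) '' (Edge.start '' E) := by
      simp only [Set.image_image]; rfl
    rw [h1, h2, h.closed]
  embedded := by
    rintro ⟨_, s⟩ ⟨⟨e, he, rfl⟩, hs⟩ ⟨_, t⟩ ⟨⟨f, hf, rfl⟩, ht⟩ heq
    simp only [translate_pt] at heq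
    obtain ⟨rfl, rfl⟩ := h.eq_of_pt_eq he hf hs ht (add_right_cancel heq)
    rfl

lemma isotopic_translate (α : Multicurve) (v : Plane) :
    Isotopic α ⟨Edge.translate v '' α.edges, α.isMulticurve.translate v⟩ := by
  refine Relation.EqvGen.rel _ _ (Or.inr ⟨fun t => Edge.translate ((t : ℝ) • v), fun e _ => ?_,
    fun e _ => ?_, fun t => ⟨(translate_injective _).injOn, α.isMulticurve.translate _⟩, ?_⟩)
  · exact (continuous_const.add (continuous_proj.comp
      (continuous_subtype_val.smul continuous_const))).prodMk continuous_const
  · simp [Edge.translate, proj_zero]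
  · simp

/-- Every curve can be moved into general position with respect to finitely many curves. -/
lemma exists_isotopic_generalPosition (α β : Multicurve) :
    ∃ α', Isotopic α α' ∧ InGeneralPosition α' β := by
  have hαc : Countable α.edges := α.isMulticurve.finite.countable
  have hβc : Countable β.edges := β.isMulticurve.finite.countable
  choose a ha using fun e : Edge => proj_surjective e.1
  let w : α.edges × β.edges × (ℤ × ℤ) × Fin 4 → Plane := fun i =>
    if i.2.2.2 < 2 then i.2.1.1.2 else i.1.1.2
  let d : α.edges × β.edges × (ℤ × ℤ) × Fin 4 → Plane := fun i => a i.2.1.1 - a i.1.1 + lat i.2.2.1 +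
    if i.2.2.2 = 1 then -i.1.1.2 else if i.2.2.2 = 3 then i.2.1.1.2 else 0
  obtain ⟨v, hv⟩ := exists_off_lines w (fun i => det (w i) (d i)) fun i => by
    simp only [w]; split_ifs
    · exact β.isMulticurve.disp_ne_zero i.2.1.2
    · exact α.isMulticurve.disp_ne_zero i.1.2
  refine ⟨_, isotopic_translate α v, ?_⟩
  rintro _ ⟨e, he, rfl⟩ f hf s hs t ht heq
  rw [translate_pt, Edge.pt, Edge.pt, ← ha e, ← ha f, ← proj_add, ← proj_add, ← proj_add] at heq
  obtain ⟨n, hn⟩ := (proj_eq_iff _ _).1 heq.symm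
  have hvn : v = a f - a e + lat n + (t • f.2 - s • e.2) := by
    have : v = (a e + s • e.2 + v) - (a e + s • e.2) := by abel
    rw [this, hn]; module
  have key (k : Fin 4) := hv ⟨⟨e, he⟩, ⟨f, hf⟩, n, k⟩
  have k0 := key 0
  have k1 := key 1
  have k2 := key 2
  have k3 := key 3
  simp [w, d, hvn, det_add_right, det_sub_right, det_smul_right, det_self, det_neg_right] at k0 k1 k2 k3
  exact ⟨⟨hs.1.lt_of_ne (Ne.symm k0.1), hs.2.lt_of_ne (by rintro rfl; simp at k1)⟩,
    ⟨ht.1.lt_of_ne (Ne.symm k2.1), ht.2.lt_of_ne (by rintro rfl; simp at k3)⟩, k2.2⟩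

/-! ### Superposition diagrams -/

lemma finite_norm_lat_le (r : ℝ) : {n : ℤ × ℤ | ‖lat n‖ ≤ r}.Finite := by
  refine (isCompact_iff_finite.1 (isCompact_closedBall (0 : ℤ × ℤ) r)).subset fun n hn => ?_
  simpa [Prod.norm_def, lat, Int.norm_eq_abs] using hn

/-- Two curves in general position meet in finitely many points. -/
lemma InGeneralPosition.finite (h : InGeneralPosition α β) :
    (support α.edges ∩ support β.edges).Finite := by
  have hsub : support α.edges ∩ support β.edges ⊆ ⋃ e ∈ α.edges, ⋃ f ∈ β.edges,
      {z | ∃ s ∈ Icc₀₁, ∃ t ∈ Icc₀₁, e.pt s = z ∧ f.pt t = z} := by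
    rintro z ⟨⟨e, he, s, hs, hes⟩, ⟨f, hf, t, ht, hft⟩⟩
    simp only [mem_iUnion]
    exact ⟨e, he, f, hf, s, hs, t, ht, hes, hft⟩
  refine (α.isMulticurve.finite.biUnion fun e he => β.isMulticurve.finite.biUnion fun f hf =>
    ?_).subset hsub
  obtain ⟨a, ha⟩ := proj_surjective e.1
  obtain ⟨b, hb⟩ := proj_surjective f.1
  refine ((finite_norm_lat_le (‖a‖ + ‖b‖ + ‖e.2‖ + ‖f.2‖)).image fun n =>
    e.pt (det f.2 (b + lat n - a) / det f.2 e.2)).subset ?_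
  rintro z ⟨s, hs, t, ht, hes, hft⟩
  have hd := (h e he f hf s hs t ht (hes.trans hft.symm)).2.2
  have heq : proj (b + t • f.2) = proj (a + s • e.2) := by
    rw [proj_add, proj_add, ha, hb]; exact hft.trans hes.symm
  obtain ⟨n, hn⟩ := (proj_eq_iff _ _).1 heq
  have hbd {r : ℝ} (hr : r ∈ Icc₀₁) (v : Plane) : ‖r • v‖ ≤ ‖v‖ := by
    rw [norm_smul, norm_of_nonneg hr.1]; exact mul_le_of_le_one_left (norm_nonneg v) hr.2
  refine ⟨n, ?_, ?_⟩
  · rw [mem_ofPred_eq, show lat n = a + s • e.2 - (b + t • f.2) by rw [hn]; abel]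
    linarith [norm_sub_le (a + s • e.2) (b + t • f.2), norm_add_le a (s • e.2),
      norm_add_le b (t • f.2), hbd hs e.2, hbd ht f.2]
  · have hd' : det f.2 e.2 ≠ 0 := by rw [det_comm]; simpa using hd
    have : s = det f.2 (b + lat n - a) / det f.2 e.2 := by
      rw [eq_div_iff hd', ← det_smul_right,
        show b + lat n - a = s • e.2 - t • f.2 by
          rw [show b + lat n - a = (b + t • f.2 + lat n) - t • f.2 - a by abel, ← hn]; abel,
        det_sub_right, det_smul_right t, det_self]
      ring
    beta_reduce
    rw [← this, hes]

lemma eventually_small (c : ℝ) {ε : ℝ} (hε : 0 < ε) : ∀ᶠ δ : ℝ in 𝓝[>] 0, δ * c < ε := by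
  have h1 : Tendsto (fun δ : ℝ => δ * c) (𝓝[>] 0) (𝓝 (0 * c)) :=
    (tendsto_id.mul_const c).mono_left nhdsWithin_le_nhds
  rw [zero_mul] at h1
  exact h1.eventually_lt_const hε

lemma norm_comb_lt {δ ε : ℝ} (hδ : 0 < δ) (h : δ * (‖u‖ + ‖w‖) < ε) {q : ℝ × ℝ}
    (hq : |q.1| + |q.2| ≤ 1) : ‖q.1 • δ • u + q.2 • δ • w‖ < ε := by
  refine (norm_add_le _ _).trans_lt (lt_of_le_of_lt ?_ h)
  simp only [norm_smul, Real.norm_eq_abs, abs_of_pos hδ, mul_add]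
  have hu : 0 ≤ δ * ‖u‖ := by positivity
  have hw : 0 ≤ δ * ‖w‖ := by positivity
  exact add_le_add (mul_le_of_le_one_left hu (by linarith [abs_nonneg q.2]))
    (mul_le_of_le_one_left hw (by linarith [abs_nonneg q.1]))

lemma eventually_coords {U : Set Torus} (hU : IsOpen U) {z : Torus} (hz : z ∈ U) (u w : Plane) :
    ∀ᶠ δ : ℝ in 𝓝[>] 0, ∀ q ∈ Crossing.discDomain, coords z (δ • u) (δ • w) q ∈ U := by
  have hc : Continuous fun v : Plane => z + proj v := continuous_const.add continuous_proj
  obtain ⟨ε, hε, hball⟩ := Metric.isOpen_iff.1 (hU.preimage hc) 0 (by simpa [proj_zero] using hz)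
  filter_upwards [eventually_small (‖u‖ + ‖w‖) hε, self_mem_nhdsWithin] with δ hδ hδ0 q hq
  exact hball (mem_ball_zero_iff.2 (norm_comb_lt hδ0 hδ hq))

lemma eventually_embedded (z : Torus) (hd : det u w ≠ 0) : ∀ᶠ δ : ℝ in 𝓝[>] 0,
    InjOn (coords z (δ • u) (δ • w)) Crossing.discDomain := by
  filter_upwards [eventually_small (‖u‖ + ‖w‖) one_half_pos, self_mem_nhdsWithin]
    with δ h1 (h0 : 0 < δ) q hq r hr heq
  have hz := eq_of_proj_eq_of_norm_lt (add_left_cancel heq) (by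
    linarith [norm_sub_le (r.1 • δ • u + r.2 • δ • w) (q.1 • δ • u + q.2 • δ • w),
      norm_comb_lt h0 h1 hq, norm_comb_lt h0 h1 hr])
  have hz' : (r.1 - q.1) • u + (r.2 - q.2) • w = 0 := by
    refine (smul_eq_zero.1 (?_ : δ • ((r.1 - q.1) • u + (r.2 - q.2) • w) = 0)).resolve_left h0.ne'
    rw [← sub_eq_zero.2 hz.symm]; module
  have e1 := congrArg (det u) hz'
  have e2 := congrArg (det w) hz'
  rw [det_add_right, det_smul_right, det_smul_right, det_self, det_zero_right] at e1 e2
  have hd' : det w u ≠ 0 := by rw [det_comm]; simpa using hd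
  simp only [mul_zero, zero_add, add_zero, mul_eq_zero, hd, hd', or_false] at e1 e2
  exact Prod.ext (by linarith) (by linarith)

/-- Near an interior point of an edge, the curve is the edge. -/
lemma eventually_on_edge (he : e ∈ α.edges)
    (hs : s ∈ Ioo₀₁) (hd : det e.2 w ≠ 0) : ∀ᶠ δ : ℝ in 𝓝[>] 0,
    ∀ q ∈ Crossing.discDomain, coords (e.pt s) (δ • e.2) (δ • w) q ∈ support α.edges → q.2 = 0 := by
  have hm := α.isMulticurve
  obtain ⟨η, h1, h2, h3, (h5 : 0 < η)⟩ := ((eventually_small 1 hs.1).and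
    ((eventually_small 1 (sub_pos.2 hs.2)).and
    ((eventually_small ‖e.2‖ one_half_pos).and self_mem_nhdsWithin))).exists
  rw [mul_one] at h1 h2
  set C := support (α.edges \ {e}) ∪ e.pt '' (Icc 0 (s - η) ∪ Icc (s + η) 1) with hC
  have hCc : IsClosed C := (isCompact_support (hm.finite.subset sdiff_subset)).isClosed.union
    ((isCompact_Icc.union isCompact_Icc).image (continuous_pt e)).isClosed
  have hpt1 : ∀ d ∈ α.edges, d.pt 1 ≠ e.pt s := fun d hd' h => by
    obtain ⟨d', hd', hdd⟩ := hm.exists_start hd'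
    have := (hm.eq_of_pt_eq hd' he zero_mem_Ico ⟨hs.1.le, hs.2⟩
      (by rw [pt_zero, hdd, ← pt_one, h])).2
    exact hs.1.ne this
  have hzC : e.pt s ∉ C := by
    rintro (⟨d, ⟨hd, hde⟩, t, ht, hdt⟩ | ⟨t, ht, het⟩)
    · rcases ht.2.eq_or_lt with rfl | ht1
      · exact hpt1 d hd hdt
      · exact hde (hm.eq_of_pt_eq hd he ⟨ht.1, ht1⟩ ⟨hs.1.le, hs.2⟩ hdt).1
    · have ht01 : 0 ≤ t ∧ t ≤ 1 ∧ t ≠ s := by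
        rcases ht with ht | ht
        · exact ⟨ht.1, by linarith [ht.2, hs.2], by linarith [ht.2]⟩
        · exact ⟨by linarith [ht.1, hs.1], ht.2, by linarith [ht.1]⟩
      rcases ht01.2.1.eq_or_lt with rfl | ht1
      · exact hpt1 e he het
      · exact ht01.2.2 (hm.eq_of_pt_eq he he ⟨ht01.1, ht1⟩ ⟨hs.1.le, hs.2⟩ het).2
  filter_upwards [eventually_coords hCc.isOpen_compl hzC e.2 w,
    eventually_small (‖e.2‖ + ‖w‖) one_half_pos, self_mem_nhdsWithin]
    with δ k1 k2 (h0 : 0 < δ) q hq ⟨d, hd', t, ht, hdt⟩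
  have hqC := k1 q hq
  obtain rfl : d = e := by
    by_contra hde
    exact hqC (Or.inl ⟨d, ⟨hd', hde⟩, t, ht, hdt⟩)
  have t1 : s - η < t := by
    by_contra hcon
    exact hqC (Or.inr ⟨t, Or.inl ⟨ht.1, not_lt.1 hcon⟩, hdt⟩)
  have t2 : t < s + η := by
    by_contra hcon
    exact hqC (Or.inr ⟨t, Or.inr ⟨not_lt.1 hcon, ht.2⟩, hdt⟩)
  have hz := eq_of_proj_eq_of_norm_lt
    (z := (t - s) • d.2) (z' := q.1 • δ • d.2 + q.2 • δ • w) (by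
      refine add_left_cancel (a := d.pt s) (Eq.trans ?_ hdt)
      rw [Edge.pt, Edge.pt, add_assoc, ← proj_add]; congr 2; module) (by
    have : ‖(t - s) • d.2‖ ≤ η * ‖d.2‖ := by
      rw [norm_smul]
      exact mul_le_mul_of_nonneg_right (abs_le.2 ⟨by linarith, by linarith⟩) (norm_nonneg _)
    linarith [norm_sub_le (q.1 • δ • d.2 + q.2 • δ • w) ((t - s) • d.2), norm_comb_lt h0 k2 hq])
  have e1 := congrArg (det d.2) hz
  simpa [det_add_right, det_smul_right, det_self, h0.ne', hd] using e1

/-- A curve can be subdivided such that small segments around given points become edges. -/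
lemma eventually_exists_strands (α : Multicurve) {Z : Set Torus} (hZ : Z.Finite)
    {ε : Torus → Edge} {s : Torus → ℝ} (hε : ∀ z ∈ Z, ε z ∈ α.edges)
    (hs : ∀ z ∈ Z, s z ∈ Ioo₀₁) (hz : ∀ z ∈ Z, (ε z).pt (s z) = z) :
    ∀ᶠ δ : ℝ in 𝓝[>] 0, ∃ α₁ : Multicurve, Subdivision α.edges α₁.edges ∧
      support α₁.edges = support α.edges ∧
      ∀ z ∈ Z, (z + proj (-(δ • (ε z).2)), (2 : ℝ) • δ • (ε z).2) ∈ α₁.edges := by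
  have hm := α.isMulticurve
  have hsep : ∀ᶠ δ : ℝ in 𝓝[>] 0, ∀ z ∈ Z, δ < s z ∧ δ < 1 - s z ∧
      ∀ z' ∈ Z, s z ≠ s z' → δ * 2 < |s z - s z'| := by
    rw [eventually_all_finite hZ]
    intro z hzZ
    have h1 := eventually_small 1 (hs z hzZ).1
    have h2 := eventually_small 1 (sub_pos.2 (hs z hzZ).2)
    simp only [mul_one] at h1 h2
    refine h1.and (h2.and ((eventually_all_finite hZ).2 fun z' _ => ?_))
    by_cases h : s z = s z'
    · exact Eventually.of_forall fun δ h' => (h' h).elim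
    · filter_upwards [eventually_small 2 (abs_pos.2 (sub_ne_zero.2 h))] with δ hδ _ using hδ
  filter_upwards [hsep, self_mem_nhdsWithin] with δ hδ hδ0
  have hδ0' : 0 < δ := hδ0
  have hminus (z : Torus) (hzZ : z ∈ Z) : z + proj (-(δ • (ε z).2)) = (ε z).pt (s z - δ) := by
    nth_rw 1 [← hz z hzZ]
    rw [Edge.pt, Edge.pt, add_assoc, ← proj_add]; congr 2; module
  set V : Set Torus := (fun z => (ε z).pt (s z - δ)) '' Z ∪ (fun z => (ε z).pt (s z + δ)) '' Z
  obtain ⟨α₁, hsub, -, hsupp, hV, hpart, hstart⟩ := exists_subdivision α (V := V)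
    ((hZ.image _).union (hZ.image _))
  have hm₁ := α₁.isMulticurve
  refine ⟨α₁, hsub, hsupp, fun z hzZ => ?_⟩
  obtain ⟨d1, d2, d3⟩ := hδ z hzZ
  have h01 := hs z hzZ
  have he := hε z hzZ
  obtain ⟨f, hf, hfs⟩ := hV ((ε z).pt (s z - δ)) (Or.inl ⟨z, hzZ, rfl⟩)
    (pt_mem_support he ⟨by linarith, by linarith [h01.2]⟩)
  obtain ⟨e, heα, s₁, t₁, hs₁, hst, ht₁, rfl⟩ := hpart f hf
  rw [sub_start] at hfs
  obtain ⟨rfl, rfl⟩ := hm.eq_of_pt_eq heα he ⟨hs₁, by linarith⟩ ⟨by linarith, by linarith [h01.2]⟩ hfs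
  have hle : t₁ ≤ s z + δ := by
    by_contra! hcon
    obtain ⟨f', hf', hfs'⟩ := hV ((ε z).pt (s z + δ)) (Or.inr ⟨z, hzZ, rfl⟩)
      (pt_mem_support he ⟨by linarith [h01.1], by linarith⟩)
    have hpos : 0 < t₁ - (s z - δ) := by linarith
    have hr : (s z - δ) + 2 * δ / (t₁ - (s z - δ)) * (t₁ - (s z - δ)) = s z + δ := by
      rw [div_mul_cancel₀ _ hpos.ne']; ring
    have := (hm₁.eq_of_pt_eq hf' hf zero_mem_Ico ⟨by positivity, by
      rw [div_lt_one hpos]; linarith⟩ (show _ = Edge.pt _ (2 * δ / (t₁ - (s z - δ))) by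
        rw [pt_zero, hfs', sub_pt, hr])).2
    have h2 : 0 < 2 * δ / (t₁ - (s z - δ)) := by positivity
    exact h2.ne this
  have hge : s z + δ ≤ t₁ := by
    by_contra! hcon
    obtain ⟨g, hg, hgs⟩ := hm₁.exists_start hf
    rw [sub_finish] at hgs
    have hIco : t₁ ∈ Ico₀₁ := ⟨by linarith, by linarith⟩
    rcases hstart g hg with (⟨z', hz', h⟩ | ⟨z', hz', h⟩) | ⟨d, hd, h⟩
    iterate 2
      · obtain ⟨e1, e2, e3⟩ := hδ z' hz'
        have h01' := hs z' hz'
        have := (hm.eq_of_pt_eq he (hε z' hz') hIco ⟨by linarith [h01'.1], by linarith [h01'.2]⟩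
          (hgs.symm.trans h.symm)).2
        by_cases hss : s z = s z'
        · linarith
        · rcases abs_cases (s z - s z') with h | h <;> linarith [d3 z' hz' hss]
    · have := (hm.eq_of_pt_eq he hd hIco zero_mem_Ico (by rw [pt_zero, ← h, hgs])).2
      linarith
  rw [hminus z hzZ]
  convert hf using 2
  rw [le_antisymm hle hge]; module

/-- A strand of a crossing meets the remaining edges of the curve at most in its ends. -/
lemma IsMulticurve.strand_end (h : IsMulticurve E) {z : Torus}
    (hg : (z + proj (-u), (2 : ℝ) • u) ∈ E) (hP : P ⊆ E) (hgP : (z + proj (-u), (2 : ℝ) • u) ∉ P)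
    {q : ℝ × ℝ} (hq : |q.1| + |q.2| ≤ 1) (h0 : q.2 = 0) (hx : coords z u v q ∈ support P) :
    coords z u v q = z + proj u ∨ coords z u v q = z + proj (-u) := by
  obtain ⟨r, _⟩ := q
  obtain rfl : _ = (0 : ℝ) := h0
  have hgr : Edge.pt (z + proj (-u), (2 : ℝ) • u) ((r + 1) / 2) = coords z u v (r, 0) := by
    rw [Edge.pt, add_assoc, ← proj_add, coords]; congr 2; module
  simp only [abs_zero, add_zero, abs_le] at hq
  rcases hq.1.eq_or_lt with rfl | h1
  · simp [coords]
  rcases hq.2.eq_or_lt with rfl | h2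
  · simp [coords]
  have hI : (r + 1) / 2 ∈ Ico₀₁ := ⟨by linarith, by linarith⟩
  obtain ⟨d, hd, t, ht, hdt⟩ := hx
  rcases ht.2.eq_or_lt with rfl | ht1
  · obtain ⟨d', hd', hdd⟩ := h.exists_start (hP hd)
    have := (h.eq_of_pt_eq hd' hg zero_mem_Ico hI (by rw [pt_zero, hdd, ← pt_one, hdt, hgr])).2
    linarith
  · exact (hgP ((h.eq_of_pt_eq (hP hd) hg ⟨ht.1, ht1⟩ hI (hdt.trans hgr.symm)).1 ▸ hd)).elim

/-- Two curves in general position have a superposition diagram. -/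
lemma InGeneralPosition.exists_isSuperposition (h : InGeneralPosition α β) :
    ∃ D : Diagram, D.IsSuperposition α β := by
  classical
  have hfin := h.finite
  set Z := support α.edges ∩ support β.edges with hZ
  have hdata : ∀ z ∈ Z, ∃ e ∈ α.edges, ∃ f ∈ β.edges, ∃ s ∈ Ioo₀₁,
      ∃ t ∈ Ioo₀₁, e.pt s = z ∧ f.pt t = z ∧ det e.2 f.2 ≠ 0 := by
    rintro z ⟨⟨e, he, s, hs, hes⟩, ⟨f, hf, t, ht, hft⟩⟩
    obtain ⟨h1, h2, h3⟩ := h e he f hf s hs t ht (hes.trans hft.symm)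
    exact ⟨e, he, f, hf, s, h1, t, h2, hes, hft, h3⟩
  choose! ε hε φ hφ s hs t ht hes hft hd using hdata
  obtain ⟨U, hU, hUd⟩ := hfin.t2_separation
  have hev : ∀ᶠ δ : ℝ in 𝓝[>] 0, ∀ z ∈ Z,
      InjOn (coords z (δ • (ε z).2) (δ • (φ z).2)) Crossing.discDomain ∧
      (∀ q ∈ Crossing.discDomain, coords z (δ • (ε z).2) (δ • (φ z).2) q ∈ U z) ∧
      (∀ q ∈ Crossing.discDomain, coords z (δ • (ε z).2) (δ • (φ z).2) q ∈ support α.edges →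
        q.2 = 0) ∧
      (∀ q ∈ Crossing.discDomain, coords z (δ • (φ z).2) (δ • (ε z).2) q ∈ support β.edges →
        q.2 = 0) := by
    rw [eventually_all_finite hfin]
    intro z hz
    have h3 := eventually_on_edge (hε z hz) (hs z hz) (hd z hz)
    have h4 := eventually_on_edge (hφ z hz) (ht z hz) (w := (ε z).2)
      (by rw [det_comm]; simpa using hd z hz)
    rw [hes z hz] at h3
    rw [hft z hz] at h4
    exact (eventually_embedded z (hd z hz)).and ((eventually_coords (hU z).2 (hU z).1 _ _).and
      (h3.and h4))
  obtain ⟨δ, ⟨⟨⟨α₁, hα₁, hαs, hαZ⟩, ⟨β₁, hβ₁, hβs, hβZ⟩⟩, hloc⟩, hδ⟩ :=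
    (((eventually_exists_strands α hfin hε hs hes).and
      (eventually_exists_strands β hfin hφ ht hft)).and hev).and self_mem_nhdsWithin |>.exists
  have hδ0 : 0 < δ := hδ
  set c : Torus → Crossing := fun z => ⟨z, δ • (ε z).2, δ • (φ z).2⟩ with hc
  set X : Finset Crossing := hfin.toFinset.image c with hX
  have hXmem {k : Crossing} : k ∈ X ↔ ∃ z ∈ Z, c z = k := by simp [hX]
  have hXall {P : Crossing → Prop} (h : ∀ z ∈ Z, P (c z)) : ∀ k ∈ X, P k := fun k hk => by
    obtain ⟨z, hz, rfl⟩ := hXmem.1 hk; exact h z hz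
  have hover : Crossing.overStrand '' (X : Set Crossing) ⊆ α₁.edges :=
    Set.image_subset_iff.2 (hXall hαZ)
  have hunder : Crossing.underStrand '' (X : Set Crossing) ⊆ β₁.edges :=
    Set.image_subset_iff.2 (hXall hβZ)
  set E := α₁.edges \ Crossing.overStrand '' (X : Set Crossing) with hE
  set F := β₁.edges \ Crossing.underStrand '' (X : Set Crossing) with hF
  have hEu : E ∪ Crossing.overStrand '' (X : Set Crossing) = α₁.edges := Set.sdiff_union_of_subset hover
  have hFu : F ∪ Crossing.underStrand '' (X : Set Crossing) = β₁.edges :=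
    Set.sdiff_union_of_subset hunder
  have hall : E ∪ F ∪ strands X = α₁.edges ∪ β₁.edges := by
    rw [strands, ← hEu, ← hFu, Set.union_union_union_comm]
  have hswap (z : Torus) (x y : Plane) (q : ℝ × ℝ) : coords z x y q = coords z y x q.swap := by
    simp only [coords, Prod.fst_swap, Prod.snd_swap, add_comm]
  have hsw {q : ℝ × ℝ} (hq : q ∈ Crossing.discDomain) : q.swap ∈ Crossing.discDomain :=
    (add_comm |q.2| |q.1|).trans_le hq
  refine ⟨⟨E ∪ F, X, (α₁.isMulticurve.finite.subset sdiff_subset).union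
    (β₁.isMulticurve.finite.subset sdiff_subset), ?_, ?_, ?_, ?_, ?_, ?_⟩, h, E, F, rfl, ?_, ?_⟩
  · exact hXall fun z hz => by simpa [hc, det_smul_left, det_smul_right, hδ0.ne'] using hd z hz
  · exact hXall fun z hz => (hloc z hz).1
  · intro k hk k' hk' hkk
    obtain ⟨z, hz, rfl⟩ := hXmem.1 hk
    obtain ⟨z', hz', rfl⟩ := hXmem.1 hk'
    exact (hUd hz hz' fun h => hkk (h ▸ rfl)).mono (Set.image_subset_iff.2 (hloc z hz).2.1)
      (Set.image_subset_iff.2 (hloc z' hz').2.1)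
  · refine hXall fun z hz => ?_
    obtain ⟨-, -, l3, l4⟩ := hloc z hz
    rintro _ ⟨hx, q, hq, rfl⟩
    rw [support_union] at hx
    have hn := hXmem.2 ⟨z, hz, rfl⟩
    rcases hx with hx | hx
    · rcases α₁.isMulticurve.strand_end (P := E) (hαZ z hz) sdiff_subset
        (fun hmem => hmem.2 ⟨c z, hn, rfl⟩) hq
        (l3 q hq (hαs ▸ support_mono sdiff_subset hx)) hx with h | h <;>
        exact h.symm ▸ by simp [Crossing.corners, hc]
    · rw [hswap] at hx ⊢
      rcases β₁.isMulticurve.strand_end (P := F) (hβZ z hz) sdiff_subset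
        (fun hmem => hmem.2 ⟨c z, hn, rfl⟩) (hsw hq)
        (l4 _ (hsw hq) (hβs ▸ support_mono sdiff_subset hx)) hx with h | h <;>
        exact h.symm ▸ by simp [Crossing.corners, hc]
  · rw [hall, image_union, image_union, α₁.isMulticurve.closed, β₁.isMulticurve.closed]
  · rw [hall]
    have hmix {e f : Edge} (he : e ∈ α₁.edges) (hf : f ∈ β₁.edges) {s t : ℝ}
        (hs : s ∈ Ico₀₁) (ht : t ∈ Ico₀₁) (heq : e.pt s = f.pt t) :
        ∃ k ∈ X, e.pt s = k.center := by
      refine ⟨c (e.pt s), hXmem.2 ⟨_, ⟨?_, ?_⟩, rfl⟩, rfl⟩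
      · rw [← hαs]; exact pt_mem_support he ⟨hs.1, hs.2.le⟩
      · rw [← hβs, heq]; exact pt_mem_support hf ⟨ht.1, ht.2.le⟩
    rintro e (he | he) f (hf | hf) s hs t ht heq
    · exact Or.inl (α₁.isMulticurve.eq_of_pt_eq he hf hs ht heq)
    · exact Or.inr (hmix he hf hs ht heq)
    · rw [heq]; exact Or.inr (hmix hf he ht hs heq.symm)
    · exact Or.inl (β₁.isMulticurve.eq_of_pt_eq he hf hs ht heq)
  · rw [hEu]; exact hα₁
  · rw [hFu]; exact hβ₁

/-! ### The intersection pairing -/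

lemma turn_eq_sub (hu : 0 < w.1 * u.1 + w.2 * u.2)
    (hv : 0 < w.1 * v.1 + w.2 * v.2) : turn u v = turn w v - turn w u := by
  have hne : ∀ {v : Plane}, 0 < w.1 * v.1 + w.2 * v.2 → w ≠ 0 ∧ v ≠ 0 := by
    rintro v h
    constructor <;> rintro rfl <;> simp at h
  have hlt : ∀ {v : Plane}, 0 < w.1 * v.1 + w.2 * v.2 → |turn w v| < π / 2 := by
    intro v h
    rw [turn, Complex.abs_arg_lt_pi_div_two_iff, re_turn]
    exact .inl h
  apply eq_of_angle_eq
  · rw [Real.Angle.coe_sub, turn_coe (hne hu).2 (hne hv).2, turn_coe (hne hu).1 (hne hv).2,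
      turn_coe (hne hu).1 (hne hu).2]
    abel
  all_goals
    have h1 := abs_lt.1 (hlt hu)
    have h2 := abs_lt.1 (hlt hv)
    linarith [turn_lt u v, turn_le u v, pi_pos]

lemma exists_dot_pos (hc : Convex ℝ K) (hK : IsClosed K) (h0 : 0 ∉ K) :
    ∃ w : Plane, ∀ u ∈ K, 0 < w.1 * u.1 + w.2 * u.2 := by
  obtain ⟨f, s, hs, hf⟩ := geometric_hahn_banach_point_closed hc hK h0
  refine ⟨(f (1, 0), f (0, 1)), fun u hu => ?_⟩
  have hu' : u = u.1 • ((1, 0) : Plane) + u.2 • (0, 1) := by ext <;> simp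
  have h := hf u hu
  rw [hu', map_add, map_smul, map_smul] at h
  simp only [map_zero, smul_eq_mul] at h hs
  dsimp only
  linarith

/-- `2π` times the signed number of crossings of a segment with displacement `u` starting at `P`
and a segment with displacement `v` starting at `P + A`. -/
def crossAngle (u v A : Plane) : ℝ :=
  turn A (A + v) - turn (A - u) (A - u + v) - turn A (A - u) + turn (A + v) (A + v - u)

/-- `2π` times the winding number about `0` of the triangle `A, A + v, A + v + w`. -/
def triAngle (v w A : Plane) : ℝ :=
  turn A (A + v) + turn (A + v) (A + v + w) - turn A (A + (v + w))

lemma crossAngle_add (u v w A : Plane) : crossAngle u v A + crossAngle u w (A + v) =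
    crossAngle u (v + w) A + (triAngle v w A - triAngle v w (A - u)) := by
  simp only [crossAngle, triAngle]
  rw [show A + v - u = A - u + v by abel, show A - u + v + w = A + v + w - u by abel,
    show A + (v + w) = A + v + w by abel, show A - u + (v + w) = A + v + w - u by abel]
  ring

lemma crossAngle_neg (u v A : Plane) : crossAngle v u (-A) = -crossAngle u v A := by
  simp only [crossAngle]
  rw [show -A + u = -(A - u) by abel, show -A - v = -(A + v) by abel,
    show -(A + v) + u = -(A + v - u) by abel, show -(A - u) - v = -(A - u + v) by abel]
  simp only [turn_neg_neg]
  rw [show A - u + v = A + v - u by abel]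
  ring

lemma crossAngle_eq_of_det_pos {A : Plane} (hs : s ∈ Ioo₀₁)
    (ht : t ∈ Ioo₀₁) (hd : 0 < det u v) (hA : A = s • u - t • v) :
    crossAngle u v A = 2 * π := by
  have hm {a b : Plane} {r : ℝ} (hr : 0 < r) (hab : det a b = r * det u v) :
      (0 < turn a b ∧ turn a b < π) ∧ det a b ≠ 0 :=
    ⟨turn_pos (hab ▸ mul_pos hr hd), hab ▸ (mul_pos hr hd).ne'⟩
  obtain ⟨⟨a1, b1⟩, n1⟩ := hm (a := A) (b := A + v) hs.1 (by simp [hA, det]; ring)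
  obtain ⟨⟨a2, b2⟩, n2⟩ := hm (a := A + v) (b := A + v - u) (sub_pos.2 ht.2) (by simp [hA, det]; ring)
  obtain ⟨⟨a3, b3⟩, n3⟩ := hm (a := A + v - u) (b := A - u) (sub_pos.2 hs.2) (by simp [hA, det]; ring)
  obtain ⟨⟨a4, b4⟩, n4⟩ := hm (a := A - u) (b := A) ht.1 (by simp [hA, det]; ring)
  have hsum : crossAngle u v A = turn A (A + v) + turn (A + v) (A + v - u) +
      turn (A + v - u) (A - u) + turn (A - u) A := by
    rw [crossAngle, show A - u + v = A + v - u by abel, turn_swap_of_det n3, turn_swap_of_det n4]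
    ring
  rw [hsum]
  apply eq_of_angle_eq
  · rw [Real.Angle.coe_add, Real.Angle.coe_add, Real.Angle.coe_add,
      turn_coe (ne_zero_of_det n1).1 (ne_zero_of_det n1).2,
      turn_coe (ne_zero_of_det n2).1 (ne_zero_of_det n2).2,
      turn_coe (ne_zero_of_det n3).1 (ne_zero_of_det n3).2,
      turn_coe (ne_zero_of_det n4).1 (ne_zero_of_det n4).2, Real.Angle.coe_two_pi]
    abel
  all_goals linarith [pi_pos]

lemma crossAngle_eq {A : Plane} (hs : s ∈ Ioo₀₁)
    (ht : t ∈ Ioo₀₁) (hd : det u v ≠ 0) (hA : A = s • u - t • v) :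
    crossAngle u v A = 2 * π * (SignType.sign (det u v) : ℤ) := by
  rcases lt_or_gt_of_ne hd with hd | hd
  · rw [sign_neg hd, ← neg_eq_iff_eq_neg.2 (crossAngle_neg u v A), crossAngle_eq_of_det_pos ht hs
      (by rw [det_comm]; linarith) (by rw [hA, neg_sub])]
    simp
  · rw [sign_pos hd, crossAngle_eq_of_det_pos hs ht hd hA]; simp

lemma crossAngle_eq_zero {A : Plane}
    (h : ∀ s ∈ Icc₀₁, ∀ t ∈ Icc₀₁, A ≠ s • u - t • v) :
    crossAngle u v A = 0 := by
  have hcpt (a b : Plane) : IsCompact (segment ℝ a b) := by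
    rw [segment_eq_image']; exact isCompact_Icc.image (by fun_prop)
  obtain ⟨w, hw⟩ := exists_dot_pos ((convex_segment A (A + v)).sub (convex_segment 0 u))
    (by
      rw [← Set.sub_image_prod]
      exact (((hcpt _ _).prod (hcpt _ _)).image continuous_sub).isClosed) (by
      rw [segment_eq_image', segment_eq_image']
      rintro ⟨_, ⟨t, ht, rfl⟩, _, ⟨s, hs, rfl⟩, h'⟩
      refine h s hs t ht ?_
      simp only [add_sub_cancel_left, sub_zero, zero_add, sub_eq_zero] at h'
      rw [← h']; abel)
  have hw' {a b : Plane} (ha : a ∈ segment ℝ A (A + v)) (hb : b ∈ segment ℝ 0 u) :=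
    hw _ (Set.sub_mem_sub ha hb)
  have p1 := hw' (left_mem_segment ℝ _ _) (left_mem_segment ℝ _ _)
  have p2 := hw' (right_mem_segment ℝ _ _) (left_mem_segment ℝ _ _)
  have p3 := hw' (left_mem_segment ℝ _ _) (right_mem_segment ℝ _ _)
  have p4 := hw' (right_mem_segment ℝ _ _) (right_mem_segment ℝ _ _)
  rw [sub_zero] at p1 p2
  rw [crossAngle, show A - u + v = A + v - u by abel, turn_eq_sub p1 p2, turn_eq_sub p3 p4,
    turn_eq_sub p1 p3, turn_eq_sub p2 p4]
  ring

/-- `φ` vanishes outside a bounded set. -/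
def Vanishes (φ : Plane → ℝ) : Prop := ∃ r, ∀ A, r < ‖A‖ → φ A = 0

lemma Vanishes.finite {φ : Plane → ℝ} (h : Vanishes φ) (A : Plane) :
    (Function.support fun n : ℤ × ℤ => φ (A + lat n)).Finite := by
  obtain ⟨r, hr⟩ := h
  refine (finite_norm_lat_le (r + ‖A‖)).subset fun n hn => ?_
  have h1 : ‖A + lat n‖ ≤ r := not_lt.1 fun h => hn (hr _ h)
  have := norm_sub_le (A + lat n) A
  rw [add_sub_cancel_left] at this
  exact this.trans (by linarith)

lemma vanishes_crossAngle (u v : Plane) : Vanishes (crossAngle u v) := by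
  refine ⟨‖u‖ + ‖v‖, fun A hA => ?_⟩
  refine crossAngle_eq_zero fun s hs t ht h => hA.not_ge ?_
  rw [h]
  refine (norm_sub_le _ _).trans (add_le_add ?_ ?_) <;> rw [norm_smul]
  exacts [mul_le_of_le_one_left (norm_nonneg u) (by rw [norm_of_nonneg hs.1]; exact hs.2),
    mul_le_of_le_one_left (norm_nonneg v) (by rw [norm_of_nonneg ht.1]; exact ht.2)]

lemma vanishes_triAngle (v w : Plane) : Vanishes (triAngle v w) := by
  refine ⟨‖v‖ + ‖w‖, fun A hA => ?_⟩
  obtain ⟨x, hx⟩ := exists_dot_pos (convex_closedBall A (‖v‖ + ‖w‖)) Metric.isClosed_closedBall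
    (by simpa using hA)
  have p1 := hx A (Metric.mem_closedBall_self (by positivity))
  have p2 := hx (A + v) (by simp)
  have p3 := hx (A + (v + w)) (by simpa using norm_add_le v w)
  rw [triAngle, show A + v + w = A + (v + w) by abel, turn_eq_sub p1 p2, turn_eq_sub p2 p3,
    turn_eq_sub p1 p3]
  ring

def latSum (φ : Plane → ℝ) (A : Plane) : ℝ := ∑ᶠ n : ℤ × ℤ, φ (A + lat n)

lemma latSum_add_lat (φ : Plane → ℝ) (A : Plane) (m : ℤ × ℤ) :
    latSum φ (A + lat m) = latSum φ A := by
  refine (finsum_congr fun n => ?_).trans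
    (finsum_comp_equiv (Equiv.addLeft m) (f := fun n => φ (A + lat n)))
  rw [Equiv.coe_addLeft, lat_add, add_assoc]

lemma latSum_congr (φ : Plane → ℝ) {A B : Plane} (h : proj A = proj B) :
    latSum φ A = latSum φ B := by
  obtain ⟨n, rfl⟩ := (proj_eq_iff A B).1 h
  exact (latSum_add_lat φ A n).symm

lemma latSum_crossAngle_add (u v w A : Plane) :
    latSum (crossAngle u v) A + latSum (crossAngle u w) (A + v) =
      latSum (crossAngle u (v + w)) A +
        (latSum (triAngle v w) A - latSum (triAngle v w) (A - u)) := by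
  rw [latSum, latSum, latSum, latSum, latSum,
    ← finsum_sub_distrib ((vanishes_triAngle v w).finite A) ((vanishes_triAngle v w).finite _),
    ← finsum_add_distrib ((vanishes_crossAngle u v).finite A) ((vanishes_crossAngle u w).finite _),
    ← finsum_add_distrib ((vanishes_crossAngle u (v + w)).finite A)
      ((((vanishes_triAngle v w).finite A).union ((vanishes_triAngle v w).finite (A - u))).subset
        (Function.support_sub _ _))]
  refine finsum_congr fun n => ?_
  rw [show A + v + lat n = A + lat n + v by abel, show A - u + lat n = A + lat n - u by abel]
  exact crossAngle_add u v w (A + lat n)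

lemma lat_neg (n : ℤ × ℤ) : lat (-n) = -lat n := by
  ext <;> simp [lat]

lemma latSum_crossAngle_neg (u v A : Plane) :
    latSum (crossAngle v u) (-A) = -latSum (crossAngle u v) A := by
  rw [latSum, latSum, ← finsum_neg_distrib, ← finsum_comp_equiv (Equiv.neg (ℤ × ℤ))]
  refine finsum_congr fun n => ?_
  rw [Equiv.neg_apply, lat_neg, ← crossAngle_neg, neg_add]

def liftPt (z : Torus) : Plane := (proj_surjective z).choose

lemma proj_liftPt (z : Torus) : proj (liftPt z) = z := (proj_surjective z).choose_spec

/-- `2π` times the intersection number of two oriented closed curves. -/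
def pairing (E F : Finset Edge) : ℝ :=
  ∑ e ∈ E, ∑ f ∈ F, latSum (crossAngle e.2 f.2) (liftPt f.1 - liftPt e.1)

lemma pairing_swap (E F : Finset Edge) : pairing F E = -pairing E F := by
  rw [pairing, pairing, sum_comm, ← Finset.sum_neg_distrib]
  refine sum_congr rfl fun e _ => ?_
  rw [← Finset.sum_neg_distrib]
  refine sum_congr rfl fun f _ => ?_
  rw [← latSum_crossAngle_neg, neg_sub]

/-- Starting points and end points of the edges of `E` agree with multiplicities. -/
def IsBalanced (E : Finset Edge) : Prop :=
  ∀ φ : Torus → ℝ, ∑ e ∈ E, φ e.start = ∑ e ∈ E, φ e.finish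

lemma IsClosedCurve.isBalanced (h : IsClosedCurve E) :
    IsBalanced h.finite.toFinset := by
  intro φ
  rw [← sum_image (f := φ) (g := Edge.start) (by simpa using h.start_injOn),
    ← sum_image (f := φ) (g := Edge.finish) (by simpa using h.finish_injOn)]
  congr 1
  rw [← Finset.coe_inj]
  simpa using h.closed.symm

/-- `2π` times the intersection number of `E` with the segment from `0` to `b`. -/
def potential (E : Finset Edge) (b : Plane) : ℝ :=
  ∑ e ∈ E, latSum (crossAngle e.2 b) (-liftPt e.1)

lemma potential_add {E : Finset Edge} (hE : IsBalanced E) (b v : Plane) :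
    potential E (b + v) =
      potential E b + ∑ e ∈ E, latSum (crossAngle e.2 v) (b - liftPt e.1) := by
  have h : ∑ e ∈ E, latSum (triAngle b v) (-liftPt e.1) =
      ∑ e ∈ E, latSum (triAngle b v) (-liftPt e.1 - e.2) := by
    have := hE fun z => latSum (triAngle b v) (-liftPt z)
    refine this.trans (sum_congr rfl fun e _ => latSum_congr _ ?_)
    rw [proj_neg, proj_liftPt, proj_sub, proj_neg, proj_liftPt, Edge.finish]
    abel
  rw [potential, potential, ← sum_add_distrib]
  have := fun e : Edge => latSum_crossAngle_add e.2 b v (-liftPt e.1)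
  simp only [neg_add_eq_sub] at this
  rw [sum_congr rfl fun e _ => this e, sum_add_distrib, sum_sub_distrib, h,
    sub_self, add_zero]

lemma potential_lat_add {E : Finset Edge} (hE : IsBalanced E) (n : ℤ × ℤ) (b : Plane) :
    potential E (lat n + b) = potential E (lat n) + potential E b := by
  rw [potential_add hE, potential]
  congr 1
  refine sum_congr rfl fun e _ => ?_
  rw [sub_eq_neg_add, latSum_add_lat]

def potentialHom {E : Finset Edge} (hE : IsBalanced E) : ℤ × ℤ →+ ℝ :=
  AddMonoidHom.mk' (fun n => potential E (lat n)) fun m n => by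
    rw [lat_add, potential_lat_add hE]

lemma pairing_eq {E F : Finset Edge} (hE : IsBalanced E) (hF : IsBalanced F) {n : ℤ × ℤ}
    (hn : ∑ f ∈ F, f.2 = lat n) : pairing E F = potential E (lat n) := by
  have hex : ∀ f : Edge, ∃ m : ℤ × ℤ, liftPt f.1 + f.2 = lat m + liftPt f.finish := by
    intro f
    obtain ⟨m, hm⟩ := (proj_eq_iff (liftPt f.finish) (liftPt f.1 + f.2)).1 (by
      rw [proj_add, proj_liftPt, proj_liftPt, Edge.finish])
    exact ⟨m, by rw [hm, add_comm]⟩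
  choose m hm using hex
  have h1 : lat (∑ f ∈ F, m f) = lat n := by
    let L : ℤ × ℤ →+ Plane := AddMonoidHom.mk' lat lat_add
    have hL : ∀ k, lat k = L k := fun _ => rfl
    have h1 := hF fun z => (liftPt z).1
    have h2 := hF fun z => (liftPt z).2
    rw [← hn, hL, map_sum]
    have : ∀ f ∈ F, L (m f) = f.2 + (liftPt f.start - liftPt f.finish) := fun f _ => by
      rw [← hL, eq_sub_of_add_eq (hm f).symm, Edge.start]; abel
    rw [sum_congr rfl this, sum_add_distrib, add_eq_left]
    ext <;> simp [Prod.fst_sum, Prod.snd_sum, sum_sub_distrib, h1, h2]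
  rw [← lat_injective h1]
  change _ = potentialHom hE _
  rw [map_sum, pairing, sum_comm]
  have key : ∀ f ∈ F, ∑ e ∈ E, latSum (crossAngle e.2 f.2) (liftPt f.1 - liftPt e.1) =
      potentialHom hE (m f) + (potential E (liftPt f.finish) - potential E (liftPt f.start)) := by
    intro f _
    have h := potential_add hE (liftPt f.1) f.2
    rw [hm, potential_lat_add hE] at h
    change _ = potential E (lat (m f)) + _
    rw [Edge.start]
    linarith
  rw [sum_congr rfl key, sum_add_distrib, sum_sub_distrib,
    hF fun z => potential E (liftPt z), sub_self, add_zero]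

lemma isBalanced_singleton (z : Torus) (n : ℤ × ℤ) : IsBalanced {((z, lat n) : Edge)} := by
  intro φ
  simp [Edge.start, Edge.finish, proj_lat]

lemma pairing_axes : pairing {((0, lat (1, 0)) : Edge)}
    {((proj (1 / 2, 1 / 2), lat (0, 1)) : Edge)} = 2 * π := by
  have hl : latSum (crossAngle (lat (1, 0)) (lat (0, 1))) (1 / 2, 1 / 2) = 2 * π := by
    have key : ∀ n : ℤ × ℤ, ∀ s ∈ Icc₀₁, ∀ t ∈ Icc₀₁,
        ((1 / 2, 1 / 2) : Plane) + lat n = s • lat (1, 0) - t • lat (0, 1) →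
          n = (0, -1) ∧ s = 1 / 2 ∧ t = 1 / 2 := by
      rintro ⟨a, b⟩ s ⟨hs0, hs1⟩ t ⟨ht0, ht1⟩ h
      simp only [lat, Prod.ext_iff, fst_add, snd_add, fst_sub, snd_sub,
        smul_fst, smul_snd, smul_eq_mul, Int.cast_one, Int.cast_zero, mul_one,
        mul_zero, sub_zero, zero_sub] at h ⊢
      obtain ⟨h1, h2⟩ := h
      have ha : a = 0 := by
        have : a < 1 := by rify; linarith
        have : -1 < a := by rify; linarith
        omega
      have hb : b = -1 := by
        have : b < 0 := by rify; linarith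
        have : -2 < b := by rify; linarith
        omega
      subst ha hb
      push_cast at h1 h2
      exact ⟨⟨rfl, rfl⟩, by linarith, by linarith⟩
    have hd : det (lat (1, 0)) (lat (0, 1)) = 1 := by simp [det, lat]
    rw [latSum, finsum_eq_single _ (0, -1) fun n hn => crossAngle_eq_zero fun s hs t ht h =>
      hn (key n s hs t ht h).1, crossAngle_eq (s := 1 / 2) (t := 1 / 2) (by norm_num)
      (by norm_num) (by simp [hd]), hd]
    · simp
    · ext <;> simp [lat]; norm_num
  rw [pairing, sum_singleton, sum_singleton, ← hl]
  refine latSum_congr _ ?_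
  rw [proj_sub, proj_liftPt, proj_liftPt, sub_zero]

/-- The intersection number of two closed curves is the determinant of their homology classes. -/
lemma pairing_eq_det {E F : Finset Edge} (hE : IsBalanced E) (hF : IsBalanced F) {m n : ℤ × ℤ}
    (hm : ∑ e ∈ E, e.2 = lat m) (hn : ∑ f ∈ F, f.2 = lat n) :
    pairing E F = 2 * π * (m.1 * n.2 - m.2 * n.1 : ℤ) := by
  have lin : ∀ {E : Finset Edge} (hE : IsBalanced E) (n : ℤ × ℤ), potential E (lat n) =
      n.1 * potential E (lat (1, 0)) + n.2 * potential E (lat (0, 1)) := by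
    intro E hE n
    change potentialHom hE n = n.1 * potentialHom hE (1, 0) + n.2 * potentialHom hE (0, 1)
    rw [← zsmul_eq_mul, ← zsmul_eq_mul, ← map_zsmul, ← map_zsmul, ← map_add]
    congr 1
    ext <;> simp
  set X : Finset Edge := {((0, lat (1, 0)) : Edge)}
  set Y : Finset Edge := {((proj (1 / 2, 1 / 2), lat (0, 1)) : Edge)}
  have hX : IsBalanced X := isBalanced_singleton _ _
  have hY : IsBalanced Y := isBalanced_singleton _ _
  have sX : ∑ e ∈ X, e.2 = lat (1, 0) := sum_singleton _ _
  have sY : ∑ e ∈ Y, e.2 = lat (0, 1) := sum_singleton _ _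
  have h1 := pairing_axes
  have h2 := pairing_swap X Y
  have h3 := pairing_swap X X
  have h4 := pairing_swap Y Y
  have h5 := pairing_swap E X
  have h6 := pairing_swap E Y
  rw [pairing_eq hX hY sY] at h1
  rw [pairing_eq hX hY sY, pairing_eq hY hX sX] at h2
  rw [pairing_eq hX hX sX] at h3
  rw [pairing_eq hY hY sY] at h4
  rw [pairing_eq hX hE hm, pairing_eq hE hX sX, lin hX] at h5
  rw [pairing_eq hY hE hm, pairing_eq hE hY sY, lin hY] at h6
  rw [pairing_eq hE hF hn, lin hE]
  have h7 : potential X (lat (1, 0)) = 0 := by linarith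
  have h8 : potential Y (lat (0, 1)) = 0 := by linarith
  rw [h7, h1] at h5
  rw [h8, h2, h1] at h6
  push_cast
  linear_combination (n.1 : ℝ) * h5 + (n.2 : ℝ) * h6

lemma Subdivision.exists_coarse (h : Subdivision E E') {e' : Edge}
    (he' : e' ∈ E') : ∃ e ∈ E, ∃ a r : ℝ, 0 ≤ a ∧ 0 < r ∧ a + r ≤ 1 ∧ e' = (e.pt a, r • e.2) := by
  induction h generalizing e' with
  | refl => exact ⟨e', he', 0, 1, le_rfl, one_pos, by norm_num, by simp [Edge.pt, proj_zero]⟩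
  | tail _ hs ih =>
    obtain ⟨F, g, s, hs0, hs1, -, -, -, rfl, rfl⟩ := hs
    rcases he' with he' | rfl | he'
    · exact ih (.inl he')
    · obtain ⟨e, he, a, r, ha, hr, har, rfl⟩ := ih (.inr rfl)
      exact ⟨e, he, a, s * r, ha, by positivity, by nlinarith, by rw [smul_smul]⟩
    · obtain ⟨e, he, a, r, ha, hr, har, rfl⟩ := ih (.inr rfl)
      have h1 : 0 < 1 - s := by linarith
      refine ⟨e, he, a + s * r, (1 - s) * r, by positivity, by positivity, by linarith, ?_⟩
      rw [Set.mem_singleton_iff.1 he', smul_smul]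
      congr 1
      simp only [Edge.pt]
      rw [add_assoc, ← proj_add]
      congr 2
      module

lemma Subdivision.exists_fine (h : Subdivision E E') (he : e ∈ E) (hs : s ∈ Ico₀₁) :
    ∃ e' ∈ E', ∃ t ∈ Ico₀₁, ∃ r > (0 : ℝ), e'.pt t = e.pt s ∧ e'.2 = r • e.2 := by
  induction h with
  | refl => exact ⟨e, he, s, hs, 1, one_pos, rfl, (one_smul _ _).symm⟩
  | tail _ hst ih =>
    obtain ⟨F, g, a, ha0, ha1, -, -, -, rfl, rfl⟩ := hst
    obtain ⟨e', he', t, ht, r, hr, h1, h2⟩ := ih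
    rcases he' with he' | rfl
    · exact ⟨e', .inl he', t, ht, r, hr, h1, h2⟩
    have h1a : 0 < 1 - a := by linarith
    rcases lt_or_ge t a with hta | hta
    · refine ⟨_, Or.inr (.inl rfl), t / a, ⟨div_nonneg ht.1 ha0.le, (div_lt_one ha0).2 hta⟩,
        a * r, by positivity, ?_, by rw [h2, smul_smul]⟩
      rw [← h1]
      simp only [Edge.pt, smul_smul, div_mul_cancel₀ _ ha0.ne']
    · refine ⟨_, Or.inr (.inr rfl), (t - a) / (1 - a),
        ⟨div_nonneg (by linarith) h1a.le, (div_lt_one h1a).2 (by linarith [ht.2])⟩,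
        (1 - a) * r, by positivity, ?_, by rw [h2, smul_smul]⟩
      rw [← h1]
      simp only [Edge.pt, smul_smul, div_mul_cancel₀ _ h1a.ne']
      rw [add_assoc, ← proj_add, ← add_smul]
      congr 3
      ring

lemma Crossing.overStrand_pt (c : Crossing) (t : ℝ) :
    c.overStrand.pt t = c.center + proj ((2 * t - 1) • c.overDir) := by
  simp only [Edge.pt, Crossing.overStrand]
  rw [add_assoc, ← proj_add]
  congr 2
  module

lemma Crossing.underStrand_pt (c : Crossing) (t : ℝ) :
    c.underStrand.pt t = c.center + proj ((2 * t - 1) • c.underDir) := by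
  simp only [Edge.pt, Crossing.underStrand]
  rw [add_assoc, ← proj_add]
  congr 2
  module

lemma Diagram.center_injOn (D : Diagram) : InjOn Crossing.center (D.crossings : Set Crossing) := by
  have h0 : ∀ c : Crossing, c.center ∈ c.disc := fun c =>
    ⟨(0, 0), by simp [Crossing.discDomain], by simp [coords, proj_zero]⟩
  intro c hc d hd h
  by_contra hcd
  exact Set.disjoint_left.1 (D.disc_disjoint c hc d hd hcd) (h0 c) (h ▸ h0 d)

/-- The writhe of a superposition is the intersection number of the two curves. -/
lemma Diagram.IsSuperposition.sum_sign
    (h : D.IsSuperposition α β) :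
    ∑ c ∈ D.crossings, c.sign = α.hom.1 * β.hom.2 - α.hom.2 * β.hom.1 := by
  obtain ⟨hg, E, F, hEF, hα, hβ⟩ := h
  have hm := α.isMulticurve
  have hm' := β.isMulticurve
  have hp := pairing_eq_det (m := α.hom) (n := β.hom) hm.isClosedCurve.isBalanced
    hm'.isClosedCurve.isBalanced
    (by rw [← finsum_mem_eq_finite_toFinset_sum]; exact α.homology_eq)
    (by rw [← finsum_mem_eq_finite_toFinset_sum]; exact β.homology_eq)
  suffices hs : pairing hm.finite.toFinset hm'.finite.toFinset =
      2 * π * (∑ c ∈ D.crossings, c.sign : ℤ) by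
    have h2 := hs.symm.trans hp
    exact_mod_cast mul_left_cancel₀ (by positivity) h2
  have hpt : ∀ (e f : Edge) (s t : ℝ), e.pt s = f.pt t ↔
      ∃ n, liftPt f.1 - liftPt e.1 + lat n = s • e.2 - t • f.2 := by
    intro e f s t
    have h1 : ∀ (e : Edge) (s : ℝ), e.pt s = proj (liftPt e.1 + s • e.2) := fun e s => by
      rw [proj_add, proj_liftPt]; rfl
    rw [h1, h1, eq_comm, proj_eq_iff]
    refine exists_congr fun n => ⟨fun h => ?_, fun h => ?_⟩
    · rw [eq_sub_of_add_eq' h.symm]; abel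
    · rw [eq_sub_iff_add_eq] at h
      rw [← h]; abel
  have hval {e f : Edge} (he : e ∈ α.edges) (hf : f ∈ β.edges) {n : ℤ × ℤ} {s t : ℝ}
      (hs : s ∈ Icc₀₁) (ht : t ∈ Icc₀₁)
      (hst : liftPt f.1 - liftPt e.1 + lat n = s • e.2 - t • f.2) :
      crossAngle e.2 f.2 (liftPt f.1 - liftPt e.1 + lat n) =
        2 * π * (SignType.sign (det e.2 f.2) : ℤ) := by
    obtain ⟨hs, ht, hd⟩ := hg e he f hf s hs t ht ((hpt e f s t).2 ⟨n, hst⟩)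
    exact crossAngle_eq hs ht hd hst
  have hN := (hm.finite.prod hm'.finite).biUnion fun q _ =>
    (vanishes_crossAngle q.1.2 q.2.2).finite (liftPt q.2.1 - liftPt q.1.1)
  set X := {x ∈ hm.finite.toFinset ×ˢ hm'.finite.toFinset ×ˢ hN.toFinset |
    crossAngle x.1.2 x.2.1.2 (liftPt x.2.1.1 - liftPt x.1.1 + lat x.2.2) ≠ 0} with hXdef
  have hXmem : ∀ e f n, (e, f, n) ∈ X ↔ e ∈ α.edges ∧ f ∈ β.edges ∧
      crossAngle e.2 f.2 (liftPt f.1 - liftPt e.1 + lat n) ≠ 0 := by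
    intro e f n
    rw [hXdef, mem_filter, mem_product, mem_product]
    simp only [Set.Finite.mem_toFinset]
    refine ⟨fun h => ⟨h.1.1, h.1.2.1, h.2⟩, fun h => ⟨⟨h.1, h.2.1, ?_⟩, h.2.2⟩⟩
    exact Set.mem_biUnion (x := (e, f)) ⟨h.1, h.2.1⟩ h.2.2
  have hsum : pairing hm.finite.toFinset hm'.finite.toFinset = ∑ x ∈ X,
      crossAngle x.1.2 x.2.1.2 (liftPt x.2.1.1 - liftPt x.1.1 + lat x.2.2) := by
    rw [hXdef, Finset.sum_filter_ne_zero, sum_product, pairing]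
    refine sum_congr rfl fun e he => ?_
    rw [sum_product]
    refine sum_congr rfl fun f hf => ?_
    refine finsum_eq_sum_of_support_subset _ fun n hn => ?_
    rw [Set.Finite.mem_toFinset] at he hf
    rw [Set.Finite.coe_toFinset]
    exact Set.mem_biUnion (x := (e, f)) ⟨he, hf⟩ hn
  have hstrand : ∀ {γ : Multicurve} {G : Set Edge}, Subdivision γ.edges G → ∀ {z : Torus} {v : Plane},
      (z + proj (-v), (2 : ℝ) • v) ∈ G → ∃ e ∈ γ.edges, ∃ s ∈ Ico₀₁, ∃ r > (0 : ℝ),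
        z = e.pt s ∧ v = r • e.2 := by
    intro γ G hG z v hv
    obtain ⟨e, he, a, r, ha, hr, har, h⟩ := hG.exists_coarse hv
    obtain ⟨h1, h2⟩ := Prod.mk.inj h
    have hv : v = (r / 2) • e.2 := by
      rw [div_eq_inv_mul, mul_smul, ← h2, smul_smul, inv_mul_cancel₀ two_ne_zero, one_smul]
    refine ⟨e, he, a + r / 2, ⟨by linarith, by linarith⟩, r / 2, by linarith, ?_, hv⟩
    rw [proj_neg, ← sub_eq_add_neg, sub_eq_iff_eq_add] at h1
    rw [h1, hv, Edge.pt, Edge.pt, add_assoc, ← proj_add, add_smul]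
  have hcenter : ∀ {e f : Edge}, e ∈ α.edges → f ∈ β.edges → ∀ {s t : ℝ}, s ∈ Icc₀₁ →
      t ∈ Icc₀₁ → e.pt s = f.pt t → ∃ c ∈ D.crossings, e.pt s = c.center := by
    intro e f he hf s t hs ht hst
    obtain ⟨hs', ht', hd⟩ := hg e he f hf s hs t ht hst
    obtain ⟨e', he', s', hs', r, hr, h1, h2⟩ := hα.exists_fine he ⟨hs'.1.le, hs'.2⟩
    obtain ⟨f', hf', t', ht', r', hr', h3, h4⟩ := hβ.exists_fine hf ⟨ht'.1.le, ht'.2⟩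
    have hsub : ∀ {g : Edge}, g ∈ E ∪ Crossing.overStrand '' D.crossings ∨
        g ∈ F ∪ Crossing.underStrand '' D.crossings → g ∈ D.arcs ∪ strands D.crossings := by
      rw [hEF]
      rintro g ((h | h) | (h | h))
      exacts [Or.inl (.inl h), Or.inr (.inl h), Or.inl (.inr h), Or.inr (.inr h)]
    rcases D.double_points e' (hsub (.inl he')) f' (hsub (.inr hf')) s' hs' t' ht'
      (h1.trans (hst.trans h3.symm)) with ⟨rfl, -⟩ | ⟨c, hc, h⟩
    · have h5 : det (r • e.2) (r' • f.2) = 0 := by rw [← h2, ← h4, det_self]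
      rw [det_smul_left, det_smul_right] at h5
      simp [hr.ne', hr'.ne', hd] at h5
    · exact ⟨c, hc, h1.symm.trans h⟩
  have hstr : ∀ c ∈ D.crossings, ∃ e ∈ α.edges, ∃ f ∈ β.edges, ∃ s ∈ Ico₀₁,
      ∃ t ∈ Ico₀₁, ∃ n, e.pt s = c.center ∧ f.pt t = c.center ∧
      liftPt f.1 - liftPt e.1 + lat n = s • e.2 - t • f.2 ∧ det e.2 f.2 ≠ 0 ∧
      c.sign = (SignType.sign (det e.2 f.2) : ℤ) := by
    intro c hc
    obtain ⟨e, he, s, hs, r, hr, h4, h5⟩ := hstrand hα (Or.inr ⟨c, hc, rfl⟩)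
    obtain ⟨f, hf, t, ht, r', hr', h6, h7⟩ := hstrand hβ (Or.inr ⟨c, hc, rfl⟩)
    obtain ⟨n, hn⟩ := (hpt e f s t).1 (h4.symm.trans h6)
    refine ⟨e, he, f, hf, s, hs, t, ht, n, h4.symm, h6.symm, hn, (hg e he f hf _
      (mem_Icc_of_mem_Ico hs) _ (mem_Icc_of_mem_Ico ht) (h4.symm.trans h6)).2.2, ?_⟩
    rw [Crossing.sign, h5, h7, det_smul_left, det_smul_right, sign_mul, sign_mul, sign_pos hr,
      sign_pos hr', one_mul, one_mul]
  choose! ε hε φ hφ σ hσ τ hτ ν h1 h2 h3 h4 h5 using hstr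
  have hang {c : Crossing} (hc : c ∈ D.crossings) := hval (hε c hc) (hφ c hc)
    (mem_Icc_of_mem_Ico (hσ c hc)) (mem_Icc_of_mem_Ico (hτ c hc)) (h3 c hc)
  rw [hsum, Int.cast_sum, mul_sum]
  refine (Finset.sum_bij (fun c _ => (ε c, φ c, ν c)) ?_ ?_ ?_ ?_).symm
  · refine fun c hc => (hXmem _ _ _).2 ⟨hε c hc, hφ c hc, ?_⟩
    rw [hang hc]
    refine mul_ne_zero (by positivity) (Int.cast_ne_zero.2 ?_)
    rcases lt_or_gt_of_ne (h4 c hc) with h | h <;> simp [h]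
  · intro c hc c' hc' hcc
    obtain ⟨a1, a2, a3⟩ : ε c = ε c' ∧ φ c = φ c' ∧ ν c = ν c' := by simpa using hcc
    refine D.center_injOn hc hc' ?_
    have h8 := congrArg (det · (φ c').2) ((h3 c hc).symm.trans (a1 ▸ a2 ▸ a3 ▸ h3 c' hc'))
    simp only [a1, a2, det_sub_left, det_smul_left, det_self, mul_zero, sub_zero] at h8
    rw [← h1 c hc, ← h1 c' hc', a1, mul_right_cancel₀ (h4 c' hc') h8]
  · rintro ⟨e, f, n⟩ hx
    obtain ⟨he, hf, h0⟩ := (hXmem e f n).1 hx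
    obtain ⟨s, hs, t, ht, hst⟩ : ∃ s ∈ Icc₀₁, ∃ t ∈ Icc₀₁,
        liftPt f.1 - liftPt e.1 + lat n = s • e.2 - t • f.2 := by
      by_contra! h
      exact h0 (crossAngle_eq_zero h)
    have hst' := (hpt e f s t).2 ⟨n, hst⟩
    obtain ⟨hs', ht', -⟩ := hg e he f hf s hs t ht hst'
    obtain ⟨c, hc, hcc⟩ := hcenter he hf hs ht hst'
    obtain ⟨e1, e2⟩ := hm.eq_of_pt_eq (hε c hc) he (hσ c hc) ⟨hs'.1.le, hs'.2⟩
      ((h1 c hc).trans hcc.symm)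
    obtain ⟨e3, e4⟩ := hm'.eq_of_pt_eq (hφ c hc) hf (hτ c hc) ⟨ht'.1.le, ht'.2⟩
      ((h2 c hc).trans (hcc.symm.trans hst'))
    have h3' := h3 c hc
    rw [e1, e2, e3, e4, ← hst] at h3'
    exact ⟨c, hc, by rw [e1, e3, lat_injective (add_left_cancel h3')]⟩
  · intro c hc
    rw [hang hc, h5 c hc]

/-! ### The invariants of the oriented smoothing -/

lemma mem_discDomain {q : ℝ × ℝ} : q ∈ Crossing.discDomain ↔
    q.1 + q.2 ≤ 1 ∧ q.1 - q.2 ≤ 1 ∧ -q.1 + q.2 ≤ 1 ∧ -q.1 - q.2 ≤ 1 := by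
  simp only [Crossing.discDomain, mem_ofPred_eq]
  grind

lemma convex_discDomain : Convex ℝ Crossing.discDomain := by
  intro q hq r hr a b ha hb hab
  rw [mem_discDomain] at hq hr ⊢
  obtain ⟨h1, h2, h3, h4⟩ := hq
  obtain ⟨k1, k2, k3, k4⟩ := hr
  simp only [fst_add, snd_add, smul_fst, smul_snd, smul_eq_mul]
  exact ⟨by nlinarith, by nlinarith, by nlinarith, by nlinarith⟩

namespace Diagram

variable (D : Diagram)

lemma coords_inj {c d : Crossing} (hc : c ∈ D.crossings) (hd : d ∈ D.crossings) {q r : ℝ × ℝ}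
    (hq : q ∈ Crossing.discDomain) (hr : r ∈ Crossing.discDomain)
    (h : coords c.center c.overDir c.underDir q = coords d.center d.overDir d.underDir r) :
    c = d ∧ q = r := by
  by_cases hcd : c = d
  · subst hcd
    exact ⟨rfl, D.disc_embedded c hc hq hr h⟩
  · exact (Set.disjoint_left.1 (D.disc_disjoint c hc d hd hcd) ⟨q, hq, rfl⟩ ⟨r, hr, h.symm⟩).elim

/-- The edge of the crossing disc of `c` between points given in disc coordinates. -/
def discEdge (q r : ℝ × ℝ) (c : Crossing) : Edge :=
  (coords c.center c.overDir c.underDir q,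
    (r.1 - q.1) • c.overDir + (r.2 - q.2) • c.underDir)

lemma discEdge_finish (q r : ℝ × ℝ) (c : Crossing) :
    (discEdge q r c).finish = coords c.center c.overDir c.underDir r := by
  simp only [discEdge, Edge.finish, coords]
  rw [add_assoc, ← proj_add]
  congr 2
  module

lemma underlying_eq : D.underlying = D.arcs ∪
    (discEdge (-1, 0) (1, 0) '' D.crossings ∪ discEdge (0, -1) (0, 1) '' D.crossings) := by
  rw [underlying, strands]
  congr 3 <;> funext c <;> ext1 <;>
    simp [discEdge, Crossing.overStrand, Crossing.underStrand, coords] <;> norm_num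

lemma smoothedEdges_eq : D.smoothedEdges = D.arcs ∪
    (discEdge (-1, 0) (0, 1) '' D.crossings ∪ discEdge (0, -1) (1, 0) '' D.crossings) := by
  rw [smoothedEdges]
  congr 1
  ext e
  have h1 (c : Crossing) : (c.center + proj (-c.overDir), c.overDir + c.underDir) =
      discEdge (-1, 0) (0, 1) c := by simp [discEdge, coords]
  have h2 (c : Crossing) : (c.center + proj (-c.underDir), c.overDir + c.underDir) =
      discEdge (0, -1) (1, 0) c := by simp [discEdge, coords]
  simp only [Crossing.smoothing, h1, h2, mem_iUnion, mem_insert_iff, mem_singleton_iff,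
    mem_union, Set.mem_image, mem_coe]
  grind

lemma mem_underlying {c : Crossing} (hc : c ∈ D.crossings) {q : ℝ × ℝ}
    (hq : q = (-1, 0) ∨ q = (0, -1)) : discEdge q (-q) c ∈ D.underlying := by
  rw [underlying_eq]
  rcases hq with rfl | rfl
  exacts [Or.inr (Or.inl ⟨c, hc, by simp⟩), Or.inr (Or.inr ⟨c, hc, by simp⟩)]

lemma mem_smoothedEdges {c : Crossing} (hc : c ∈ D.crossings) {q : ℝ × ℝ}
    (hq : q = (-1, 0) ∨ q = (0, -1)) : discEdge q (-q.swap) c ∈ D.smoothedEdges := by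
  rw [smoothedEdges_eq]
  rcases hq with rfl | rfl
  exacts [Or.inr (Or.inl ⟨c, hc, by simp⟩), Or.inr (Or.inr ⟨c, hc, by simp⟩)]

lemma isClosedCurve_underlying : IsClosedCurve D.underlying where
  finite := D.finite.union ((D.crossings.finite_toSet.image _).union
    (D.crossings.finite_toSet.image _))
  closed := D.closed
  start_injOn := by
    intro e he f hf hef
    rcases D.double_points e he f hf 0 zero_mem_Ico 0 zero_mem_Ico (by rwa [pt_zero, pt_zero]) with
      ⟨h, -⟩ | ⟨c, hc, h⟩
    · exact h
    · have h0 : c.center = coords c.center c.overDir c.underDir (0, 0) := by simp [coords, proj_zero]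
      rw [pt_zero] at h
      rw [underlying_eq] at he
      rcases he with he | ⟨d, hd, rfl⟩ | ⟨d, hd, rfl⟩
      · exact (center_notMem_arcs D hc ⟨e, he, 0, by simp, by rw [pt_zero, h]⟩).elim
      all_goals
        have := (D.coords_inj hd hc (by simp [Crossing.discDomain]) (by simp [Crossing.discDomain])
          (h.trans h0)).2
        simp at this

lemma arc_ne_zero (he : e ∈ D.arcs) : e.2 ≠ 0 := by
  intro h0
  rcases D.double_points e (.inl he) e (.inl he) 0 zero_mem_Ico (1 / 2) (by norm_num)
    (by simp [Edge.pt, h0]) with ⟨-, h⟩ | ⟨c, hc, h⟩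
  · norm_num at h
  · exact center_notMem_arcs D hc ⟨e, he, 0, by simp, h⟩

lemma avoids_arcs {c : Crossing} (hc : c ∈ D.crossings) {q r r' : ℝ × ℝ}
    (hq : q ∈ Crossing.discDomain) (hr : r ∈ Crossing.discDomain)
    (hr' : r' ∈ Crossing.discDomain) :
    Avoids D.arcs (coords c.center c.overDir c.underDir q) (discEdge q r c).2
      (discEdge q r' c).2 :=
  avoids_of_convex (b := r - q) (c := r' - q) convex_discDomain
    ((by rw [Crossing.corners]; exact toFinite _ : c.corners.Finite).subset (D.disc_arcs c hc)) hq (by simpa) (by simpa)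

lemma exists_arc {c : Crossing} (hc : c ∈ D.crossings) {q : ℝ × ℝ}
    (hq : q = (-1, 0) ∨ q = (0, -1)) :
    (∃ f ∈ D.arcs, f.finish = coords c.center c.overDir c.underDir q) ∧
      ∃ f ∈ D.arcs, f.start = coords c.center c.overDir c.underDir (-q) := by
  have hU := D.isClosedCurve_underlying
  have hqd : q ∈ Crossing.discDomain ∧ -q ∈ Crossing.discDomain := by
    rcases hq with rfl | rfl <;> simp [Crossing.discDomain]
  obtain ⟨f, hf, hfe⟩ := hU.exists_finish (D.mem_underlying hc hq)
  obtain ⟨g, hg, hge⟩ := hU.exists_start (D.mem_underlying hc hq)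
  rw [discEdge_finish] at hge
  rw [underlying_eq] at hf hg
  refine ⟨⟨f, ?_, hfe⟩, g, ?_, hge⟩
  · rcases hf with hf | ⟨d, hd, rfl⟩ | ⟨d, hd, rfl⟩
    · exact hf
    all_goals
      rw [discEdge_finish] at hfe
      have := (D.coords_inj hd hc (by simp [Crossing.discDomain]) hqd.1 hfe).2
      rcases hq with rfl | rfl <;> norm_num at this
  · rcases hg with hg | ⟨d, hd, rfl⟩ | ⟨d, hd, rfl⟩
    · exact hg
    all_goals
      have := (D.coords_inj hd hc (by simp [Crossing.discDomain]) hqd.2 hge).2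
      rcases hq with rfl | rfl <;> norm_num at this

lemma homology_arcs_union (r r' : ℝ × ℝ) : homology (D.arcs ∪
    (discEdge (-1, 0) r '' D.crossings ∪ discEdge (0, -1) r' '' D.crossings)) =
    homology D.arcs + ∑ c ∈ D.crossings, ((discEdge (-1, 0) r c).2 + (discEdge (0, -1) r' c).2) := by
  have hd1 : ((-1, 0) : ℝ × ℝ) ∈ Crossing.discDomain := by simp [Crossing.discDomain]
  have hd2 : ((0, -1) : ℝ × ℝ) ∈ Crossing.discDomain := by simp [Crossing.discDomain]
  have hfin (q r) : (discEdge q r '' (D.crossings : Set Crossing)).Finite :=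
    D.crossings.finite_toSet.image _
  have him {q : ℝ × ℝ} (hq : q ∈ Crossing.discDomain) (r) :
      homology (discEdge q r '' D.crossings) = ∑ c ∈ D.crossings, (discEdge q r c).2 := by
    rw [homology, finsum_mem_image fun c hc d hd h =>
      (D.coords_inj hc hd hq hq (congrArg Prod.fst h)).1, finsum_mem_coe_finset]
  have harc {q r : ℝ × ℝ} {c : Crossing} (hc : c ∈ D.crossings) (hq : q = (-1, 0) ∨ q = (0, -1)) :
      discEdge q r c ∉ D.arcs := fun h => by
    rw [← D.isClosedCurve_underlying.start_injOn (D.mem_underlying hc hq) (.inl h) rfl] at h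
    refine center_notMem_arcs D hc ⟨_, h, 1 / 2, by norm_num, ?_⟩
    rw [Edge.pt, discEdge, coords, add_assoc, ← proj_add, add_eq_left, ← proj_zero]
    congr 1
    simp only [fst_neg, snd_neg]
    module
  rw [homology_union D.finite ((hfin _ _).union (hfin _ _)), homology_union (hfin _ _) (hfin _ _),
    him hd1, him hd2, sum_add_distrib]
  · rw [disjoint_left]
    rintro _ ⟨c, hc, rfl⟩ ⟨d, hd, h⟩
    have := (D.coords_inj hd hc hd2 hd1 (congrArg Prod.fst h)).2
    norm_num at this
  · rw [disjoint_left]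
    rintro _ h (⟨c, hc, rfl⟩ | ⟨c, hc, rfl⟩)
    exacts [harc hc (.inl rfl) h, harc hc (.inr rfl) h]

lemma homology_smoothedEdges : homology D.smoothedEdges = homology D.underlying := by
  rw [smoothedEdges_eq, underlying_eq, homology_arcs_union, homology_arcs_union]
  congr 1
  refine sum_congr rfl fun c _ => ?_
  simp only [discEdge]
  module

lemma rotation_smoothedEdges : rotation D.smoothedEdges = rotation D.underlying := by
  classical
  have hU := D.isClosedCurve_underlying
  have hS := D.isMulticurve_smoothedEdges.isClosedCurve
  have hAU : D.arcs ⊆ D.underlying := subset_union_left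
  have hAS : D.arcs ⊆ D.smoothedEdges := subset_union_left
  set P : Crossing → ℝ × ℝ → Torus := fun c => coords c.center c.overDir c.underDir
  set Q : Finset (ℝ × ℝ) := {(-1, 0), (1, 0), (0, -1), (0, 1)} with hQ
  have hQd : ∀ q ∈ Q, q ∈ Crossing.discDomain := by simp [hQ, Crossing.discDomain]
  -- the contributions of both ends of a strand cancel
  have hpair {c : Crossing} (hc : c ∈ D.crossings) {q : ℝ × ℝ} (hq : q = (-1, 0) ∨ q = (0, -1)) :
      (vertexTurn D.smoothedEdges (P c q) - vertexTurn D.underlying (P c q)) +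
        (vertexTurn D.smoothedEdges (P c (-q)) - vertexTurn D.underlying (P c (-q))) = 0 := by
    have hdet := D.transverse c hc
    have hd : det (discEdge q (-q) c).2 (discEdge q (-q.swap) c).2 ≠ 0 := by
      rcases hq with rfl | rfl <;> intro h <;> apply hdet <;> simp [discEdge, det] at h ⊢ <;>
        linarith
    have he : (discEdge q.swap (-q) c).2 = (discEdge q (-q.swap) c).2 := by
      rcases hq with rfl | rfl <;> simp [discEdge]
    have hneg {q r : ℝ × ℝ} : -(discEdge q r c).2 = (discEdge r q c).2 := by
      simp only [discEdge]
      module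
    obtain ⟨hqd, hr, hr', hq'⟩ : q ∈ Crossing.discDomain ∧ -q ∈ Crossing.discDomain ∧
        -q.swap ∈ Crossing.discDomain ∧ q.swap ∈ Crossing.discDomain := by
      rcases hq with rfl | rfl <;> simp [Crossing.discDomain]
    obtain ⟨⟨f, hf, hff⟩, g, hg, hgs⟩ := D.exists_arc hc hq
    have hs := D.mem_smoothedEdges hc (q := q.swap) (by rcases hq with rfl | rfl <;> simp)
    rw [Prod.swap_swap] at hs
    rw [vertexTurn_out hS hU hAS hAU (D.mem_smoothedEdges hc hq) (D.mem_underlying hc hq) hf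
        (D.arc_ne_zero hf) hd (z := P c q) rfl rfl hff (D.avoids_arcs hc hqd hr hr'),
      vertexTurn_in hS hU hAS hAU hs (D.mem_underlying hc hq) hg (D.arc_ne_zero hg)
        (he.symm ▸ hd) (z := P c (-q)) (discEdge_finish _ _ _) (discEdge_finish _ _ _) hgs
        (by rw [hneg, hneg]; exact D.avoids_arcs hc hr hqd hq'), he, turn_swap_of_det hd]
    ring
  have hout : ∀ z ∉ D.crossings.biUnion (fun c => Q.image (P c)),
      vertexTurn D.smoothedEdges z = vertexTurn D.underlying z := by
    intro z hz
    rw [smoothedEdges_eq, underlying_eq]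
    have hz' : ∀ c ∈ D.crossings, ∀ q ∈ Q, P c q ≠ z := fun c hc q hq h => hz
      (Finset.mem_biUnion.2 ⟨c, hc, Finset.mem_image.2 ⟨q, hq, h⟩⟩)
    refine vertexTurn_eq ?_ ?_ <;> rintro _ (⟨c, hc, rfl⟩ | ⟨c, hc, rfl⟩) <;>
      rw [discEdge_finish] <;> exact ⟨hz' c hc _ (by simp [hQ]), hz' c hc _ (by simp [hQ])⟩
  rw [← sub_eq_zero, rotation_sub hS.finite hU.finite _ hout, Finset.sum_biUnion]
  · refine Finset.sum_eq_zero fun c hc => ?_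
    rw [sum_image fun q hq r hr h => (D.coords_inj hc hc (hQd q hq) (hQd r hr) h).2, hQ,
      sum_insert (by norm_num), sum_insert (by norm_num),
      sum_insert (by norm_num), sum_singleton, ← add_assoc]
    have k1 := hpair hc (.inl rfl)
    have k2 := hpair hc (.inr rfl)
    simp only [Prod.neg_mk, neg_neg, neg_zero] at k1 k2
    exact (congrArg₂ (· + ·) k1 k2).trans (add_zero 0)
  · intro c hc d hd hcd
    rw [Function.onFun, Finset.disjoint_left]
    intro z hz hz'
    obtain ⟨q, hq, rfl⟩ := Finset.mem_image.1 hz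
    obtain ⟨r, hr, h⟩ := Finset.mem_image.1 hz'
    exact hcd (D.coords_inj hd hc (hQd r hr) (hQd q hq) h).1.symm

end Diagram

lemma Subdivision.isMulticurve (h : Subdivision E E') (hE : IsMulticurve E) :
    IsMulticurve E' ∧ homology E = homology E' := by
  induction h with
  | refl => exact ⟨hE, rfl⟩
  | tail _ hs ih =>
    refine ⟨?_, ih.2.trans (hs.homology_eq ih.1)⟩
    obtain ⟨F, e, s, hs0, hs1, he, -, -, rfl, rfl⟩ := hs
    exact ih.1.cut he ⟨hs0, hs1⟩

lemma Diagram.IsSuperposition.invariants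
    (h : D.IsSuperposition α β) : D.smoothed.hom = α.hom + β.hom ∧
      D.smoothed.rot = α.rot + β.rot := by
  obtain ⟨hg, E, F, hEF, hα, hβ⟩ := h
  set A := E ∪ Crossing.overStrand '' D.crossings
  set B := F ∪ Crossing.underStrand '' D.crossings
  have hAB : D.underlying = A ∪ B := by
    rw [Diagram.underlying, hEF, strands, Set.union_union_union_comm]
  obtain ⟨hA, hA'⟩ := hα.isMulticurve α.isMulticurve
  obtain ⟨hB, hB'⟩ := hβ.isMulticurve β.isMulticurve
  have hU := D.isClosedCurve_underlying
  rw [hAB] at hU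
  have hdisj : ∀ e ∈ A, e ∉ B := by
    intro e he he'
    obtain ⟨f, hf, a, r, ha, hr, har, rfl⟩ := hα.exists_coarse he
    obtain ⟨f', hf', a', r', ha', hr', har', h⟩ := hβ.exists_coarse he'
    obtain ⟨h1, h2⟩ := Prod.mk.inj h
    have hd := (hg f hf f' hf' a ⟨ha, by linarith⟩ a' ⟨ha', by linarith⟩ h1).2.2
    have h3 : det (r • f.2) (r' • f'.2) = 0 := by rw [h2, det_self]
    rw [det_smul_left, det_smul_right] at h3
    simp [hr.ne', hr'.ne', hd] at h3
  have hrot := rotation_union hA.finite hB.finite fun e he f hf => by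
    have hs {e f : Edge} (he : e ∈ A) (hf : f ∈ B) : e.start ≠ f.start := fun h =>
      hdisj _ he (hU.start_injOn (.inl he) (.inr hf) h ▸ hf)
    have hfi {e f : Edge} (he : e ∈ A) (hf : f ∈ B) : e.finish ≠ f.finish := fun h =>
      hdisj _ he (hU.finish_injOn (.inl he) (.inr hf) h ▸ hf)
    obtain ⟨e', he', h1⟩ := hA.exists_finish he
    obtain ⟨e'', he'', h2⟩ := hA.exists_start he
    exact ⟨hs he hf, hfi he hf, h1 ▸ hfi he' hf, h2 ▸ hs he'' hf⟩
  rw [← hAB, ← D.rotation_smoothedEdges, ← (hα.isClosedCurve hA.isClosedCurve).2,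
    ← (hβ.isClosedCurve hB.isClosedCurve).2, α.rotation_eq, β.rotation_eq] at hrot
  have hhom := homology_union hA.finite hB.finite (Set.disjoint_left.2 hdisj)
  rw [← hAB, ← D.homology_smoothedEdges, ← hA', ← hB', α.homology_eq, β.homology_eq, ← lat_add]
    at hhom
  refine ⟨lat_injective (D.smoothed.homology_eq.symm.trans hhom), ?_⟩
  rw [← mul_add, show rotation D.smoothedEdges = _ from D.smoothed.rotation_eq] at hrot
  exact_mod_cast mul_left_cancel₀ (by positivity) hrot

/-! ### Homology and subdivisions of diagrams -/

/-- Divide a lattice vector by the largest possible power of two. -/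
def oddPart (n : ℤ × ℤ) : ℤ × ℤ :=
  (n.1 / 2 ^ padicValNat 2 (Int.gcd n.1 n.2), n.2 / 2 ^ padicValNat 2 (Int.gcd n.1 n.2))

lemma oddPart_add_self (n : ℤ × ℤ) : oddPart (n + n) = oddPart n := by
  have h : Int.gcd (n.1 + n.1) (n.2 + n.2) = 2 * Int.gcd n.1 n.2 := by
    rw [← two_mul, ← two_mul, Int.gcd_mul_left]; rfl
  rcases Nat.eq_zero_or_pos (Int.gcd n.1 n.2) with h0 | h0
  · obtain ⟨h1, h2⟩ := Int.gcd_eq_zero_iff.1 h0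
    have : n = 0 := Prod.ext h1 h2
    rw [this, add_zero]
  · simp only [oddPart, fst_add, snd_add, h]
    rw [padicValNat.mul two_ne_zero h0.ne', padicValNat.self one_lt_two, pow_add, pow_one,
      ← two_mul, ← two_mul, Int.mul_ediv_mul_of_pos _ _ two_pos,
      Int.mul_ediv_mul_of_pos _ _ two_pos]

lemma oddPart_eq {n : ℤ × ℤ} (h : ∀ m, n ≠ m + m) : oddPart n = n := by
  have : padicValNat 2 (Int.gcd n.1 n.2) = 0 := by
    refine padicValNat.eq_zero_of_not_dvd fun hd => ?_
    have hd' : ((2 : ℕ) : ℤ) ∣ Int.gcd n.1 n.2 := Int.natCast_dvd_natCast.2 hd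
    obtain ⟨a, ha⟩ := hd'.trans (Int.gcd_dvd_left _ _)
    obtain ⟨b, hb⟩ := hd'.trans (Int.gcd_dvd_right _ _)
    exact h (a, b) (Prod.ext (by push_cast at ha; simp; omega) (by push_cast at hb; simp; omega))
  simp [oddPart, this]

open Classical in
/-- The displacement of a single passage of a closed straight segment. -/
def primitive (u : Plane) : Plane :=
  if h : ∃ n : ℤ × ℤ, u = lat n then lat (oddPart h.choose) else u

lemma primitive_lat (n : ℤ × ℤ) : primitive (lat n) = lat (oddPart n) := by
  have h : ∃ m : ℤ × ℤ, lat n = lat m := ⟨n, rfl⟩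
  rw [primitive, dif_pos h, ← lat_injective h.choose_spec]

lemma primitive_eq (h : ∀ n : ℤ × ℤ, u ≠ lat (n + n)) : primitive u = u := by
  by_cases hu : ∃ n : ℤ × ℤ, u = lat n
  · obtain ⟨n, rfl⟩ := hu
    rw [primitive_lat, oddPart_eq fun m hm => h m (by rw [hm])]
  · rw [primitive, dif_neg hu]

lemma primitive_of_proj (h : proj u ≠ 0) : primitive u = u :=
  primitive_eq fun _ hn => h (hn ▸ proj_lat _)

def Edge.primitive (e : Edge) : Edge := (e.1, OrientedSkein.primitive e.2)

/-- All but finitely many points are passed at most once by the edges in `E`. -/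
def AlmostEmbedded (E : Set Edge) : Prop :=
  ∃ Z : Set Torus, Z.Finite ∧ ∀ e ∈ E, ∀ f ∈ E, ∀ s ∈ Ico₀₁, ∀ t ∈ Ico₀₁,
    e.pt s = f.pt t → (e = f ∧ s = t) ∨ e.pt s ∈ Z

lemma AlmostEmbedded.primitive_eq (h : AlmostEmbedded E) (he : e ∈ E)
    (h0 : e.2 ≠ 0) : primitive e.2 = e.2 := by
  obtain ⟨Z, hZ, h⟩ := h
  refine OrientedSkein.primitive_eq fun n hn => ?_
  refine (infinite_ray e.1 h0 (ε := 1 / 2) (by norm_num)) (hZ.subset ?_)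
  rintro _ ⟨t, ⟨t0, t1⟩, rfl⟩
  have heq : e.pt t = e.pt (t + 1 / 2) := by
    have h1 : (1 / 2 : ℝ) • e.2 = lat n := by
      rw [hn, lat_add]
      module
    rw [Edge.pt, Edge.pt, add_smul, proj_add, h1, proj_lat, add_zero]
  rcases h e he e he t ⟨t0.le, by linarith⟩ (t + 1 / 2) ⟨by linarith, by linarith⟩ heq with
    ⟨-, h⟩ | h
  · linarith
  · exact h

lemma AlmostEmbedded.merge {G : Set Edge} (hs0 : 0 < s) (hs1 : s < 1)
    (h : AlmostEmbedded (G ∪ {(e.1, s • e.2), (e.pt s, (1 - s) • e.2)}))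
    (h1 : (e.1, s • e.2) ∉ G) (h2 : (e.pt s, (1 - s) • e.2) ∉ G)
    (hne : (e.1, s • e.2) ≠ (e.pt s, (1 - s) • e.2)) : AlmostEmbedded (G ∪ {e}) := by
  obtain ⟨Z, hZ, h⟩ := h
  have h1s : 0 < 1 - s := by linarith
  have key : ∀ t ∈ Ico₀₁, ∃ (f : Edge) (r : ℝ), r ∈ Ico₀₁ ∧
      f.pt r = e.pt t ∧ ((f = (e.1, s • e.2) ∧ t = r * s) ∨
        (f = (e.pt s, (1 - s) • e.2) ∧ t = s + r * (1 - s))) := by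
    rintro t ⟨t0, t1⟩
    rcases lt_or_ge t s with hts | hts
    · refine ⟨_, t / s, ⟨by positivity, (div_lt_one hs0).2 hts⟩, ?_, Or.inl ⟨rfl, ?_⟩⟩
      · simp only [Edge.pt, smul_smul, div_mul_cancel₀ _ hs0.ne']
      · rw [div_mul_cancel₀ _ hs0.ne']
    · refine ⟨_, (t - s) / (1 - s), ⟨div_nonneg (by linarith) h1s.le,
        (div_lt_one h1s).2 (by linarith)⟩, ?_, Or.inr ⟨rfl, ?_⟩⟩
      · simp only [Edge.pt, smul_smul, div_mul_cancel₀ _ h1s.ne']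
        rw [add_assoc, ← proj_add, ← add_smul, add_sub_cancel]
      · rw [div_mul_cancel₀ _ h1s.ne']; ring
  have hmem : ∀ {f : Edge} {P Q : Prop}, (f = (e.1, s • e.2) ∧ P) ∨
      (f = (e.pt s, (1 - s) • e.2) ∧ Q) →
      f ∈ ({(e.1, s • e.2), (e.pt s, (1 - s) • e.2)} : Set Edge) ∧ f ∉ G := by
    rintro f P Q (⟨rfl, -⟩ | ⟨rfl, -⟩)
    exacts [⟨.inl rfl, h1⟩, ⟨.inr rfl, h2⟩]
  refine ⟨Z, hZ, ?_⟩
  rintro f (hf | rfl) g (hg | rfl) a ha b hb hab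
  · exact h f (.inl hf) g (.inl hg) a ha b hb hab
  · obtain ⟨k, r, hr, hk, hc⟩ := key b hb
    rcases h f (.inl hf) k (Or.inr (hmem hc).1) a ha r hr (hab.trans hk.symm) with ⟨rfl, -⟩ | h
    · exact ((hmem hc).2 hf).elim
    · exact .inr h
  · obtain ⟨k, r, hr, hk, hc⟩ := key a ha
    rcases h k (Or.inr (hmem hc).1) g (.inl hg) r hr b hb (hk.trans hab) with ⟨rfl, -⟩ | h
    · exact ((hmem hc).2 hg).elim
    · exact Or.inr (hk ▸ h)
  · obtain ⟨k, r, hr, hk, hc⟩ := key a ha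
    obtain ⟨k', r', hr', hk', hc'⟩ := key b hb
    rcases h k (Or.inr (hmem hc).1) k' (Or.inr (hmem hc').1) r hr r' hr'
      (hk.trans (hab.trans hk'.symm)) with ⟨rfl, rfl⟩ | h
    · refine Or.inl ⟨rfl, ?_⟩
      rcases hc with ⟨rfl, h3⟩ | ⟨rfl, h3⟩ <;> rcases hc' with ⟨h4, h5⟩ | ⟨h4, h5⟩
      · rw [h3, h5]
      · exact (hne h4).elim
      · exact (hne h4.symm).elim
      · rw [h3, h5]
    · exact Or.inr (hk ▸ h)

def primitiveHomology (E : Set Edge) : Plane := ∑ᶠ e ∈ E, primitive e.2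

lemma SubdivisionStep.primitiveHomology_eq (h : SubdivisionStep E E')
    (hE' : IsClosedCurve E') (hA : AlmostEmbedded (Edge.primitive '' E')) :
    AlmostEmbedded (Edge.primitive '' E) ∧ primitiveHomology E = primitiveHomology E' := by
  obtain ⟨G, e, s, hs0, hs1, he, h1, h2, rfl, rfl⟩ := h
  have hG : G.Finite := hE'.finite.subset subset_union_left
  have hsum : ∀ {f : Edge}, f ∉ G →
      primitiveHomology (G ∪ {f}) = primitiveHomology G + primitive f.2 := by
    intro f hf
    rw [primitiveHomology, finsum_mem_union (by simpa using hf) hG (finite_singleton _),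
      finsum_mem_singleton]
    rfl
  by_cases hne : (e.1, s • e.2) = (e.pt s, (1 - s) • e.2)
  · rw [← hne, Set.pair_eq_singleton] at hA ⊢
    obtain ⟨h3, h4⟩ := Prod.mk.inj hne
    obtain ⟨n, hn⟩ := (proj_eq_zero_iff (s • e.2)).1 (by
      rw [Edge.pt] at h3; exact left_eq_add.1 h3)
    have hu : e.2 = lat (n + n) := by
      rw [lat_add, ← hn]
      nth_rw 2 [h4]
      module
    have hp : primitive e.2 = primitive (s • e.2) := by
      rw [hn, hu, primitive_lat, primitive_lat, oddPart_add_self]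
    refine ⟨?_, by rw [hsum he, hsum h1, hp]⟩
    rw [image_union, image_singleton] at hA ⊢
    rwa [show e.primitive = Edge.primitive (e.1, s • e.2) by rw [Edge.primitive, Edge.primitive, hp]]
  · set e₁ : Edge := (e.1, s • e.2) with he₁
    set e₂ : Edge := (e.pt s, (1 - s) • e.2) with he₂
    have m1 : e₁ ∈ G ∪ {e₁, e₂} := by simp
    have m2 : e₂ ∈ G ∪ {e₁, e₂} := by simp
    have n1 : proj (s • e.2) ≠ 0 := fun h => hne (hE'.start_injOn m1 m2 (by
      simp [he₁, he₂, Edge.start, Edge.pt, h]))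
    have n2 : proj ((1 - s) • e.2) ≠ 0 := fun h => hne (hE'.finish_injOn m1 m2 (by
      simp [he₁, he₂, Edge.finish, Edge.pt, h]))
    have k1 : Edge.primitive e₁ = e₁ := by rw [Edge.primitive, primitive_of_proj n1]
    have k2 : Edge.primitive e₂ = e₂ := by rw [Edge.primitive, primitive_of_proj n2]
    have hnot : ∀ f ∈ G ∪ {e₁, e₂}, f ∉ G → f ∉ Edge.primitive '' G := by
      rintro f hf hfG ⟨g, hg, hgf⟩
      rw [hE'.start_injOn (.inl hg) hf
        (show g.primitive.1 = f.1 by rw [hgf])] at hg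
      exact hfG hg
    rw [image_union, image_pair, k1, k2] at hA
    have hA' := hA.merge hs0 hs1 (hnot _ m1 h1) (hnot _ m2 h2) hne
    have hp : primitive e.2 = e.2 := hA'.primitive_eq (.inr rfl) fun h => n1 (by
      rw [h, smul_zero, proj_zero])
    rw [image_union, image_singleton, show e.primitive = e by rw [Edge.primitive, hp]]
    refine ⟨hA', ?_⟩
    rw [hsum he, hp, primitiveHomology, primitiveHomology, finsum_mem_union _ hG (toFinite _),
      finsum_mem_pair hne, primitive_of_proj n1, primitive_of_proj n2]
    · congr 1
      module
    · rw [disjoint_left]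
      rintro f hf (rfl | rfl)
      exacts [h1 hf, h2 hf]

lemma Subdivision.primitiveHomology_eq (h : Subdivision E E')
    (hE' : IsClosedCurve E') (hA : AlmostEmbedded (Edge.primitive '' E')) :
    primitiveHomology E = primitiveHomology E' := by
  suffices IsClosedCurve E ∧ AlmostEmbedded (Edge.primitive '' E) ∧
    primitiveHomology E = primitiveHomology E' from this.2.2
  induction h using Relation.ReflTransGen.head_induction_on with
  | refl => exact ⟨hE', hA, rfl⟩
  | head hs _ ih =>
    obtain ⟨h1, h2, h3⟩ := ih
    obtain ⟨h4, h5⟩ := hs.primitiveHomology_eq h1 h2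
    exact ⟨(hs.isClosedCurve h1).1, h4, h5.trans h3⟩

namespace Diagram

variable (D : Diagram)

lemma underlying_ne_zero (he : e ∈ D.underlying) : e.2 ≠ 0 := by
  rcases he with he | ⟨c, hc, rfl⟩ | ⟨c, hc, rfl⟩
  · exact D.arc_ne_zero he
  · exact smul_ne_zero two_ne_zero (ne_zero_of_det (D.transverse c hc)).1
  · exact smul_ne_zero two_ne_zero (ne_zero_of_det (D.transverse c hc)).2

lemma homology_underlying (h : Subdivision E D.underlying) :
    homology D.underlying = primitiveHomology E := by
  have hA : AlmostEmbedded D.underlying := ⟨_, D.crossings.finite_toSet.image Crossing.center,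
    fun e he f hf s hs t ht hst => (D.double_points e he f hf s hs t ht hst).imp_right
      fun ⟨c, hc, h⟩ => ⟨c, hc, h.symm⟩⟩
  have hp : ∀ e ∈ D.underlying, primitive e.2 = e.2 := fun e he =>
    hA.primitive_eq he (D.underlying_ne_zero he)
  have him : Edge.primitive '' D.underlying = D.underlying := by
    rw [Set.image_congr (g := id) fun e he => by rw [Edge.primitive, hp e he]; rfl, Set.image_id]
  rw [h.primitiveHomology_eq D.isClosedCurve_underlying (him.symm ▸ hA), primitiveHomology, homology]
  exact (finsum_mem_congr rfl hp).symm

end Diagram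

/-! ### The triangle of a Reidemeister II move -/

/-- The edges in `F` meet an embedded triangle, apart from two of its vertices, exactly in a chord
between interior points of two sides. -/
structure ChordTriangle (F : Set Edge) (p : Torus) (x y : Plane) (s t : ℝ) : Prop where
  det_ne : det x y ≠ 0
  inj : InjOn (coords p x y) triangleDomain
  hs : s ∈ Ioo₀₁
  ht : t ∈ Ioo₀₁
  inter : support F ∩ triangle p x y =
    {p, p + proj (x + y)} ∪ coords p x y '' segment ℝ (s, 0) (1, t)

namespace ChordTriangle

variable {F : Set Edge} {p : Torus} {x y : Plane} {s t : ℝ}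

lemma mem_of_chord (h : ChordTriangle F p x y s t) {l : ℝ} (h0 : 0 ≤ l) (h1 : l ≤ 1) :
    ((s + l * (1 - s), l * t) : ℝ × ℝ) ∈ triangleDomain := by
  obtain ⟨hs0, hs1⟩ := h.hs
  obtain ⟨ht0, ht1⟩ := h.ht
  exact ⟨by positivity, by nlinarith, by nlinarith⟩

lemma cases_of_mem (h : ChordTriangle F p x y s t) {q : ℝ × ℝ} (hq : q ∈ triangleDomain)
    (hqF : coords p x y q ∈ support F) :
    q = (0, 0) ∨ q = (1, 1) ∨ ∃ l ∈ Icc₀₁, q = (s + l * (1 - s), l * t) := by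
  have h0 : ((0, 0) : ℝ × ℝ) ∈ triangleDomain := by simp [triangleDomain]
  have h1 : ((1, 1) : ℝ × ℝ) ∈ triangleDomain := by simp [triangleDomain]
  have hm : coords p x y q ∈ support F ∩ triangle p x y := ⟨hqF, q, hq, rfl⟩
  rw [h.inter] at hm
  rcases hm with (hm | hm) | ⟨r, hr, hm⟩
  · exact Or.inl (h.inj hq h0 (hm.trans (by simp [coords, proj_zero])))
  · exact Or.inr (Or.inl (h.inj hq h1 (hm.trans (by simp [coords]))))
  · obtain ⟨l, hl, rfl⟩ := segment_eq_image ℝ (s, (0 : ℝ)) (1, t) ▸ hr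
    have hr' : ((1 - l) • (s, (0 : ℝ)) + l • ((1 : ℝ), t)) = (s + l * (1 - s), l * t) := by
      ext <;> simp; ring
    simp only [hr'] at hm
    exact Or.inr (Or.inr ⟨l, hl, h.inj hq (h.mem_of_chord hl.1 hl.2) hm.symm⟩)

lemma chord_mem (h : ChordTriangle F p x y s t) {l : ℝ} (hl : l ∈ Icc₀₁) :
    coords p x y (s + l * (1 - s), l * t) ∈ support F := by
  have : coords p x y (s + l * (1 - s), l * t) ∈ support F ∩ triangle p x y := by
    rw [h.inter]
    refine Or.inr ⟨_, ?_, rfl⟩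
    rw [segment_eq_image]
    exact ⟨l, hl, by ext <;> simp; ring⟩
  exact this.1

lemma coords_ne (h : ChordTriangle F p x y s t) {q r : ℝ × ℝ} (hq : q ∈ triangleDomain)
    (hr : r ∈ triangleDomain) (hqr : q ≠ r) :
    coords p x y q ≠ coords p x y r := fun heq => hqr (h.inj hq hr heq)

lemma vertices_ne (h : ChordTriangle F p x y s t) :
    p ≠ p + proj x ∧ p ≠ p + proj (x + y) ∧ p + proj x ≠ p + proj (x + y) := by
  have h0 : coords p x y (0, 0) = p := by simp [coords, proj_zero]
  have h1 : coords p x y (1, 0) = p + proj x := by simp [coords]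
  have h2 : coords p x y (1, 1) = p + proj (x + y) := by simp [coords]
  rw [← h1, ← h2]
  nth_rw 1 3 [← h0]
  refine ⟨h.coords_ne ?_ ?_ ?_, h.coords_ne ?_ ?_ ?_, h.coords_ne ?_ ?_ ?_⟩ <;>
    simp [triangleDomain]

lemma notMem (h : ChordTriangle F p x y s t) :
    (p, x + y) ∉ F ∧ (p, x) ∉ F ∧ (p + proj x, y) ∉ F := by
  obtain ⟨hs0, hs1⟩ := h.hs
  obtain ⟨ht0, ht1⟩ := h.ht
  refine ⟨fun hF => ?_, fun hF => ?_, fun hF => ?_⟩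
  · rcases h.cases_of_mem (q := (1 / 2, 1 / 2)) (by norm_num [triangleDomain])
      ⟨_, hF, 1 / 2, by norm_num, by simp [Edge.pt, coords]⟩ with h | h | ⟨l, ⟨hl0, hl1⟩, h⟩ <;>
      obtain ⟨h1, h2⟩ := Prod.mk.inj h <;> nlinarith
  · rcases h.cases_of_mem (q := (s / 2, 0)) ⟨le_rfl, by positivity, by dsimp only; linarith⟩
      ⟨_, hF, s / 2, ⟨by positivity, by linarith⟩, by simp [Edge.pt, coords]⟩ with
        h | h | ⟨l, ⟨hl0, hl1⟩, h⟩ <;> obtain ⟨h1, h2⟩ := Prod.mk.inj h <;> nlinarith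
  · rcases h.cases_of_mem (q := (1, t / 2)) ⟨by positivity, by dsimp only; linarith, le_rfl⟩
      ⟨_, hF, t / 2, ⟨by positivity, by linarith⟩, by simp [Edge.pt, coords, proj_add, add_assoc]⟩
        with h | h | ⟨l, ⟨hl0, hl1⟩, h⟩ <;> obtain ⟨h1, h2⟩ := Prod.mk.inj h <;> nlinarith

lemma primitiveHomology_eq (h : ChordTriangle F p x y s t) (hF : F.Finite) :
    primitiveHomology (F ∪ {(p, x + y)}) =
      primitiveHomology (F ∪ {(p, x), (p + proj x, y)}) := by
  obtain ⟨n1, n2, n3⟩ := h.vertices_ne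
  obtain ⟨m1, m2, m3⟩ := h.notMem
  have k1 : proj x ≠ 0 := fun h0 => n1 (by rw [h0, add_zero])
  have k2 : proj (x + y) ≠ 0 := fun h0 => n2 (by rw [h0, add_zero])
  have k3 : proj y ≠ 0 := fun h0 => n3 (by rw [proj_add, h0, add_zero])
  rw [primitiveHomology, primitiveHomology,
    finsum_mem_union (Set.disjoint_singleton_right.2 m1) hF (finite_singleton _),
    finsum_mem_union _ hF (toFinite _), finsum_mem_pair fun h0 => n1 (congrArg Prod.fst h0),
    finsum_mem_singleton, primitive_of_proj k1, primitive_of_proj k2, primitive_of_proj k3]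
  rw [disjoint_left]
  rintro f hf (rfl | rfl)
  exacts [m2 hf, m3 hf]

lemma avoids_vertex {q b c : ℝ × ℝ} {k : ℝ} (hk : 0 < k)
    (hK : ∀ r ∈ triangleDomain, dist r q ≤ k → coords p x y r ∈ support F → r = q)
    (hq : q ∈ triangleDomain) (hb : q + k • b ∈ triangleDomain) (hc : q + k • c ∈ triangleDomain)
    (hb1 : ‖b‖ ≤ 1) (hc1 : ‖c‖ ≤ 1) :
    Avoids F (coords p x y q) (b.1 • x + b.2 • y) (c.1 • x + c.2 • y) := by
  have hT : Convex ℝ triangleDomain := by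
    rintro q ⟨a1, a2, a3⟩ r ⟨b1, b2, b3⟩ a b ha hb hab
    refine ⟨?_, ?_, ?_⟩ <;> simp <;> nlinarith
  have hball {b : ℝ × ℝ} (hb : ‖b‖ ≤ 1) : q + k • b ∈ Metric.closedBall q k := by
    simpa [norm_smul, abs_of_pos hk] using mul_le_of_le_one_right hk.le hb
  have := avoids_of_convex (F := F) (o := p) (x := x) (y := y)
    (hT.inter (convex_closedBall q k)) ((finite_singleton (coords p x y q)).subset (by
      rintro _ ⟨hz, r, ⟨hr, hd⟩, rfl⟩; rw [hK r hr hd hz]; rfl))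
    ⟨hq, Metric.mem_closedBall_self hk.le⟩ ⟨hb, hball hb1⟩ ⟨hc, hball hc1⟩
  refine Avoids.of_smul hk ?_
  simpa [smul_smul] using this

lemma avoids_start (h : ChordTriangle F p x y s t) : Avoids F p x (x + y) := by
  obtain ⟨hs0, hs1⟩ := h.hs
  obtain ⟨ht0, ht1⟩ := h.ht
  have := avoids_vertex (F := F) (p := p) (x := x) (y := y) (q := (0, 0)) (b := (1, 0))
    (c := (1, 1)) (k := s / 2) (by positivity) (fun r hr hd hz => ?_)
    (by simp [triangleDomain]) (by simp [triangleDomain]; grind)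
    (by simp [triangleDomain]; grind) (by simp) (by simp)
  · simpa [coords, proj_zero] using this
  · have := (abs_le.1 ((le_max_left _ _).trans hd)).2
    rcases h.cases_of_mem hr hz with rfl | rfl | ⟨l, ⟨hl0, hl1⟩, rfl⟩
    · rfl
    · dsimp only at this; linarith
    · dsimp only at this; nlinarith

lemma avoids_finish (h : ChordTriangle F p x y s t) :
    Avoids F (p + proj (x + y)) (-y) (-(x + y)) := by
  obtain ⟨hs0, hs1⟩ := h.hs
  obtain ⟨ht0, ht1⟩ := h.ht
  have := avoids_vertex (F := F) (p := p) (x := x) (y := y) (q := (1, 1)) (b := (0, -1))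
    (c := (-1, -1)) (k := (1 - t) / 2) (by linarith) (fun r hr hd hz => ?_)
    (by simp [triangleDomain]) (by simp [triangleDomain]; grind)
    (by simp [triangleDomain]; grind) (by simp) (by simp)
  · simpa [coords, add_comm] using this
  · have := (abs_le.1 ((le_max_right _ _).trans hd)).1
    rcases h.cases_of_mem hr hz with rfl | rfl | ⟨l, ⟨hl0, hl1⟩, rfl⟩
    · dsimp only at this; linarith
    · rfl
    · dsimp only at this; nlinarith

lemma rotation_eq (h : ChordTriangle F p x y s t) (hE : IsClosedCurve (F ∪ {(p, x + y)}))
    (hE' : IsClosedCurve (F ∪ {(p, x), (p + proj x, y)})) (h0 : ∀ e ∈ F, e.2 ≠ 0) :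
    rotation (F ∪ {(p, x + y)}) = rotation (F ∪ {(p, x), (p + proj x, y)}) := by
  classical
  obtain ⟨n1, n2, n3⟩ := h.vertices_ne
  have hd := h.det_ne
  have f1 : Edge.finish (p, x) = p + proj x := rfl
  have f2 : Edge.finish (p + proj x, y) = p + proj (x + y) := by
    rw [Edge.finish, proj_add, add_assoc]
  have f3 : Edge.finish (p, x + y) = p + proj (x + y) := rfl
  have e1 : (p, x) ∈ F ∪ {(p, x), (p + proj x, y)} := by simp
  have e2 : (p + proj x, y) ∈ F ∪ {(p, x), (p + proj x, y)} := by simp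
  have e3 : (p, x + y) ∈ F ∪ {(p, x + y)} := by simp
  have hF : F ⊆ F ∪ {(p, x + y)} := subset_union_left
  have hF' : F ⊆ F ∪ {(p, x), (p + proj x, y)} := subset_union_left
  obtain ⟨f, hf, hff⟩ := hE.exists_finish e3
  obtain ⟨g, hg, hgs⟩ := hE.exists_start e3
  replace hf : f ∈ F := hf.resolve_right fun e => n2 (by rw [e] at hff; exact hff.symm)
  replace hg : g ∈ F := hg.resolve_right fun e => n2 (by rw [e] at hgs; exact hgs)
  have v1 := vertexTurn_out hE hE' hF hF' e3 e1 hf (h0 f hf)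
    (by rw [det_add_right, det_self, zero_add]; exact hd) (z := p) rfl rfl hff h.avoids_start
  have v2 := vertexTurn_in hE hE' hF hF' e3 e2 hg (h0 g hg)
    (by rw [det_add_right, det_self, add_zero, det_comm]; exact neg_ne_zero.2 hd) f3 f2 hgs
    h.avoids_finish
  have hx : p + proj x ∉ support F := by
    intro hx
    obtain ⟨hs0, hs1⟩ := h.hs
    obtain ⟨ht0, ht1⟩ := h.ht
    rcases h.cases_of_mem (q := (1, 0)) (by simp [triangleDomain])
      (by simpa [coords] using hx) with h | h | ⟨l, ⟨hl0, hl1⟩, h⟩ <;>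
        obtain ⟨h1, h2⟩ := Prod.mk.inj h <;> nlinarith
  have v3 : vertexTurn (F ∪ {(p, x + y)}) (p + proj x) -
      vertexTurn (F ∪ {(p, x), (p + proj x, y)}) (p + proj x) = -turn x y := by
    rw [vertexTurn, vertexTurn, inDir_eq hE'.finish_injOn e1 f1,
      outDir_eq hE'.start_injOn e2 (z := p + proj x) rfl,
      inDir_eq_zero, turn_zero_left, zero_sub]
    rintro e (he | rfl) heq
    · exact hx ⟨e, he, 1, by simp, by rw [pt_one, heq]⟩
    · exact n3 (heq.symm.trans f3)
  have hsum : turn x (x + y) + turn (x + y) y = turn x y := by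
    refine turn_add (ne_zero_of_det hd).1 (by rw [det_add_left, det_self, add_zero]; exact hd) ?_
    intro l m hl hm heq
    have k1 := congrArg (det · y) heq
    simp only [det_neg_left, det_add_left, det_smul_left, det_self, mul_zero, add_zero] at k1
    exact hd (by nlinarith [mul_self_pos.2 hd])
  rw [← sub_eq_zero, rotation_sub hE.finite hE'.finite {p, p + proj x, p + proj (x + y)},
    sum_insert (by simp [n1, n2]), Finset.sum_pair n3]
  · exact (congrArg₂ (· + ·) v1 (congrArg₂ (· + ·) v3 v2)).trans (by dsimp only; linarith)
  · intro z hz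
    have s1 (z : Torus) (v : Plane) : Edge.start (z, v) = z := rfl
    refine vertexTurn_eq ?_ ?_
    · rintro _ rfl
      simp only [s1, f3]; grind
    · rintro _ (rfl | rfl) <;> simp only [s1, f1, f2] <;> grind

end ChordTriangle

/-! ### The signs of the crossings of a Reidemeister II move -/

lemma exists_comb {x y : Plane} (h : det x y ≠ 0) (v : Plane) : ∃ a b : ℝ, v = a • x + b • y := by
  refine ⟨det v y / det x y, det x v / det x y, ?_⟩
  ext <;> simp [div_mul_eq_mul_div] <;> rw [← add_div, eq_div_iff h] <;> simp only [det] <;> ring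

lemma sign_add_sign_eq_zero {a b : ℝ} (h : a * b < 0) :
    (SignType.sign a : ℤ) + (SignType.sign b : ℤ) = 0 := by
  rcases mul_neg_iff.1 h with ⟨h1, h2⟩ | ⟨h1, h2⟩ <;> simp [sign_pos, sign_neg, h1, h2]

lemma Diagram.exists_smul_of_ray (D : Diagram) {c : Crossing} (hc : c ∈ D.crossings)
    (hv : ∀ᶠ η : ℝ in 𝓝[>] 0, c.center + proj (η • v) ∈ support D.underlying) :
    ∃ b : ℝ, v = b • c.overDir ∨ v = b • c.underDir := by
  obtain ⟨a, b, rfl⟩ := exists_comb (D.transverse c hc) v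
  obtain ⟨η, hη, h1, (hη0 : 0 < η)⟩ := (hv.and ((eventually_small (|a| + |b|) one_pos).and
    self_mem_nhdsWithin)).exists
  have hlt : |η * a| + |η * b| < 1 := by
    rw [abs_mul, abs_mul, abs_of_pos hη0]; linarith
  have hq : ((η * a, η * b) : ℝ × ℝ) ∈ Crossing.discDomain := hlt.le
  have heq : c.center + proj (η • (a • c.overDir + b • c.underDir)) =
      coords c.center c.overDir c.underDir (η * a, η * b) := by
    simp only [coords, smul_add, smul_smul]
  rw [heq] at hη
  rw [Diagram.underlying, strands, support_union] at hη
  have hstrand {d : Crossing} (hd : d ∈ D.crossings) {r : ℝ × ℝ} (hr : r ∈ Crossing.discDomain)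
      (h : coords d.center d.overDir d.underDir r =
        coords c.center c.overDir c.underDir (η * a, η * b)) : r = (η * a, η * b) :=
    (D.coords_inj hd hc hr hq h).2
  rcases hη with hη | ⟨_, ⟨d, hd, rfl⟩ | ⟨d, hd, rfl⟩, τ, ⟨h0, h1⟩, hτ⟩
  · obtain ⟨r, hr, hrd, hrz⟩ := Diagram.corners_coords c (D.disc_arcs c hc ⟨hη, _, hq, rfl⟩)
    rw [hstrand hc hrd hrz.symm] at hr
    simp only [mem_insert_iff, mem_singleton_iff, Prod.mk.injEq] at hr
    rcases hr with ⟨h3, h4⟩ | ⟨h3, h4⟩ | ⟨h3, h4⟩ | ⟨h3, h4⟩ <;> simp [h3, h4] at hlt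
  · have := hstrand hd (r := (2 * τ - 1, 0)) (by simp only [mem_discDomain]; grind) (by
      rw [← hτ, Crossing.overStrand_pt]; simp [coords])
    obtain rfl : b = 0 := by simpa [hη0.ne'] using (Prod.mk.inj this).2
    exact ⟨a, by simp⟩
  · have := hstrand hd (r := (0, 2 * τ - 1)) (by simp only [mem_discDomain]; grind) (by
      rw [← hτ, Crossing.underStrand_pt]; simp [coords])
    obtain rfl : a = 0 := by simpa [hη0.ne'] using (Prod.mk.inj this).1
    exact ⟨b, by simp⟩

/-- The edges in `U` that point in the direction of `v`. -/
def along (U : Set Edge) (v : Plane) : Set Edge := {e ∈ U | ∃ r : ℝ, 0 < r ∧ e.2 = r • v}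

namespace ChordTriangle

variable {F : Set Edge} {p : Torus} {x y : Plane} {s t : ℝ} {D : Diagram}

local notation "bent" => F ∪ {(p, x), (p + proj x, y)}

local notation "chordPt" l => coords p x y (s + l * (1 - s), l * t)

lemma collinear_of_mem (h : ChordTriangle F p x y s t)
    (hD : Subdivision bent D.underlying) {q : ℝ × ℝ} (h1 : 0 < q.2)
    (h2 : q.2 < q.1) (h3 : q.1 < 1) (hq : coords p x y q ∈ support D.underlying) :
    t * (q.1 - s) = (1 - s) * q.2 := by
  have hqd : q ∈ triangleDomain := ⟨h1.le, h2.le, h3.le⟩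
  obtain ⟨e, he, τ, ⟨τ0, τ1⟩, hτ⟩ := hq
  obtain ⟨f, hf, a, r, ha, hr, har, rfl⟩ := hD.exists_coarse he
  have hpt : f.pt (a + τ * r) = coords p x y q := by
    rw [← hτ]
    simp only [Edge.pt]
    rw [add_assoc, ← proj_add, add_smul, smul_smul]
  have h0 : 0 ≤ a + τ * r := by positivity
  have h1' : a + τ * r ≤ 1 := by nlinarith
  rcases hf with hf | rfl | hf
  · rcases h.cases_of_mem hqd ⟨f, hf, _, ⟨h0, h1'⟩, hpt⟩ with rfl | rfl | ⟨l, -, rfl⟩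
    exacts [by simp at h1, by simp at h3, by ring]
  · have := h.inj (x₁ := (a + τ * r, 0)) ⟨le_rfl, h0, h1'⟩ hqd (by
      rw [← hpt]; simp [Edge.pt, coords])
    rw [← this] at h1
    simp at h1
  · rw [Set.mem_singleton_iff.1 hf] at hpt
    have := h.inj (x₁ := (1, a + τ * r)) ⟨h0, h1', le_rfl⟩ hqd (by
      rw [← hpt]; simp [Edge.pt, coords, proj_add, add_assoc])
    rw [← this] at h3
    simp at h3

lemma exists_smul_of_mem (h : ChordTriangle F p x y s t)
    (hD : Subdivision bent D.underlying)
    (he : e ∈ D.underlying) {τ : ℝ} (hτ : τ ∈ Icc₀₁) {l : ℝ}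
    (hl : l ∈ Ioo₀₁) (hel : e.pt τ = (chordPt l)) :
    ∃ r : ℝ, r ≠ 0 ∧ e.2 = r • ((1 - s) • x + t • y) := by
  obtain ⟨hs0, hs1⟩ := h.hs
  obtain ⟨ht0, ht1⟩ := h.ht
  obtain ⟨l0, l1⟩ := hl
  obtain ⟨a, b, hab⟩ := exists_comb h.det_ne e.2
  have hσ : ∃ σ : ℝ, (σ = 1 ∨ σ = -1) ∧ ∀ᶠ η : ℝ in 𝓝[>] 0, τ + σ * η ∈ Icc₀₁ := by
    rcases hτ.2.lt_or_eq with h1 | rfl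
    · refine ⟨1, .inl rfl, ?_⟩
      filter_upwards [eventually_small 1 (sub_pos.2 h1), self_mem_nhdsWithin] with η h2 (_ : 0 < η)
      exact ⟨by linarith [hτ.1], by linarith⟩
    · refine ⟨-1, .inr rfl, ?_⟩
      filter_upwards [eventually_small 1 one_pos, self_mem_nhdsWithin] with η h2 (_ : 0 < η)
      exact ⟨by linarith, by linarith⟩
  obtain ⟨σ, hσ, hev⟩ := hσ
  have hσ0 : σ ≠ 0 := by rcases hσ with rfl | rfl <;> norm_num
  obtain ⟨η, h1, h2, h3, h4, (hη0 : 0 < η)⟩ := (hev.and ((eventually_small (-(σ * b)) (mul_pos l0 ht0)).and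
    ((eventually_small (σ * (b - a)) (show 0 < s + l * (1 - s) - l * t by nlinarith)).and
    ((eventually_small (σ * a) (show 0 < 1 - (s + l * (1 - s)) by nlinarith)).and
      self_mem_nhdsWithin)))).exists
  have := h.collinear_of_mem hD (q := (s + l * (1 - s) + σ * η * a, l * t + σ * η * b))
    (by dsimp only; linarith) (by dsimp only; linarith) (by dsimp only; linarith)
    ⟨e, he, _, h1, by
      rw [Edge.pt, add_smul, proj_add, ← add_assoc, ← Edge.pt, hel, hab, coords, coords, add_assoc,
        ← proj_add]
      congr 2
      module⟩
  have key : t * a = (1 - s) * b := by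
    have h6 : (σ * η) * (t * a) = (σ * η) * ((1 - s) * b) := by linarith
    exact mul_left_cancel₀ (mul_ne_zero hσ0 hη0.ne') h6
  have hr : e.2 = (b / t) • ((1 - s) • x + t • y) := by
    rw [hab, smul_add, smul_smul, smul_smul, div_mul_cancel₀ _ ht0.ne', div_mul_eq_mul_div,
      mul_comm b, ← key, mul_div_cancel_left₀ _ ht0.ne']
  refine ⟨_, fun h0 => D.underlying_ne_zero he ?_, hr⟩
  rw [hr, h0, zero_smul]

lemma center_ne (h : ChordTriangle F p x y s t)
    (hD : Subdivision bent D.underlying) {c : Crossing}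
    (hc : c ∈ D.crossings) {l : ℝ} (hl : l ∈ Ioo₀₁) :
    (chordPt l) ≠ c.center := by
  intro hcl
  obtain ⟨r, -, hr⟩ := h.exists_smul_of_mem hD (e := c.overStrand) (Or.inr (Or.inl ⟨c, hc, rfl⟩))
    (τ := 1 / 2) (by norm_num) hl (by rw [hcl, Crossing.overStrand_pt]; norm_num [proj_zero])
  obtain ⟨r', -, hr'⟩ := h.exists_smul_of_mem hD (e := c.underStrand) (Or.inr (Or.inr ⟨c, hc, rfl⟩))
    (τ := 1 / 2) (by norm_num) hl (by rw [hcl, Crossing.underStrand_pt]; norm_num [proj_zero])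
  have hd : det ((2 : ℝ) • c.overDir) ((2 : ℝ) • c.underDir) = 0 := by
    change det c.overStrand.2 c.underStrand.2 = 0
    rw [hr, hr', det_smul_left, det_smul_right, det_self, mul_zero, mul_zero]
  rw [det_smul_left, det_smul_right] at hd
  exact D.transverse c hc (by linarith)

lemma chord_add (l η σ : ℝ) : coords p x y (s + (l + η * σ) * (1 - s), (l + η * σ) * t) =
    (chordPt l) + proj (η • σ • ((1 - s) • x + t • y)) := by
  rw [coords, coords, add_assoc, ← proj_add]
  congr 2
  module

lemma exists_Ico_along (h : ChordTriangle F p x y s t)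
    (hD : Subdivision bent D.underlying) {l : ℝ}
    (hl : l ∈ Ioo₀₁) {σ : ℝ} (hσ : σ = 1 ∨ σ = -1)
    (hm : (chordPt l) ∈
      support (along D.underlying (σ • ((1 - s) • x + t • y)))) :
    ∃ e ∈ along D.underlying (σ • ((1 - s) • x + t • y)), ∃ τ ∈ Ico₀₁,
      e.pt τ = (chordPt l) := by
  obtain ⟨e, he, τ, ⟨τ0, τ1⟩, hτ⟩ := hm
  rcases τ1.lt_or_eq with τ1 | rfl
  · exact ⟨e, he, τ, ⟨τ0, τ1⟩, hτ⟩
  obtain ⟨g, hg, hge⟩ := D.isClosedCurve_underlying.exists_start he.1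
  rw [pt_one] at hτ
  obtain ⟨r', hr', hgr⟩ := h.exists_smul_of_mem hD hg (τ := 0) (by simp) hl
    (by rw [pt_zero, hge, hτ])
  have hσσ : σ * σ = 1 := by rcases hσ with rfl | rfl <;> norm_num
  have hgr' : g.2 = (r' * σ) • (σ • ((1 - s) • x + t • y)) := by
    rw [smul_smul, mul_assoc, hσσ, mul_one, hgr]
  rcases lt_or_gt_of_ne (mul_ne_zero hr' (show σ ≠ 0 by rcases hσ with rfl | rfl <;> norm_num))
    with hneg | hpos
  · exfalso
    obtain ⟨heU, r, hr, her⟩ := he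
    set v := σ • ((1 - s) • x + t • y) with hv
    set k := -(r' * σ) with hk
    have hk0 : 0 < k := by linarith
    obtain ⟨η, h1, h2, h3, h4, (hη0 : 0 < η)⟩ := ((eventually_small 1 hr).and ((eventually_small 1 hk0).and
      ((eventually_small σ hl.1).and
      ((eventually_small (-σ) (sub_pos.2 hl.2)).and self_mem_nhdsWithin)))).exists
    have hpt : e.pt (1 - η / r) = coords p x y (s + (l + η * (-σ)) * (1 - s), (l + η * (-σ)) * t) := by
      rw [chord_add, ← hτ, Edge.pt, Edge.finish, add_assoc, ← proj_add]
      congr 2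
      rw [neg_smul, smul_neg, sub_smul, one_smul, ← hv, ← sub_eq_add_neg, her, smul_smul (η / r),
        div_mul_cancel₀ _ hr.ne']
    have hpt' : g.pt (η / k) = coords p x y (s + (l + η * (-σ)) * (1 - s), (l + η * (-σ)) * t) := by
      rw [chord_add, ← hτ, ← hge, Edge.pt, Edge.start]
      congr 2
      rw [hgr', show r' * σ = -k by rw [hk, neg_neg], smul_smul, mul_neg,
        div_mul_cancel₀ _ hk0.ne', neg_smul, neg_smul, smul_neg]
    have hη1 : η / r < 1 := (div_lt_one hr).2 (by linarith)
    have hη2 : 0 < η / r := by positivity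
    rcases D.double_points e heU g hg (1 - η / r) ⟨by linarith, by linarith⟩ (η / k)
      ⟨by positivity, (div_lt_one hk0).2 (by linarith)⟩ (hpt.trans hpt'.symm) with
      ⟨rfl, -⟩ | ⟨c, hc, hcc⟩
    · have h6 : (r + k) • v = 0 := by
        rw [add_smul, ← her, hgr', hk, ← add_smul, add_neg_cancel, zero_smul]
      refine D.underlying_ne_zero heU ?_
      rw [her, (smul_eq_zero.1 h6).resolve_left (by linarith), smul_zero]
    · exact h.center_ne hD hc ⟨by linarith, by linarith⟩ (hpt.symm.trans hcc)
  · exact ⟨g, ⟨hg, _, hpos, hgr'⟩, 0, zero_mem_Ico, by rw [pt_zero, hge, hτ]⟩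

lemma exists_underlying (h : ChordTriangle F p x y s t)
    (hE : IsClosedCurve bent)
    (hD : Subdivision bent D.underlying) {l : ℝ}
    (hl : l ∈ Icc₀₁) : ∃ e ∈ D.underlying, ∃ τ ∈ Ico₀₁,
      e.pt τ = (chordPt l) := by
  obtain ⟨e, he, τ, ⟨τ0, τ1⟩, hek⟩ := h.chord_mem hl
  rcases τ1.lt_or_eq with τ1 | rfl
  · obtain ⟨e', he', τ', hτ', -, -, h3, -⟩ := hD.exists_fine (.inl he) ⟨τ0, τ1⟩
    exact ⟨e', he', τ', hτ', h3.trans hek⟩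
  · obtain ⟨g, hg, hge⟩ := hE.exists_start (.inl he)
    obtain ⟨e', he', τ', hτ', -, -, h3, -⟩ := hD.exists_fine hg zero_mem_Ico
    exact ⟨e', he', τ', hτ', by rw [h3, pt_zero, hge, ← pt_one, hek]⟩

lemma along_unique (h : ChordTriangle F p x y s t)
    (hE : IsClosedCurve bent)
    (hD : Subdivision bent D.underlying) {l l' : ℝ}
    (hl : l ∈ Ioo₀₁) (hl' : l' ∈ Ioo₀₁)
    (hm : (chordPt l) ∈
      support (along D.underlying ((1 : ℝ) • ((1 - s) • x + t • y))))
    (hm' : coords p x y (s + l' * (1 - s), l' * t) ∈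
      support (along D.underlying ((-1 : ℝ) • ((1 - s) • x + t • y)))) : False := by
  set w := (1 - s) • x + t • y with hw
  have hcont : Continuous fun l : ℝ => (chordPt l) :=
    continuous_const.add (continuous_proj.comp (by fun_prop))
  have hcl (v : Plane) : IsClosed
      {l : ℝ | (chordPt l) ∈ support (along D.underlying v)} :=
    (isCompact_support (D.isClosedCurve_underlying.finite.subset (Set.sep_subset _ _))).isClosed.preimage
      hcont
  have hcover : Ioo₀₁ ⊆
      {l : ℝ | (chordPt l) ∈ support (along D.underlying ((1 : ℝ) • w))} ∪
      {l : ℝ | (chordPt l) ∈ support (along D.underlying ((-1 : ℝ) • w))} := by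
    intro k hk
    obtain ⟨e', he', τ', hτ', hek'⟩ := h.exists_underlying hE hD ⟨hk.1.le, hk.2.le⟩
    obtain ⟨r, hr0, hr⟩ := h.exists_smul_of_mem hD he' (mem_Icc_of_mem_Ico hτ') hk hek'
    rcases lt_or_gt_of_ne hr0 with hr0 | hr0
    · exact Or.inr ⟨e', ⟨he', -r, by linarith, by rw [hr]; module⟩, τ', mem_Icc_of_mem_Ico hτ', hek'⟩
    · exact Or.inl ⟨e', ⟨he', r, hr0, by rw [hr, one_smul]⟩, τ', mem_Icc_of_mem_Ico hτ', hek'⟩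
  obtain ⟨k, hk, h1, h2⟩ := isPreconnected_closed_iff.1 isPreconnected_Ioo _ _
    (hcl ((1 : ℝ) • w)) (hcl ((-1 : ℝ) • w)) hcover ⟨l, hl, hm⟩ ⟨l', hl', hm'⟩
  obtain ⟨e, ⟨he, r, hr, her⟩, τ, hτ, hek⟩ := h.exists_Ico_along hD hk (.inl rfl) h1
  obtain ⟨f, ⟨hf, r', hr', hfr⟩, τ', hτ', hfk⟩ := h.exists_Ico_along hD hk (.inr rfl) h2
  rcases D.double_points e he f hf τ hτ τ' hτ' (hek.trans hfk.symm) with ⟨rfl, -⟩ | ⟨c, hc, hcc⟩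
  · have h6 : (r + r') • w = 0 := by
      have := her.symm.trans hfr
      rw [one_smul, ← hw, neg_one_smul, smul_neg] at this
      rw [add_smul, this, neg_add_cancel]
    refine D.underlying_ne_zero he ?_
    rw [her, ← hw, (smul_eq_zero.1 h6).resolve_left (by linarith), smul_zero, smul_zero]
  · exact h.center_ne hD hc hk (hek.symm.trans hcc)

end ChordTriangle

lemma ChordTriangle.eventually_along {c : Crossing} {d : Plane} {b : ℝ}
    (hg : (c.center + proj (-d), (2 : ℝ) • d) ∈ D.underlying) (hv : v = b • d) (hb : b ≠ 0) :
    ∃ σ : ℝ, (σ = 1 ∨ σ = -1) ∧ 0 < b * σ ∧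
      ∀ᶠ η : ℝ in 𝓝[>] 0, c.center + proj (η • v) ∈ support (along D.underlying (σ • v)) := by
  have hσ : ∃ σ : ℝ, (σ = 1 ∨ σ = -1) ∧ 0 < b * σ := by
    rcases lt_or_gt_of_ne hb with h | h
    exacts [⟨-1, .inr rfl, by linarith⟩, ⟨1, .inl rfl, by linarith⟩]
  obtain ⟨σ, hσ, hbσ⟩ := hσ
  refine ⟨σ, hσ, hbσ, ?_⟩
  filter_upwards [eventually_small b one_pos, eventually_small (-b) one_pos] with η h1 h2
  refine ⟨_, ⟨hg, 2 / (b * σ), by positivity, ?_⟩, (1 + η * b) / 2, ⟨by linarith, by linarith⟩, ?_⟩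
  · rw [hv, smul_smul, smul_smul, mul_assoc, mul_comm σ b, div_mul_cancel₀ _ hbσ.ne']
  · rw [Edge.pt, add_assoc, ← proj_add, hv]
    congr 2
    module

/-- The two crossings created by a Reidemeister II move have opposite signs. -/
lemma ChordTriangle.sign_add_sign {p : Torus} {x y : Plane}
    (h : ChordTriangle F p x y s t) (hE : IsClosedCurve (F ∪ {(p, x), (p + proj x, y)}))
    (hD : Subdivision (F ∪ {(p, x), (p + proj x, y)}) D.underlying) {c₁ c₂ : Crossing}
    (hc₁ : c₁ ∈ D.crossings) (hc₂ : c₂ ∈ D.crossings) (h₁ : c₁.center = coords p x y (s, 0))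
    (h₂ : c₂.center = coords p x y (1, t))
    (hdir : (∃ k > (0 : ℝ), ∃ l > (0 : ℝ), c₁.overDir = k • x ∧ c₂.overDir = l • y) ∨
      (∃ k > (0 : ℝ), ∃ l > (0 : ℝ), c₁.underDir = k • x ∧ c₂.underDir = l • y)) :
    c₁.sign + c₂.sign = 0 := by
  obtain ⟨hs0, hs1⟩ := h.hs
  obtain ⟨ht0, ht1⟩ := h.ht
  have hdet := h.det_ne
  set w := (1 - s) • x + t • y with hw
  have hwx : det x w = t * det x y := by
    rw [hw, det_add_right, det_smul_right, det_smul_right, det_self, mul_zero, zero_add]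
  have hwy : det y (-w) = (1 - s) * det x y := by
    rw [det_neg_right, hw, det_add_right, det_smul_right, det_smul_right, det_self, mul_zero,
      add_zero, det_comm y x, mul_neg, neg_neg]
  have hwx0 : det x w ≠ 0 := hwx ▸ mul_ne_zero ht0.ne' hdet
  have hwy0 : det y (-w) ≠ 0 := hwy ▸ mul_ne_zero (by linarith) hdet
  have p1 (η : ℝ) : c₁.center + proj (η • w) = coords p x y (s + η * (1 - s), η * t) := by
    have := chord_add (p := p) (x := x) (y := y) (s := s) (t := t) 0 η 1
    simp only [one_smul, zero_mul, add_zero, zero_add, mul_one] at this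
    rw [this, h₁]
  have p2 (η : ℝ) : c₂.center + proj (η • -w) =
      coords p x y (s + (1 - η) * (1 - s), (1 - η) * t) := by
    have := chord_add (p := p) (x := x) (y := y) (s := s) (t := t) 1 η (-1)
    simp only [one_mul, add_sub_cancel, mul_neg, mul_one, neg_one_smul] at this
    rw [h₂, hw, ← this, ← sub_eq_add_neg]
  have hI : ∀ᶠ η : ℝ in 𝓝[>] 0, η ∈ Ioo₀₁ := Ioo_mem_nhdsGT one_pos
  have hcover (l : ℝ) (h0 : 0 ≤ l) (h1 : l ≤ 1) :
      coords p x y (s + l * (1 - s), l * t) ∈ support D.underlying := by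
    obtain ⟨e, he, τ, hτ, hel⟩ := h.exists_underlying hE hD ⟨h0, h1⟩
    exact ⟨e, he, τ, mem_Icc_of_mem_Ico hτ, hel⟩
  have r1 : ∀ᶠ η : ℝ in 𝓝[>] 0, c₁.center + proj (η • w) ∈ support D.underlying :=
    hI.mono fun η hη => p1 η ▸ hcover η hη.1.le hη.2.le
  have r2 : ∀ᶠ η : ℝ in 𝓝[>] 0, c₂.center + proj (η • -w) ∈ support D.underlying :=
    hI.mono fun η hη => p2 η ▸ hcover _ (by linarith [hη.2]) (by linarith [hη.1])
  have key : ∀ d₁ d₂ : Plane, (c₁.center + proj (-d₁), (2 : ℝ) • d₁) ∈ D.underlying →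
      (c₂.center + proj (-d₂), (2 : ℝ) • d₂) ∈ D.underlying → (∃ b : ℝ, w = b • d₁) →
      (∃ b : ℝ, -w = b • d₂) → det x d₁ * det y d₂ < 0 := by
    rintro d₁ d₂ m₁ m₂ ⟨b₁, hb₁⟩ ⟨b₂, hb₂⟩
    have q1 : b₁ * det x d₁ = t * det x y := by rw [← hwx, hb₁, det_smul_right]
    have q2 : b₂ * det y d₂ = (1 - s) * det x y := by rw [← hwy, hb₂, det_smul_right]
    have b₁0 : b₁ ≠ 0 := by
      rintro rfl; exact mul_ne_zero ht0.ne' hdet (by linarith)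
    have b₂0 : b₂ ≠ 0 := by
      rintro rfl; exact mul_ne_zero (sub_pos.2 hs1).ne' hdet (by linarith)
    obtain ⟨σ₁, hσ₁, hs₁, e₁⟩ := eventually_along m₁ hb₁ b₁0
    obtain ⟨σ₂, hσ₂, hs₂, e₂⟩ := eventually_along m₂ hb₂ b₂0
    obtain ⟨η₁, a₁, i₁⟩ := (e₁.and hI).exists
    obtain ⟨η₂, a₂, i₂⟩ := (e₂.and hI).exists
    rw [p1] at a₁
    rw [p2] at a₂
    have i₂' : 1 - η₂ ∈ Ioo₀₁ := ⟨by linarith [i₂.2], by linarith [i₂.1]⟩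
    have hσ : σ₁ ≠ σ₂ := by
      rintro rfl
      rcases hσ₁ with rfl | rfl
      · exact h.along_unique hE hD i₁ i₂' a₁ (by rwa [neg_one_smul, ← hw, ← one_smul ℝ (-w)])
      · refine h.along_unique hE hD i₂' i₁ ?_ a₁
        rwa [one_smul, ← hw, ← neg_neg w, ← neg_one_smul ℝ (-w)]
    have hb : b₁ * b₂ < 0 := by
      rcases hσ₁ with rfl | rfl <;> rcases hσ₂ with rfl | rfl <;>
        first | exact (hσ rfl).elim | nlinarith
    have hpos : 0 < (b₁ * b₂) * (det x d₁ * det y d₂) := by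
      rw [show (b₁ * b₂) * (det x d₁ * det y d₂) = (b₁ * det x d₁) * (b₂ * det y d₂) by ring, q1, q2]
      nlinarith [mul_pos (mul_pos ht0 (sub_pos.2 hs1)) (mul_self_pos.2 hdet)]
    by_contra! hcon
    nlinarith
  have hov {c : Crossing} (hc : c ∈ D.crossings) :
      (c.center + proj (-c.overDir), (2 : ℝ) • c.overDir) ∈ D.underlying :=
    Or.inr (Or.inl ⟨c, hc, rfl⟩)
  have hun {c : Crossing} (hc : c ∈ D.crossings) :
      (c.center + proj (-c.underDir), (2 : ℝ) • c.underDir) ∈ D.underlying :=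
    Or.inr (Or.inr ⟨c, hc, rfl⟩)
  have hpar {x v d : Plane} {k b : ℝ} (hv : det x v ≠ 0) (hd : d = k • x) : v ≠ b • d := by
    rintro rfl
    simp [hd, det_smul_right, det_self] at hv
  obtain ⟨b₁, hb₁⟩ := D.exists_smul_of_ray hc₁ r1
  obtain ⟨b₂, hb₂⟩ := D.exists_smul_of_ray hc₂ r2
  refine sign_add_sign_eq_zero ?_
  rcases hdir with ⟨k, hk, l, hl, e₁, e₂⟩ | ⟨k, hk, l, hl, e₁, e₂⟩
  · have := key _ _ (hun hc₁) (hun hc₂) ⟨b₁, hb₁.resolve_left (hpar hwx0 e₁)⟩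
      ⟨b₂, hb₂.resolve_left (hpar hwy0 e₂)⟩
    rw [e₁, e₂, det_smul_left, det_smul_left]
    nlinarith [mul_pos hk hl]
  · have := key _ _ (hov hc₁) (hov hc₂) ⟨b₁, hb₁.resolve_right (hpar hwx0 e₁)⟩
      ⟨b₂, hb₂.resolve_right (hpar hwy0 e₂)⟩
    rw [e₁, e₂, det_smul_right, det_smul_right, det_comm, det_comm c₂.overDir]
    nlinarith [mul_pos hk hl]

lemma Multicurve.toSkein_eq (h : homology α.edges = homology β.edges)
    (hr : rotation α.edges = rotation β.edges) : α.toSkein = β.toSkein := by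
  rw [← section₀_invariant α.toSkein, ← section₀_invariant β.toSkein, invariant_toSkein,
    invariant_toSkein, Multicurve.hom_eq h, Multicurve.rot_eq (β := β) (k := 0) (by rw [hr]; simp), add_zero]

lemma ReidemeisterII.toSkein_eq (h : ReidemeisterII D D') :
    D.toSkein = D'.toSkein := by
  classical
  obtain ⟨p, x, y, F, s, t, c₁, c₂, hdet, hinj, hs, ht, hD, hD', hF, hc₁, hc₂, hcr, h₁, h₂, hdir⟩ := h
  have hT : ChordTriangle F p x y s t := ⟨hdet, hinj, hs, ht, hF⟩
  obtain ⟨hE, hr⟩ := hD.isClosedCurve D.isClosedCurve_underlying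
  obtain ⟨hE', hr'⟩ := hD'.isClosedCurve D'.isClosedCurve_underlying
  have h0 : ∀ e ∈ F, e.2 ≠ 0 := by
    intro e he h0
    obtain ⟨e', he', -, -, r, -, -, h1⟩ := hD.exists_fine (.inl he) zero_mem_Ico
    exact D.underlying_ne_zero he' (by rw [h1, h0, smul_zero])
  have hne : c₁ ≠ c₂ := by
    rintro rfl
    refine hT.coords_ne (q := (s, 0)) (r := (1, t)) ⟨le_rfl, hs.1.le, hs.2.le⟩
      ⟨ht.1.le, ht.2.le, le_rfl⟩ (fun h => hs.2.ne (congrArg Prod.fst h)) (h₁.symm.trans h₂)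
  have hcr' : D'.crossings = insert c₁ (insert c₂ D.crossings) := by
    rw [← Finset.coe_inj, hcr]
    push_cast
    rw [Set.union_comm, Set.insert_union, Set.singleton_union]
  have hsum : ∑ c ∈ D'.crossings, c.sign = ∑ c ∈ D.crossings, c.sign := by
    rw [hcr', sum_insert (by simp [hne, hc₁]), sum_insert hc₂, ← add_assoc,
      hT.sign_add_sign hE' hD' (by simp [hcr']) (by simp [hcr']) h₁ h₂ hdir, zero_add]
  rw [Diagram.toSkein, Diagram.toSkein, hsum]
  congr 1
  apply Multicurve.toSkein_eq
  · change homology D.smoothedEdges = homology D'.smoothedEdges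
    rw [D.homology_smoothedEdges, D'.homology_smoothedEdges, D.homology_underlying hD,
      D'.homology_underlying hD', hT.primitiveHomology_eq (hE.finite.subset subset_union_left)]
  · change rotation D.smoothedEdges = rotation D'.smoothedEdges
    rw [D.rotation_smoothedEdges, D'.rotation_smoothedEdges, ← hr, ← hr', hT.rotation_eq hE hE' h0]

/-! ### The product -/

/-- The twisted group algebra product on `R[ℤ²]`. -/
def twistedMul : (ℤ × ℤ →₀ R) →ₗ[R] (ℤ × ℤ →₀ R) →ₗ[R] (ℤ × ℤ →₀ R) :=
  Finsupp.lsum R fun m => LinearMap.toSpanSingleton R _ (Finsupp.lsum R fun n =>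
    LinearMap.toSpanSingleton R _
      (Finsupp.single (m + n) (LaurentPolynomial.T (m.1 * n.2 - m.2 * n.1))))

lemma twistedMul_single (m n : ℤ × ℤ) (r r' : R) :
    twistedMul (Finsupp.single m r) (Finsupp.single n r') =
      Finsupp.single (m + n) (r * (r' * LaurentPolynomial.T (m.1 * n.2 - m.2 * n.1))) := by
  rw [twistedMul, Finsupp.lsum_single, LinearMap.toSpanSingleton_apply, LinearMap.smul_apply,
    Finsupp.lsum_single, LinearMap.toSpanSingleton_apply, Finsupp.smul_single, Finsupp.smul_single,
    smul_eq_mul, smul_eq_mul]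

def skeinMul : SkeinModule →ₗ[R] SkeinModule →ₗ[R] SkeinModule :=
  (twistedMul.compl₁₂ invariant invariant).compr₂ section₀

lemma skeinMul_toSkein (h : D.IsSuperposition α β) :
    skeinMul α.toSkein β.toSkein = D.toSkein := by
  obtain ⟨h1, h2⟩ := h.invariants
  have h3 : invariant D.toSkein = twistedMul (invariant α.toSkein) (invariant β.toSkein) := by
    rw [Diagram.toSkein, map_smul, invariant_toSkein, invariant_toSkein, invariant_toSkein,
      twistedMul_single, h1, h2, h.sum_sign, Finsupp.smul_single, smul_eq_mul, zpow_add,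
      Units.val_mul]
    congr 1
    ring
  change section₀ (twistedMul (invariant α.toSkein) (invariant β.toSkein)) = _
  rw [← h3, section₀_invariant]

lemma linearMap_ext {M : Type*} [AddCommGroup M] [Module R M] {f g : SkeinModule →ₗ[R] M}
    (h : ∀ α : Multicurve, f α.toSkein = g α.toSkein) : f = g :=
  Submodule.linearMap_qext _ (Finsupp.lhom_ext' fun α => LinearMap.ext_ring (h α))

lemma existsUnique_skeinMul : ∃! μ : SkeinModule →ₗ[R] SkeinModule →ₗ[R] SkeinModule,
    ∀ (α β : Multicurve) (D : Diagram), D.IsSuperposition α β →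
      μ α.toSkein β.toSkein = D.toSkein := by
  refine ⟨skeinMul, fun α β D h => skeinMul_toSkein h, fun μ hμ => ?_⟩
  refine linearMap_ext fun α => linearMap_ext fun β => ?_
  obtain ⟨α', hα, hg⟩ := exists_isotopic_generalPosition α β
  obtain ⟨D, hD⟩ := hg.exists_isSuperposition
  rw [hα.toSkein_eq, hμ _ _ D hD, skeinMul_toSkein hD]

end OrientedSkein

end

theorem mainTheorem5 :
    (∀ α β : OrientedSkein.Multicurve,
      ∃ α', OrientedSkein.Isotopic α α' ∧ OrientedSkein.InGeneralPosition α' β) ∧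
    (∀ α β : OrientedSkein.Multicurve, OrientedSkein.InGeneralPosition α β →
      ∃ D : OrientedSkein.Diagram, D.IsSuperposition α β) ∧
    (∃! μ : OrientedSkein.SkeinModule →ₗ[OrientedSkein.R]
        OrientedSkein.SkeinModule →ₗ[OrientedSkein.R] OrientedSkein.SkeinModule,
      ∀ (α β : OrientedSkein.Multicurve) (D : OrientedSkein.Diagram),
        D.IsSuperposition α β → μ α.toSkein β.toSkein = D.toSkein) ∧
    (∀ D D' : OrientedSkein.Diagram,
      OrientedSkein.ReidemeisterII D D' → D.toSkein = D'.toSkein) :=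
  ⟨OrientedSkein.exists_isotopic_generalPosition,
    fun _ _ h => h.exists_isSuperposition,
    OrientedSkein.existsUnique_skeinMul,
    fun _ _ h => h.toSkein_eq⟩
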